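/- **The model.** Fix $d\in\mathbb N$, complex weights $\hat t_3,\dots,\hat t_d$, $\mathfrak n\in\mathbb C$ and $c\in\mathbb C\setminus\{0\}$. For $k\ge 1$, $g\ge 0$, $v\ge 1$, let $\mathbb M_k^{(g)}(v)$ be the (finite) set of isomorphism classes of connected oriented surfaces of genus $g$ with $v$ vertices, obtained by gluing along edges: $k$ labelled marked polygons of degrees $l_1,\dots,l_k\ge 1$, each with a marked edge; unmarked empty $j$-gons with $3\le j\le d$ ($n_j$ of them for each $j$); and $\ell$ unmarked triangles carrying a piece of path that joins two of their sides, such that all the paths are closed loops. By convention $\mathbb M_1^{(0)}(1)$ consists of one map, reduced to a vertex, with $l_1=0$. Define the formal power series in $t$ $$W_k^{(g)}(x_1,\dots,x_k)=\sum_{v\ge1}t^v\sum_{\mathcal M\in\mathbb M_k^{(g)}(v)}\frac{(-1/c)^{\ell(\mathcal M)}\,\mathfrak n^{\#\mathrm{loops}(\mathcal M)}}{\#\mathrm{Aut}(\mathcal M)}\;\frac{\prod_{j=3}^{d}\hat t_j^{\,n_j(\mathcal M)}}{\prod_{i=1}^k (x_i-\frac c2)^{l_i(\mathcal M)+1}},\qquad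 W_k^{(-1)}=0,$$ whose coefficients are rational functions of the $x_i$. Let $V(x)=\frac12(x-\frac c2)^2-\sum_{j=3}^{d}\frac{\hat t_j}{j}(x-\frac c2)^j$, and let $P_k^{(g)}(x,x_2,\dots,x_k)$ be the polynomial part at large $x$ (coefficient by coefficient in $t$) of $V'(x)\,W_k^{(g)}(x,x_2,\dots,x_k)$. **Theorem (higher loop equations).** Let $k\ge1$, $g\ge0$, $I=\{x_2,\dots,x_k\}$. As formal power series in $t$ (with $x\ne\pm\frac c2$, $x_i\ne\frac c2$, $x\neq\pm x_i$), $$\begin{aligned} &W^{(g-1)}_{k+1}(x,x,I)+W^{(g-1)}_{k+1}(-x,-x,I)+\mathfrak n\,W^{(g-1)}_{k+1}(x,-x,I)\\ &+\sum_{J\subseteq I,\ 0\le h\le g}\Big(W^{(h)}_{|J|+1}(x,J)\,W^{(g-h)}_{k-|J|}(x,I\setminus J)+W^{(h)}_{|J|+1}(-x,J)\,W^{(g-h)}_{k-|J|}(-x,I\setminus J)+\mathfrak n\,W^{(h)}_{|J|+1}(x,J)\,W^{(g-h)}_{k-|J|}(-x,I\setminus J)\Big)\\ &+\sum_{x_i\in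 I}\frac{\partial}{\partial x_i}\left(\frac{W^{(g)}_{k-1}(x,I\setminus\{x_i\})-W^{(g)}_{k-1}(I)}{x-x_i}-\frac{W^{(g)}_{k-1}(-x,I\setminus\{x_i\})-W^{(g)}_{k-1}(I)}{x+x_i}\right)\\ &=V'(x)\,W^{(g)}_k(x,I)+V'(-x)\,W^{(g)}_k(-x,I)-P^{(g)}_k(x,I)-P^{(g)}_k(-x,I). \end{aligned}$$ In particular, for $(k,g)=(1,0)$, the master loop equation holds: $$W_1^{(0)}(x)^2+\mathfrak n\,W_1^{(0)}(x)W_1^{(0)}(-x)+W_1^{(0)}(-x)^2=V'(x)W_1^{(0)}(x)+V'(-x)W_1^{(0)}(-x)-P_1^{(0)}(x)-P_1^{(0)}(-x).$$ -/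

import Mathlib

open Filter Topology

namespace ONModel

/-- A map of the `O(𝔫)` model whose marked faces are labelled by `ι`, presented by permutations of
its set `D` of half-edges. The polygons are the cycles of `face` (which sends a half-edge to the next
one around its polygon), the edges are the pairs `{a, glue a}`. `path` is the set of half-edges
that are crossed by a piece of path, and `root i` is the marked edge of the `i`-th marked face.
A polygon is either marked (of any degree `≥ 1`), or an empty polygon of degree between `3` and `d`,
or an unmarked triangle carrying a piece of path, which enters and leaves through two of its three
sides. Since `path` is stable under `glue`, the pieces of path close up into loops. -/
structure LoopMap (d : ℕ) (ι D : Type) where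
  face : Equiv.Perm D
  glue : Equiv.Perm D
  path : Set D
  root : ι → D
  glue_glue : ∀ a, glue (glue a) = a
  glue_ne : ∀ a, glue a ≠ a
  nonempty : Nonempty D
  connected : ∀ a b, ∃ s ∈ Subgroup.closure {face, glue}, s a = b
  root_face : ∀ i j, face.SameCycle (root i) (root j) → i = j
  path_glue : ∀ a ∈ path, glue a ∈ path
  path_unmarked : ∀ a ∈ path, ∀ i, ¬ face.SameCycle (root i) a
  path_triangle : ∀ a ∈ path,
    Function.minimalPeriod face a = 3 ∧ ¬ (face a ∈ path ↔ face (face a) ∈ path)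
  degree_mem : ∀ a, (∀ i, ¬ face.SameCycle (root i) a) → (∀ b ∈ path, ¬ face.SameCycle b a) →
    3 ≤ Function.minimalPeriod face a ∧ Function.minimalPeriod face a ≤ d

namespace LoopMap

variable {d : ℕ} {ι D D' : Type}

/-- The polygons of the map. -/
def Face (M : LoopMap d ι D) : Type := Quotient (Equiv.Perm.SameCycle.setoid M.face)

/-- The edges of the map. -/
def Edge (M : LoopMap d ι D) : Type := Quotient (Equiv.Perm.SameCycle.setoid M.glue)

/-- The vertices of the map: `face (glue a)` is the next half-edge with the same origin as `a`. -/
def Vertex (M : LoopMap d ι D) : Type := Quotient (Equiv.Perm.SameCycle.setoid (M.face * M.glue))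

/-- The number of vertices. -/
noncomputable def numVertices (M : LoopMap d ι D) : ℕ := Nat.card M.Vertex

/-- The map has genus `g`: its Euler characteristic is `2 - 2g`. -/
def HasGenus (M : LoopMap d ι D) (g : ℕ) : Prop :=
  (Nat.card M.Vertex : ℤ) - Nat.card M.Edge + Nat.card M.Face = 2 - 2 * g

/-- The degree of the `i`-th marked face. -/
noncomputable def length (M : LoopMap d ι D) (i : ι) : ℕ :=
  Function.minimalPeriod M.face (M.root i)

/-- The number `n_j` of unmarked empty polygons of degree `j`. -/
noncomputable def numEmpty (M : LoopMap d ι D) (j : ℕ) : ℕ :=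
  Nat.card {q : M.Face // ∃ a : D, Quotient.mk _ a = q ∧
    (∀ i, ¬ M.face.SameCycle (M.root i) a) ∧ (∀ b ∈ M.path, ¬ M.face.SameCycle b a) ∧
    Function.minimalPeriod M.face a = j}

/-- The number `ℓ` of triangles carrying a piece of path. -/
noncomputable def numPathTriangles (M : LoopMap d ι D) : ℕ :=
  Nat.card {q : M.Face // ∃ a ∈ M.path, Quotient.mk _ a = q}

/-- The number of loops: two half-edges crossed by a path belong to the same loop if they can be
joined by moving through triangles and across edges along the path. -/
noncomputable def numLoops (M : LoopMap d ι D) : ℕ :=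
  Nat.card (Quot fun a b : M.path => (b : D) = M.glue a ∨ M.face.SameCycle (a : D) b)

/-- Isomorphisms of maps; they preserve the orientation, the paths, the labels of the marked faces
and the marked edges. -/
def IsIso (M : LoopMap d ι D) (M' : LoopMap d ι D') (e : D ≃ D') : Prop :=
  (∀ a, e (M.face a) = M'.face (e a)) ∧ (∀ a, e (M.glue a) = M'.glue (e a)) ∧
    (∀ a, a ∈ M.path ↔ e a ∈ M'.path) ∧ ∀ i, e (M.root i) = M'.root i

/-- The number of automorphisms. -/
noncomputable def numAut (M : LoopMap d ι D) : ℕ := Nat.card {e : D ≃ D // IsIso M M e}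

/-- Two maps with finitely many half-edges are equivalent if they are isomorphic. -/
instance isoSetoid (d : ℕ) (ι : Type) : Setoid (Σ n : ℕ, LoopMap d ι (Fin n)) where
  r M M' := ∃ e, IsIso M.2 M'.2 e
  iseqv :=
    { refl := fun M => ⟨Equiv.refl _, by simp [IsIso]⟩
      symm := by
        rintro M M' ⟨e, h1, h2, h3, h4⟩
        refine ⟨e.symm, fun a => ?_, fun a => ?_, fun a => ?_, fun i => ?_⟩
        · rw [Equiv.symm_apply_eq, h1, e.apply_symm_apply]
        · rw [Equiv.symm_apply_eq, h2, e.apply_symm_apply]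
        · rw [h3, e.apply_symm_apply]
        · rw [Equiv.symm_apply_eq, h4]
      trans := by
        rintro M M' M'' ⟨e, h1, h2, h3, h4⟩ ⟨f, k1, k2, k3, k4⟩
        exact ⟨e.trans f, fun a => by simp [h1, k1], fun a => by simp [h2, k2],
          fun a => by simp [h3 a, k3], fun i => by simp [h4, k4]⟩ }

end LoopMap

/-- The isomorphism classes of maps with marked faces labelled by `ι`. -/
abbrev MapClass (d : ℕ) (ι : Type) : Type := Quotient (LoopMap.isoSetoid d ι)

/-- The set of isomorphism classes of maps of genus `g` with `v` vertices, and with marked faces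
labelled by `ι`. -/
def maps (d : ℕ) (ι : Type) (g v : ℕ) : Set (MapClass d ι) :=
  {q | ∃ M, Quotient.mk _ M = q ∧ M.2.HasGenus g ∧ M.2.numVertices = v}

/-- A chosen representative of an isomorphism class. -/
noncomputable def MapClass.rep {d : ℕ} {ι : Type} (q : MapClass d ι) :
    LoopMap d ι (Fin (Quotient.out q).1) := (Quotient.out q).2

/-- The parameters of the model: the maximal degree `d` of the empty polygons, their weights
`tHat j` (used for `3 ≤ j ≤ d`), the weight `𝔫` of a loop, and `c`, each triangle carrying a piece
of path having weight `-1/c`. -/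
structure Params where
  d : ℕ
  tHat : ℕ → ℂ
  𝔫 : ℂ
  c : ℂ

theorem LoopMap.three_le {d : ℕ} {ι : Type} {n : ℕ} (M : LoopMap d ι (Fin n)) (a : Fin n)
    (ha : ∀ i, ¬ M.face.SameCycle (M.root i) a) : 3 ≤ Function.minimalPeriod M.face a := by
  by_cases h : ∀ b ∈ M.path, ¬ M.face.SameCycle b a
  · exact (M.degree_mem a ha h).1
  · push Not at h
    obtain ⟨b, hb, hba⟩ := h
    obtain ⟨j, rfl⟩ := hba
    have h3 := (M.path_triangle b hb).1
    have hp : Function.minimalPeriod M.face ((M.face ^ j) b) = 3 := by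
      rw [← h3]
      have key : ∀ m, Function.IsPeriodicPt M.face m ((M.face ^ j) b) ↔
          Function.IsPeriodicPt M.face m b := by
        intro m
        simp only [Function.IsPeriodicPt, Function.IsFixedPt, Equiv.Perm.iterate_eq_pow]
        rw [← Equiv.Perm.mul_apply, ((Commute.refl M.face).pow_left m).zpow_right j |>.eq,
          Equiv.Perm.mul_apply, Equiv.apply_eq_iff_eq]
      apply Nat.dvd_antisymm
      · rw [← Function.isPeriodicPt_iff_minimalPeriod_dvd, key]
        exact Function.isPeriodicPt_minimalPeriod _ _
      · rw [← Function.isPeriodicPt_iff_minimalPeriod_dvd, ← key]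
        exact Function.isPeriodicPt_minimalPeriod _ _
    omega

theorem LoopMap.card_le {d : ℕ} {ι : Type} [Fintype ι] {n g v : ℕ} (M : LoopMap d ι (Fin n))
    (hg : M.HasGenus g) (hv : M.numVertices = v) : n ≤ 6 * (2 * g + Fintype.card ι + v) := by
  classical
  have hfin : Finite M.Face := Quotient.finite _
  have hfin' : Finite M.Edge := Quotient.finite _
  let _ := Fintype.ofFinite M.Face
  let _ := Fintype.ofFinite M.Edge
  let mk : Fin n → M.Face := fun a => Quotient.mk _ a
  have hmk : ∀ q : M.Face, mk q.out = q := fun q => Quotient.out_eq _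
  -- every edge has at most two half-edges
  have hE : n ≤ 2 * Nat.card M.Edge := by
    have hs : Function.Surjective
        (fun z : M.Edge × Bool => if z.2 then z.1.out else M.glue z.1.out) := by
      intro a
      let q : M.Edge := Quotient.mk _ a
      have hq : M.glue.SameCycle q.out a := Quotient.exact (Quotient.out_eq q)
      obtain ⟨j, hj⟩ := hq
      have h2 : M.glue ^ (2 : ℤ) = 1 := by
        ext b
        rw [zpow_two, Equiv.Perm.mul_apply, M.glue_glue]; rfl
      rcases Int.even_or_odd' j with ⟨i, rfl | rfl⟩
      · refine ⟨(q, true), ?_⟩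
        rw [zpow_mul, h2, one_zpow] at hj
        simpa using hj
      · refine ⟨(q, false), ?_⟩
        rw [zpow_add, zpow_mul, h2, one_zpow, one_mul, zpow_one] at hj
        simpa using hj
    have := Fintype.card_le_of_surjective _ hs
    rw [Fintype.card_prod, Fintype.card_bool, Fintype.card_fin] at this
    rw [Nat.card_eq_fintype_card]
    omega
  -- every unmarked polygon has at least three half-edges
  have hF : 3 * Nat.card M.Face ≤ n + 3 * Fintype.card ι := by
    let U : Finset M.Face := Finset.univ \ Finset.univ.image (fun i => mk (M.root i))
    have hU : Fintype.card M.Face ≤ U.card + Fintype.card ι := by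
      have h1 : Fintype.card M.Face - (Finset.univ.image (fun i => mk (M.root i))).card ≤ U.card :=
        Finset.le_card_sdiff _ _
      have h2 : (Finset.univ.image (fun i => mk (M.root i))).card ≤ Fintype.card ι :=
        Finset.card_image_le
      omega
    have hinj : Function.Injective (fun z : {q // q ∈ U} × Fin 3 =>
        (M.face ^ (z.2 : ℕ)) (Quotient.out z.1.1 : Fin n)) := by
      rintro ⟨⟨q, hq⟩, i⟩ ⟨⟨r, hr⟩, j⟩ h
      simp only at h
      have hqr : q = r := by
        have h' : mk q.out = mk r.out := by
          apply Quotient.sound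
          change M.face.SameCycle q.out r.out
          rw [← Equiv.Perm.sameCycle_pow_left (n := (i : ℕ)), h, Equiv.Perm.sameCycle_pow_left]
        rwa [hmk, hmk] at h'
      subst hqr
      have h3 := M.three_le q.out (by
        intro k hk
        have : mk (M.root k) = mk q.out := Quotient.sound hk
        rw [hmk] at this
        simp only [U, Finset.mem_sdiff, Finset.mem_image] at hq
        exact hq.2 ⟨k, Finset.mem_univ _, this⟩)
      rw [← Equiv.Perm.iterate_eq_pow, ← Equiv.Perm.iterate_eq_pow] at h
      have := Function.iterate_injOn_Iio_minimalPeriod (f := M.face) (x := q.out)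
        (Set.mem_Iio.mpr (lt_of_lt_of_le i.2 h3)) (Set.mem_Iio.mpr (lt_of_lt_of_le j.2 h3)) h
      simp [Fin.ext_iff, this]
    have := Fintype.card_le_of_injective _ hinj
    rw [Fintype.card_prod, Fintype.card_fin, Fintype.card_fin, Fintype.card_coe] at this
    rw [Nat.card_eq_fintype_card]
    omega
  unfold LoopMap.HasGenus at hg
  unfold LoopMap.numVertices at hv
  omega

/-- There are finitely many maps with given genus, number of marked faces and number of vertices, so
that the sums over maps below are finite sums. -/
theorem maps_finite (d : ℕ) (ι : Type) [Fintype ι] (g v : ℕ) : (maps d ι g v).Finite := by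
  classical
  have hF : ∀ n, Finite (LoopMap d ι (Fin n)) := fun n =>
    Finite.of_injective (β := Equiv.Perm (Fin n) × Equiv.Perm (Fin n) × Set (Fin n) × (ι → Fin n))
      (fun M => (M.face, M.glue, M.path, M.root)) (by
        rintro ⟨⟩ ⟨⟩ h
        simp only [Prod.mk.injEq] at h
        obtain ⟨rfl, rfl, rfl, rfl⟩ := h
        rfl)
  let B := 6 * (2 * g + Fintype.card ι + v)
  let f : (Σ n : Fin (B + 1), LoopMap d ι (Fin n)) → MapClass d ι :=
    fun M => Quotient.mk _ ⟨M.1, M.2⟩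
  refine (Set.finite_range f).subset ?_
  rintro q ⟨⟨n, M⟩, rfl, hg, hv⟩
  exact ⟨⟨⟨n, Nat.lt_succ_of_le (M.card_le hg hv)⟩, M⟩, rfl⟩

variable {ι : Type} [Fintype ι]

/-- The Boltzmann weight of a map (without the variables `t` and `x`). -/
noncomputable def weight (p : Params) (q : MapClass p.d ι) : ℂ :=
  (-1 / p.c) ^ q.rep.numPathTriangles * p.𝔫 ^ q.rep.numLoops / q.rep.numAut *
    ∏ j ∈ Finset.Icc 3 p.d, p.tHat j ^ q.rep.numEmpty j

/-- The generating function `W_k^{(g)}` of maps of genus `g` with `k = |ι|` marked faces, a formal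
power series in `t`, at the point `x`. The coefficient of `t ^ v` is a finite sum over the maps with
`v` vertices. The first term is the map reduced to one vertex, which conventionally is a planar map
with one marked face of degree `0`. -/
noncomputable def W (p : Params) (g : ℕ) (x : ι → ℂ) : PowerSeries ℂ :=
  PowerSeries.mk fun v =>
    (if Fintype.card ι = 1 ∧ g = 0 ∧ v = 1 then ∏ i, 1 / (x i - p.c / 2) else 0) +
      ∑ᶠ q ∈ maps p.d ι g v, weight p q * ∏ i, 1 / (x i - p.c / 2) ^ (q.rep.length i + 1)

/-- `W_k^{(g - 1)}`, with the convention `W_k^{(-1)} = 0`. -/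
noncomputable def WPred (p : Params) : ℕ → (ι → ℂ) → PowerSeries ℂ
  | 0, _ => 0
  | g + 1, x => W p g x

/-- The list of variables `(x, I)`. -/
def adjoin {ι : Type} (x : ℂ) (I : ι → ℂ) : Option ι → ℂ := fun o => o.elim x I

/-- The potential `V(x) = (x - c/2)² / 2 - ∑ tHat_j (x - c/2)^j / j`. -/
noncomputable def V (p : Params) : Polynomial ℂ :=
  (Polynomial.C (1 / 2) * Polynomial.X ^ 2 -
      ∑ j ∈ Finset.Icc 3 p.d, Polynomial.C (p.tHat j / j) * Polynomial.X ^ j).comp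
    (Polynomial.X - Polynomial.C (p.c / 2))

/-- The value `V'(x)`, as a constant power series in `t`. -/
noncomputable def V' (p : Params) (x : ℂ) : PowerSeries ℂ :=
  PowerSeries.C ((Polynomial.derivative (V p)).eval x)

open Classical in
/-- The polynomial part of `f` at infinity: the polynomial `q` such that `f x - q x → 0` as
`|x| → ∞`. -/
noncomputable def polyPart (f : ℂ → ℂ) : Polynomial ℂ :=
  if h : ∃ q : Polynomial ℂ, Tendsto (fun x => f x - q.eval x) (Bornology.cobounded ℂ) (𝓝 0)
  then h.choose else 0

/-- `P_k^{(g)}(x, I)`: the polynomial part, with respect to `x`, of `V'(x) W_k^{(g)}(x, I)`. -/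
noncomputable def P (p : Params) (g : ℕ) (x : ℂ) (I : ι → ℂ) : PowerSeries ℂ :=
  PowerSeries.mk fun v =>
    (polyPart fun y => PowerSeries.coeff v (V' p y * W p g (adjoin y I))).eval x

/-- The derivative at `y` of a family of power series in `t`, coefficient by coefficient. -/
noncomputable def ddx (F : ℂ → PowerSeries ℂ) (y : ℂ) : PowerSeries ℂ :=
  PowerSeries.mk fun v => deriv (fun z => PowerSeries.coeff v (F z)) y

/-- The polynomial part is unique. -/
theorem polyPart_eq {f : ℂ → ℂ} {q : Polynomial ℂ}
    (h : Tendsto (fun x => f x - q.eval x) (Bornology.cobounded ℂ) (𝓝 0)) : polyPart f = q := by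
  have hex : ∃ q : Polynomial ℂ,
      Tendsto (fun x => f x - q.eval x) (Bornology.cobounded ℂ) (𝓝 0) := ⟨q, h⟩
  have h2 : Tendsto (fun x => (polyPart f - q).eval x) (Bornology.cobounded ℂ) (𝓝 0) := by
    have h1 := hex.choose_spec
    unfold polyPart
    rw [dif_pos hex]
    have := h.sub h1
    simpa using this
  by_contra hne
  have hq : polyPart f - q ≠ 0 := sub_ne_zero.mpr hne
  by_cases hd : 0 < (polyPart f - q).degree
  · have h3 := Polynomial.tendsto_norm_atTop _ hd
      (tendsto_norm_cobounded_atTop : Tendsto (fun x : ℂ => ‖x‖) _ _)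
    exact not_tendsto_nhds_of_tendsto_atTop h3 _ h2.norm
  · rw [Polynomial.eq_C_of_degree_le_zero (not_lt.mp hd)] at h2 hq
    simp only [Polynomial.eval_C] at h2
    have := tendsto_nhds_unique h2 tendsto_const_nhds
    rw [← this] at hq
    simp at hq

end ONModel

/-!
The loop equation is the removal of the root edge, in the manner of Tutte. The coefficient of `t ^ v`
in `W` is a finite sum over isomorphism classes weighted by `1 / #Aut`. By orbit counting
(`PMap.ncard_orbit`) it is a sum over labelled maps on `Fin n`, divided by `n!`
(`LoopMap.finsum_maps`). A labelled map is presented as a `PMap`: two permutations of the half-edges,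
a colouring of the half-edges crossed by a path, and the marked faces as cyclic lists of half-edges.
Main faces carry a prescribed word of colours and may be reduced to a vertex; they are distinguished
from auxiliary faces, which are only counted by their degree. In this form the objects produced by
the removal of an edge, such as a root face crossed by a path or two root faces in two components,
are maps of the same kind. Nothing is infinite: unmarked faces have degree at least `3`, so Euler's
relation bounds the number of half-edges (`labSum_eq_zero`).

The face on the other side of the root edge is an unmarked polygon, an auxiliary face, or the root
face itself (`PMap.sum_rooted_false`, `PMap.sum_rooted_true`). In the first two cases it is merged
with the root face; in the last one the root face is cut in two. For `tot`, which counts maps with a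
root face of degree `l` without crossed sides, this gives `tot_succ`. Its unknown term is
`totH p f g v 0 l`, which comes from the triangles with a piece of path and counts maps whose root
face has two crossed sides. Removing a crossed root edge gives another recursion, `totH_rec`: the
path goes on through a triangle, or closes a loop of weight `𝔫` and the root face is cut in two. A
map with two root faces is connected, of genus lower by one, or has two components (`tot₂_eq`). In
the second case each component has a genus, as follows from adding edges one by one
(`exists_genus`).

In generating functions, with `u = x - c / 2`, multiplication by `V'` shifts the degree of the root
face, up to a polynomial, which is the polynomial part `P` (`V'_mul_gen`, `coeff_P`). Hence
`V' W - P` is the sum of the triangle term, of a term for each other marked face, and of the maps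
with two root faces (`gen_tot_succ`). The auxiliary face of degree `L + 1` can be adjacent to the
root edge along any of its `L + 1` edges; this factor is the derivative with respect to `x_i` of a
divided difference (`gen_divided_difference`, `coeff_ddx`). The triangle term is not a function of
the `W`'s. However, let `H` be the generating function of maps whose root face has two crossed
sides, in powers of `1 / u` and `1 / u'` for the numbers of sides between them. The recursion
`totH_rec` multiplies `H` by `1 + (u + u') / c`, which vanishes for `u = x - c / 2` and
`u' = - x - c / 2`. What remains says that the triangle terms for `x` and `-x` add up to `𝔫` times
the generating function of maps with two root faces, at `x` and `-x` (`gen_totH`). The sum of the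
equations for `x` and `-x` is therefore closed (`coeff_loop_equation`).
-/


/-! ### Cycles of permutations as lists -/

namespace ONModel

open Equiv

variable {D D' : Type}

/-- The list `l` is a cycle of `σ`, read from one of its elements. The empty list is allowed. -/
def IsCyc (σ : Perm D) (l : List D) : Prop := l.Nodup ∧ l.map σ = l.rotate 1

theorem isCyc_nil (σ : Perm D) : IsCyc σ [] := by simp [IsCyc]

theorem isCyc_cons {σ : Perm D} {a : D} {l : List D} :
    IsCyc σ (a :: l) ↔ (a :: l).Nodup ∧ (a :: l).map σ = l ++ [a] := by
  simp [IsCyc]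

namespace IsCyc

variable {σ : Perm D} {l l' A B : List D} {a b : D}

theorem nodup (h : IsCyc σ l) : l.Nodup := h.1

theorem apply_mem_iff (h : IsCyc σ l) : σ a ∈ l ↔ a ∈ l := by
  rw [← List.mem_rotate (n := 1), ← h.2, List.mem_map_of_injective σ.injective]

theorem rotate (h : IsCyc σ l) (n : ℕ) : IsCyc σ (l.rotate n) := by
  refine ⟨List.nodup_rotate.2 h.1, ?_⟩
  rw [List.map_rotate, h.2, List.rotate_rotate, List.rotate_rotate, add_comm]

theorem of_isRotated (h : IsCyc σ l) (hl : l ~r l') : IsCyc σ l' := by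
  obtain ⟨n, rfl⟩ := hl
  exact h.rotate n

theorem append_comm (h : IsCyc σ (A ++ B)) : IsCyc σ (B ++ A) :=
  h.of_isRotated List.isRotated_append

theorem apply_getElem (h : IsCyc σ l) (k : ℕ) (hk : k < l.length) :
    σ l[k] = l[(k + 1) % l.length]'(Nat.mod_lt _ (by omega)) := by
  have h1 : (l.map σ)[k]'(by simpa using hk) = (l.rotate 1)[k]'(by simpa using hk) := by
    simp only [h.2]
  rw [List.getElem_map, List.getElem_rotate] at h1
  exact h1

/-- The `k`-th element of a cycle is the `k`-th iterate of its head. -/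
theorem getElem_eq (h : IsCyc σ (a :: l)) : ∀ (k : ℕ) (hk : k < (a :: l).length),
    (a :: l)[k] = (σ^[k]) a
  | 0, _ => rfl
  | k + 1, hk => by
    rw [Function.iterate_succ_apply', ← h.getElem_eq k (by omega), h.apply_getElem k (by omega)]
    congr 1
    rw [Nat.mod_eq_of_lt hk]

theorem minimalPeriod_eq (h : IsCyc σ l) (ha : a ∈ l) :
    Function.minimalPeriod σ a = l.length := by
  obtain ⟨A, B, rfl⟩ := List.append_of_mem ha
  have h' : IsCyc σ (a :: (B ++ A)) := by simpa using h.append_comm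
  set m := B ++ A
  have hlen : (A ++ a :: B).length = (a :: m).length := by simp [m]; omega
  rw [hlen]
  have hper : Function.IsPeriodicPt σ (a :: m).length a := by
    have h1 := h'.apply_getElem m.length (by simp)
    rw [h'.getElem_eq, ← Function.iterate_succ_apply' σ] at h1
    simpa [Function.IsPeriodicPt, Function.IsFixedPt] using h1
  apply le_antisymm (hper.minimalPeriod_le (by simp))
  by_contra! hlt
  have h2 := Function.iterate_minimalPeriod (f := σ) (x := a)
  rw [← h'.getElem_eq _ hlt] at h2
  have h0 : (a :: m)[0]'(by simp) = a := rfl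
  have := (h'.nodup.getElem_inj_iff).1 (h2.trans h0.symm)
  exact (hper.minimalPeriod_pos (by simp)).ne' this

theorem unique (h : IsCyc σ (a :: l)) (h' : IsCyc σ (a :: l')) : l = l' := by
  have h1 := h.minimalPeriod_eq (a := a) (by simp)
  have h2 := h'.minimalPeriod_eq (a := a) (by simp)
  have : a :: l = a :: l' := List.ext_getElem (by omega) fun k hk hk' => by
    rw [h.getElem_eq, h'.getElem_eq]
  exact (List.cons.inj this).2

theorem exists_cons (h : IsCyc σ l) (ha : a ∈ l) : ∃ m, IsCyc σ (a :: m) ∧ l ~r (a :: m) := by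
  obtain ⟨A, B, rfl⟩ := List.append_of_mem ha
  exact ⟨B ++ A, by simpa using h.append_comm, by
    simpa using List.isRotated_append (l := A) (l' := a :: B)⟩

theorem isRotated (h : IsCyc σ l) (h' : IsCyc σ l') (ha : a ∈ l) (ha' : a ∈ l') : l ~r l' := by
  obtain ⟨m, hm, hl⟩ := h.exists_cons ha
  obtain ⟨m', hm', hl'⟩ := h'.exists_cons ha'
  rw [hm.unique hm'] at hl
  exact hl.trans hl'.symm

theorem sameCycle_iff (h : IsCyc σ l) (ha : a ∈ l) : σ.SameCycle a b ↔ b ∈ l := by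
  constructor
  · rintro ⟨i, rfl⟩
    have key : ∀ c ∈ l, ∀ n : ℕ, (σ ^ n) c ∈ l := by
      intro c hc n
      induction n with
      | zero => simpa
      | succ n ih => rwa [pow_succ', Perm.mul_apply, h.apply_mem_iff]
    have key' : ∀ n : ℕ, ∀ c ∈ l, (σ ^ n)⁻¹ c ∈ l := by
      intro n
      induction n with
      | zero => simp
      | succ n ih =>
        intro c hc
        rw [pow_succ', mul_inv_rev, Perm.mul_apply]
        apply ih
        rw [← h.apply_mem_iff]
        simpa
    obtain ⟨n, rfl | rfl⟩ := i.eq_nat_or_neg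
    · simpa using key a ha n
    · simpa using key' n a ha
  · intro hb
    obtain ⟨m, hm, hl⟩ := h.exists_cons ha
    have hb' : b ∈ a :: m := hl.mem_iff.1 hb
    obtain ⟨k, hk, rfl⟩ := List.getElem_of_mem hb'
    rw [hm.getElem_eq k hk]
    exact ⟨k, by simp [Perm.iterate_eq_pow]⟩

theorem apply_eq_self_iff {x : D} (h : IsCyc σ (A ++ x :: B)) : σ x = x ↔ A = [] ∧ B = [] := by
  have h1 := h.minimalPeriod_eq (a := x) (by simp)
  rw [← Function.IsFixedPt, ← Function.minimalPeriod_eq_one_iff_isFixedPt, h1]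
  simp only [List.length_append, List.length_cons, ← List.length_eq_zero_iff]
  omega

theorem apply_congr {σ' : Perm D} (h : IsCyc σ l) (h' : IsCyc σ' l) (ha : a ∈ l) :
    σ a = σ' a :=
  List.map_inj_left.1 (h.2.trans h'.2.symm) a ha

theorem map {τ : Perm D'} {f : D → D'} (hf : Function.Injective f) (h : IsCyc σ l)
    (hl : ∀ a ∈ l, τ (f a) = f (σ a)) : IsCyc τ (l.map f) := by
  refine ⟨h.1.map hf, ?_⟩
  rw [List.map_map, ← List.map_rotate, ← h.2, List.map_map]
  exact List.map_inj_left.2 hl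

theorem of_map {τ : Perm D'} {f : D → D'} (hf : Function.Injective f) (h : IsCyc τ (l.map f))
    (hl : ∀ a ∈ l, τ (f a) = f (σ a)) : IsCyc σ l := by
  refine ⟨h.1.of_map, ?_⟩
  apply hf.list_map
  rw [List.map_rotate, ← h.2, List.map_map, List.map_map]
  exact List.map_inj_left.2 fun a ha => (hl a ha).symm

end IsCyc

theorem exists_isCyc [Finite D] (σ : Perm D) (a : D) : ∃ l, IsCyc σ (a :: l) := by
  have hpos : 0 < Function.minimalPeriod σ a :=
    Function.minimalPeriod_pos_of_mem_periodicPts (σ.injective.mem_periodicPts a)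
  obtain ⟨n, hn⟩ := Nat.exists_eq_succ_of_ne_zero hpos.ne'
  have hL : IsCyc σ ((List.range (n + 1)).map fun k => (σ^[k]) a) := by
    constructor
    · refine (List.nodup_map_iff_inj_on List.nodup_range).2 fun i hi j hj hij => ?_
      simp only [List.mem_range] at hi hj
      exact Function.iterate_injOn_Iio_minimalPeriod (f := σ) (x := a)
        (by simp [hn]; omega) (by simp [hn]; omega) hij
    · have h1 := Function.iterate_minimalPeriod (f := σ) (x := a)
      rw [hn] at h1
      apply List.ext_getElem (by simp)
      intro k hk hk'
      simp only [List.length_map, List.length_range] at hk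
      rw [List.getElem_rotate]
      simp only [List.getElem_map, List.getElem_range, List.length_map, List.length_range,
        ← Function.iterate_succ_apply' σ]
      rcases Nat.lt_succ_iff_lt_or_eq.1 hk with h | rfl
      · rw [Nat.mod_eq_of_lt (by omega)]
      · rw [Nat.mod_self]; exact h1
  rw [List.range_succ_eq_map] at hL
  exact ⟨_, hL⟩

/-- Multiplying by a transposition merges two cycles, or cuts one cycle into two. -/
theorem isCyc_mul_swap [DecidableEq D] {σ : Perm D} {r b : D} {U W : List D} :
    (IsCyc σ (b :: U) ∧ IsCyc σ (r :: W) ∧ (r :: U ++ b :: W).Nodup) ↔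
      IsCyc (σ * swap r b) (r :: U ++ b :: W) := by
  have key : (r :: U ++ b :: W).Nodup →
      (r :: U ++ b :: W).map (σ * swap r b) = (b :: U).map σ ++ (r :: W).map σ := by
    intro h
    simp only [List.cons_append, List.nodup_cons, List.mem_append, List.mem_cons, not_or,
      List.nodup_append] at h
    have hU : U.map (σ * swap r b) = U.map σ := List.map_inj_left.2 fun x hx => by
      rw [Perm.mul_apply, swap_apply_of_ne_of_ne]
      · rintro rfl; exact h.1.1 hx
      · rintro rfl; exact h.2.2.2 x hx x (by simp) rfl
    have hW : W.map (σ * swap r b) = W.map σ := List.map_inj_left.2 fun x hx => by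
      rw [Perm.mul_apply, swap_apply_of_ne_of_ne]
      · rintro rfl; exact h.1.2.2 hx
      · rintro rfl; exact h.2.2.1.1 hx
    simp only [List.map_append, List.map_cons, hU, hW]
    simp
  have hrot : (r :: U ++ b :: W).rotate 1 = (U ++ [b]) ++ (W ++ [r]) := by simp
  constructor
  · rintro ⟨h1, h2, h3⟩
    refine ⟨h3, ?_⟩
    rw [key h3, h1.2, h2.2, hrot]; simp
  · rintro ⟨h3, h4⟩
    rw [key h3, hrot] at h4
    obtain ⟨h5, h6⟩ := List.append_inj h4 (by simp)
    have h7 := h3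
    simp only [List.cons_append, List.nodup_cons, List.mem_append, List.mem_cons, not_or,
      List.nodup_append] at h7
    refine ⟨isCyc_cons.2 ⟨List.nodup_cons.2 ⟨fun hx => h7.2.2.2 b hx b (by simp) rfl, h7.2.1⟩, h5⟩,
      isCyc_cons.2 ⟨List.nodup_cons.2 ⟨h7.1.2.2, h7.2.2.1.2⟩, h6⟩, h3⟩

theorem reduceOption_map_some (l : List D) : (l.map some).reduceOption = l := by
  induction l with
  | nil => rfl
  | cons a l ih => rw [List.map_cons, List.reduceOption_cons_of_some, ih]

theorem exists_map_some {l : List (Option D)} (h : none ∉ l) : ∃ m : List D, l = m.map some := by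
  induction l with
  | nil => exact ⟨[], rfl⟩
  | cons a l ih =>
    simp only [List.mem_cons, not_or] at h
    obtain ⟨m, rfl⟩ := ih h.2
    cases a with
    | none => exact absurd rfl h.1
    | some a => exact ⟨a :: m, rfl⟩

theorem removeNone_apply {σ : Perm (Option D)} {a c : D} (h : σ (some a) = some c) :
    removeNone σ a = c := by
  have := removeNone_some σ (x := a) ⟨c, h⟩
  rw [h] at this
  exact Option.some_injective _ this

theorem removeNone_apply' {σ : Perm (Option D)} {a c : D} (h : σ (some a) = none)
    (h' : σ none = some c) : removeNone σ a = c := by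
  have := removeNone_none σ (x := a) h
  rw [h'] at this
  exact Option.some_injective _ this

/-- `removeNone σ` sends the predecessor of `none` to its successor. -/
theorem isCyc_cons_none {σ : Perm (Option D)} {l : List D} (h : IsCyc σ (none :: l.map some)) :
    IsCyc (removeNone σ) l := by
  cases l with
  | nil => exact isCyc_nil _
  | cons x s =>
    rw [isCyc_cons] at h ⊢
    obtain ⟨h1, h2⟩ := h
    simp only [List.map_cons, List.cons_append, List.cons.injEq] at h2
    obtain ⟨h3, h4⟩ := h2
    have hnd : (x :: s).Nodup := by
      rw [← List.nodup_map_iff (Option.some_injective D)]; exact (List.nodup_cons.1 h1).2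
    refine ⟨hnd, ?_⟩
    -- `x = σ none`, so that skipping `none` amounts to replacing it by `x`.
    have hF : ∀ a, removeNone σ a = (σ (some a)).getD x := by
      intro a
      cases h : σ (some a) with
      | none => simpa using removeNone_apply' h h3
      | some c => simpa using removeNone_apply h
    have h5 : (x :: s).map (fun a => (σ (some a)).getD x) = s ++ [x] := by
      have h6 := congrArg (List.map fun o : Option D => o.getD x) h4
      simpa [Function.comp_def] using h6
    rw [← h5]
    exact List.map_inj_left.2 fun a _ => hF a

/-- Deleting `none` from a permutation deletes it from its cycles. -/
theorem IsCyc.reduceOption {σ : Perm (Option D)} {l : List (Option D)} (h : IsCyc σ l) :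
    IsCyc (removeNone σ) l.reduceOption := by
  by_cases hn : none ∈ l
  · obtain ⟨A, B, rfl⟩ := List.append_of_mem hn
    have h' : IsCyc σ (none :: (B ++ A)) := by simpa using h.append_comm
    obtain ⟨m, hm⟩ := exists_map_some (List.nodup_cons.1 h'.1).1
    rw [hm] at h'
    have h1 := isCyc_cons_none h'
    rw [← reduceOption_map_some m, ← hm, List.reduceOption_append] at h1
    rw [List.reduceOption_append, List.reduceOption_cons_of_none]
    exact h1.append_comm
  · obtain ⟨m, rfl⟩ := exists_map_some hn
    rw [reduceOption_map_some]
    refine h.of_map (Option.some_injective D) fun a ha => ?_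
    have h1 : σ (some a) ∈ m.map some := h.apply_mem_iff.2 (List.mem_map_of_mem ha)
    obtain ⟨c, _, hc⟩ := List.mem_map.1 h1
    rw [removeNone_apply hc.symm, hc]

/-- A new element can be inserted anywhere in a cycle, without changing the other cycles. -/
theorem exists_insert (σ' : Perm D) (A B : List D) (h : IsCyc σ' (A ++ B)) :
    ∃ σ : Perm (Option D), removeNone σ = σ' ∧
      IsCyc σ (A.map some ++ none :: B.map some) := by
  classical
  suffices hs : ∀ l : List D, IsCyc σ' l →
      ∃ σ : Perm (Option D), removeNone σ = σ' ∧ IsCyc σ (none :: l.map some) by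
    obtain ⟨σ, h1, h2⟩ := hs _ h.append_comm
    refine ⟨σ, h1, ?_⟩
    have : IsCyc σ ((none :: B.map some) ++ A.map some) := by simpa using h2
    exact this.append_comm
  intro l hl
  cases l with
  | nil =>
    refine ⟨optionCongr σ', removeNone_optionCongr σ', ?_⟩
    simp [isCyc_cons]
  | cons x s =>
    -- The permutation that sends `none` to `x`, and that deletes to `σ'`.
    refine ⟨Perm.decomposeOption.symm (some x, σ'), ?_, ?_⟩
    · exact congrArg Prod.snd (Perm.decomposeOption.apply_symm_apply (some x, σ'))
    · rw [isCyc_cons] at hl ⊢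
      refine ⟨by simpa [List.nodup_map_iff (Option.some_injective D)] using hl.1, ?_⟩
      have hx : x ∉ s := (List.nodup_cons.1 hl.1).1
      have h1 : ((x :: s).map some).map (Perm.decomposeOption.symm (some x, σ')) =
          (s ++ [x]).map (fun a => swap none (some x) (some a)) := by
        rw [← hl.2]; simp
      rw [List.map_cons, h1]
      have h2 : s.map (fun a => swap none (some x) (some a)) = s.map some :=
        List.map_inj_left.2 fun a ha => by
          rw [swap_apply_of_ne_of_ne (by simp)]
          rintro h; rw [Option.some_injective _ h] at ha; exact hx ha
      simp [h2]

theorem perm_option_ext {σ τ : Perm (Option D)} (h : removeNone σ = removeNone τ)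
    (h' : σ none = τ none) : σ = τ := by
  classical
  exact Perm.decomposeOption.injective (Prod.ext h' h)

/-- The number of cycles of a permutation, fixed points included. -/
noncomputable def cycNum (σ : Perm D) : ℕ := Nat.card (Quot fun a b => σ a = b)

theorem eqvGen_iff_sameCycle {σ : Perm D} {a b : D} :
    Relation.EqvGen (fun a b => σ a = b) a b ↔ σ.SameCycle a b := by
  constructor
  · intro h
    induction h with
    | rel a b h => exact ⟨1, by simpa using h⟩
    | refl => exact Perm.SameCycle.refl _ _
    | symm _ _ _ ih => exact ih.symm
    | trans _ _ _ _ _ ih ih' => exact ih.trans ih'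
  · rintro ⟨i, rfl⟩
    induction i using Int.induction_on with
    | zero => exact Relation.EqvGen.refl _
    | succ i ih =>
      refine ih.trans _ _ _ (.rel _ _ ?_)
      rw [add_comm, zpow_add, zpow_one, Perm.mul_apply]
    | pred i ih =>
      refine ih.trans _ _ _ (.symm _ _ (.rel _ _ ?_))
      rw [sub_eq_neg_add, zpow_add, zpow_neg_one, Perm.mul_apply]
      simp

theorem card_quotient_sameCycle (σ : Perm D) :
    Nat.card (Quotient (Perm.SameCycle.setoid σ)) = cycNum σ := by
  exact Nat.card_congr
    { toFun := Quotient.lift (Quot.mk _) fun a b h => Quot.eqvGen_sound (eqvGen_iff_sameCycle.2 h)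
      invFun := Quot.lift (Quotient.mk _) (by
        rintro a _ rfl
        exact Quotient.sound (eqvGen_iff_sameCycle.1 (.rel _ _ rfl)))
      left_inv := by rintro ⟨x⟩; rfl
      right_inv := by rintro ⟨x⟩; rfl }

/-- Gluing together two classes of an equivalence relation lowers the number of classes by one. -/
theorem card_quot_insert [Finite D] (r : D → D → Prop) (a b : D) :
    (Relation.EqvGen r a b →
      Nat.card (Quot fun x y => r x y ∨ (x = a ∧ y = b)) = Nat.card (Quot r)) ∧
    (¬ Relation.EqvGen r a b →
      Nat.card (Quot fun x y => r x y ∨ (x = a ∧ y = b)) + 1 = Nat.card (Quot r)) := by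
  classical
  constructor
  · intro h
    have h0 : Quot.mk r a = Quot.mk r b := Quot.eqvGen_sound h
    exact Nat.card_congr
      { toFun := Quot.lift (Quot.mk r) (by
          rintro x y (h1 | ⟨rfl, rfl⟩)
          · exact Quot.sound h1
          · exact h0)
        invFun := Quot.lift (Quot.mk _) fun x y h1 => Quot.sound (Or.inl h1)
        left_inv := by rintro ⟨x⟩; rfl
        right_inv := by rintro ⟨x⟩; rfl }
  · intro h
    have h0 : Quot.mk r a ≠ Quot.mk r b := fun h1 => h (Quot.eqvGen_exact h1)
    -- The glued quotient is the old one without the class of `b`, which is identified with that of `a`.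
    let f : D → {q : Quot r // q ≠ Quot.mk r b} := fun x =>
      if hx : Quot.mk r x = Quot.mk r b then ⟨Quot.mk r a, h0⟩ else ⟨Quot.mk r x, hx⟩
    let e : (Quot fun x y => r x y ∨ (x = a ∧ y = b)) ≃ {q : Quot r // q ≠ Quot.mk r b} :=
      { toFun := Quot.lift f (by
          rintro x y (h1 | ⟨rfl, rfl⟩)
          · have : Quot.mk r x = Quot.mk r y := Quot.sound h1
            simp only [f, this]
          · simp [f, h0])
        invFun := fun q => Quot.lift (Quot.mk _) (fun x y h1 => Quot.sound (Or.inl h1)) q.1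
        left_inv := by
          rintro ⟨x⟩
          by_cases hx : Quot.mk r x = Quot.mk r b
          · simp only [f, hx, dite_true]
            have h2 : (Quot.mk (fun x y => r x y ∨ (x = a ∧ y = b)) x) = Quot.mk _ b :=
              congrArg (Quot.lift (Quot.mk _) (fun x y h1 => Quot.sound (Or.inl h1))) hx
            exact (Quot.sound (Or.inr ⟨rfl, rfl⟩) : Quot.mk _ a = Quot.mk _ b).trans h2.symm
          · simp only [f, hx, dite_false]
        right_inv := by
          rintro ⟨⟨x⟩, hx⟩
          simp only [f]
          rw [dif_neg hx] }
    rw [Nat.card_congr e, ← Finite.card_option, Nat.card_congr (optionSubtypeNe (Quot.mk r b))]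

/-- Deleting a fixed point removes one cycle. -/
theorem cycNum_removeNone_of_fixed [Finite D] {π : Perm (Option D)} (h : π none = none) :
    cycNum π = cycNum (removeNone π) + 1 := by
  rw [cycNum, cycNum, ← Finite.card_option]
  have hs : ∀ a, π (some a) = some (removeNone π a) := by
    intro a
    cases h' : π (some a) with
    | none => exact absurd (π.injective (h'.trans h.symm)) (by simp)
    | some c => rw [removeNone_apply h']
  exact Nat.card_congr
    { toFun := Quot.lift (fun o => o.map (Quot.mk _)) (by
        rintro (_ | a) y rfl
        · rw [h]
        · rw [hs]; exact congrArg some (Quot.sound rfl))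
      invFun := fun o => o.elim (Quot.mk _ none)
        (Quot.lift (fun a => Quot.mk _ (some a)) (by
          rintro a _ rfl
          exact Quot.sound (hs a)))
      left_inv := by rintro ⟨_ | a⟩ <;> rfl
      right_inv := by
        rintro (_ | q)
        · rfl
        · induction q using Quot.ind
          rfl }

/-- Deleting a point that is not fixed leaves the number of cycles unchanged. -/
theorem cycNum_removeNone_of_ne {π : Perm (Option D)} (h : π none ≠ none) :
    cycNum π = cycNum (removeNone π) := by
  obtain ⟨x, hx⟩ := Option.ne_none_iff_exists'.1 h
  -- `none` belongs to the cycle of its image `x`.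
  exact Nat.card_congr
    { toFun := Quot.lift (fun o => Quot.mk _ (o.getD x)) (by
        rintro (_ | a) y rfl
        · rw [hx]; rfl
        · cases h' : π (some a) with
          | none => exact Quot.sound (removeNone_apply' h' hx)
          | some c => exact Quot.sound (removeNone_apply h'))
      invFun := Quot.lift (fun a => Quot.mk _ (some a)) (by
        rintro a _ rfl
        cases h' : π (some a) with
        | none =>
          rw [removeNone_apply' h' hx]
          exact (Quot.sound h' : Quot.mk (fun a b => π a = b) (some a) = Quot.mk _ none).trans
            (Quot.sound hx)
        | some c => rw [removeNone_apply h']; exact Quot.sound h')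
      left_inv := by
        rintro ⟨_ | a⟩
        · exact (Quot.sound hx : Quot.mk (fun a b => π a = b) none = Quot.mk _ (some x)).symm
        · rfl
      right_inv := by rintro ⟨a⟩; rfl }

end ONModel

/-! ### Labelled maps -/

namespace ONModel

open Equiv

/-- Raw data of a labelled map: two permutations of the set `D` of half-edges, a colouring telling
which half-edges are crossed by a path, and two families of marked faces, given as cyclic lists of
half-edges. An empty list in `main` stands for a component reduced to a vertex. -/
structure PMap (κ ι D : Type) where
  face : Perm D
  glue : Perm D
  col : D → Bool
  main : κ → List D
  aux : ι → List D

theorem cycle_map_injective {D D' : Type} {f : D → D'} (hf : Function.Injective f) :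
    Function.Injective (Cycle.map f) := by
  intro s t h
  induction s using Quotient.inductionOn' with | _ l
  induction t using Quotient.inductionOn' with | _ m
  obtain ⟨n, hn⟩ := (Cycle.coe_eq_coe.1 h : l.map f ~r m.map f)
  rw [← List.map_rotate] at hn
  exact Cycle.coe_eq_coe.2 ⟨n, hf.list_map hn⟩

theorem finite_nodup (D : Type) [Finite D] : {l : List D | l.Nodup}.Finite := by
  classical
  have := Fintype.ofFinite D
  exact @Set.toFinite _ _ (@Finite.of_fintype _ (fintypeNodupList : Fintype {l : List D // l.Nodup}))

namespace PMap

variable {κ ι D κ₁ ι₁ D₁ κ₂ ι₂ D₂ : Type}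

/-- The unmarked faces. -/
def faces (M : PMap κ ι D) : Set (Cycle D) :=
  {s | ∃ l : List D, l ≠ [] ∧ (l : Cycle D) = s ∧ IsCyc M.face l ∧
    ∀ a ∈ l, (∀ k, a ∉ M.main k) ∧ ∀ i, a ∉ M.aux i}

/-- The number of loops. -/
noncomputable def loops (M : PMap κ ι D) : ℕ :=
  Nat.card (Quot fun a b : {a // M.col a = true} =>
    (b : D) = M.glue a ∨ M.face.SameCycle (a : D) b)

/-- The number of vertices, including the components reduced to a vertex. -/
noncomputable def nv (M : PMap κ ι D) : ℕ :=
  cycNum (M.face * M.glue) + Nat.card {k // M.main k = []}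

/-- The weight of a labelled map: `τ` weighs the unmarked faces, through the cyclic word of their
colours, `z` weighs the loops, and `f` weighs the auxiliary marked faces, through their degree. -/
noncomputable def wt [Fintype ι] (τ : Cycle Bool → ℂ) (z : ℂ) (f : ι → ℕ → ℂ) (M : PMap κ ι D) :
    ℂ :=
  (∏ᶠ s ∈ M.faces, τ (s.map M.col)) * z ^ M.loops * ∏ i, f i (M.aux i).length

/-- The data defines a map, in which each component contains one of the faces of the family `main`,
and where the auxiliary marked faces are not crossed by paths. -/
structure Ok (M : PMap κ ι D) : Prop where
  glue_glue : ∀ a, M.glue (M.glue a) = a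
  glue_ne : ∀ a, M.glue a ≠ a
  col_glue : ∀ a, M.col (M.glue a) = M.col a
  main_cyc : ∀ k, IsCyc M.face (M.main k)
  aux_cyc : ∀ i, IsCyc M.face (M.aux i)
  aux_ne : ∀ i, M.aux i ≠ []
  aux_col : ∀ i, ∀ a ∈ M.aux i, M.col a = false
  main_main : ∀ k k', ∀ a ∈ M.main k, a ∈ M.main k' → k = k'
  aux_aux : ∀ i j, ∀ a ∈ M.aux i, a ∈ M.aux j → i = j
  main_aux : ∀ k i, ∀ a ∈ M.main k, a ∉ M.aux i
  conn : ∀ S : Set D, (∀ a ∈ S, M.face a ∈ S) → (∀ a ∈ S, M.glue a ∈ S) →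
    (∀ k, ∀ a ∈ M.main k, a ∈ S) → ∀ a, a ∈ S

/-- Euler's relation, in which `V - E + F` is `2 |κ| - 2 g`. Hence `g` is the genus of a connected
map with one main face and the sum of the two genera of a map with two components, each with one
main face, but it exceeds by one the genus of a connected map with two main faces. -/
def Genus (M : PMap κ ι D) (g : ℕ) : Prop :=
  2 * (M.nv + Nat.card κ + Nat.card ι + M.faces.ncard + 2 * g) = 4 * Nat.card κ + Nat.card D

/-- The labelled maps of given genus and number of vertices, whose main faces have given colours. -/
def maps (D : Type) (g v : ℕ) (w : κ → List Bool) : Set (PMap κ ι D) :=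
  {M | M.Ok ∧ M.Genus g ∧ M.nv = v ∧ ∀ k, (M.main k).map M.col = w k}

theorem faces_finite [Finite D] (M : PMap κ ι D) : M.faces.Finite := by
  refine ((finite_nodup D).image (fun l : List D => (l : Cycle D))).subset ?_
  rintro s ⟨l, _, rfl, h, _⟩
  exact ⟨l, h.1, rfl⟩

theorem finite_ok [Finite D] [Finite κ] [Finite ι] : {M : PMap κ ι D | M.Ok}.Finite := by
  have : Finite {l : List D | l.Nodup} := finite_nodup D
  let F : {M : PMap κ ι D | M.Ok} → Perm D × Perm D × (D → Bool) × (κ → {l : List D | l.Nodup}) ×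
      (ι → {l : List D | l.Nodup}) := fun M =>
    (M.1.face, M.1.glue, M.1.col, fun k => ⟨M.1.main k, (M.2.main_cyc k).1⟩,
      fun i => ⟨M.1.aux i, (M.2.aux_cyc i).1⟩)
  have hF : Function.Injective F := by
    rintro ⟨⟨f, g, c, m, x⟩, h⟩ ⟨⟨f', g', c', m', x'⟩, h'⟩ heq
    simp only [F, Prod.mk.injEq, funext_iff, Subtype.mk.injEq] at heq
    obtain ⟨rfl, rfl, h1, h2, h3⟩ := heq
    obtain rfl : c = c' := funext h1
    obtain rfl : m = m' := funext h2
    obtain rfl : x = x' := funext h3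
    rfl
  exact Set.finite_coe_iff.1 (Finite.of_injective F hF)

theorem finite_maps [Finite D] [Finite κ] [Finite ι] (g v : ℕ) (w : κ → List Bool) :
    (maps D g v w : Set (PMap κ ι D)).Finite :=
  finite_ok.subset fun _ h => h.1

/-- `M₁` is embedded in `M` as a union of components. -/
structure Emb (M₁ : PMap κ₁ ι₁ D₁) (M : PMap κ ι D) (gκ : κ₁ → κ) (gι : ι₁ → ι) (g : D₁ → D) :
    Prop where
  inj : Function.Injective g
  face : ∀ a, M.face (g a) = g (M₁.face a)
  glue : ∀ a, M.glue (g a) = g (M₁.glue a)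
  col : ∀ a, M.col (g a) = M₁.col a
  main : ∀ k, M.main (gκ k) = (M₁.main k).map g
  aux : ∀ i, M.aux (gι i) = (M₁.aux i).map g

/-- `M` is the disjoint union of `M₁` and `M₂`. -/
structure IsSum (M₁ : PMap κ₁ ι₁ D₁) (M₂ : PMap κ₂ ι₂ D₂) (M : PMap κ ι D) (eκ : κ₁ ⊕ κ₂ ≃ κ)
    (eι : ι₁ ⊕ ι₂ ≃ ι) (e : D₁ ⊕ D₂ ≃ D) : Prop where
  left : Emb M₁ M (fun k => eκ (.inl k)) (fun i => eι (.inl i)) (fun a => e (.inl a))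
  right : Emb M₂ M (fun k => eκ (.inr k)) (fun i => eι (.inr i)) (fun a => e (.inr a))

namespace Emb

variable {M₁ : PMap κ₁ ι₁ D₁} {M : PMap κ ι D} {gκ : κ₁ → κ} {gι : ι₁ → ι} {g : D₁ → D}

theorem isCyc_iff (h : Emb M₁ M gκ gι g) {l : List D₁} :
    IsCyc M.face (l.map g) ↔ IsCyc M₁.face l :=
  ⟨fun h' => h'.of_map h.inj fun a _ => h.face a, fun h' => h'.map h.inj fun a _ => h.face a⟩

theorem exists_map [Finite D₁] (h : Emb M₁ M gκ gι g) {l : List D} {a : D₁} (hl : IsCyc M.face l)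
    (ha : g a ∈ l) : ∃ l₁ : List D₁, l = l₁.map g := by
  obtain ⟨m, hm⟩ := exists_isCyc M₁.face a
  obtain ⟨n, hn⟩ := (h.isCyc_iff.2 hm).isRotated hl (a := g a) (by simp) ha
  exact ⟨_, by rw [← hn, ← List.map_rotate]⟩

theorem sameCycle_iff [Finite D₁] (h : Emb M₁ M gκ gι g) {a b : D₁} :
    M.face.SameCycle (g a) (g b) ↔ M₁.face.SameCycle a b := by
  obtain ⟨m, hm⟩ := exists_isCyc M₁.face a
  rw [hm.sameCycle_iff (by simp), (h.isCyc_iff.2 hm).sameCycle_iff (a := g a) (by simp),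
    List.mem_map_of_injective h.inj]

end Emb

/-- The classes of a relation that never relates the two summands. -/
theorem card_quot_sum {X X₁ X₂ : Type} [Finite X₁] [Finite X₂] (e : X₁ ⊕ X₂ ≃ X)
    {r : X → X → Prop} {r₁ : X₁ → X₁ → Prop} {r₂ : X₂ → X₂ → Prop}
    (h₁ : ∀ a b, r (e (.inl a)) (e (.inl b)) ↔ r₁ a b)
    (h₂ : ∀ a b, r (e (.inr a)) (e (.inr b)) ↔ r₂ a b)
    (h₁₂ : ∀ a b, ¬ r (e (.inl a)) (e (.inr b))) (h₂₁ : ∀ a b, ¬ r (e (.inr a)) (e (.inl b))) :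
    Nat.card (Quot r) = Nat.card (Quot r₁) + Nat.card (Quot r₂) := by
  rw [← Nat.card_sum]
  let F : X₁ ⊕ X₂ → Quot r₁ ⊕ Quot r₂ := Sum.map (Quot.mk r₁) (Quot.mk r₂)
  refine Nat.card_congr
    { toFun := Quot.lift (fun x => F (e.symm x)) ?_
      invFun := Sum.elim (Quot.lift (fun a => Quot.mk r (e (.inl a)))
          fun a b h => Quot.sound ((h₁ a b).2 h))
        (Quot.lift (fun a => Quot.mk r (e (.inr a))) fun a b h => Quot.sound ((h₂ a b).2 h))
      left_inv := ?_
      right_inv := ?_ }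
  · intro x y h
    obtain ⟨x, rfl⟩ := e.surjective x
    obtain ⟨y, rfl⟩ := e.surjective y
    simp only [Equiv.symm_apply_apply]
    rcases x with a | a <;> rcases y with b | b
    · exact congrArg Sum.inl (Quot.sound ((h₁ a b).1 h))
    · exact absurd h (h₁₂ a b)
    · exact absurd h (h₂₁ a b)
    · exact congrArg Sum.inr (Quot.sound ((h₂ a b).1 h))
  · rintro ⟨x⟩
    obtain ⟨x | x, rfl⟩ := e.surjective x
    · change Sum.elim _ _ (F (e.symm (e _))) = _
      rw [Equiv.symm_apply_apply]; rfl
    · change Sum.elim _ _ (F (e.symm (e _))) = _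
      rw [Equiv.symm_apply_apply]; rfl
  · rintro (⟨⟨x⟩⟩ | ⟨⟨x⟩⟩)
    · change F (e.symm (e (.inl x))) = _
      rw [Equiv.symm_apply_apply]; rfl
    · change F (e.symm (e (.inr x))) = _
      rw [Equiv.symm_apply_apply]; rfl

theorem card_subtype_sum {X X₁ X₂ : Type} [Finite X₁] [Finite X₂] (e : X₁ ⊕ X₂ ≃ X) (P : X → Prop) :
    Nat.card {x // P x} = Nat.card {a // P (e (.inl a))} + Nat.card {a // P (e (.inr a))} := by
  rw [← Nat.card_sum]
  exact Nat.card_congr ((e.subtypeEquiv fun _ => Iff.rfl).symm.trans subtypeSum)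

namespace IsSum

variable {M₁ : PMap κ₁ ι₁ D₁} {M₂ : PMap κ₂ ι₂ D₂} {M : PMap κ ι D} {eκ : κ₁ ⊕ κ₂ ≃ κ}
  {eι : ι₁ ⊕ ι₂ ≃ ι} {e : D₁ ⊕ D₂ ≃ D}

theorem cycNum_eq [Finite D₁] [Finite D₂] (h : IsSum M₁ M₂ M eκ eι e) :
    cycNum (M.face * M.glue) = cycNum (M₁.face * M₁.glue) + cycNum (M₂.face * M₂.glue) := by
  refine card_quot_sum e ?_ ?_ ?_ ?_
  all_goals intro a b; simp [h.left.glue, h.left.face, h.right.glue, h.right.face]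

theorem nv_eq [Finite D₁] [Finite D₂] [Finite κ₁] [Finite κ₂] (h : IsSum M₁ M₂ M eκ eι e) :
    M.nv = M₁.nv + M₂.nv := by
  unfold nv
  rw [h.cycNum_eq, card_subtype_sum eκ]
  simp only [h.left.main, h.right.main, List.map_eq_nil_iff]
  omega

theorem loops_eq [Finite D₁] [Finite D₂] (h : IsSum M₁ M₂ M eκ eι e) :
    M.loops = M₁.loops + M₂.loops := by
  let e' : {a // M₁.col a = true} ⊕ {a // M₂.col a = true} ≃ {a // M.col a = true} :=
    ((Equiv.sumCongr (subtypeEquivRight fun a => by rw [← h.left.col a])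
      (subtypeEquivRight fun a => by rw [← h.right.col a])).trans subtypeSum.symm).trans
      (e.subtypeEquiv fun _ => Iff.rfl)
  have h1 : ∀ a, (e' (.inl a) : D) = e (.inl a) := fun a => rfl
  have h2 : ∀ a, (e' (.inr a) : D) = e (.inr a) := fun a => rfl
  have hx : ∀ a b, ¬ M.face.SameCycle (e (.inl a)) (e (.inr b)) := by
    intro a b hab
    obtain ⟨m, hm⟩ := exists_isCyc M₁.face a
    rw [(h.left.isCyc_iff.2 hm).sameCycle_iff (a := e (.inl a)) (by simp)] at hab
    simp at hab
  refine card_quot_sum e' ?_ ?_ ?_ ?_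
  · intro a b
    rw [h1, h1, h.left.glue, h.left.sameCycle_iff]; simp
  · intro a b
    rw [h2, h2, h.right.glue, h.right.sameCycle_iff]; simp
  · intro a b
    rw [h1, h2, h.left.glue]
    simpa using hx a b
  · intro a b
    rw [h1, h2, h.right.glue]
    simpa using fun h' => hx b a h'.symm

theorem faces_eq [Finite D₁] [Finite D₂] (h : IsSum M₁ M₂ M eκ eι e) :
    M.faces = Cycle.map (fun a => e (.inl a)) '' M₁.faces ∪
      Cycle.map (fun a => e (.inr a)) '' M₂.faces := by
  have um1 : ∀ a, ((∀ k, e (.inl a) ∉ M.main k) ∧ ∀ i, e (.inl a) ∉ M.aux i) ↔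
      (∀ k, a ∉ M₁.main k) ∧ ∀ i, a ∉ M₁.aux i := by
    intro a
    rw [← eκ.forall_congr_right, ← eι.forall_congr_right]
    simp [h.left.main, h.right.main, h.left.aux, h.right.aux]
  have um2 : ∀ a, ((∀ k, e (.inr a) ∉ M.main k) ∧ ∀ i, e (.inr a) ∉ M.aux i) ↔
      (∀ k, a ∉ M₂.main k) ∧ ∀ i, a ∉ M₂.aux i := by
    intro a
    rw [← eκ.forall_congr_right, ← eι.forall_congr_right]
    simp [h.left.main, h.right.main, h.left.aux, h.right.aux]
  ext s
  constructor
  · rintro ⟨l, hne, rfl, hl, hu⟩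
    obtain ⟨x, hx⟩ := List.exists_mem_of_ne_nil l hne
    obtain ⟨a | a, rfl⟩ := e.surjective x
    · obtain ⟨m, rfl⟩ := h.left.exists_map hl hx
      refine Or.inl ⟨(m : Cycle D₁), ⟨m, by simpa using hne, rfl, h.left.isCyc_iff.1 hl,
        fun b hb => (um1 b).1 (hu _ (List.mem_map_of_mem hb))⟩, rfl⟩
    · obtain ⟨m, rfl⟩ := h.right.exists_map hl hx
      refine Or.inr ⟨(m : Cycle D₂), ⟨m, by simpa using hne, rfl, h.right.isCyc_iff.1 hl,
        fun b hb => (um2 b).1 (hu _ (List.mem_map_of_mem hb))⟩, rfl⟩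
  · rintro (⟨_, ⟨m, hne, rfl, hm, hu⟩, rfl⟩ | ⟨_, ⟨m, hne, rfl, hm, hu⟩, rfl⟩)
    · refine ⟨_, by simpa using hne, rfl, h.left.isCyc_iff.2 hm, fun b hb => ?_⟩
      obtain ⟨a, ha, rfl⟩ := List.mem_map.1 hb
      exact (um1 a).2 (hu a ha)
    · refine ⟨_, by simpa using hne, rfl, h.right.isCyc_iff.2 hm, fun b hb => ?_⟩
      obtain ⟨a, ha, rfl⟩ := List.mem_map.1 hb
      exact (um2 a).2 (hu a ha)

theorem faces_disjoint :
    Disjoint (Cycle.map (fun a => e (.inl a)) '' M₁.faces)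
      (Cycle.map (fun a => e (.inr a)) '' M₂.faces) := by
  rw [Set.disjoint_left]
  rintro _ ⟨_, ⟨m, hne, rfl, -, -⟩, rfl⟩ ⟨_, ⟨m', hne', rfl, -, -⟩, h⟩
  obtain ⟨x, hx⟩ := List.exists_mem_of_ne_nil m hne
  have h1 : e (.inl x) ∈ Cycle.map (fun a => e (.inl a)) (m : Cycle D₁) :=
    Cycle.mem_map.2 ⟨x, hx, rfl⟩
  rw [← h] at h1
  obtain ⟨y, _, hy⟩ := Cycle.mem_map.1 h1
  simp at hy

theorem ncard_faces [Finite D₁] [Finite D₂] (h : IsSum M₁ M₂ M eκ eι e) :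
    M.faces.ncard = M₁.faces.ncard + M₂.faces.ncard := by
  rw [h.faces_eq, Set.ncard_union_eq faces_disjoint (M₁.faces_finite.image _)
    (M₂.faces_finite.image _), Set.ncard_image_of_injective _ (cycle_map_injective h.left.inj),
    Set.ncard_image_of_injective _ (cycle_map_injective h.right.inj)]

theorem wt_eq [Fintype ι] [Fintype ι₁] [Fintype ι₂] [Finite D₁] [Finite D₂] (τ : Cycle Bool → ℂ)
    (z : ℂ) (f : ι → ℕ → ℂ) (h : IsSum M₁ M₂ M eκ eι e) :
    M.wt τ z f = M₁.wt τ z (fun i => f (eι (.inl i))) * M₂.wt τ z (fun i => f (eι (.inr i))) := by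
  unfold wt
  have c1 : ∀ s : Cycle D₁, (s.map (fun a => e (.inl a))).map M.col = s.map M₁.col := by
    intro s
    induction s using Quotient.inductionOn' with | _ l
    simp [h.left.col, Function.comp_def]
  have c2 : ∀ s : Cycle D₂, (s.map (fun a => e (.inr a))).map M.col = s.map M₂.col := by
    intro s
    induction s using Quotient.inductionOn' with | _ l
    simp [h.right.col, Function.comp_def]
  rw [h.faces_eq, finprod_mem_union faces_disjoint (M₁.faces_finite.image _)
    (M₂.faces_finite.image _), finprod_mem_image (cycle_map_injective h.left.inj).injOn,
    finprod_mem_image (cycle_map_injective h.right.inj).injOn, h.loops_eq, pow_add,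
    ← eι.prod_comp, Fintype.prod_sum_type]
  simp only [c1, c2, h.left.aux, h.right.aux, List.length_map]
  ring

theorem symm (h : IsSum M₁ M₂ M eκ eι e) :
    IsSum M₂ M₁ M ((sumComm κ₂ κ₁).trans eκ) ((sumComm ι₂ ι₁).trans eι) ((sumComm D₂ D₁).trans e) :=
  ⟨h.right, h.left⟩

theorem ok_left (h : IsSum M₁ M₂ M eκ eι e) (H : M.Ok) : M₁.Ok := by
  have i1 := h.left.inj
  constructor
  · intro a; apply i1; simp only [← h.left.glue, H.glue_glue]
  · intro a ha; apply H.glue_ne (e (.inl a)); rw [h.left.glue, ha]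
  · intro a; rw [← h.left.col, ← h.left.glue, H.col_glue, h.left.col]
  · intro k; rw [← h.left.isCyc_iff, ← h.left.main]; exact H.main_cyc _
  · intro i; rw [← h.left.isCyc_iff, ← h.left.aux]; exact H.aux_cyc _
  · intro i hi; apply H.aux_ne (eι (.inl i)); rw [h.left.aux, hi]; rfl
  · intro i a ha; rw [← h.left.col]; apply H.aux_col (eι (.inl i))
    rw [h.left.aux]; exact List.mem_map_of_mem ha
  · intro k k' a ha ha'
    have := H.main_main (eκ (.inl k)) (eκ (.inl k')) (e (.inl a))
      (by rw [h.left.main]; exact List.mem_map_of_mem ha)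
      (by rw [h.left.main]; exact List.mem_map_of_mem ha')
    simpa using this
  · intro k k' a ha ha'
    have := H.aux_aux (eι (.inl k)) (eι (.inl k')) (e (.inl a))
      (by rw [h.left.aux]; exact List.mem_map_of_mem ha)
      (by rw [h.left.aux]; exact List.mem_map_of_mem ha')
    simpa using this
  · intro k i a ha ha'
    exact H.main_aux (eκ (.inl k)) (eι (.inl i)) (e (.inl a))
      (by rw [h.left.main]; exact List.mem_map_of_mem ha)
      (by rw [h.left.aux]; exact List.mem_map_of_mem ha')
  · intro S s1 s2 s3 a
    -- A set that is stable in `M₁` is stable in `M` once all of `M₂` is added to it.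
    have := H.conn {x | ∀ b, x = e (.inl b) → b ∈ S} (fun x hx b hb => by
        obtain ⟨y | y, rfl⟩ := e.surjective x
        · rw [h.left.face] at hb; rw [← i1 hb]; exact s1 _ (hx y rfl)
        · rw [h.right.face] at hb; simp at hb)
      (fun x hx b hb => by
        obtain ⟨y | y, rfl⟩ := e.surjective x
        · rw [h.left.glue] at hb; rw [← i1 hb]; exact s2 _ (hx y rfl)
        · rw [h.right.glue] at hb; simp at hb)
      (fun k x hx b hb => by
        obtain ⟨k | k, rfl⟩ := eκ.surjective k
        · rw [h.left.main] at hx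
          obtain ⟨y, hy, rfl⟩ := List.mem_map.1 hx
          rw [← i1 hb]; exact s3 _ _ hy
        · rw [h.right.main] at hx
          obtain ⟨y, hy, rfl⟩ := List.mem_map.1 hx
          simp at hb) (e (.inl a))
    exact this a rfl

theorem ok_iff (h : IsSum M₁ M₂ M eκ eι e) : M.Ok ↔ M₁.Ok ∧ M₂.Ok := by
  have i1 := h.left.inj
  have i2 := h.right.inj
  constructor
  · exact fun H => ⟨h.ok_left H, h.symm.ok_left H⟩
  · rintro ⟨H1, H2⟩
    constructor
    · rw [← e.forall_congr_right]
      rintro (a | a)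
      · rw [h.left.glue, h.left.glue, H1.glue_glue]
      · rw [h.right.glue, h.right.glue, H2.glue_glue]
    · rw [← e.forall_congr_right]
      rintro (a | a)
      · rw [h.left.glue, i1.ne_iff]; exact H1.glue_ne a
      · rw [h.right.glue, i2.ne_iff]; exact H2.glue_ne a
    · rw [← e.forall_congr_right]
      rintro (a | a)
      · rw [h.left.glue, h.left.col, h.left.col, H1.col_glue]
      · rw [h.right.glue, h.right.col, h.right.col, H2.col_glue]
    · rw [← eκ.forall_congr_right]
      rintro (k | k)
      · rw [h.left.main, h.left.isCyc_iff]; exact H1.main_cyc k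
      · rw [h.right.main, h.right.isCyc_iff]; exact H2.main_cyc k
    · rw [← eι.forall_congr_right]
      rintro (k | k)
      · rw [h.left.aux, h.left.isCyc_iff]; exact H1.aux_cyc k
      · rw [h.right.aux, h.right.isCyc_iff]; exact H2.aux_cyc k
    · rw [← eι.forall_congr_right]
      rintro (k | k)
      · simpa [h.left.aux] using H1.aux_ne k
      · simpa [h.right.aux] using H2.aux_ne k
    · rw [← eι.forall_congr_right]
      rintro (k | k)
      · simpa [h.left.aux, h.left.col] using H1.aux_col k
      · simpa [h.right.aux, h.right.col] using H2.aux_col k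
    · rw [← eκ.forall_congr_right]
      intro k
      rw [← eκ.forall_congr_right]
      intro k'
      rw [← e.forall_congr_right]
      rcases k with k | k <;> rcases k' with k' | k' <;> rintro (a | a) <;>
        simp only [h.left.main, h.right.main, List.mem_map, EmbeddingLike.apply_eq_iff_eq,
          Sum.inl.injEq, Sum.inr.injEq, exists_eq_right, reduceCtorEq, and_false, exists_false,
          false_imp_iff, imp_true_iff, imp_false, not_false_eq_true]
      · exact H1.main_main k k' a
      · exact H2.main_main k k' a
    · rw [← eι.forall_congr_right]
      intro k
      rw [← eι.forall_congr_right]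
      intro k'
      rw [← e.forall_congr_right]
      rcases k with k | k <;> rcases k' with k' | k' <;> rintro (a | a) <;>
        simp only [h.left.aux, h.right.aux, List.mem_map, EmbeddingLike.apply_eq_iff_eq,
          Sum.inl.injEq, Sum.inr.injEq, exists_eq_right, reduceCtorEq, and_false, exists_false,
          false_imp_iff, imp_true_iff, imp_false, not_false_eq_true]
      · exact H1.aux_aux k k' a
      · exact H2.aux_aux k k' a
    · rw [← eκ.forall_congr_right]
      intro k
      rw [← eι.forall_congr_right]
      intro k'
      rw [← e.forall_congr_right]
      rcases k with k | k <;> rcases k' with k' | k' <;> rintro (a | a) <;>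
        simp only [h.left.aux, h.right.aux, h.left.main, h.right.main, List.mem_map,
          EmbeddingLike.apply_eq_iff_eq, not_false_eq_true,
          Sum.inl.injEq, Sum.inr.injEq, exists_eq_right, reduceCtorEq, and_false, exists_false,
          false_imp_iff, imp_true_iff]
      · exact H1.main_aux k k' a
      · exact H2.main_aux k k' a
    · intro S s1 s2 s3
      rw [← e.forall_congr_right]
      rintro (a | a)
      · exact H1.conn {a | e (.inl a) ∈ S} (fun a ha => by
            have := s1 _ ha; rwa [h.left.face] at this)
          (fun a ha => by have := s2 _ ha; rwa [h.left.glue] at this)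
          (fun k a ha => s3 (eκ (.inl k)) _ (by rw [h.left.main]; exact List.mem_map_of_mem ha)) a
      · exact H2.conn {a | e (.inr a) ∈ S} (fun a ha => by
            have := s1 _ ha; rwa [h.right.face] at this)
          (fun a ha => by have := s2 _ ha; rwa [h.right.glue] at this)
          (fun k a ha => s3 (eκ (.inr k)) _ (by rw [h.right.main]; exact List.mem_map_of_mem ha)) a

end IsSum

/-- Transport of a map along a relabelling of its half-edges and of its marked faces. -/
def relabel (eκ : κ₁ ≃ κ) (eι : ι₁ ≃ ι) (e : D₁ ≃ D) (M : PMap κ₁ ι₁ D₁) : PMap κ ι D where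
  face := e.permCongr M.face
  glue := e.permCongr M.glue
  col a := M.col (e.symm a)
  main k := (M.main (eκ.symm k)).map e
  aux i := (M.aux (eι.symm i)).map e

/-- The empty map. -/
def empty : PMap Empty Empty Empty := ⟨1, 1, Empty.elim, Empty.elim, Empty.elim⟩

theorem relabel_isSum (eκ : κ₁ ≃ κ) (eι : ι₁ ≃ ι) (e : D₁ ≃ D) (M : PMap κ₁ ι₁ D₁) :
    IsSum M empty (M.relabel eκ eι e) ((sumEmpty κ₁ Empty).trans eκ) ((sumEmpty ι₁ Empty).trans eι)
      ((sumEmpty D₁ Empty).trans e) := by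
  constructor <;> constructor
  · intro a b h; simpa using h
  all_goals first
    | rintro ⟨⟩
    | (intro a; simp [relabel])

theorem empty_ok : empty.Ok := by
  constructor
  case conn => exact fun _ _ _ _ a => a.elim
  all_goals rintro ⟨⟩

theorem empty_faces : empty.faces = ∅ := by
  ext s
  simp only [faces, Set.mem_ofPred_eq, Set.mem_empty_iff_false, iff_false]
  rintro ⟨_ | ⟨⟨⟩, _⟩, h, -⟩
  exact h rfl

theorem empty_nv : empty.nv = 0 := by
  have : IsEmpty (Quot fun a b => (empty.face * empty.glue) a = b) := ⟨by rintro ⟨⟨⟩⟩⟩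
  simp [nv, cycNum]

theorem empty_wt (τ : Cycle Bool → ℂ) (z : ℂ) (f : Empty → ℕ → ℂ) : empty.wt τ z f = 1 := by
  have : IsEmpty (Quot fun a b : {a // empty.col a = true} =>
    (b : Empty) = empty.glue a ∨ empty.face.SameCycle (a : Empty) b) := ⟨by rintro ⟨⟨⟨⟩, _⟩⟩⟩
  simp [wt, empty_faces, loops]

theorem relabel_ok (eκ : κ₁ ≃ κ) (eι : ι₁ ≃ ι) (e : D₁ ≃ D) (M : PMap κ₁ ι₁ D₁) :
    (M.relabel eκ eι e).Ok ↔ M.Ok := by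
  rw [(relabel_isSum eκ eι e M).ok_iff, and_iff_left empty_ok]

theorem relabel_nv [Finite D₁] [Finite κ₁] (eκ : κ₁ ≃ κ) (eι : ι₁ ≃ ι) (e : D₁ ≃ D)
    (M : PMap κ₁ ι₁ D₁) : (M.relabel eκ eι e).nv = M.nv := by
  rw [(relabel_isSum eκ eι e M).nv_eq, empty_nv, add_zero]

theorem relabel_genus [Finite D₁] [Finite κ₁] (eκ : κ₁ ≃ κ) (eι : ι₁ ≃ ι) (e : D₁ ≃ D)
    (M : PMap κ₁ ι₁ D₁) (g : ℕ) : (M.relabel eκ eι e).Genus g ↔ M.Genus g := by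
  unfold Genus
  rw [relabel_nv, (relabel_isSum eκ eι e M).ncard_faces, empty_faces, Set.ncard_empty,
    Nat.card_congr eκ, Nat.card_congr eι, Nat.card_congr e, add_zero]

theorem relabel_wt [Finite D₁] [Fintype ι] [Fintype ι₁] (τ : Cycle Bool → ℂ) (z : ℂ)
    (f : ι → ℕ → ℂ) (eκ : κ₁ ≃ κ) (eι : ι₁ ≃ ι) (e : D₁ ≃ D) (M : PMap κ₁ ι₁ D₁) :
    (M.relabel eκ eι e).wt τ z f = M.wt τ z (fun i => f (eι i)) := by
  rw [(relabel_isSum eκ eι e M).wt_eq, empty_wt, mul_one]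
  rfl

theorem relabel_mem_maps [Finite D₁] [Finite κ₁] (eκ : κ₁ ≃ κ) (eι : ι₁ ≃ ι) (e : D₁ ≃ D)
    (M : PMap κ₁ ι₁ D₁) (g v : ℕ) (w : κ → List Bool) :
    M.relabel eκ eι e ∈ maps D g v w ↔ M ∈ maps D₁ g v (fun k => w (eκ k)) := by
  simp only [maps, Set.mem_ofPred_eq, relabel_ok, relabel_genus, relabel_nv]
  rw [← eκ.forall_congr_right (q := fun k => List.map _ _ = w k)]
  simp [relabel, Function.comp_def]

theorem relabel_symm (eκ : κ₁ ≃ κ) (eι : ι₁ ≃ ι) (e : D₁ ≃ D) (M : PMap κ ι D) :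
    (M.relabel eκ.symm eι.symm e.symm).relabel eκ eι e = M := by
  obtain ⟨f, g, c, m, x⟩ := M
  simp only [relabel, PMap.mk.injEq]
  refine ⟨?_, ?_, ?_, ?_, ?_⟩
  · ext a; simp
  · ext a; simp
  · ext a; simp
  · ext1 k; simp
  · ext1 k; simp

theorem relabel_injective (eκ : κ₁ ≃ κ) (eι : ι₁ ≃ ι) (e : D₁ ≃ D) :
    Function.Injective (relabel eκ eι e) :=
  Function.LeftInverse.injective (g := relabel eκ.symm eι.symm e.symm)
    fun M => relabel_symm eκ.symm eι.symm e.symm M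

end PMap

/-- The weighted sum over labelled maps with set of half-edges `D`. -/
noncomputable def labSum {κ ι : Type} [Fintype ι] (τ : Cycle Bool → ℂ) (z : ℂ) (f : ι → ℕ → ℂ)
    (D : Type) (g v : ℕ) (w : κ → List Bool) : ℂ :=
  ∑ᶠ M ∈ (PMap.maps D g v w : Set (PMap κ ι D)), M.wt τ z f

theorem labSum_relabel {κ ι κ₁ ι₁ D D₁ : Type} [Fintype ι] [Fintype ι₁] [Finite κ₁] [Finite D₁]
    (τ : Cycle Bool → ℂ) (z : ℂ) (f : ι → ℕ → ℂ) (eκ : κ₁ ≃ κ) (eι : ι₁ ≃ ι) (e : D₁ ≃ D)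
    (g v : ℕ) (w : κ → List Bool) :
    labSum τ z (fun i => f (eι i)) D₁ g v (fun k => w (eκ k)) = labSum τ z f D g v w := by
  refine finsum_mem_eq_of_bijOn (PMap.relabel eκ eι e) ⟨?_, ?_, ?_⟩ ?_
  · exact fun M hM => (PMap.relabel_mem_maps eκ eι e M g v w).2 hM
  · exact (PMap.relabel_injective eκ eι e).injOn
  · intro M hM
    refine ⟨M.relabel eκ.symm eι.symm e.symm, ?_, PMap.relabel_symm eκ eι e M⟩
    rw [← PMap.relabel_mem_maps eκ eι e, PMap.relabel_symm]
    exact hM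
  · exact fun M _ => (PMap.relabel_wt τ z f eκ eι e M).symm

end ONModel

/-! ### Insertion and removal of an edge -/

namespace ONModel

open Equiv

/-- The set of half-edges `D`, together with the two half-edges `none` and `some none` of a new
edge. -/
abbrev Ext (D : Type) : Type := Option (Option D)

/-- The inclusion of the old half-edges. -/
def ss {D : Type} (a : D) : Ext D := some (some a)

theorem ss_injective {D : Type} : Function.Injective (ss : D → Ext D) := fun _ _ h =>
  Option.some_injective _ (Option.some_injective _ h)

variable {D κ ι κ' ι' : Type}

@[simp] theorem ss_inj {a b : D} : ss a = ss b ↔ a = b := ss_injective.eq_iff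
@[simp] theorem ss_ne_none (a : D) : ss a ≠ none := Option.some_ne_none _
@[simp] theorem none_ne_ss (a : D) : none ≠ ss a := (ss_ne_none a).symm
@[simp] theorem ss_ne_some_none (a : D) : ss a ≠ some none := by simp [ss]
@[simp] theorem some_none_ne_ss (a : D) : some none ≠ ss a := (ss_ne_some_none a).symm

theorem Ext.cases (x : Ext D) : x = none ∨ x = some none ∨ ∃ a, x = ss a := by
  rcases x with _ | _ | a
  · simp
  · simp
  · exact Or.inr (Or.inr ⟨a, rfl⟩)

theorem exists_map_ss {l : List (Ext D)} (h : none ∉ l) (h' : some none ∉ l) :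
    ∃ m : List D, l = m.map ss := by
  obtain ⟨m, rfl⟩ := exists_map_some h
  obtain ⟨m', rfl⟩ := exists_map_some (l := m) fun h1 => h' (List.mem_map_of_mem h1)
  exact ⟨m', by simp [ss, Function.comp_def]⟩

theorem mem_map_ss {l : List D} {a : D} : ss a ∈ l.map ss ↔ a ∈ l :=
  List.mem_map_of_injective ss_injective

/-- The permutation of `D` obtained by skipping the two new half-edges. -/
def del (σ : Perm (Ext D)) : Perm D := removeNone (removeNone σ)

theorem mem_of_isCyc {X : Type} {σ : Perm X} {a : X} {l : List X} (h : IsCyc σ (a :: l)) {T : Set X}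
    (hT : ∀ x ∈ T, σ x ∈ T) (ha : a ∈ T) : ∀ x ∈ a :: l, x ∈ T := by
  intro x hx
  obtain ⟨k, hk, rfl⟩ := List.getElem_of_mem hx
  rw [h.getElem_eq k hk]
  clear hk hx
  induction k with
  | zero => exact ha
  | succ k ih => rw [Function.iterate_succ_apply']; exact hT _ ih

theorem del_apply {σ : Perm (Ext D)} {a c : D} (h : σ (ss a) = ss c) : del σ a = c :=
  removeNone_apply (removeNone_apply h)

theorem reduceOption_map_ss (l : List D) : (l.map ss).reduceOption = l.map some := by
  have : l.map ss = (l.map some).map some := by simp [ss, Function.comp_def]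
  rw [this, reduceOption_map_some]

theorem removeNone_mul_optionCongr {X : Type} (σ : Perm (Option X)) (g : Perm X) :
    removeNone (σ * optionCongr g) = removeNone σ * g := by
  ext a
  have h0 : (σ * optionCongr g) (some a) = σ (some (g a)) := by simp
  have h1 : (σ * optionCongr g) none = σ none := by simp
  cases h : σ (some (g a)) with
  | none =>
    obtain ⟨c, hc⟩ := Option.ne_none_iff_exists'.1
      (fun h' => by simpa using σ.injective (h.trans h'.symm) : σ none ≠ none)
    rw [removeNone_apply' (h0.trans h) (h1.trans hc), Perm.mul_apply, removeNone_apply' h hc]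
  | some c => rw [removeNone_apply (h0.trans h), Perm.mul_apply, removeNone_apply h]

section Perm

variable {face : Perm (Ext D)} {U W W₁ W₂ K : List D}

/-- The two cycles through the new half-edges become one. -/
theorem merge_cyc [DecidableEq D] (hb : IsCyc face (some none :: U.map ss))
    (hr : IsCyc face (none :: W.map ss)) :
    IsCyc (face * swap none (some none)) (none :: U.map ss ++ some none :: W.map ss) := by
  refine isCyc_mul_swap.1 ⟨hb, hr, ?_⟩
  have hdis : ∀ a ∈ U, a ∉ W := by
    intro a ha ha'
    have := hb.isRotated hr (a := ss a) (by simp [ha]) (by simp [ha'])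
    have h1 : none ∈ some none :: U.map ss := this.mem_iff.2 (by simp)
    simp at h1
  have h1 := hb.nodup
  have h2 := hr.nodup
  rw [List.nodup_cons] at h1 h2
  simp only [List.cons_append, List.nodup_cons, List.nodup_append]
  refine ⟨by simp, h1.2, ⟨by simp, h2.2⟩, ?_⟩
  intro a ha c hc
  obtain ⟨a, ha', rfl⟩ := List.mem_map.1 ha
  rcases List.mem_cons.1 hc with rfl | hc
  · simp
  · obtain ⟨c, hc', rfl⟩ := List.mem_map.1 hc
    rintro h
    rw [ss_inj] at h
    subst h
    exact hdis a ha' hc'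

theorem merge_cyc_removeNone [DecidableEq D]
    (h : IsCyc (face * swap none (some none)) (none :: U.map ss ++ some none :: W.map ss)) :
    IsCyc (removeNone (face * swap none (some none))) (U.map some ++ none :: W.map some) := by
  have := h.reduceOption
  rwa [List.cons_append, List.reduceOption_cons_of_none, List.reduceOption_append,
    reduceOption_map_ss, List.reduceOption_cons_of_some, reduceOption_map_ss] at this

theorem merge_cyc_del [DecidableEq D]
    (h : IsCyc (face * swap none (some none)) (none :: U.map ss ++ some none :: W.map ss)) :
    IsCyc (del (face * swap none (some none))) (U ++ W) := by
  have := (merge_cyc_removeNone h).reduceOption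
  rwa [List.reduceOption_append, List.reduceOption_cons_of_none, reduceOption_map_some,
    reduceOption_map_some] at this

/-- The cycle through both new half-edges is cut into two. -/
theorem split_cyc [DecidableEq D] (h : IsCyc face (none :: W₁.map ss ++ some none :: W₂.map ss)) :
    IsCyc (face * swap none (some none)) (some none :: W₁.map ss) ∧
      IsCyc (face * swap none (some none)) (none :: W₂.map ss) ∧
      (none :: W₁.map ss ++ some none :: W₂.map ss : List (Ext D)).Nodup := by
  refine isCyc_mul_swap.2 ?_
  rwa [mul_assoc, swap_mul_self, mul_one]

theorem split_cyc_removeNone {σ : Perm (Ext D)} (h : IsCyc σ (some none :: W₁.map ss)) :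
    IsCyc (removeNone σ) (none :: W₁.map some) := by
  have := h.reduceOption
  rwa [List.reduceOption_cons_of_some, reduceOption_map_ss] at this

theorem split_cyc_del {σ : Perm (Ext D)} (h : IsCyc σ (some none :: W₁.map ss)) :
    IsCyc (del σ) W₁ := isCyc_cons_none (split_cyc_removeNone h)

theorem split_cyc_del' {σ : Perm (Ext D)} (h : IsCyc σ (none :: W₂.map ss)) :
    IsCyc (del σ) W₂ := by
  have := h.reduceOption.reduceOption
  rwa [List.reduceOption_cons_of_none, reduceOption_map_ss, reduceOption_map_some] at this

/-- Outside the cycles that meet the new edge, whose old half-edges form the list `K`, the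
permutations `face` and `face'` agree. -/
structure Surg (face : Perm (Ext D)) (face' : Perm D) (K : List D) : Prop where
  off : ∀ a ∉ K, face (ss a) = ss (face' a)
  mem : ∀ a, face' a ∈ K ↔ a ∈ K
  on : ∀ a ∈ K, ∀ c, face (ss a) = ss c → c ∈ K
  r : ∀ c, face none = ss c → c ∈ K
  b : ∀ c, face (some none) = ss c → c ∈ K

theorem surg_of [DecidableEq D] (L : List (Ext D))
    (hL : ∀ x, x ∈ L ↔ x = none ∨ x = some none ∨ ∃ a ∈ K, x = ss a)
    (hinv : ∀ x, face x ∈ L ↔ x ∈ L)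
    (hmem : ∀ a, del (face * swap none (some none)) a ∈ K ↔ a ∈ K) :
    Surg face (del (face * swap none (some none))) K where
  off a ha := by
    have h1 : face (ss a) ∉ L := by
      rw [hinv, hL]; simp [ha]
    rcases Ext.cases (face (ss a)) with h | h | ⟨c, hc⟩
    · exact absurd ((hL _).2 (Or.inl h)) h1
    · exact absurd ((hL _).2 (Or.inr (Or.inl h))) h1
    · have h2 : (face * swap (none : Ext D) (some none)) (ss a) = ss c := by
        rw [Perm.mul_apply, swap_apply_of_ne_of_ne (by simp) (by simp), hc]
      rw [del_apply h2, hc]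
  mem := hmem
  on a ha c hc := by
    have h1 : face (ss a) ∈ L := by rw [hinv, hL]; simp [ha]
    rw [hc, hL] at h1; simpa using h1
  r c hc := by
    have h1 : face none ∈ L := by rw [hinv, hL]; simp
    rw [hc, hL] at h1; simpa using h1
  b c hc := by
    have h1 : face (some none) ∈ L := by rw [hinv, hL]; simp
    rw [hc, hL] at h1; simpa using h1

theorem merge_surg [DecidableEq D] (hb : IsCyc face (some none :: U.map ss))
    (hr : IsCyc face (none :: W.map ss)) :
    Surg face (del (face * swap none (some none))) (U ++ W) := by
  refine surg_of ((some none :: U.map ss) ++ (none :: W.map ss)) ?_ ?_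
    fun a => (merge_cyc_del (merge_cyc hb hr)).apply_mem_iff
  · intro x
    rcases Ext.cases x with rfl | rfl | ⟨a, rfl⟩ <;> simp
  · intro x
    rw [List.mem_append, List.mem_append, hb.apply_mem_iff, hr.apply_mem_iff]

theorem split_surg [DecidableEq D] (h : IsCyc face (none :: W₁.map ss ++ some none :: W₂.map ss)) :
    Surg face (del (face * swap none (some none))) (W₁ ++ W₂) := by
  obtain ⟨h1, h2, _⟩ := split_cyc h
  refine surg_of _ ?_ (fun x => h.apply_mem_iff) ?_
  · intro x
    rcases Ext.cases x with rfl | rfl | ⟨a, rfl⟩ <;> simp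
  · intro a
    rw [List.mem_append, List.mem_append, (split_cyc_del h1).apply_mem_iff,
      (split_cyc_del' h2).apply_mem_iff]

theorem Surg.isCyc_iff {face' : Perm D} (h : Surg face face' K) {l : List D}
    (hl : ∀ a ∈ l, a ∉ K) : IsCyc face (l.map ss) ↔ IsCyc face' l :=
  ⟨fun h' => h'.of_map ss_injective fun a ha => h.off a (hl a ha),
    fun h' => h'.map ss_injective fun a ha => h.off a (hl a ha)⟩

end Perm

theorem Surg.exists_isCyc [Finite D] {face : Perm (Ext D)} {face' : Perm D} {K : List D}
    (h : Surg face face' K) {a : D} (ha : a ∉ K) :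
    ∃ m, a ∈ m ∧ IsCyc face' m ∧ IsCyc face (m.map ss) ∧ ∀ c ∈ m, c ∉ K := by
  obtain ⟨m, hm⟩ := ONModel.exists_isCyc face' a
  have hK : ∀ c ∈ a :: m, c ∉ K := by
    intro c hc hcK
    rw [← hm.sameCycle_iff (a := a) (by simp)] at hc
    obtain ⟨i, rfl⟩ := hc
    have key : ∀ i : ℤ, ∀ c, (face' ^ i) c ∈ K ↔ c ∈ K := by
      intro i
      induction i using Int.induction_on with
      | zero => simp
      | succ i ih => intro c; rw [zpow_add, Perm.mul_apply, ih, zpow_one, h.mem]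
      | pred i ih =>
        intro c
        rw [zpow_sub, Perm.mul_apply, ih, zpow_one]
        rw [← h.mem]; simp
    exact ha ((key i a).1 hcK)
  exact ⟨a :: m, by simp, hm, (h.isCyc_iff hK).2 hm, hK⟩

theorem Surg.sameCycle_iff [Finite D] {face : Perm (Ext D)} {face' : Perm D} {K : List D}
    (h : Surg face face' K) {a c : D} (ha : a ∉ K) :
    face.SameCycle (ss a) (ss c) ↔ face'.SameCycle a c := by
  obtain ⟨m, ham, hm, hm', -⟩ := h.exists_isCyc ha
  rw [hm.sameCycle_iff ham, hm'.sameCycle_iff (mem_map_ss.2 ham), mem_map_ss]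

theorem Surg.not_sameCycle [Finite D] {face : Perm (Ext D)} {face' : Perm D} {K : List D}
    (h : Surg face face' K) {a : D} (ha : a ∉ K) :
    ¬ face.SameCycle (ss a) none ∧ ¬ face.SameCycle (ss a) (some none) := by
  obtain ⟨m, ham, hm, hm', -⟩ := h.exists_isCyc ha
  rw [hm'.sameCycle_iff (mem_map_ss.2 ham), hm'.sameCycle_iff (mem_map_ss.2 ham)]
  simp

theorem perm_ext_of_del {σ τ : Perm (Ext D)} (h : del σ = del τ) {l m : List (Ext D)}
    (hl : IsCyc σ l) (hl' : IsCyc τ l) (hm : IsCyc σ m) (hm' : IsCyc τ m) (h1 : none ∈ l)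
    (h2 : some none ∈ m) : σ = τ := by
  refine perm_option_ext (perm_option_ext h ?_) (hl.apply_congr hl' h1)
  exact hm.reduceOption.apply_congr hm'.reduceOption (List.reduceOption_mem_iff.2 h2)

/-- Converse of `merge_cyc_del`: a face may be cut at any place into two faces adjacent to a new edge. -/
theorem exists_merge [DecidableEq D] (face' : Perm D) (U W : List D) (h : IsCyc face' (U ++ W)) :
    ∃ face : Perm (Ext D), del (face * swap none (some none)) = face' ∧
      IsCyc face (some none :: U.map ss) ∧ IsCyc face (none :: W.map ss) := by
  -- The two new half-edges are inserted into the cycle `U ++ W`, which is then cut by the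
  -- transposition that exchanges them.
  obtain ⟨σ, h1, h2⟩ := exists_insert face' U W h
  obtain ⟨ψ, h3, h4⟩ := exists_insert σ [] (U.map some ++ none :: W.map some) h2
  have h5 : IsCyc ψ (none :: U.map ss ++ some none :: W.map ss) := by
    simp only [List.map_nil, List.nil_append, List.map_append, List.map_cons, List.map_map] at h4
    exact h4
  have h6 : ψ * swap none (some none) * swap none (some none) = ψ := by
    rw [mul_assoc, swap_mul_self, mul_one]
  refine ⟨ψ * swap none (some none), by rw [h6, del, h3, h1], ?_⟩
  rw [← h6] at h5
  obtain ⟨h7, h8, _⟩ := isCyc_mul_swap.2 h5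
  exact ⟨h7, h8⟩

/-- Converse of `split_cyc_del`: two faces may be joined by a new edge. -/
theorem exists_split [DecidableEq D] (face' : Perm D) (W₁ W₂ : List D) (h₁ : IsCyc face' W₁)
    (h₂ : IsCyc face' W₂) (hd : ∀ a ∈ W₁, a ∉ W₂) :
    ∃ face : Perm (Ext D), del (face * swap none (some none)) = face' ∧
      IsCyc face (none :: W₁.map ss ++ some none :: W₂.map ss) := by
  obtain ⟨σ, h1, h2⟩ := exists_insert face' [] W₁ h₁
  have hσ : IsCyc σ (W₂.map some) := by
    refine h₂.map (Option.some_injective D) fun a ha => ?_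
    have : σ (some a) ≠ none := by
      intro h
      have h3 : some a ∈ [].map some ++ none :: W₁.map some := by
        rw [← h2.apply_mem_iff, h]; simp
      simp only [List.map_nil, List.nil_append, List.mem_cons, reduceCtorEq, false_or,
        List.mem_map_of_injective (Option.some_injective D)] at h3
      exact hd a h3 ha
    obtain ⟨c, hc⟩ := Option.ne_none_iff_exists'.1 this
    rw [hc, ← h1, removeNone_apply hc]
  obtain ⟨ψ, h3, h4⟩ := exists_insert σ [] _ hσ
  have h5 : IsCyc ψ (none :: W₂.map ss) := by
    simp only [List.map_nil, List.nil_append, List.map_map] at h4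
    exact h4
  have h6 : IsCyc ψ (some none :: W₁.map ss) := by
    have h7 : (some none :: W₁.map ss : List (Ext D)) =
        ([].map some ++ none :: W₁.map some).map some := by simp [ss, Function.comp_def]
    rw [h7]
    refine h2.map (Option.some_injective _) fun a ha => ?_
    have : ψ (some a) ≠ none := by
      intro h
      have h8 : some a ∈ none :: W₂.map ss := by rw [← h5.apply_mem_iff, h]; simp
      rcases a with _ | a
      · simp at h8
      · simp only [List.map_nil, List.nil_append, List.mem_cons, reduceCtorEq, false_or,
          List.mem_map_of_injective (Option.some_injective D)] at ha
        rcases List.mem_cons.1 h8 with h8 | h8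
        · cases h8
        · exact hd a ha (mem_map_ss.1 h8)
    obtain ⟨c, hc⟩ := Option.ne_none_iff_exists'.1 this
    rw [hc, ← h3, removeNone_apply hc]
  refine ⟨ψ * swap none (some none), ?_, isCyc_mul_swap.1 ⟨h6, h5, ?_⟩⟩
  · rw [mul_assoc, swap_mul_self, mul_one, del, h3, h1]
  · have n1 := (List.nodup_cons.1 h6.nodup).2
    have n2 := (List.nodup_cons.1 h5.nodup).2
    simp only [List.cons_append, List.nodup_cons, List.nodup_append]
    refine ⟨by simp, n1, ⟨by simp, n2⟩, ?_⟩
    intro a ha c hc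
    obtain ⟨a, ha', rfl⟩ := List.mem_map.1 ha
    rcases List.mem_cons.1 hc with rfl | hc
    · simp
    · obtain ⟨c, hc', rfl⟩ := List.mem_map.1 hc
      rintro h
      rw [ss_inj] at h
      subst h
      exact hd a ha' hc'

namespace PMap

/-- The relation between a map `M` with a distinguished edge and the map `M'` obtained by removing
this edge, whose half-edges `none` and `some none` have colour `p`. The faces adjacent to the edge
are modified by a transposition; the other marked faces are unchanged. -/
structure Cut [DecidableEq D] (h : ι' → ι) (p : Bool) (M : PMap κ ι (Ext D)) (M' : PMap κ' ι' D) :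
    Prop where
  glue_r : M.glue none = some none
  glue_b : M.glue (some none) = none
  glue_ss : ∀ a, M.glue (ss a) = ss (M'.glue a)
  col_r : M.col none = p
  col_b : M.col (some none) = p
  col_ss : ∀ a, M.col (ss a) = M'.col a
  face : del (M.face * swap none (some none)) = M'.face
  aux : ∀ i, M.aux (h i) = (M'.aux i).map ss

namespace Cut

variable [DecidableEq D] {h : ι' → ι} {p : Bool} {M : PMap κ ι (Ext D)} {M' : PMap κ' ι' D}
  {K U W W₁ W₂ : List D}

theorem map_col (C : Cut h p M M') (l : List D) : (l.map ss).map M.col = l.map M'.col := by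
  rw [List.map_map]
  exact List.map_inj_left.2 fun a _ => C.col_ss a

/-- The rotation `face * glue` around the vertices only involves `face` composed with the
transposition of the two ends of the removed edge. -/
theorem rotation_eq (C : Cut h p M M') :
    M.face * M.glue = M.face * swap none (some none) * optionCongr (optionCongr M'.glue) := by
  rw [mul_assoc]
  congr 1
  ext1 x
  rcases Ext.cases x with rfl | rfl | ⟨a, rfl⟩
  · simp [C.glue_r]
  · simp [C.glue_b]
  · rw [C.glue_ss, Perm.mul_apply]
    have : optionCongr (optionCongr M'.glue) (ss a) = ss (M'.glue a) := by simp [ss]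
    rw [this, swap_apply_of_ne_of_ne (by simp) (by simp)]

theorem removeNone_rotation (C : Cut h p M M') :
    removeNone (M.face * M.glue) =
      removeNone (M.face * swap none (some none)) * optionCongr M'.glue := by
  rw [C.rotation_eq, removeNone_mul_optionCongr]

theorem del_rotation (C : Cut h p M M') :
    removeNone (removeNone (M.face * M.glue)) = M'.face * M'.glue := by
  rw [C.removeNone_rotation, removeNone_mul_optionCongr, ← C.face, del]

/-- Removal of an edge between two faces. The number of vertices is unchanged, but when the new face
has degree `0` its vertex is no longer counted as a cycle. -/
theorem cycNum_merge [Finite D] (C : Cut h p M M') (hb : IsCyc M.face (some none :: U.map ss))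
    (hr : IsCyc M.face (none :: W.map ss)) :
    cycNum (M.face * M.glue) = cycNum (M'.face * M'.glue) + if U ++ W = [] then 1 else 0 := by
  have hψ := merge_cyc hb hr
  have h1 : (M.face * M.glue) none ≠ none := by
    intro h
    have h2 : IsCyc (M.face * swap none (some none))
      ([] ++ none :: (U.map ss ++ some none :: W.map ss)) := by simpa using hψ
    have := (h2.apply_eq_self_iff).1 (by rw [C.rotation_eq] at h; simpa using h)
    simp at this
  rw [cycNum_removeNone_of_ne h1]
  have hψ' := merge_cyc_removeNone hψ
  have h3 : removeNone (M.face * M.glue) none = none ↔ U ++ W = [] := by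
    rw [C.removeNone_rotation, Perm.mul_apply]
    have : (optionCongr M'.glue) none = none := rfl
    rw [this, hψ'.apply_eq_self_iff]; simp
  split_ifs with h4
  · rw [cycNum_removeNone_of_fixed (h3.2 h4), C.del_rotation]
  · rw [cycNum_removeNone_of_ne (mt h3.1 h4), C.del_rotation, add_zero]

/-- Removal of an edge with the same face on both sides. As above, a vertex is no longer counted as
a cycle when it has no other edge. -/
theorem cycNum_split [Finite D] (C : Cut h p M M')
    (hr : IsCyc M.face (none :: W₁.map ss ++ some none :: W₂.map ss)) :
    cycNum (M.face * M.glue) = cycNum (M'.face * M'.glue) +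
      ((if W₁ = [] then 1 else 0) + if W₂ = [] then 1 else 0) := by
  obtain ⟨hb', hr', -⟩ := split_cyc hr
  have h1 : (M.face * M.glue) none = none ↔ W₂ = [] := by
    have h2 : IsCyc (M.face * swap none (some none)) ([] ++ none :: W₂.map ss) := hr'
    have h3 := h2.apply_eq_self_iff
    simp only [List.map_eq_nil_iff, true_and] at h3
    rw [← h3, C.rotation_eq]; simp
  have h4 : removeNone (M.face * M.glue) none = none ↔ W₁ = [] := by
    have h2 : IsCyc (removeNone (M.face * swap none (some none))) ([] ++ none :: W₁.map some) :=
      split_cyc_removeNone hb'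
    have h3 := h2.apply_eq_self_iff
    simp only [List.map_eq_nil_iff, true_and] at h3
    rw [← h3, C.removeNone_rotation]; simp
  have h5 : cycNum (removeNone (M.face * M.glue)) =
      cycNum (M'.face * M'.glue) + if W₁ = [] then 1 else 0 := by
    split_ifs with h6
    · rw [cycNum_removeNone_of_fixed (h4.2 h6), C.del_rotation]
    · rw [cycNum_removeNone_of_ne (mt h4.1 h6), C.del_rotation, add_zero]
  by_cases h6 : W₂ = []
  · rw [cycNum_removeNone_of_fixed (h1.2 h6), h5, if_pos h6]; ring
  · rw [cycNum_removeNone_of_ne (mt h1.1 h6), h5, if_neg h6]; ring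

theorem map_faces (C : Cut h p M M') (s : Cycle D) : (s.map ss).map M.col = s.map M'.col := by
  induction s using Quotient.inductionOn' with | _ l
  exact congrArg _ (C.map_col l)

/-- Connectedness is preserved by the removal of the edge, `K` being the list of the old half-edges
of the main faces. -/
theorem conn_iff (C : Cut h p M M') (S : Surg M.face M'.face K)
    (hm' : ∀ a, (∃ k, a ∈ M'.main k) ↔ a ∈ K)
    (hm : ∀ k, ∀ x ∈ M.main k, x = none ∨ x = some none ∨ ∃ a ∈ K, x = ss a)
    (hK : ∀ T : Set (Ext D), (∀ a ∈ T, M.face a ∈ T) → (∀ a ∈ T, M.glue a ∈ T) →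
      (∀ k, ∀ a ∈ M.main k, a ∈ T) → none ∈ T ∧ some none ∈ T ∧ ∀ a ∈ K, ss a ∈ T) :
    (∀ T : Set (Ext D), (∀ a ∈ T, M.face a ∈ T) → (∀ a ∈ T, M.glue a ∈ T) →
      (∀ k, ∀ a ∈ M.main k, a ∈ T) → ∀ a, a ∈ T) ↔
    (∀ T : Set D, (∀ a ∈ T, M'.face a ∈ T) → (∀ a ∈ T, M'.glue a ∈ T) →
      (∀ k, ∀ a ∈ M'.main k, a ∈ T) → ∀ a, a ∈ T) := by
  constructor
  · intro H T t1 t2 t3 a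
    have hKT : ∀ a ∈ K, a ∈ T := fun a ha => by
      obtain ⟨k, hk⟩ := (hm' a).2 ha
      exact t3 k a hk
    -- Add the two ends of the removed edge to `T`.
    have := H {x | ∀ a, x = ss a → a ∈ T} ?_ ?_ ?_ (ss a)
    · exact this a rfl
    · intro x hx c hc
      rcases Ext.cases x with rfl | rfl | ⟨a, rfl⟩
      · exact hKT c (S.r c hc)
      · exact hKT c (S.b c hc)
      · by_cases ha : a ∈ K
        · exact hKT c (S.on a ha c hc)
        · rw [S.off a ha, ss_inj] at hc
          subst hc
          exact t1 a (hx a rfl)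
    · intro x hx c hc
      rcases Ext.cases x with rfl | rfl | ⟨a, rfl⟩
      · rw [C.glue_r] at hc; simp at hc
      · rw [C.glue_b] at hc; simp at hc
      · rw [C.glue_ss, ss_inj] at hc
        subst hc
        exact t2 a (hx a rfl)
    · rintro k x hx c rfl
      rcases hm k _ hx with h | h | ⟨a, ha, h⟩
      · simp at h
      · simp at h
      · rw [ss_inj] at h
        exact hKT _ (h ▸ ha)
  · intro H T t1 t2 t3
    obtain ⟨hr, hb, hK⟩ := hK T t1 t2 t3
    have := H {a | ss a ∈ T} ?_ ?_ ?_
    · intro x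
      rcases Ext.cases x with rfl | rfl | ⟨a, rfl⟩
      · exact hr
      · exact hb
      · exact this a
    · intro a ha
      by_cases haK : a ∈ K
      · exact hK _ ((S.mem a).2 haK)
      · have := t1 _ ha
        rwa [S.off a haK] at this
    · intro a ha
      have := t2 _ ha
      rwa [C.glue_ss] at this
    · intro k a ha
      exact hK a ((hm' a).1 ⟨k, ha⟩)

/-- The result of the removal of an edge is a map. -/
theorem ok_down (C : Cut h p M M') (S : Surg M.face M'.face K) (hh : Function.Injective h)
    (H : M.Ok) (hK : ∀ i, ∀ a ∈ M'.aux i, a ∉ K) (hc : ∀ k, IsCyc M'.face (M'.main k))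
    (hd : ∀ k k', ∀ a ∈ M'.main k, a ∈ M'.main k' → k = k')
    (hm' : ∀ a, (∃ k, a ∈ M'.main k) ↔ a ∈ K)
    (hconn : ∀ T : Set D, (∀ a ∈ T, M'.face a ∈ T) → (∀ a ∈ T, M'.glue a ∈ T) →
      (∀ k, ∀ a ∈ M'.main k, a ∈ T) → ∀ a, a ∈ T) : M'.Ok where
  glue_glue a := by rw [← ss_inj, ← C.glue_ss, ← C.glue_ss, H.glue_glue]
  glue_ne a := by rw [← ss_injective.ne_iff, ← C.glue_ss]; exact H.glue_ne _
  col_glue a := by rw [← C.col_ss, ← C.glue_ss, H.col_glue, C.col_ss]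
  main_cyc := hc
  aux_cyc i := by rw [← S.isCyc_iff (hK i), ← C.aux]; exact H.aux_cyc _
  aux_ne i hi := H.aux_ne (h i) (by rw [C.aux, hi]; rfl)
  aux_col i a ha := by
    rw [← C.col_ss]; exact H.aux_col (h i) _ (by rw [C.aux]; exact mem_map_ss.2 ha)
  main_main := hd
  aux_aux i j a ha ha' := hh (H.aux_aux _ _ (ss a) (by rw [C.aux]; exact mem_map_ss.2 ha)
    (by rw [C.aux]; exact mem_map_ss.2 ha'))
  main_aux k i a ha ha' := hK i a ha' ((hm' a).1 ⟨k, ha⟩)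
  conn := hconn

/-- The result of the insertion of an edge is a map. The new edge is adjacent to main faces and to at
most one auxiliary face, the only one that is not in the range of `h`. -/
theorem ok_up (C : Cut h p M M') (S : Surg M.face M'.face K)
    (H : M'.Ok) (hm' : ∀ a, (∃ k, a ∈ M'.main k) ↔ a ∈ K)
    (hm : ∀ k, ∀ x ∈ M.main k, x = none ∨ x = some none ∨ ∃ a ∈ K, x = ss a)
    (hc : ∀ k, IsCyc M.face (M.main k)) (hd : ∀ k k', ∀ a ∈ M.main k, a ∈ M.main k' → k = k')
    (haux : ∀ i, (∃ i', h i' = i) ∨ IsCyc M.face (M.aux i) ∧ M.aux i ≠ [] ∧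
      (∀ a ∈ M.aux i, M.col a = false) ∧
      (∀ x ∈ M.aux i, x = some none ∨ ∃ a ∈ K, x = ss a) ∧ (∀ k, ∀ x ∈ M.main k, x ∉ M.aux i) ∧
      ∀ j, j = i ∨ ∃ i', h i' = j)
    (hconn : ∀ T : Set (Ext D), (∀ a ∈ T, M.face a ∈ T) → (∀ a ∈ T, M.glue a ∈ T) →
      (∀ k, ∀ a ∈ M.main k, a ∈ T) → ∀ a, a ∈ T) : M.Ok where
  glue_glue x := by
    rcases Ext.cases x with rfl | rfl | ⟨a, rfl⟩
    · rw [C.glue_r, C.glue_b]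
    · rw [C.glue_b, C.glue_r]
    · rw [C.glue_ss, C.glue_ss, H.glue_glue]
  glue_ne x := by
    rcases Ext.cases x with rfl | rfl | ⟨a, rfl⟩
    · rw [C.glue_r]; simp
    · rw [C.glue_b]; simp
    · rw [C.glue_ss, ss_injective.ne_iff]; exact H.glue_ne a
  col_glue x := by
    rcases Ext.cases x with rfl | rfl | ⟨a, rfl⟩
    · rw [C.glue_r, C.col_r, C.col_b]
    · rw [C.glue_b, C.col_r, C.col_b]
    · rw [C.glue_ss, C.col_ss, C.col_ss, H.col_glue]
  main_cyc := hc
  aux_cyc i := by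
    rcases haux i with ⟨i, rfl⟩ | h1
    · rw [C.aux, S.isCyc_iff fun a ha haK => ?_]
      · exact H.aux_cyc i
      · obtain ⟨k, hk⟩ := (hm' a).2 haK
        exact H.main_aux k i a hk ha
    · exact h1.1
  aux_ne i := by
    rcases haux i with ⟨i, rfl⟩ | h1
    · rw [C.aux]; simpa using H.aux_ne i
    · exact h1.2.1
  aux_col i := by
    rcases haux i with ⟨i, rfl⟩ | h1
    · rw [C.aux]
      intro x hx
      obtain ⟨a, ha, rfl⟩ := List.mem_map.1 hx
      rw [C.col_ss]; exact H.aux_col i a ha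
    · exact h1.2.2.1
  main_main := hd
  aux_aux := by
    have key : ∀ i j, ∀ x, x ∈ M.aux (h i) → x ∈ M.aux j → (∀ x ∈ M.aux j, x = some none ∨
        ∃ a ∈ K, x = ss a) → False := by
      intro i j x hx hx' hj
      rw [C.aux] at hx
      obtain ⟨a, ha, rfl⟩ := List.mem_map.1 hx
      rcases hj _ hx' with h1 | ⟨c, hc, h1⟩
      · simp at h1
      · rw [ss_inj] at h1
        subst h1
        obtain ⟨k, hk⟩ := (hm' a).2 hc
        exact H.main_aux k i a hk ha
    intro i j x hx hx'
    rcases haux i with ⟨i, rfl⟩ | h1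
    · rcases haux j with ⟨j, rfl⟩ | h2
      · rw [C.aux] at hx hx'
        obtain ⟨a, ha, rfl⟩ := List.mem_map.1 hx
        rw [H.aux_aux i j a ha (mem_map_ss.1 hx')]
      · exact (key i j x hx hx' h2.2.2.2.1).elim
    · rcases haux j with ⟨j, rfl⟩ | h2
      · exact (key j i x hx' hx h1.2.2.2.1).elim
      · rcases h1.2.2.2.2.2 j with h3 | ⟨j, rfl⟩
        · exact h3.symm
        · exact (key j i x hx' hx h1.2.2.2.1).elim
  main_aux k i x hx := by
    rcases haux i with ⟨i, rfl⟩ | h1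
    · intro hx'
      rw [C.aux] at hx'
      obtain ⟨a, ha, rfl⟩ := List.mem_map.1 hx'
      rcases hm k _ hx with h1 | h1 | ⟨c, hc, h1⟩
      · simp at h1
      · simp at h1
      · rw [ss_inj] at h1
        subst h1
        obtain ⟨k', hk'⟩ := (hm' a).2 hc
        exact H.main_aux k' i a hk' ha
    · exact h1.2.2.2.2.1 k x hx
  conn := hconn

end Cut

end PMap

end ONModel

/-! ### Data of a map after the removal of an edge -/

namespace ONModel

open Equiv

variable {D κ ι κ' ι' : Type}

/-- Two finite sums over sets in bijection are equal. The bijection is given as a relation, total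
(`h₁`, `h₂`) and injective (`h₃`, `h₄`) in both directions, which spares the choice of the data on
which it depends. -/
theorem finsum_mem_eq_of_rel {α β E : Type*} [AddCommMonoid E] {X : Set α} {Y : Set β}
    (R : α → β → Prop) {f : α → E} {g : β → E}
    (h₁ : ∀ x ∈ X, ∃ y ∈ Y, R x y) (h₂ : ∀ y ∈ Y, ∃ x ∈ X, R x y)
    (h₃ : ∀ x ∈ X, ∀ x' ∈ X, ∀ y ∈ Y, R x y → R x' y → x = x')
    (h₄ : ∀ x ∈ X, ∀ y ∈ Y, ∀ y' ∈ Y, R x y → R x y' → y = y')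
    (hf : ∀ x ∈ X, ∀ y ∈ Y, R x y → f x = g y) : ∑ᶠ x ∈ X, f x = ∑ᶠ y ∈ Y, g y := by
  classical
  rcases X.eq_empty_or_nonempty with rfl | ⟨x₀, hx₀⟩
  · have : Y = ∅ := by
      by_contra hne
      obtain ⟨y, hy⟩ := Set.nonempty_iff_ne_empty.2 hne
      obtain ⟨x, hx, -⟩ := h₂ y hy
      exact hx
    simp [this]
  · obtain ⟨y₀, -, -⟩ := h₁ x₀ hx₀
    let e : α → β := fun x => if hx : x ∈ X then (h₁ x hx).choose else y₀
    have he : ∀ x ∈ X, e x ∈ Y ∧ R x (e x) := fun x hx => by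
      simp only [e, dif_pos hx]
      exact (h₁ x hx).choose_spec
    refine finsum_mem_eq_of_bijOn e ⟨fun x hx => (he x hx).1, ?_, ?_⟩
      fun x hx => hf x hx _ (he x hx).1 (he x hx).2
    · intro x hx x' hx' hxx
      exact h₃ x hx x' hx' _ (he x hx).1 (he x hx).2 (hxx ▸ (he x' hx').2)
    · intro y hy
      obtain ⟨x, hx, hR⟩ := h₂ y hy
      exact ⟨x, hx, h₄ x hx _ (he x hx).1 y hy (he x hx).2 hR⟩

namespace PMap

/-- The half-edge `x` is on an unmarked face. -/
def Unm (M : PMap κ ι D) (x : D) : Prop := (∀ k, x ∉ M.main k) ∧ ∀ i, x ∉ M.aux i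

theorem card_unit (P : Unit → Prop) [Decidable (P ())] :
    Nat.card {k // P k} = if P () then 1 else 0 := by
  split_ifs with h
  · have : Unique {k // P k} := ⟨⟨⟨(), h⟩⟩, fun x => Subtype.ext rfl⟩
    exact Nat.card_unique
  · have : IsEmpty {k // P k} := ⟨fun x => h x.2⟩
    exact Nat.card_of_isEmpty

theorem card_bool (P : Bool → Prop) [Decidable (P false)] [Decidable (P true)] :
    Nat.card {k // P k} = (if P false then 1 else 0) + if P true then 1 else 0 := by
  rw [card_subtype_sum boolEquivPUnitSumPUnit.symm P]
  congr 1
  · exact card_unit (fun _ => P false)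
  · exact card_unit (fun _ => P true)

namespace Cut

variable {h : ι' → ι} {p : Bool} {M : PMap κ ι (Ext D)} {M' : PMap κ' ι' D}
  {K U W W₁ W₂ : List D}

/-- The unmarked faces, when no unmarked face is adjacent to the removed edge. -/
theorem faces_eq (S : Surg M.face M'.face K)
    (hu : ∀ a ∉ K, M.Unm (ss a) ↔ M'.Unm a) (hK : ∀ a ∈ K, ¬ M.Unm (ss a) ∧ ¬ M'.Unm a)
    (hr : ¬ M.Unm none) (hb : ¬ M.Unm (some none)) :
    M.faces = Cycle.map ss '' M'.faces := by
  ext s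
  constructor
  · rintro ⟨l, hne, rfl, hl, hun⟩
    obtain ⟨m, rfl⟩ := exists_map_ss (fun h => hr (hun _ h)) (fun h => hb (hun _ h))
    have hmK : ∀ a ∈ m, a ∉ K := fun a ha haK => (hK a haK).1 (hun _ (mem_map_ss.2 ha))
    exact ⟨m, ⟨m, by simpa using hne, rfl, (S.isCyc_iff hmK).1 hl,
      fun a ha => (hu a (hmK a ha)).1 (hun _ (mem_map_ss.2 ha))⟩, rfl⟩
  · rintro ⟨_, ⟨m, hne, rfl, hl, hun⟩, rfl⟩
    have hmK : ∀ a ∈ m, a ∉ K := fun a ha haK => (hK a haK).2 (hun _ ha)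
    refine ⟨m.map ss, by simpa using hne, rfl, (S.isCyc_iff hmK).2 hl, fun x hx => ?_⟩
    obtain ⟨a, ha, rfl⟩ := List.mem_map.1 hx
    exact (hu a (hmK a ha)).2 (hun a ha)

/-- The unmarked faces, when the removed edge is adjacent to the unmarked face
`some none :: U.map ss`. -/
theorem faces_eq_insert (S : Surg M.face M'.face K)
    (hu : ∀ a ∉ K, M.Unm (ss a) ↔ M'.Unm a) (hK : ∀ a ∈ K, a ∈ U ∨ ¬ M.Unm (ss a))
    (hK' : ∀ a ∈ K, ¬ M'.Unm a) (hr : ¬ M.Unm none)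
    (hU : IsCyc M.face (some none :: U.map ss)) (hUn : ∀ x ∈ some none :: U.map ss, M.Unm x) :
    M.faces = insert ((some none :: U.map ss : List (Ext D)) : Cycle (Ext D))
      (Cycle.map ss '' M'.faces) := by
  ext s
  constructor
  · rintro ⟨l, hne, rfl, hl, hun⟩
    by_cases hb : some none ∈ l
    · exact Or.inl (Cycle.coe_eq_coe.2 (hl.isRotated hU hb (by simp)))
    · refine Or.inr ?_
      obtain ⟨m, rfl⟩ := exists_map_ss (fun h => hr (hun _ h)) hb
      have hmK : ∀ a ∈ m, a ∉ K := by
        intro a ha haK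
        rcases hK a haK with h | h
        · have := hU.isRotated hl (a := ss a) (by simp [h]) (mem_map_ss.2 ha)
          exact hb (this.mem_iff.1 (by simp))
        · exact h (hun _ (mem_map_ss.2 ha))
      exact ⟨m, ⟨m, by simpa using hne, rfl, (S.isCyc_iff hmK).1 hl,
        fun a ha => (hu a (hmK a ha)).1 (hun _ (mem_map_ss.2 ha))⟩, rfl⟩
  · rintro (rfl | ⟨_, ⟨m, hne, rfl, hl, hun⟩, rfl⟩)
    · exact ⟨_, by simp, rfl, hU, hUn⟩
    · have hmK : ∀ a ∈ m, a ∉ K := fun a ha haK => hK' a haK (hun _ ha)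
      refine ⟨m.map ss, by simpa using hne, rfl, (S.isCyc_iff hmK).2 hl, fun x hx => ?_⟩
      obtain ⟨a, ha, rfl⟩ := List.mem_map.1 hx
      exact (hu a (hmK a ha)).2 (hun a ha)

theorem notMem_image (U : List D) (F : Set (Cycle D)) :
    ((some none :: U.map ss : List (Ext D)) : Cycle (Ext D)) ∉ Cycle.map ss '' F := by
  rintro ⟨s, _, hs⟩
  have : some none ∈ Cycle.map ss s := by rw [hs]; simp
  obtain ⟨a, _, ha⟩ := Cycle.mem_map.1 this
  simp at ha

variable [DecidableEq D]

/-- Off the faces adjacent to the removed edge, whose old half-edges form `K`, a half-edge is on an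
unmarked face before the removal if and only if it is after the removal. -/
theorem unm_iff (C : Cut h p M M') (hm' : ∀ a, (∃ k, a ∈ M'.main k) ↔ a ∈ K)
    (hm : ∀ k, ∀ x ∈ M.main k, x = none ∨ x = some none ∨ ∃ a ∈ K, x = ss a)
    (haux : ∀ i, (∃ i', h i' = i) ∨ ∀ x ∈ M.aux i, x = some none ∨ ∃ a ∈ K, x = ss a)
    {a : D} (ha : a ∉ K) : M.Unm (ss a) ↔ M'.Unm a := by
  constructor
  · rintro ⟨_, h2⟩
    refine ⟨fun k hk => ha ((hm' a).1 ⟨k, hk⟩), fun i hi => h2 (h i) ?_⟩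
    rw [C.aux]; exact mem_map_ss.2 hi
  · rintro ⟨_, h2⟩
    refine ⟨fun k hk => ?_, fun i hi => ?_⟩
    · rcases hm k _ hk with h | h | ⟨c, hc, h⟩
      · simp at h
      · simp at h
      · rw [ss_inj] at h; exact ha (h ▸ hc)
    · rcases haux i with ⟨i, rfl⟩ | h'
      · rw [C.aux] at hi; exact h2 i (mem_map_ss.1 hi)
      · rcases h' _ hi with h | ⟨c, hc, h⟩
        · simp at h
        · rw [ss_inj] at h; exact ha (h ▸ hc)

/-- Removing an edge that is not crossed by a path does not change the number of loops, if the old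
half-edges of its faces that are crossed by a path were, and remain, on the same face. -/
theorem loops_eq_of_false [Finite D] (C : Cut h false M M') (S : Surg M.face M'.face K)
    (hK : ∀ a ∈ K, ∀ c ∈ K, M'.col a = true → M'.col c = true →
      M.face.SameCycle (ss a) (ss c) ∧ M'.face.SameCycle a c) : M.loops = M'.loops := by
  let e : {a // M'.col a = true} ≃ {x // M.col x = true} := Equiv.ofBijective
    (fun a => ⟨ss a.1, by rw [C.col_ss]; exact a.2⟩) ⟨fun a c hac => by
      simpa [Subtype.ext_iff] using hac, fun x => by
      obtain ⟨x, hx⟩ := x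
      rcases Ext.cases x with rfl | rfl | ⟨a, rfl⟩
      · rw [C.col_r] at hx; simp at hx
      · rw [C.col_b] at hx; simp at hx
      · exact ⟨⟨a, by rwa [C.col_ss] at hx⟩, rfl⟩⟩
  refine (Nat.card_congr (Quot.congr e fun a c => ?_)).symm
  change _ ↔ ss c.1 = M.glue (ss a.1) ∨ M.face.SameCycle (ss a.1) (ss c.1)
  rw [C.glue_ss, ss_inj]
  refine or_congr Iff.rfl ?_
  by_cases ha : a.1 ∈ K
  · by_cases hc : c.1 ∈ K
    · have := hK _ ha _ hc a.2 c.2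
      exact ⟨fun _ => this.1, fun _ => this.2⟩
    · rw [Perm.sameCycle_comm, Perm.sameCycle_comm (f := M.face), S.sameCycle_iff hc]
  · rw [S.sameCycle_iff ha]

/-- Removing an edge between two faces does not change the number of loops, if this edge and a
half-edge `a₀` of its faces are crossed by the same path. -/
theorem loops_eq_of_true [Finite D] (C : Cut h true M M') (S : Surg M.face M'.face K) {a₀ : D}
    (h₀ : a₀ ∈ K) (hc₀ : M'.col a₀ = true)
    (hK : ∀ a ∈ K, M'.col a = true → M'.face.SameCycle a₀ a ∧
      (M.face.SameCycle none (ss a) ∨ M.face.SameCycle (some none) (ss a))) :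
    M.loops = M'.loops := by
  classical
  let r' : {a // M'.col a = true} → {a // M'.col a = true} → Prop :=
    fun a c => (c : D) = M'.glue a ∨ M'.face.SameCycle (a : D) c
  let r : {x // M.col x = true} → {x // M.col x = true} → Prop :=
    fun x y => (y : Ext D) = M.glue x ∨ M.face.SameCycle (x : Ext D) y
  let i : {a // M'.col a = true} → {x // M.col x = true} :=
    fun a => ⟨ss a.1, by rw [C.col_ss]; exact a.2⟩
  let q : ∀ x : Ext D, M.col x = true → {a // M'.col a = true} := fun x hx =>
    match x, hx with
    | some (some a), hx => ⟨a, by rwa [← C.col_ss]⟩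
    -- The new half-edges are both linked to `a₀`, which stands for their loop.
    | some none, _ => ⟨a₀, hc₀⟩
    | none, _ => ⟨a₀, hc₀⟩
  have qs : ∀ a ha, q (ss a) ha = ⟨a, by rwa [← C.col_ss]⟩ := fun a ha => rfl
  have mem_K : ∀ a, M.face.SameCycle none (ss a) ∨ M.face.SameCycle (some none) (ss a) → a ∈ K := by
    intro a ha
    by_contra haK
    have := S.not_sameCycle haK
    exact ha.elim (fun h => this.1 h.symm) fun h => this.2 h.symm
  have hrx : ∀ a : {a // M'.col a = true}, a.1 ∈ K →
      Quot.mk r (i a) = Quot.mk r ⟨none, C.col_r⟩ := by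
    intro a ha
    rcases (hK a.1 ha a.2).2 with h1 | h1
    · exact (Quot.sound (Or.inr h1) : Quot.mk r ⟨none, C.col_r⟩ = Quot.mk r (i a)).symm
    · have h2 : Quot.mk r ⟨none, C.col_r⟩ = Quot.mk r ⟨some none, C.col_b⟩ :=
        Quot.sound (Or.inl C.glue_r.symm)
      exact (h2.trans (Quot.sound (Or.inr h1))).symm
  have hq₀ : ∀ a : {a // M'.col a = true}, a.1 ∈ K → Quot.mk r' ⟨a₀, hc₀⟩ = Quot.mk r' a :=
    fun a ha => Quot.sound (Or.inr (hK a.1 ha a.2).1)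
  symm
  refine Nat.card_congr (α := Quot r') (β := Quot r)
    { toFun := Quot.lift (fun a => Quot.mk r (i a)) ?_
      invFun := Quot.lift (fun x => Quot.mk r' (q x.1 x.2)) ?_
      left_inv := ?_
      right_inv := ?_ }
  · intro a c hac
    rcases hac with h1 | h1
    · refine Quot.sound (Or.inl ?_)
      change ss c.1 = M.glue (ss a.1)
      rw [C.glue_ss, h1]
    · by_cases ha : a.1 ∈ K
      · by_cases hc : c.1 ∈ K
        · exact (hrx a ha).trans (hrx c hc).symm
        · exact Quot.sound (Or.inr (((S.sameCycle_iff hc).2 h1.symm).symm))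
      · exact Quot.sound (Or.inr ((S.sameCycle_iff ha).2 h1))
  · have key : ∀ x (hx : M.col x = true), (x = none ∨ x = some none) → ∀ y (hy : M.col y = true),
        r ⟨x, hx⟩ ⟨y, hy⟩ ∨ r ⟨y, hy⟩ ⟨x, hx⟩ → Quot.mk r' ⟨a₀, hc₀⟩ = Quot.mk r' (q y hy) := by
      intro x hx hx' y hy hxy
      rcases Ext.cases y with rfl | rfl | ⟨c, rfl⟩
      · rfl
      · rfl
      · rw [qs]
        apply hq₀
        apply mem_K
        rcases hx' with rfl | rfl
        · rcases hxy with (h1 | h1) | (h1 | h1)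
          · rw [C.glue_r] at h1; simp at h1
          · exact Or.inl h1
          · simp [C.glue_ss] at h1
          · exact Or.inl h1.symm
        · rcases hxy with (h1 | h1) | (h1 | h1)
          · rw [C.glue_b] at h1; simp at h1
          · exact Or.inr h1
          · simp [C.glue_ss] at h1
          · exact Or.inr h1.symm
    rintro ⟨x, hx⟩ ⟨y, hy⟩ hxy
    rcases Ext.cases x with rfl | rfl | ⟨a, rfl⟩
    · exact key none hx (Or.inl rfl) y hy (Or.inl hxy)
    · exact key (some none) hx (Or.inr rfl) y hy (Or.inl hxy)
    · rcases Ext.cases y with rfl | rfl | ⟨c, rfl⟩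
      · exact (key none hy (Or.inl rfl) (ss a) hx (Or.inr hxy)).symm
      · exact (key (some none) hy (Or.inr rfl) (ss a) hx (Or.inr hxy)).symm
      · change Quot.mk r' (q (ss a) hx) = Quot.mk r' (q (ss c) hy)
        rw [qs, qs]
        rcases hxy with h1 | h1
        · exact Quot.sound (Or.inl (by simpa [C.glue_ss] using h1))
        · change M.face.SameCycle (ss a) (ss c) at h1
          by_cases ha : a ∈ K
          · by_cases hc : c ∈ K
            · exact (hq₀ ⟨a, _⟩ ha).symm.trans (hq₀ ⟨c, _⟩ hc)
            · exact Quot.sound (Or.inr (((S.sameCycle_iff hc).1 h1.symm).symm))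
          · exact Quot.sound (Or.inr ((S.sameCycle_iff ha).1 h1))
  · rintro ⟨a, ha⟩
    rfl
  · rintro ⟨x, hx⟩
    rcases Ext.cases x with rfl | rfl | ⟨a, rfl⟩
    · exact hrx ⟨a₀, hc₀⟩ h₀
    · exact (hrx ⟨a₀, hc₀⟩ h₀).trans (Quot.sound (Or.inl C.glue_r.symm))
    · rfl

/-- Removing an edge crossed by a path whose two sides are the only half-edges of their face that
are crossed by a path removes a loop. -/
theorem loops_eq_add_one [Finite D] (C : Cut h true M M') (S : Surg M.face M'.face K)
    (hK : ∀ a ∈ K, M'.col a = false) (hrb : M.face.SameCycle none (some none)) :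
    M.loops = M'.loops + 1 := by
  let f : {a // M'.col a = true} ⊕ Bool → {x // M.col x = true} := Sum.elim
    (fun a => ⟨ss a.1, by rw [C.col_ss]; exact a.2⟩)
    (fun b => if b then ⟨some none, C.col_b⟩ else ⟨none, C.col_r⟩)
  have hf : Function.Bijective f := by
    constructor
    · rintro (⟨a, ha⟩ | _ | _) (⟨c, hc⟩ | _ | _) hac <;> simp_all [f]
    · rintro ⟨x, hx⟩
      rcases Ext.cases x with rfl | rfl | ⟨a, rfl⟩
      · exact ⟨.inr false, rfl⟩
      · exact ⟨.inr true, rfl⟩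
      · exact ⟨.inl ⟨a, by rwa [C.col_ss] at hx⟩, rfl⟩
  have hnK : ∀ a : {a // M'.col a = true}, a.1 ∉ K := fun a ha => by
    have := hK a.1 ha; rw [a.2] at this; simp at this
  have h1 : Nat.card (Quot fun _ _ : Bool => True) = 1 := by
    rw [Nat.card_eq_one_iff_unique]
    exact ⟨⟨by rintro ⟨x⟩ ⟨y⟩; exact Quot.sound trivial⟩, ⟨Quot.mk _ true⟩⟩
  rw [← h1]
  refine card_quot_sum (Equiv.ofBijective f hf) ?_ ?_ ?_ ?_
  · intro a c
    change ss c.1 = M.glue (ss a.1) ∨ M.face.SameCycle (ss a.1) (ss c.1) ↔ _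
    rw [C.glue_ss, ss_inj, S.sameCycle_iff (hnK a)]
  · rintro (_ | _) (_ | _) <;> simp [f, hrb, hrb.symm, Perm.SameCycle.refl]
  · rintro a (_ | _)
    · change ¬ (none = M.glue (ss a.1) ∨ M.face.SameCycle (ss a.1) none)
      simp [C.glue_ss, (S.not_sameCycle (hnK a)).1]
    · change ¬ (some none = M.glue (ss a.1) ∨ M.face.SameCycle (ss a.1) (some none))
      simp [C.glue_ss, (S.not_sameCycle (hnK a)).2]
  · rintro (_ | _) a
    · change ¬ (ss a.1 = M.glue none ∨ M.face.SameCycle none (ss a.1))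
      rw [Perm.sameCycle_comm]
      simp [C.glue_r, (S.not_sameCycle (hnK a)).1]
    · change ¬ (ss a.1 = M.glue (some none) ∨ M.face.SameCycle (some none) (ss a.1))
      rw [Perm.sameCycle_comm]
      simp [C.glue_b, (S.not_sameCycle (hnK a)).2]

/-- The removal of the root edge `none, some none`: the map on the old half-edges with prescribed
marked faces. The gluing is disconnected from the edge, and the face permutation is multiplied by
the transposition of the two half-edges, which then become fixed points and are deleted. -/
theorem exists_down (h : ι' → ι) (H : M.Ok) (hg : M.glue none = some none) (main' : κ' → List D)
    (aux' : ι' → List D) (haux : ∀ i, M.aux (h i) = (aux' i).map ss) :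
    Cut h (M.col none) M ⟨del (M.face * swap none (some none)),
      del (M.glue * swap none (some none)), fun a => M.col (ss a), main', aux'⟩ where
  glue_r := hg
  glue_b := by rw [← hg, H.glue_glue]
  glue_ss a := by
    have hgb : M.glue (some none) = none := by rw [← hg, H.glue_glue]
    rcases Ext.cases (M.glue (ss a)) with h | h | ⟨c, hc⟩
    · have := M.glue.injective (h.trans hgb.symm); simp at this
    · have := M.glue.injective (h.trans hg.symm); simp at this
    · rw [hc]
      refine (congrArg ss (del_apply ?_)).symm
      rw [Perm.mul_apply, swap_apply_of_ne_of_ne (by simp) (by simp), hc]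
  col_r := rfl
  col_b := by rw [← hg, H.col_glue]
  col_ss _ := rfl
  face := rfl
  aux := haux

/-- The insertion of the edge `none, some none`, crossed by a path if `p`, with prescribed face
permutation and marked faces. -/
theorem exists_up (h : ι' → ι) (p : Bool) (M' : PMap κ' ι' D) (face : Perm (Ext D))
    (hf : del (face * swap none (some none)) = M'.face) (main : κ → List (Ext D))
    (aux : ι → List (Ext D)) (haux : ∀ i, aux (h i) = (M'.aux i).map ss) :
    Cut h p ⟨face, optionCongr (optionCongr M'.glue) * swap none (some none),
      fun x => x.elim p fun y => y.elim p M'.col, main, aux⟩ M' where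
  glue_r := by simp
  glue_b := by simp
  glue_ss a := by
    change (optionCongr (optionCongr M'.glue) * swap (none : Ext D) (some none)) (ss a) = _
    rw [Perm.mul_apply, swap_apply_of_ne_of_ne (by simp) (by simp)]
    rfl
  col_r := rfl
  col_b := rfl
  col_ss _ := rfl
  face := hf
  aux := haux

/-- The map before the removal is determined by the map after the removal, the face permutation and
the marked faces. -/
theorem ext_up {N : PMap κ ι (Ext D)} (C : Cut h p M M') (C' : Cut h p N M')
    (hf : M.face = N.face) (hm : M.main = N.main) (ha : M.aux = N.aux) : M = N := by
  have hg : M.glue = N.glue := by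
    ext1 x
    rcases Ext.cases x with rfl | rfl | ⟨a, rfl⟩
    · rw [C.glue_r, C'.glue_r]
    · rw [C.glue_b, C'.glue_b]
    · rw [C.glue_ss, C'.glue_ss]
  have hc : M.col = N.col := by
    funext x
    rcases Ext.cases x with rfl | rfl | ⟨a, rfl⟩
    · rw [C.col_r, C'.col_r]
    · rw [C.col_b, C'.col_b]
    · rw [C.col_ss, C'.col_ss]
  obtain ⟨_, _, _, _, _⟩ := M
  obtain ⟨_, _, _, _, _⟩ := N
  simp_all

/-- The map after the removal is determined by the map before the removal and the new main faces. -/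
theorem ext_down {N' : PMap κ' ι' D} (C : Cut h p M M') (C' : Cut h p M N')
    (hm : M'.main = N'.main) : M' = N' := by
  have hf : M'.face = N'.face := C.face.symm.trans C'.face
  have hg : M'.glue = N'.glue := by
    ext1 a
    rw [← ss_inj, ← C.glue_ss, C'.glue_ss]
  have hc : M'.col = N'.col := by
    funext a
    rw [← C.col_ss, C'.col_ss]
  have ha : M'.aux = N'.aux := by
    funext i
    exact ss_injective.list_map ((C.aux i).symm.trans (C'.aux i))
  obtain ⟨_, _, _, _, _⟩ := M'
  obtain ⟨_, _, _, _, _⟩ := N'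
  simp_all

end Cut

end PMap

end ONModel

/-! ### Weighted sums over maps after the removal of the root edge -/

namespace ONModel

open Equiv

variable {D ι ι' : Type}

namespace PMap

namespace Cut

theorem main_of_eq {M : PMap Unit ι (Ext D)} {U W : List D} (hm : M.main () = none :: W.map ss) :
    ∀ k, ∀ x ∈ M.main k, x = none ∨ x = some none ∨ ∃ a ∈ U ++ W, x = ss a := by
  rintro ⟨⟩ x hx
  rw [hm] at hx
  rcases List.mem_cons.1 hx with h | h
  · exact Or.inl h
  · obtain ⟨a, ha, rfl⟩ := List.mem_map.1 h
    exact Or.inr (Or.inr ⟨a, by simp [ha], rfl⟩)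

theorem main_iff_of_eq {M' : PMap Unit ι' D} {U W : List D} (hm' : M'.main () = U ++ W) :
    ∀ a, (∃ k, a ∈ M'.main k) ↔ a ∈ U ++ W :=
  fun a => ⟨by rintro ⟨⟨⟩, h⟩; rwa [hm'] at h, fun h => ⟨(), by rwa [hm']⟩⟩

section Merge

variable [DecidableEq D] {h : ι' → ι} {p : Bool} {M : PMap Unit ι (Ext D)}
  {M' : PMap Unit ι' D} {U W : List D}

theorem surg_merge (C : Cut h p M M') (hb : IsCyc M.face (some none :: U.map ss))
    (hr : IsCyc M.face (none :: W.map ss)) : Surg M.face M'.face (U ++ W) := by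
  rw [← C.face]; exact merge_surg hb hr

theorem isCyc_merge (C : Cut h p M M') (hb : IsCyc M.face (some none :: U.map ss))
    (hr : IsCyc M.face (none :: W.map ss)) : IsCyc M'.face (U ++ W) := by
  rw [← C.face]; exact merge_cyc_del (merge_cyc hb hr)

theorem conn_merge (C : Cut h p M M') (hb : IsCyc M.face (some none :: U.map ss))
    (hr : IsCyc M.face (none :: W.map ss)) (hm : M.main () = none :: W.map ss)
    (hm' : M'.main () = U ++ W) :
    (∀ T : Set (Ext D), (∀ a ∈ T, M.face a ∈ T) → (∀ a ∈ T, M.glue a ∈ T) →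
      (∀ k, ∀ a ∈ M.main k, a ∈ T) → ∀ a, a ∈ T) ↔
    (∀ T : Set D, (∀ a ∈ T, M'.face a ∈ T) → (∀ a ∈ T, M'.glue a ∈ T) →
      (∀ k, ∀ a ∈ M'.main k, a ∈ T) → ∀ a, a ∈ T) := by
  refine C.conn_iff (C.surg_merge hb hr) (main_iff_of_eq hm') (main_of_eq hm) ?_
  intro T t1 t2 t3
  have h1 : none ∈ T := t3 () _ (by rw [hm]; simp)
  have h2 : some none ∈ T := C.glue_r ▸ t2 _ h1
  refine ⟨h1, h2, fun a ha => ?_⟩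
  rcases List.mem_append.1 ha with h | h
  · exact mem_of_isCyc hb t1 h2 _ (by simp [h])
  · exact mem_of_isCyc hr t1 h1 _ (by simp [h])

theorem nv_merge [Finite D] (C : Cut h p M M') (hb : IsCyc M.face (some none :: U.map ss))
    (hr : IsCyc M.face (none :: W.map ss)) (hm : M.main () = none :: W.map ss)
    (hm' : M'.main () = U ++ W) : M.nv = M'.nv := by
  classical
  unfold nv
  rw [C.cycNum_merge hb hr, card_unit, card_unit, hm, hm']
  simp

/-- Merging the root face with another face preserves the number of loops when the removed edge is
not crossed by a path and neither is any other side of the root face (then the arcs of the merged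
face are those of the other face), and when the removed edge and another side of the root face
are crossed by the same piece of path (then the two pieces that meet on the edge are joined). -/
theorem loops_merge [Finite D] (C : Cut h p M M') (hb : IsCyc M.face (some none :: U.map ss))
    (hr : IsCyc M.face (none :: W.map ss))
    (hp : (p = false ∧ ∀ a ∈ W, M'.col a = false) ∨ (p = true ∧ ∃ a ∈ W, M'.col a = true)) :
    M.loops = M'.loops := by
  have S := C.surg_merge hb hr
  have hc := C.isCyc_merge hb hr
  rcases hp with ⟨rfl, hW⟩ | ⟨rfl, a₀, ha₀, hc₀⟩
  · have hU : ∀ a ∈ U ++ W, M'.col a = true → a ∈ U := by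
      intro a ha hac
      rcases List.mem_append.1 ha with h | h
      · exact h
      · rw [hW a h] at hac; simp at hac
    refine C.loops_eq_of_false S fun a ha c hc' hac hcc => ⟨?_, (hc.sameCycle_iff ha).2 hc'⟩
    rw [hb.sameCycle_iff (a := ss a) (by simp [hU a ha hac])]
    simp [hU c hc' hcc]
  · refine C.loops_eq_of_true S (a₀ := a₀) (by simp [ha₀]) hc₀ fun a ha _ =>
      ⟨(hc.sameCycle_iff (by simp [ha₀])).2 ha, ?_⟩
    rw [hb.sameCycle_iff (a := some none) (by simp), hr.sameCycle_iff (a := none) (by simp)]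
    rcases List.mem_append.1 ha with h | h
    · right; simp [h]
    · left; simp [h]

end Merge

/-- A face with one unmarked half-edge is unmarked. -/
theorem unm_of_sameCycle {κ : Type} {M : PMap κ ι D} (H : M.Ok) {l : List D} (hl : IsCyc M.face l)
    {a : D} (ha : a ∈ l) (hu : M.Unm a) : ∀ x ∈ l, M.Unm x := by
  refine fun x hx => ⟨fun k hk => hu.1 k ?_, fun i hi => hu.2 i ?_⟩
  · exact ((hl.isRotated (H.main_cyc k) hx hk).mem_iff).1 ha
  · exact ((hl.isRotated (H.aux_cyc i) hx hi).mem_iff).1 ha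

section MergeUnm

variable [DecidableEq D] {p : Bool} {M : PMap Unit ι (Ext D)}
  {M' : PMap Unit ι D} {U W : List D}

theorem faces_merge_unm (C : Cut id p M M') (H : M.Ok)
    (hb : IsCyc M.face (some none :: U.map ss))
    (hr : IsCyc M.face (none :: W.map ss)) (hm : M.main () = none :: W.map ss)
    (hm' : M'.main () = U ++ W) (hu : M.Unm (some none)) :
    M.faces = insert ((some none :: U.map ss : List (Ext D)) : Cycle (Ext D))
      (Cycle.map ss '' M'.faces) := by
  refine faces_eq_insert (C.surg_merge hb hr) (fun a ha => C.unm_iff (main_iff_of_eq hm')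
    (main_of_eq hm) (fun i => Or.inl ⟨i, rfl⟩) ha) ?_ ?_ ?_ hb
    (unm_of_sameCycle H hb (by simp) hu)
  · intro a ha
    rcases List.mem_append.1 ha with h | h
    · exact Or.inl h
    · exact Or.inr fun h' => h'.1 () (by rw [hm]; simp [h])
  · exact fun a ha h' => h'.1 () (by rw [hm']; exact ha)
  · exact fun h' => h'.1 () (by rw [hm]; simp)

/-- The weight loses the factor of the unmarked face that is merged with the root face. -/
theorem wt_merge_unm [Finite D] [Fintype ι] (τ : Cycle Bool → ℂ) (z : ℂ) (f : ι → ℕ → ℂ)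
    (C : Cut id p M M')
    (H : M.Ok) (hb : IsCyc M.face (some none :: U.map ss))
    (hr : IsCyc M.face (none :: W.map ss)) (hm : M.main () = none :: W.map ss)
    (hm' : M'.main () = U ++ W) (hu : M.Unm (some none))
    (hp : (p = false ∧ ∀ a ∈ W, M'.col a = false) ∨ (p = true ∧ ∃ a ∈ W, M'.col a = true)) :
    M.wt τ z f = τ ((p :: U.map M'.col : List Bool) : Cycle Bool) * M'.wt τ z f := by
  unfold wt
  rw [C.faces_merge_unm H hb hr hm hm' hu, finprod_mem_insert _ (notMem_image U _)
    (M'.faces_finite.image _), finprod_mem_image (cycle_map_injective ss_injective).injOn,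
    C.loops_merge hb hr hp]
  simp only [C.map_faces, Cycle.map_coe, List.map_cons, C.col_b, C.map_col]
  have : ∀ i, (M.aux i).length = (M'.aux i).length := fun i => by
    have := congrArg List.length (C.aux i)
    simpa using this
  simp only [this]
  ring

/-- One edge and one face disappear, and vertices do not change: the genus is preserved. -/
theorem genus_merge_unm [Finite D] (C : Cut id p M M') (H : M.Ok)
    (hb : IsCyc M.face (some none :: U.map ss))
    (hr : IsCyc M.face (none :: W.map ss)) (hm : M.main () = none :: W.map ss)
    (hm' : M'.main () = U ++ W) (hu : M.Unm (some none)) (g : ℕ) :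
    M.Genus g ↔ M'.Genus g := by
  unfold Genus
  rw [C.nv_merge hb hr hm hm', C.faces_merge_unm H hb hr hm hm' hu,
    Set.ncard_insert_of_notMem (notMem_image U _) (M'.faces_finite.image _),
    Set.ncard_image_of_injective _ (cycle_map_injective ss_injective), Finite.card_option,
    Finite.card_option]
  omega

end MergeUnm

end Cut

open Cut in
/-- Removal of an edge between the root face and an unmarked face, whose other half-edges have
colours `u`. -/
theorem sum_merge_unm [DecidableEq D] [Finite D] [Fintype ι] (τ : Cycle Bool → ℂ) (z : ℂ)
    (f : ι → ℕ → ℂ) (g v : ℕ) (p : Bool) (u w : List Bool)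
    (hp : (p = false ∧ true ∉ w) ∨ (p = true ∧ true ∈ w)) :
    ∑ᶠ M ∈ {M : PMap Unit ι (Ext D) | M ∈ maps (Ext D) g v (fun _ => p :: w) ∧
        M.glue none = some none ∧ ∃ U W : List D, M.main () = none :: W.map ss ∧
        IsCyc M.face (some none :: U.map ss) ∧ M.Unm (some none) ∧
        (U.map ss).map M.col = u}, M.wt τ z f =
      τ ((p :: u : List Bool) : Cycle Bool) * labSum τ z f D g v (fun _ : Unit => u ++ w) := by
  rw [labSum, mul_finsum_mem]
  have hp' : ∀ (W : List D) (c : D → Bool), W.map c = w →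
      (p = false ∧ ∀ a ∈ W, c a = false) ∨ (p = true ∧ ∃ a ∈ W, c a = true) := by
    rintro W c rfl
    simpa [List.mem_map] using hp
  refine finsum_mem_eq_of_rel (fun M M' => Cut id p M M' ∧ ∃ U W : List D,
    M.main () = none :: W.map ss ∧ IsCyc M.face (some none :: U.map ss) ∧
    IsCyc M.face (none :: W.map ss) ∧ M'.main () = U ++ W ∧ U.map M'.col = u ∧
    W.map M'.col = w) ?_ ?_ ?_ ?_ ?_
  -- The map after the removal.
  · rintro M ⟨⟨H, hG, hv, hw⟩, hg, U, W, hm, hb, hu, hUu⟩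
    choose aux' haux using fun i => exists_map_ss (l := M.aux i)
      (fun h => H.main_aux () i none (by rw [hm]; simp) h) (fun h => hu.2 i h)
    have hpc : M.col none = p ∧ (W.map ss).map M.col = w := by
      have := hw (); rw [hm] at this; simpa using this
    obtain ⟨M', hmM, haM, C⟩ : ∃ M' : PMap Unit ι D, M'.main = (fun _ => U ++ W) ∧ M'.aux = aux' ∧
        Cut id (M.col none) M M' := by
      refine ⟨_, ?_, ?_, exists_down id H hg (fun _ : Unit => U ++ W) aux' haux⟩ <;> rfl
    have hr : IsCyc M.face (none :: W.map ss) := hm ▸ H.main_cyc ()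
    rw [hpc.1] at C
    have hm' : M'.main () = U ++ W := by rw [hmM]
    have hUu' : U.map M'.col = u := by rw [← hUu, C.map_col]
    have hWw : W.map M'.col = w := by rw [← hpc.2, C.map_col]
    refine ⟨M', ⟨?_, (C.genus_merge_unm H hb hr hm hm' hu g).1 hG,
      (C.nv_merge hb hr hm hm').symm.trans hv, fun _ => ?_⟩, C, U, W, hm, hb, hr, hm', hUu', hWw⟩
    · refine C.ok_down (C.surg_merge hb hr) Function.injective_id H ?_
        (fun _ => hm' ▸ C.isCyc_merge hb hr) (fun _ _ _ _ _ => rfl) (main_iff_of_eq hm')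
        ((C.conn_merge hb hr hm hm').1 H.conn)
      intro i a ha haK
      have ha' : ss a ∈ M.aux i := by rw [haux]; exact mem_map_ss.2 (haM ▸ ha)
      rcases List.mem_append.1 haK with h | h
      · exact (unm_of_sameCycle H hb (by simp) hu (ss a) (by simp [h])).2 i ha'
      · exact H.main_aux () i (ss a) (by rw [hm]; simp [h]) ha'
    · rw [hm', List.map_append, hUu', hWw]
  -- The map from which a given map is obtained by removal.
  · rintro M' ⟨H, hG, hv, hw⟩
    have hw := hw ()
    obtain ⟨U, W, hUW, hU, hW⟩ := List.map_eq_append_iff.1 hw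
    have hcyc : IsCyc M'.face (U ++ W) := hUW ▸ H.main_cyc ()
    obtain ⟨face, hf, hb, hr⟩ := exists_merge M'.face U W hcyc
    obtain ⟨M, hmM, haM, hfM, C⟩ : ∃ M : PMap Unit ι (Ext D), M.main = (fun _ => none :: W.map ss) ∧
        M.aux = (fun i => (M'.aux i).map ss) ∧ M.face = face ∧ Cut id p M M' := by
      refine ⟨_, ?_, ?_, ?_, exists_up id p M' face hf (fun _ : Unit => none :: W.map ss)
        (fun i => (M'.aux i).map ss) (fun i => rfl)⟩ <;> rfl
    rw [← hfM] at hb hr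
    have hm : M.main () = none :: W.map ss := by rw [hmM]
    have hM : M.Ok := by
      refine C.ok_up (C.surg_merge hb hr) H (main_iff_of_eq hUW) (main_of_eq hm)
        (fun _ => hm ▸ hr) (fun _ _ _ _ _ => rfl) (fun i => Or.inl ⟨i, rfl⟩)
        ((C.conn_merge hb hr hm hUW).2 H.conn)
    have hu : M.Unm (some none) := by
      refine ⟨fun k h => ?_, fun i h => ?_⟩
      · rw [hmM] at h
        simp at h
      · rw [haM] at h
        simp at h
    refine ⟨M, ⟨⟨hM, (C.genus_merge_unm hM hb hr hm hUW hu g).2 hG,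
      (C.nv_merge hb hr hm hUW).trans hv, fun _ => ?_⟩, C.glue_r, U, W, hm, hb, hu, ?_⟩,
      C, U, W, hm, hb, hr, hUW, hU, hW⟩
    · rw [hm, List.map_cons, C.map_col, C.col_r, hW]
    · rw [C.map_col, hU]
  -- The removal is injective.
  · rintro M ⟨⟨H, -⟩, -⟩ N ⟨⟨H', -⟩, -⟩ M' - ⟨C, U, W, hm, hb, hr, hm', hu, hw⟩
      ⟨C', U', W', hn, hb', hr', hn', hu', hw'⟩
    obtain ⟨rfl, rfl⟩ := List.append_inj (hm'.symm.trans hn')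
      (by rw [← List.length_map M'.col, hu, ← hu', List.length_map])
    have hψ : M.face * swap none (some none) = N.face * swap none (some none) :=
      perm_ext_of_del (C.face.trans C'.face.symm) (merge_cyc hb hr) (merge_cyc hb' hr')
        (merge_cyc hb hr) (merge_cyc hb' hr') (by simp) (by simp)
    refine C.ext_up C' (mul_right_cancel hψ) ?_ ?_
    · funext k; exact hm.trans hn.symm
    · funext i; exact (C.aux i).trans (C'.aux i).symm
  -- The removal is a function: it does not depend on the choice of the lists.
  · rintro M - M' - N' - ⟨C, U, W, hm, hb, hr, hm', hu, hw⟩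
      ⟨C', U', W', hn, hb', hr', hn', hu', hw'⟩
    have h1 : U = U' := ss_injective.list_map (hb.unique hb')
    have h2 : W = W' := ss_injective.list_map (hr.unique hr')
    refine C.ext_down C' ?_
    funext k
    exact hm'.trans (by rw [h1, h2]; exact hn'.symm)
  -- The weights correspond.
  · rintro M ⟨⟨H, -⟩, -, U₁, W₁, -, hb₁, hu, -⟩ M' - ⟨C, U, W, hm, hb, hr, hm', hUu, hw⟩
    rw [C.wt_merge_unm τ z f H hb hr hm hm' hu (hp' W M'.col hw), hUu]

namespace Cut

/-- The auxiliary face `none`, written from the removed edge instead of its marked edge. -/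
theorem isCyc_of_aux {M : PMap Unit (Option ι) (Ext D)} {A B : List D}
    (H : IsCyc M.face (M.aux none))
    (ha : M.aux none = A.map ss ++ some none :: B.map ss) :
    IsCyc M.face (some none :: (B ++ A).map ss) := by
  rw [ha] at H
  simpa using H.append_comm

section MergeAux

variable [DecidableEq D] {M : PMap Unit (Option ι) (Ext D)}
  {M' : PMap Unit ι D} {A B W : List D}

theorem faces_merge_aux (C : Cut some false M M')
    (hb : IsCyc M.face (some none :: (B ++ A).map ss))
    (hr : IsCyc M.face (none :: W.map ss)) (hm : M.main () = none :: W.map ss)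
    (hm' : M'.main () = B ++ A ++ W) (ha : M.aux none = A.map ss ++ some none :: B.map ss) :
    M.faces = Cycle.map ss '' M'.faces := by
  refine faces_eq (C.surg_merge hb hr) (fun a haK => C.unm_iff (main_iff_of_eq hm')
    (main_of_eq hm) ?_ haK) ?_ ?_ ?_
  · rintro (_ | i)
    · right
      intro x hx
      rw [ha] at hx
      simp only [List.mem_append, List.mem_map, List.mem_cons] at hx
      rcases hx with ⟨a, h, rfl⟩ | rfl | ⟨a, h, rfl⟩
      · exact Or.inr ⟨a, by simp [h], rfl⟩
      · exact Or.inl rfl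
      · exact Or.inr ⟨a, by simp [h], rfl⟩
    · exact Or.inl ⟨i, rfl⟩
  · intro a haK
    refine ⟨fun h' => ?_, fun h' => h'.1 () (by rw [hm']; exact haK)⟩
    simp only [List.mem_append] at haK
    rcases haK with (h | h) | h
    · exact h'.2 none (by rw [ha]; simp [h])
    · exact h'.2 none (by rw [ha]; simp [h])
    · exact h'.1 () (by rw [hm]; simp [h])
  · exact fun h' => h'.1 () (by rw [hm]; simp)
  · exact fun h' => h'.2 none (by rw [ha]; simp)

/-- The weight loses the factor of the auxiliary face that is merged with the root face. -/
theorem wt_merge_aux [Finite D] [Fintype ι] (τ : Cycle Bool → ℂ) (z : ℂ) (f : Option ι → ℕ → ℂ)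
    (C : Cut some false M M') (hb : IsCyc M.face (some none :: (B ++ A).map ss))
    (hr : IsCyc M.face (none :: W.map ss)) (hm : M.main () = none :: W.map ss)
    (hm' : M'.main () = B ++ A ++ W) (ha : M.aux none = A.map ss ++ some none :: B.map ss)
    (hW : ∀ a ∈ W, M'.col a = false) :
    M.wt τ z f = f none (A.length + B.length + 1) * M'.wt τ z (fun i => f (some i)) := by
  unfold wt
  rw [C.faces_merge_aux hb hr hm hm' ha,
    finprod_mem_image (cycle_map_injective ss_injective).injOn,
    C.loops_merge hb hr (Or.inl ⟨rfl, hW⟩), Fintype.prod_option, ha]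
  simp only [C.map_faces]
  have : ∀ i, (M.aux (some i)).length = (M'.aux i).length := fun i => by
    have := congrArg List.length (C.aux i)
    simpa using this
  simp only [this, List.length_append, List.length_cons, List.length_map, add_assoc]
  ring

theorem genus_merge_aux [Finite D] [Finite ι] (C : Cut some false M M')
    (hb : IsCyc M.face (some none :: (B ++ A).map ss))
    (hr : IsCyc M.face (none :: W.map ss)) (hm : M.main () = none :: W.map ss)
    (hm' : M'.main () = B ++ A ++ W) (ha : M.aux none = A.map ss ++ some none :: B.map ss)
    (g : ℕ) : M.Genus g ↔ M'.Genus g := by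
  unfold Genus
  rw [C.nv_merge hb hr hm hm', C.faces_merge_aux hb hr hm hm' ha,
    Set.ncard_image_of_injective _ (cycle_map_injective ss_injective), Finite.card_option,
    Finite.card_option, Finite.card_option]
  omega

end MergeAux

end Cut

open Cut in
/-- Removal of an edge between the root face and an auxiliary marked face, at distance `s` from its
marked edge. -/
theorem sum_merge_aux [DecidableEq D] [Finite D] [Fintype ι] (τ : Cycle Bool → ℂ) (z : ℂ)
    (f : Option ι → ℕ → ℂ) (g v : ℕ) (s t : ℕ) (w : List Bool) (hp : true ∉ w) :
    ∑ᶠ M ∈ {M : PMap Unit (Option ι) (Ext D) | M ∈ maps (Ext D) g v (fun _ => false :: w) ∧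
        M.glue none = some none ∧ ∃ A B W : List D, M.main () = none :: W.map ss ∧
        M.aux none = A.map ss ++ some none :: B.map ss ∧ A.length = s ∧ B.length = t},
        M.wt τ z f =
      f none (s + t + 1) * labSum τ z (fun i => f (some i)) D g v
        (fun _ : Unit => List.replicate (s + t) false ++ w) := by
  rw [labSum, mul_finsum_mem]
  have hp' : ∀ (W : List D) (c : D → Bool), W.map c = w → ∀ a ∈ W, c a = false := by
    rintro W c rfl
    simpa [List.mem_map] using hp
  refine finsum_mem_eq_of_rel (fun M M' => Cut some false M M' ∧ ∃ A B W : List D,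
    M.main () = none :: W.map ss ∧ M.aux none = A.map ss ++ some none :: B.map ss ∧
    IsCyc M.face (some none :: (B ++ A).map ss) ∧ IsCyc M.face (none :: W.map ss) ∧
    M'.main () = B ++ A ++ W ∧ A.length = s ∧ B.length = t ∧ W.map M'.col = w) ?_ ?_ ?_ ?_ ?_
  -- The map after the removal.
  · rintro M ⟨⟨H, hG, hv, hw⟩, hg, A, B, W, hm, ha, hA, hB⟩
    choose aux' haux using fun i => exists_map_ss (l := M.aux (some i))
      (fun h => H.main_aux () _ none (by rw [hm]; simp) h)
      (fun h => by simpa using H.aux_aux (some i) none _ h (by rw [ha]; simp))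
    have hpc : M.col none = false ∧ (W.map ss).map M.col = w := by
      have := hw (); rw [hm] at this; simpa using this
    obtain ⟨M', hmM, haM, C⟩ : ∃ M' : PMap Unit ι D, M'.main = (fun _ => B ++ A ++ W) ∧
        M'.aux = aux' ∧ Cut some (M.col none) M M' := by
      refine ⟨_, ?_, ?_, exists_down some H hg (fun _ : Unit => B ++ A ++ W) aux' haux⟩ <;> rfl
    have hr : IsCyc M.face (none :: W.map ss) := hm ▸ H.main_cyc ()
    have hb := isCyc_of_aux (H.aux_cyc none) ha
    rw [hpc.1] at C
    have hm' : M'.main () = B ++ A ++ W := by rw [hmM]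
    have hWw : W.map M'.col = w := by rw [← hpc.2, C.map_col]
    refine ⟨M', ⟨?_, (C.genus_merge_aux hb hr hm hm' ha g).1 hG,
      (C.nv_merge hb hr hm hm').symm.trans hv, fun _ => ?_⟩,
      C, A, B, W, hm, ha, hb, hr, hm', hA, hB, hWw⟩
    · refine C.ok_down (C.surg_merge hb hr) (Option.some_injective _) H ?_
        (fun _ => hm' ▸ C.isCyc_merge hb hr) (fun _ _ _ _ _ => rfl) (main_iff_of_eq hm')
        ((C.conn_merge hb hr hm hm').1 H.conn)
      intro i a hai haK
      have ha' : ss a ∈ M.aux (some i) := by rw [haux]; exact mem_map_ss.2 (haM ▸ hai)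
      simp only [List.mem_append] at haK
      rcases haK with (h | h) | h
      · simpa using H.aux_aux (some i) none _ ha' (by rw [ha]; simp [h])
      · simpa using H.aux_aux (some i) none _ ha' (by rw [ha]; simp [h])
      · exact H.main_aux () (some i) (ss a) (by rw [hm]; simp [h]) ha'
    · rw [hm', List.map_append, hWw]
      congr 1
      rw [List.eq_replicate_iff]
      refine ⟨by simp [hA, hB, add_comm], ?_⟩
      intro c hc
      obtain ⟨a, hA, rfl⟩ := List.mem_map.1 hc
      rw [← C.col_ss]
      refine H.aux_col none _ ?_
      rw [ha]
      rcases List.mem_append.1 hA with h | h <;> simp [h]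
  -- The map from which a given map is obtained by removal.
  · rintro M' ⟨H, hG, hv, hw⟩
    have hw := hw ()
    obtain ⟨U, W, hUW, hU, hW⟩ := List.map_eq_append_iff.1 hw
    obtain ⟨B, A, rfl, hB, hA⟩ : ∃ B A, U = B ++ A ∧ B.length = t ∧ A.length = s := by
      have hl : U.length = s + t := by rw [← List.length_map M'.col, hU, List.length_replicate]
      exact ⟨U.take t, U.drop t, (List.take_append_drop t U).symm, by simp; omega, by simp; omega⟩
    have hcol : ∀ a ∈ B ++ A, M'.col a = false := by
      intro a ha
      have : M'.col a ∈ List.replicate (s + t) false := hU ▸ List.mem_map_of_mem ha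
      exact List.eq_of_mem_replicate this
    have hcyc : IsCyc M'.face (B ++ A ++ W) := hUW ▸ H.main_cyc ()
    obtain ⟨face, hf, hb, hr⟩ := exists_merge M'.face (B ++ A) W hcyc
    obtain ⟨M, hmM, haM, hfM, C⟩ : ∃ M : PMap Unit (Option ι) (Ext D),
        M.main = (fun _ => none :: W.map ss) ∧
        M.aux none = A.map ss ++ some none :: B.map ss ∧ M.face = face ∧ Cut some false M M' := by
      refine ⟨_, ?_, ?_, ?_, exists_up some false M' face hf (fun _ : Unit => none :: W.map ss)
        (fun i => i.elim (A.map ss ++ some none :: B.map ss) fun i => (M'.aux i).map ss)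
        (fun i => rfl)⟩ <;> rfl
    rw [← hfM] at hb hr
    have hm : M.main () = none :: W.map ss := by rw [hmM]
    have ha := haM
    have hM : M.Ok := by
      refine C.ok_up (C.surg_merge hb hr) H (main_iff_of_eq hUW) (main_of_eq hm)
        (fun _ => hm ▸ hr) (fun _ _ _ _ _ => rfl) ?_ ((C.conn_merge hb hr hm hUW).2 H.conn)
      rintro (_ | i)
      · right
        rw [ha]
        refine ⟨?_, by simp, ?_, ?_, ?_, ?_⟩
        · have hb' : IsCyc M.face ((some none :: B.map ss) ++ A.map ss) := by simpa using hb
          exact hb'.append_comm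
        · intro x hx
          simp only [List.mem_append, List.mem_map, List.mem_cons] at hx
          rcases hx with ⟨a, h, rfl⟩ | rfl | ⟨a, h, rfl⟩
          · rw [C.col_ss]; exact hcol a (by simp [h])
          · exact C.col_b
          · rw [C.col_ss]; exact hcol a (by simp [h])
        · intro x hx
          simp only [List.mem_append, List.mem_map, List.mem_cons] at hx
          rcases hx with ⟨a, h, rfl⟩ | rfl | ⟨a, h, rfl⟩
          · exact Or.inr ⟨a, by simp [h], rfl⟩
          · exact Or.inl rfl
          · exact Or.inr ⟨a, by simp [h], rfl⟩
        · rintro ⟨⟩ x hx hx'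
          rw [hm] at hx
          have hx'' : x ∈ some none :: (B ++ A).map ss := by
            simp only [List.mem_append, List.mem_cons] at hx' ⊢
            simp only [List.map_append, List.mem_append]
            tauto
          have := (hb.isRotated hr hx'' hx).mem_iff (a := none)
          simp at this
        · rintro (_ | j)
          · exact Or.inl rfl
          · exact Or.inr ⟨j, rfl⟩
      · exact Or.inl ⟨i, rfl⟩
    refine ⟨M, ⟨⟨hM, (C.genus_merge_aux hb hr hm hUW ha g).2 hG,
      (C.nv_merge hb hr hm hUW).trans hv, fun _ => ?_⟩, C.glue_r, A, B, W, hm, ha, hA, hB⟩,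
      C, A, B, W, hm, ha, hb, hr, hUW, hA, hB, hW⟩
    rw [hm, List.map_cons, C.map_col, C.col_r, hW]
  -- The removal is injective.
  · rintro M ⟨⟨H, -⟩, -⟩ N ⟨⟨H', -⟩, -⟩ M' - ⟨C, A, B, W, hm, ha, hb, hr, hm', hA, hB, hw⟩
      ⟨C', A', B', W', hn, ha', hb', hr', hn', hA', hB', hw'⟩
    obtain ⟨h1, rfl⟩ := List.append_inj (hm'.symm.trans hn') (by simp [hA, hB, hA', hB'])
    obtain ⟨rfl, rfl⟩ := List.append_inj h1 (by simp [hB, hB'])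
    have hψ : M.face * swap none (some none) = N.face * swap none (some none) :=
      perm_ext_of_del (C.face.trans C'.face.symm) (merge_cyc hb hr) (merge_cyc hb' hr')
        (merge_cyc hb hr) (merge_cyc hb' hr') (by simp) (by simp)
    refine C.ext_up C' (mul_right_cancel hψ) ?_ ?_
    · funext k; exact hm.trans hn.symm
    · funext i
      rcases i with _ | i
      · exact ha.trans ha'.symm
      · exact (C.aux i).trans (C'.aux i).symm
  -- The removal is a function: it does not depend on the choice of the lists.
  · rintro M - M' - N' - ⟨C, A, B, W, hm, ha, hb, hr, hm', hA, hB, hw⟩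
      ⟨C', A', B', W', hn, ha', hb', hr', hn', hA', hB', hw'⟩
    have h1 : B ++ A = B' ++ A' := ss_injective.list_map (hb.unique hb')
    have h2 : W = W' := ss_injective.list_map (hr.unique hr')
    refine C.ext_down C' ?_
    funext k
    exact hm'.trans (by rw [h1, h2]; exact hn'.symm)
  -- The weights correspond.
  · rintro M - M' - ⟨C, A, B, W, hm, ha, hb, hr, hm', hA, hB, hw⟩
    rw [C.wt_merge_aux τ z f hb hr hm hm' ha (hp' W M'.col hw), hA, hB]

namespace Cut

theorem main_of_split {M : PMap Unit ι (Ext D)} {W₁ W₂ : List D}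
    (hm : M.main () = none :: W₁.map ss ++ some none :: W₂.map ss) :
    ∀ k, ∀ x ∈ M.main k, x = none ∨ x = some none ∨ ∃ a ∈ W₁ ++ W₂, x = ss a := by
  rintro ⟨⟩ x hx
  rw [hm] at hx
  simp only [List.cons_append, List.mem_append, List.mem_map, List.mem_cons] at hx
  rcases hx with rfl | ⟨a, h, rfl⟩ | rfl | ⟨a, h, rfl⟩
  · simp
  · exact Or.inr (Or.inr ⟨a, by simp [h], rfl⟩)
  · simp
  · exact Or.inr (Or.inr ⟨a, by simp [h], rfl⟩)

theorem main_iff_of_split {M' : PMap Bool ι D} {W₁ W₂ : List D}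
    (h₁ : M'.main false = W₁) (h₂ : M'.main true = W₂) :
    ∀ a, (∃ k, a ∈ M'.main k) ↔ a ∈ W₁ ++ W₂ := by
  intro a
  simp [h₁, h₂]

section Split

variable [DecidableEq D] {p : Bool} {M : PMap Unit ι (Ext D)} {M' : PMap Bool ι D} {W₁ W₂ : List D}

theorem surg_split (C : Cut id p M M')
    (hr : IsCyc M.face (none :: W₁.map ss ++ some none :: W₂.map ss)) :
    Surg M.face M'.face (W₁ ++ W₂) := by
  rw [← C.face]; exact split_surg hr

theorem isCyc_split (C : Cut id p M M')
    (hr : IsCyc M.face (none :: W₁.map ss ++ some none :: W₂.map ss)) :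
    IsCyc M'.face W₁ ∧ IsCyc M'.face W₂ := by
  rw [← C.face]
  obtain ⟨h1, h2, -⟩ := split_cyc hr
  exact ⟨split_cyc_del h1, split_cyc_del' h2⟩

theorem conn_split (C : Cut id p M M')
    (hr : IsCyc M.face (none :: W₁.map ss ++ some none :: W₂.map ss))
    (hm : M.main () = none :: W₁.map ss ++ some none :: W₂.map ss)
    (h₁ : M'.main false = W₁) (h₂ : M'.main true = W₂) :
    (∀ T : Set (Ext D), (∀ a ∈ T, M.face a ∈ T) → (∀ a ∈ T, M.glue a ∈ T) →
      (∀ k, ∀ a ∈ M.main k, a ∈ T) → ∀ a, a ∈ T) ↔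
    (∀ T : Set D, (∀ a ∈ T, M'.face a ∈ T) → (∀ a ∈ T, M'.glue a ∈ T) →
      (∀ k, ∀ a ∈ M'.main k, a ∈ T) → ∀ a, a ∈ T) := by
  refine C.conn_iff (C.surg_split hr) (main_iff_of_split h₁ h₂) (main_of_split hm) ?_
  intro T t1 t2 t3
  have t3 := t3 ()
  rw [hm] at t3
  refine ⟨t3 _ (by simp), t3 _ (by simp), fun a ha => ?_⟩
  rcases List.mem_append.1 ha with h | h <;> exact t3 _ (by simp [h])

theorem nv_split [Finite D] (C : Cut id p M M')
    (hr : IsCyc M.face (none :: W₁.map ss ++ some none :: W₂.map ss))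
    (hm : M.main () = none :: W₁.map ss ++ some none :: W₂.map ss)
    (h₁ : M'.main false = W₁) (h₂ : M'.main true = W₂) : M.nv = M'.nv := by
  classical
  unfold nv
  rw [C.cycNum_split hr, card_unit, card_bool, hm, h₁, h₂]
  simp

theorem faces_split (C : Cut id p M M')
    (hr : IsCyc M.face (none :: W₁.map ss ++ some none :: W₂.map ss))
    (hm : M.main () = none :: W₁.map ss ++ some none :: W₂.map ss)
    (h₁ : M'.main false = W₁) (h₂ : M'.main true = W₂) :
    M.faces = Cycle.map ss '' M'.faces := by
  refine faces_eq (C.surg_split hr) (fun a ha => C.unm_iff (main_iff_of_split h₁ h₂)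
    (main_of_split hm) (fun i => Or.inl ⟨i, rfl⟩) ha) ?_ ?_ ?_
  · intro a ha
    refine ⟨fun h' => h'.1 () ?_, fun h' => ?_⟩
    · rw [hm]
      rcases List.mem_append.1 ha with h | h <;> simp [h]
    · obtain ⟨k, hk⟩ := (main_iff_of_split h₁ h₂ a).2 ha
      exact h'.1 k hk
  · exact fun h' => h'.1 () (by rw [hm]; simp)
  · exact fun h' => h'.1 () (by rw [hm]; simp)

/-- If no other side of the root face is crossed by a path, removing an edge with the root face on
both sides destroys a loop precisely when a path crosses that edge: this path is a loop by
itself. -/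
theorem loops_split [Finite D] (C : Cut id p M M')
    (hr : IsCyc M.face (none :: W₁.map ss ++ some none :: W₂.map ss))
    (hK : ∀ a ∈ W₁ ++ W₂, M'.col a = false) :
    M.loops = M'.loops + if p then 1 else 0 := by
  cases p with
  | false =>
    refine C.loops_eq_of_false (C.surg_split hr) fun a ha c _ hac => ?_
    rw [hK a ha] at hac; simp at hac
  | true =>
    refine C.loops_eq_add_one (C.surg_split hr) hK ?_
    rw [hr.sameCycle_iff (by simp)]; simp

theorem wt_split [Finite D] [Fintype ι] (τ : Cycle Bool → ℂ) (z : ℂ) (f : ι → ℕ → ℂ)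
    (C : Cut id p M M')
    (hr : IsCyc M.face (none :: W₁.map ss ++ some none :: W₂.map ss))
    (hm : M.main () = none :: W₁.map ss ++ some none :: W₂.map ss)
    (h₁ : M'.main false = W₁) (h₂ : M'.main true = W₂)
    (hK : ∀ a ∈ W₁ ++ W₂, M'.col a = false) :
    M.wt τ z f = (if p then z else 1) * M'.wt τ z f := by
  unfold wt
  rw [C.faces_split hr hm h₁ h₂, finprod_mem_image (cycle_map_injective ss_injective).injOn,
    C.loops_split hr hK]
  simp only [C.map_faces]
  have : ∀ i, (M.aux i).length = (M'.aux i).length := fun i => by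
    have := congrArg List.length (C.aux i)
    simpa using this
  simp only [this]
  cases p
  · simp
  · simp [pow_succ]; ring

/-- One edge disappears and the root face becomes two main faces: the Euler characteristic grows by
`2` and the number of main faces by `1`, which compensate each other in `Genus`. -/
theorem genus_split [Finite D] (C : Cut id p M M')
    (hr : IsCyc M.face (none :: W₁.map ss ++ some none :: W₂.map ss))
    (hm : M.main () = none :: W₁.map ss ++ some none :: W₂.map ss)
    (h₁ : M'.main false = W₁) (h₂ : M'.main true = W₂) (g : ℕ) : M.Genus g ↔ M'.Genus g := by
  unfold Genus
  rw [C.nv_split hr hm h₁ h₂, C.faces_split hr hm h₁ h₂,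
    Set.ncard_image_of_injective _ (cycle_map_injective ss_injective), Finite.card_option,
    Finite.card_option, Nat.card_unique, Nat.card_eq_fintype_card (α := Bool), Fintype.card_bool]
  omega

end Split

end Cut

open Cut in
/-- Removal of an edge with the root face on both sides. -/
theorem sum_split [DecidableEq D] [Finite D] [Fintype ι] (τ : Cycle Bool → ℂ) (z : ℂ)
    (f : ι → ℕ → ℂ) (g v : ℕ) (p : Bool) (w₁ w₂ : List Bool) (hw₁ : true ∉ w₁) (hw₂ : true ∉ w₂) :
    ∑ᶠ M ∈ {M : PMap Unit ι (Ext D) | M ∈ maps (Ext D) g v (fun _ => p :: w₁ ++ p :: w₂) ∧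
        M.glue none = some none ∧ ∃ W₁ W₂ : List D,
        M.main () = none :: W₁.map ss ++ some none :: W₂.map ss ∧ W₁.length = w₁.length},
        M.wt τ z f =
      (if p then z else 1) * labSum τ z f D g v (fun k : Bool => if k then w₂ else w₁) := by
  rw [labSum, mul_finsum_mem]
  refine finsum_mem_eq_of_rel (fun M M' => Cut id p M M' ∧ ∃ W₁ W₂ : List D,
    M.main () = none :: W₁.map ss ++ some none :: W₂.map ss ∧ IsCyc M.face (M.main ()) ∧
    M'.main false = W₁ ∧ M'.main true = W₂ ∧ W₁.map M'.col = w₁ ∧ W₂.map M'.col = w₂)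
    ?_ ?_ ?_ ?_ ?_
  -- The map after the removal.
  · rintro M ⟨⟨H, hG, hv, hw⟩, hg, W₁, W₂, hm, hl⟩
    choose aux' haux using fun i => exists_map_ss (l := M.aux i)
      (fun h => H.main_aux () i none (by rw [hm]; simp) h)
      (fun h => H.main_aux () i (some none) (by rw [hm]; simp) h)
    have hpc : M.col none = p ∧ (W₁.map ss).map M.col = w₁ ∧ (W₂.map ss).map M.col = w₂ := by
      have := hw ()
      rw [hm, List.map_append, List.map_cons, List.map_cons] at this
      obtain ⟨h1, h2⟩ := List.append_inj this (by simp [hl])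
      exact ⟨(List.cons.inj h1).1, (List.cons.inj h1).2, (List.cons.inj h2).2⟩
    obtain ⟨M', hmM, haM, C⟩ : ∃ M' : PMap Bool ι D,
        M'.main = (fun k => if k then W₂ else W₁) ∧ M'.aux = aux' ∧ Cut id (M.col none) M M' := by
      refine ⟨_, ?_, ?_, exists_down id H hg (fun k : Bool => if k then W₂ else W₁) aux' haux⟩ <;>
        rfl
    have hr : IsCyc M.face (none :: W₁.map ss ++ some none :: W₂.map ss) := hm ▸ H.main_cyc ()
    rw [hpc.1] at C
    have h₁ : M'.main false = W₁ := by simp [hmM]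
    have h₂ : M'.main true = W₂ := by simp [hmM]
    have hw₁' : W₁.map M'.col = w₁ := by rw [← hpc.2.1, C.map_col]
    have hw₂' : W₂.map M'.col = w₂ := by rw [← hpc.2.2, C.map_col]
    have hdis : ∀ a ∈ W₁, a ∉ W₂ := by
      intro a ha ha'
      have := (List.nodup_append.1 hr.nodup).2.2 (ss a) (by simp [ha]) (ss a) (by simp [ha'])
      exact this rfl
    refine ⟨M', ⟨?_, (C.genus_split hr hm h₁ h₂ g).1 hG,
      (C.nv_split hr hm h₁ h₂).symm.trans hv, ?_⟩, C, W₁, W₂, hm, H.main_cyc (), h₁, h₂, hw₁',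
      hw₂'⟩
    · refine C.ok_down (C.surg_split hr) Function.injective_id H ?_ ?_ ?_
        (main_iff_of_split h₁ h₂) ((C.conn_split hr hm h₁ h₂).1 H.conn)
      · intro i a ha haK
        have ha' : ss a ∈ M.aux i := by rw [haux]; exact mem_map_ss.2 (haM ▸ ha)
        refine H.main_aux () i (ss a) ?_ ha'
        rw [hm]
        rcases List.mem_append.1 haK with h | h <;> simp [h]
      · rintro (_ | _)
        · rw [h₁]; exact (C.isCyc_split hr).1
        · rw [h₂]; exact (C.isCyc_split hr).2
      · rintro (_ | _) (_ | _) a ha ha'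
        · rfl
        · exact (hdis a (h₁ ▸ ha) (h₂ ▸ ha')).elim
        · exact (hdis a (h₁ ▸ ha') (h₂ ▸ ha)).elim
        · rfl
    · rintro (_ | _)
      · rw [h₁]; exact hw₁'
      · rw [h₂]; exact hw₂'
  -- The map from which a given map is obtained by removal.
  · rintro M' ⟨H, hG, hv, hw⟩
    obtain ⟨W₁, h₁⟩ : ∃ W, M'.main false = W := ⟨_, rfl⟩
    obtain ⟨W₂, h₂⟩ : ∃ W, M'.main true = W := ⟨_, rfl⟩
    have c₁ := H.main_cyc false
    have c₂ := H.main_cyc true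
    have hw₁' : W₁.map M'.col = w₁ := h₁ ▸ hw false
    have hw₂' : W₂.map M'.col = w₂ := h₂ ▸ hw true
    have hdis : ∀ a ∈ W₁, a ∉ W₂ := by
      intro a ha ha'
      have := H.main_main false true a (h₁ ▸ ha) (h₂ ▸ ha')
      simp at this
    rw [h₁] at c₁
    rw [h₂] at c₂
    obtain ⟨face, hf, hr⟩ := exists_split M'.face W₁ W₂ c₁ c₂ hdis
    obtain ⟨M, hmM, haM, hfM, C⟩ : ∃ M : PMap Unit ι (Ext D),
        M.main = (fun _ => none :: W₁.map ss ++ some none :: W₂.map ss) ∧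
        M.aux = (fun i => (M'.aux i).map ss) ∧ M.face = face ∧ Cut id p M M' := by
      refine ⟨_, ?_, ?_, ?_, exists_up id p M' face hf
        (fun _ : Unit => none :: W₁.map ss ++ some none :: W₂.map ss)
        (fun i => (M'.aux i).map ss) (fun i => rfl)⟩ <;> rfl
    rw [← hfM] at hr
    have hm : M.main () = none :: W₁.map ss ++ some none :: W₂.map ss := by rw [hmM]
    have hM : M.Ok := by
      exact C.ok_up (C.surg_split hr) H (main_iff_of_split h₁ h₂) (main_of_split hm)
        (fun _ => hm ▸ hr) (fun _ _ _ _ _ => rfl) (fun i => Or.inl ⟨i, rfl⟩)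
        ((C.conn_split hr hm h₁ h₂).2 H.conn)
    refine ⟨M, ⟨⟨hM, (C.genus_split hr hm h₁ h₂ g).2 hG,
      (C.nv_split hr hm h₁ h₂).trans hv, fun _ => ?_⟩, C.glue_r, W₁, W₂, hm, ?_⟩,
      C, W₁, W₂, hm, hm ▸ hr, h₁, h₂, hw₁', hw₂'⟩
    · rw [hm, List.map_append, List.map_cons, List.map_cons, C.map_col, C.map_col, C.col_r,
        C.col_b, hw₁', hw₂']
    · rw [← hw₁', List.length_map]
  -- The removal is injective.
  · rintro M - N - M' - ⟨C, W₁, W₂, hm, hr, h₁, h₂, -, -⟩ ⟨C', V₁, V₂, hn, hr', h₁', h₂', -, -⟩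
    obtain rfl : W₁ = V₁ := h₁.symm.trans h₁'
    obtain rfl : W₂ = V₂ := h₂.symm.trans h₂'
    rw [hm] at hr
    rw [hn] at hr'
    obtain ⟨k1, k2, -⟩ := split_cyc hr
    obtain ⟨k3, k4, -⟩ := split_cyc hr'
    have hψ : M.face * swap none (some none) = N.face * swap none (some none) :=
      perm_ext_of_del (C.face.trans C'.face.symm) k2 k4 k1 k3 (by simp) (by simp)
    refine C.ext_up C' (mul_right_cancel hψ) ?_ ?_
    · funext k; exact hm.trans hn.symm
    · funext i; exact (C.aux i).trans (C'.aux i).symm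
  -- The removal is a function: it does not depend on the choice of the lists.
  · rintro M ⟨⟨-, -, -, hw⟩, -⟩ M' - N' - ⟨C, W₁, W₂, hm, hr, h₁, h₂, hc₁, -⟩
      ⟨C', V₁, V₂, hn, hr', h₁', h₂', hc₁', -⟩
    have h3 := hm.symm.trans hn
    obtain ⟨h4, h5⟩ := List.append_inj h3 (by
      simp only [List.length_cons, List.length_map]
      rw [← List.length_map (as := W₁) M'.col, hc₁, ← hc₁', List.length_map])
    have h1 : W₁ = V₁ := ss_injective.list_map (List.cons.inj h4).2
    have h2 : W₂ = V₂ := ss_injective.list_map (List.cons.inj h5).2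
    refine C.ext_down C' ?_
    funext k
    cases k
    · rw [h₁, h₁', h1]
    · rw [h₂, h₂', h2]
  -- The weights correspond.
  · rintro M - M' - ⟨C, W₁, W₂, hm, hr, h₁, h₂, rfl, rfl⟩
    refine C.wt_split τ z f (hm ▸ hr) hm h₁ h₂ fun a ha => ?_
    rcases List.mem_append.1 ha with h | h
    · by_contra h'
      exact hw₁ (List.mem_map.2 ⟨a, h, by simpa using h'⟩)
    · by_contra h'
      exact hw₂ (List.mem_map.2 ⟨a, h, by simpa using h'⟩)

end PMap

end ONModel

/-! ### The removal of the root edge -/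

namespace ONModel

open Equiv

/-- A finite sum is the sum over the parts of a partition, possibly with infinitely many empty
parts. -/
theorem finsum_mem_fiberwise {α K E : Type*} [AddCommMonoid E] {X : Set α} (hX : X.Finite)
    (Y : K → Set α) (hY : ∀ k, Y k ⊆ X) (hex : ∀ x ∈ X, ∃ k, x ∈ Y k)
    (hdis : ∀ k k' x, x ∈ Y k → x ∈ Y k' → k = k') (F : α → E) :
    ∑ᶠ x ∈ X, F x = ∑ᶠ k, ∑ᶠ x ∈ Y k, F x := by
  set K' : Set K := {k | (Y k).Nonempty} with hK'
  have hfin : K'.Finite := by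
    rcases X.eq_empty_or_nonempty with rfl | ⟨x₀, -⟩
    · convert Set.finite_empty
      exact Set.eq_empty_iff_forall_notMem.2 fun k ⟨x, hx⟩ => hY k hx
    have : Nonempty α := ⟨x₀⟩
    choose! c hc using fun k (hk : k ∈ K') => hk
    refine Set.Finite.of_finite_image (f := c) (hX.subset ?_) ?_
    · rintro _ ⟨k, hk, rfl⟩
      exact hY k (hc k hk)
    · intro k hk k' hk' h
      exact hdis k k' (c k) (hc k hk) (h ▸ hc k' hk')
  have hU : X = ⋃ k ∈ K', Y k := by
    ext x
    simp only [Set.mem_iUnion, exists_prop]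
    constructor
    · intro hx
      obtain ⟨k, hk⟩ := hex x hx
      exact ⟨k, ⟨x, hk⟩, hk⟩
    · rintro ⟨k, -, hk⟩
      exact hY k hk
  rw [hU, finsum_mem_biUnion ?_ hfin fun k _ => hX.subset (hY k)]
  · refine finsum_congr fun k => ?_
    by_cases hk : k ∈ K'
    · simp [hk]
    · have : Y k = ∅ := Set.not_nonempty_iff_eq_empty.1 hk
      simp [this]
  · intro k _ k' _ hne
    exact Set.disjoint_left.2 fun x h h' => hne (hdis k k' x h h')

namespace PMap

variable {D ι : Type}

/-- The maps rooted at the half-edge `none`, which is glued to `some none`. -/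
def rooted (D : Type) (g v : ℕ) (w : List Bool) : Set (PMap Unit ι (Ext D)) :=
  {M | M ∈ maps (Ext D) g v (fun _ => w) ∧ M.glue none = some none ∧ ∃ T, M.main () = none :: T}

theorem finite_rooted [Finite D] [Finite ι] (g v : ℕ) (w : List Bool) :
    (rooted D g v w : Set (PMap Unit ι (Ext D))).Finite :=
  (finite_maps (D := Ext D) g v fun _ : Unit => w).subset fun _ h => h.1

theorem exists_split_at {l : List (Ext D)} (hl : l.Nodup) (h : none ∉ l) (h' : some none ∈ l) :
    ∃ A B : List D, l = A.map ss ++ some none :: B.map ss := by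
  obtain ⟨A, B, rfl⟩ := List.append_of_mem h'
  have hn := List.nodup_middle.1 hl
  simp only [List.mem_append, List.mem_cons, List.nodup_cons, reduceCtorEq, false_or,
    not_or] at h hn
  obtain ⟨A', rfl⟩ := exists_map_ss h.1 hn.1.1
  obtain ⟨B', rfl⟩ := exists_map_ss h.2 hn.1.2
  exact ⟨A', B', rfl⟩

theorem split_unique {A B A' B' : List D}
    (h : A.map ss ++ some none :: B.map ss = A'.map ss ++ some none :: B'.map ss) :
    A = A' ∧ B = B' := by
  induction A generalizing A' with
  | nil =>
    cases A' with
    | nil => simpa [ss_injective.list_map.eq_iff] using h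
    | cons a A' => simp [ss] at h
  | cons a A ih =>
    cases A' with
    | nil => simp [ss] at h
    | cons a' A' =>
      simp only [List.map_cons, List.cons_append, List.cons.injEq] at h
      obtain ⟨rfl, rfl⟩ := ih h.2
      exact ⟨by rw [ss_injective h.1], rfl⟩

/-- The other side of the root edge is in the root face. -/
def IsSplit (M : PMap Unit ι (Ext D)) (n : ℕ) : Prop :=
  ∃ W₁ W₂ : List D, M.main () = none :: W₁.map ss ++ some none :: W₂.map ss ∧ W₁.length = n

/-- The other side of the root edge is in the `i`-th auxiliary face, at distance `s` from its
marked edge. -/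
def IsAux (M : PMap Unit ι (Ext D)) (i : ι) (s t : ℕ) : Prop :=
  ∃ A B W : List D, M.main () = none :: W.map ss ∧
    M.aux i = A.map ss ++ some none :: B.map ss ∧ A.length = s ∧ B.length = t

/-- The other side of the root edge is in an unmarked face, whose other edges have colours `u`. -/
def IsUnm (M : PMap Unit ι (Ext D)) (u : List Bool) : Prop :=
  ∃ U W : List D, M.main () = none :: W.map ss ∧ IsCyc M.face (some none :: U.map ss) ∧
    M.Unm (some none) ∧ (U.map ss).map M.col = u

/-- The half-edge opposite to the root lies in the root face, in an auxiliary face or in an unmarked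
face. -/
theorem rooted_cases [Finite D] {M : PMap Unit ι (Ext D)} {g v : ℕ} {w : List Bool}
    (hM : M ∈ rooted D g v w) :
    (∃ n, M.IsSplit n) ∨ (∃ i s t, M.IsAux i s t) ∨ ∃ u, M.IsUnm u := by
  obtain ⟨⟨H, -⟩, hg, T, hm⟩ := hM
  have hc := H.main_cyc ()
  rw [hm] at hc
  have hn := List.nodup_cons.1 hc.nodup
  by_cases h1 : some none ∈ T
  · obtain ⟨A, B, rfl⟩ := exists_split_at hn.2 hn.1 h1
    exact Or.inl ⟨_, A, B, hm, rfl⟩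
  obtain ⟨W, rfl⟩ := exists_map_ss hn.1 h1
  by_cases h2 : ∃ i, some none ∈ M.aux i
  · obtain ⟨i, hi⟩ := h2
    obtain ⟨A, B, hAB⟩ := exists_split_at (H.aux_cyc i).nodup
      (H.main_aux () i none (by rw [hm]; simp)) hi
    exact Or.inr (Or.inl ⟨i, _, _, A, B, W, hm, hAB, rfl, rfl⟩)
  push Not at h2
  obtain ⟨m, hcyc⟩ := exists_isCyc M.face (some none)
  have hb := List.nodup_cons.1 hcyc.nodup
  have h3 : none ∉ m := by
    intro h
    have := (hcyc.isRotated hc (a := none) (by simp [h]) (by simp)).mem_iff (a := some none)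
    simp at this
  obtain ⟨U, rfl⟩ := exists_map_ss h3 hb.1
  refine Or.inr (Or.inr ⟨_, U, W, hm, hcyc, ⟨?_, h2⟩, rfl⟩)
  rintro ⟨⟩
  rw [hm]
  simp

theorem IsSplit.not_aux {M : PMap Unit ι (Ext D)} {n : ℕ} (h : M.IsSplit n) {i : ι} {s t : ℕ} :
    ¬ M.IsAux i s t := by
  rintro ⟨A, B, W, hm, -⟩
  obtain ⟨W₁, W₂, hm', -⟩ := h
  have : some none ∈ M.main () := by rw [hm']; simp
  rw [hm] at this
  simp at this

theorem IsSplit.not_unm {M : PMap Unit ι (Ext D)} {n : ℕ} (h : M.IsSplit n) {u : List Bool} :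
    ¬ M.IsUnm u := by
  rintro ⟨U, W, hm, -⟩
  obtain ⟨W₁, W₂, hm', -⟩ := h
  have : some none ∈ M.main () := by rw [hm']; simp
  rw [hm] at this
  simp at this

theorem IsAux.not_unm {M : PMap Unit ι (Ext D)} {i : ι} {s t : ℕ} (h : M.IsAux i s t)
    {u : List Bool} : ¬ M.IsUnm u := by
  rintro ⟨U, W, hm, -, hu, -⟩
  obtain ⟨A, B, W', -, ha, -⟩ := h
  exact hu.2 i (by rw [ha]; simp)

theorem IsSplit.unique {M : PMap Unit ι (Ext D)} {n n' : ℕ} (h : M.IsSplit n)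
    (h' : M.IsSplit n') : n = n' := by
  obtain ⟨W₁, W₂, hm, rfl⟩ := h
  obtain ⟨V₁, V₂, hm', rfl⟩ := h'
  have h := hm.symm.trans hm'
  simp only [List.cons_append, List.cons.injEq, true_and] at h
  rw [(split_unique h).1]

theorem IsAux.unique {M : PMap Unit ι (Ext D)} (H : M.Ok) {i i' : ι} {s t s' t' : ℕ}
    (h : M.IsAux i s t) (h' : M.IsAux i' s' t') : (i, s, t) = (i', s', t') := by
  obtain ⟨A, B, W, -, ha, rfl, rfl⟩ := h
  obtain ⟨A', B', W', -, ha', rfl, rfl⟩ := h'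
  obtain rfl := H.aux_aux i i' (some none) (by rw [ha]; simp) (by rw [ha']; simp)
  obtain ⟨rfl, rfl⟩ := split_unique (ha.symm.trans ha')
  rfl

theorem IsUnm.unique {M : PMap Unit ι (Ext D)} {u u' : List Bool} (h : M.IsUnm u)
    (h' : M.IsUnm u') : u = u' := by
  obtain ⟨U, W, -, hc, -, rfl⟩ := h
  obtain ⟨U', W', -, hc', -, rfl⟩ := h'
  rw [hc.unique hc']

/-- The sum over rooted maps, according to the face on the other side of the root edge. -/
theorem sum_rooted [Finite D] [Fintype ι] (F : PMap Unit ι (Ext D) → ℂ) (g v : ℕ)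
    (w : List Bool) :
    ∑ᶠ M ∈ rooted D g v w, F M =
      (∑ᶠ u, ∑ᶠ M ∈ {M | M ∈ rooted D g v w ∧ M.IsUnm u}, F M) +
      (∑ᶠ q : ι × ℕ × ℕ, ∑ᶠ M ∈ {M | M ∈ rooted D g v w ∧ M.IsAux q.1 q.2.1 q.2.2}, F M) +
      ∑ᶠ n, ∑ᶠ M ∈ {M | M ∈ rooted D g v w ∧ M.IsSplit n}, F M := by
  have hfin := finite_rooted (D := D) (ι := ι) g v w
  have hX : (rooted D g v w : Set (PMap Unit ι (Ext D))) =
      ({M | M ∈ rooted D g v w ∧ ∃ u, M.IsUnm u} ∪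
        {M | M ∈ rooted D g v w ∧ ∃ q : ι × ℕ × ℕ, M.IsAux q.1 q.2.1 q.2.2}) ∪
        {M | M ∈ rooted D g v w ∧ ∃ n, M.IsSplit n} := by
    ext M
    simp only [Set.mem_union, Set.mem_ofPred_eq]
    constructor
    · intro hM
      rcases rooted_cases hM with h | ⟨i, s, t, h⟩ | h
      · exact Or.inr ⟨hM, h⟩
      · exact Or.inl (Or.inr ⟨hM, (i, s, t), h⟩)
      · exact Or.inl (Or.inl ⟨hM, h⟩)
    · rintro ((h | h) | h) <;> exact h.1
  have key : ∀ {K : Type} (Q : PMap Unit ι (Ext D) → K → Prop),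
      (∀ k k', ∀ M ∈ rooted D g v w, Q M k → Q M k' → k = k') →
      ∑ᶠ M ∈ {M | M ∈ rooted D g v w ∧ ∃ k, Q M k}, F M =
        ∑ᶠ k, ∑ᶠ M ∈ {M | M ∈ rooted D g v w ∧ Q M k}, F M := by
    intro K Q hQ
    refine finsum_mem_fiberwise (hfin.subset fun M h => h.1)
      (fun k => {M | M ∈ rooted D g v w ∧ Q M k}) ?_ ?_ ?_ F
    · exact fun k M h => ⟨h.1, k, h.2⟩
    · exact fun M ⟨h, u, hu⟩ => ⟨u, h, hu⟩
    · exact fun k k' M h h' => hQ k k' M h.1 h.2 h'.2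
  -- The three kinds of faces exclude each other.
  conv_lhs => rw [hX]
  rw [finsum_mem_union ?_ (hfin.subset ?_) (hfin.subset fun M h => h.1),
    finsum_mem_union ?_ (hfin.subset fun M h => h.1) (hfin.subset fun M h => h.1)]
  · rw [key (fun M u => M.IsUnm u) fun k k' M _ h h' => h.unique h',
      key (fun M (q : ι × ℕ × ℕ) => M.IsAux q.1 q.2.1 q.2.2)
        fun k k' M hM h h' => h.unique hM.1.1 h',
      key (fun M n => M.IsSplit n) fun k k' M _ h h' => h.unique h']
  · rw [Set.disjoint_left]
    rintro M ⟨-, u, hu⟩ ⟨-, q, hq⟩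
    exact hq.not_unm hu
  · rw [Set.disjoint_left]
    rintro M (⟨-, u, hu⟩ | ⟨-, q, hq⟩) ⟨-, n, hn⟩
    · exact hn.not_unm hu
    · exact hn.not_aux hq
  · rintro M (h | h) <;> exact h.1

/-- The contribution of the maps whose root edge is adjacent to an unmarked face. -/
theorem sum_isUnm [DecidableEq D] [Finite D] [Fintype ι] (τ : Cycle Bool → ℂ) (z : ℂ)
    (f : ι → ℕ → ℂ) (g v : ℕ) (p : Bool) (u w : List Bool)
    (hp : (p = false ∧ true ∉ w) ∨ (p = true ∧ true ∈ w)) :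
    ∑ᶠ M ∈ {M : PMap Unit ι (Ext D) | M ∈ rooted D g v (p :: w) ∧ M.IsUnm u}, M.wt τ z f =
      τ ((p :: u : List Bool) : Cycle Bool) * labSum τ z f D g v (fun _ : Unit => u ++ w) := by
  rw [← sum_merge_unm τ z f g v p u w hp]
  congr! 4
  ext M
  constructor
  · rintro ⟨⟨h, hg, -⟩, h'⟩; exact ⟨h, hg, h'⟩
  · rintro ⟨h, hg, h'⟩
    refine ⟨⟨h, hg, ?_⟩, h'⟩
    obtain ⟨U, W, hm, -⟩ := h'
    exact ⟨_, hm⟩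

/-- The contribution of the maps whose root edge is adjacent to a given auxiliary face, when the
indices of the auxiliary faces are written `Option ι`. -/
theorem sum_isAux_none [DecidableEq D] [Finite D] [Fintype ι] (τ : Cycle Bool → ℂ) (z : ℂ)
    (f : Option ι → ℕ → ℂ) (g v : ℕ) (s t : ℕ) (w : List Bool) (hp : true ∉ w) :
    ∑ᶠ M ∈ {M : PMap Unit (Option ι) (Ext D) | M ∈ rooted D g v (false :: w) ∧ M.IsAux none s t},
        M.wt τ z f =
      f none (s + t + 1) * labSum τ z (fun i => f (some i)) D g v
        (fun _ : Unit => List.replicate (s + t) false ++ w) := by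
  rw [← sum_merge_aux τ z f g v s t w hp]
  congr! 4
  ext M
  constructor
  · rintro ⟨⟨h, hg, -⟩, h'⟩; exact ⟨h, hg, h'⟩
  · rintro ⟨h, hg, h'⟩
    refine ⟨⟨h, hg, ?_⟩, h'⟩
    obtain ⟨A, B, W, hm, -⟩ := h'
    exact ⟨_, hm⟩

/-- The contribution of the maps whose root edge is adjacent to a given auxiliary face. -/
theorem sum_isAux [DecidableEq D] [Finite D] [Fintype ι] [DecidableEq ι] (τ : Cycle Bool → ℂ)
    (z : ℂ) (f : ι → ℕ → ℂ) (g v : ℕ) (i : ι) (s t : ℕ) (w : List Bool) (hp : true ∉ w) :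
    ∑ᶠ M ∈ {M : PMap Unit ι (Ext D) | M ∈ rooted D g v (false :: w) ∧ M.IsAux i s t},
        M.wt τ z f =
      f i (s + t + 1) * labSum τ z (fun j : {j // j ≠ i} => f j) D g v
        (fun _ : Unit => List.replicate (s + t) false ++ w) := by
  let e : Option {j // j ≠ i} ≃ ι := optionSubtypeNe i
  have he : e none = i := optionSubtypeNe_none i
  have key : ∀ M : PMap Unit (Option {j // j ≠ i}) (Ext D),
      (M.relabel (Equiv.refl _) e (Equiv.refl _) ∈ rooted D g v (false :: w) ∧
        (M.relabel (Equiv.refl _) e (Equiv.refl _)).IsAux i s t) ↔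
      (M ∈ rooted D g v (false :: w) ∧ M.IsAux none s t) := by
    intro M
    have h1 : (M.relabel (Equiv.refl _) e (Equiv.refl _)).aux i = M.aux none := by
      simp [relabel, ← he]
    have h2 : (M.relabel (Equiv.refl _) e (Equiv.refl _)).main () = M.main () := by
      simp [relabel]
    have h3 : (M.relabel (Equiv.refl _) e (Equiv.refl _)).glue none = M.glue none := by
      simp [relabel]
    unfold rooted IsAux
    simp only [Set.mem_ofPred_eq, h1, h2, h3]
    rw [relabel_mem_maps]
  have := sum_isAux_none (D := D) τ z (fun j => f (e j)) g v s t w hp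
  rw [he] at this
  simp only [e, optionSubtypeNe_some] at this
  rw [← this]
  symm
  refine finsum_mem_eq_of_bijOn (relabel (Equiv.refl _) e (Equiv.refl _)) ⟨?_, ?_, ?_⟩ ?_
  · exact fun M hM => (key M).2 hM
  · exact (relabel_injective _ _ _).injOn
  · intro M hM
    have hs := relabel_symm (Equiv.refl _) e (Equiv.refl _) M
    exact ⟨_, (key _).1 (by rw [hs]; exact hM), hs⟩
  · exact fun M _ => (relabel_wt τ z f _ e _ M).symm

/-- Paths do not enter marked faces, so an edge crossed by a path is not adjacent to an auxiliary
face. -/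
theorem sum_isAux_true [Fintype ι] (F : PMap Unit ι (Ext D) → ℂ) (g v : ℕ) (i : ι) (s t : ℕ)
    (w : List Bool) :
    ∑ᶠ M ∈ {M : PMap Unit ι (Ext D) | M ∈ rooted D g v (true :: w) ∧ M.IsAux i s t}, F M = 0 := by
  have : {M : PMap Unit ι (Ext D) | M ∈ rooted D g v (true :: w) ∧ M.IsAux i s t} = ∅ := by
    rw [Set.eq_empty_iff_forall_notMem]
    rintro M ⟨⟨⟨H, -, -, hw⟩, hg, -⟩, A, B, W, hm, ha, -⟩
    have h1 := H.aux_col i (some none) (by rw [ha]; simp)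
    have h2 := H.col_glue none
    have h3 := hw ()
    rw [hm, List.map_cons] at h3
    rw [hg, h1, (List.cons.inj h3).1] at h2
    simp at h2
  rw [this, finsum_mem_empty]

/-- The contribution of the maps whose root edge has the root face on both sides. -/
theorem sum_isSplit [DecidableEq D] [Finite D] [Fintype ι] (τ : Cycle Bool → ℂ) (z : ℂ)
    (f : ι → ℕ → ℂ) (g v : ℕ) (p : Bool) (w₁ w₂ : List Bool) (hw₁ : true ∉ w₁) (hw₂ : true ∉ w₂) :
    ∑ᶠ M ∈ {M : PMap Unit ι (Ext D) | M ∈ rooted D g v (p :: (w₁ ++ p :: w₂)) ∧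
        M.IsSplit w₁.length}, M.wt τ z f =
      (if p then z else 1) * labSum τ z f D g v (fun k : Bool => if k then w₂ else w₁) := by
  rw [← sum_split τ z f g v p w₁ w₂ hw₁ hw₂]
  congr! 4
  ext M
  constructor
  · rintro ⟨⟨h, hg, -⟩, h'⟩; exact ⟨h, hg, h'⟩
  · rintro ⟨h, hg, h'⟩
    refine ⟨⟨h, hg, ?_⟩, h'⟩
    obtain ⟨A, B, hm, -⟩ := h'
    exact ⟨_, hm⟩

/-- When the root edge has the root face on both sides, its two half-edges have the same colour,
which constrains the word of the colours of the root face. -/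
theorem IsSplit.word {M : PMap Unit ι (Ext D)} {g v n : ℕ} {p : Bool} {w : List Bool}
    (hM : M ∈ rooted D g v (p :: w)) (h : M.IsSplit n) :
    ∃ w₁ w₂, w = w₁ ++ p :: w₂ ∧ w₁.length = n := by
  obtain ⟨⟨H, -, -, hw⟩, hg, -⟩ := hM
  obtain ⟨W₁, W₂, hm, rfl⟩ := h
  have hw := hw ()
  have hc : M.col (some none) = M.col none := by rw [← hg, H.col_glue]
  rw [hm] at hw
  simp only [List.cons_append, List.map_cons, List.map_append, List.cons.injEq, hc] at hw
  obtain ⟨h1, h2⟩ := hw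
  rw [h1] at h2
  exact ⟨_, _, h2.symm, by simp⟩

/-- Removal of the root edge, when the root face is not crossed by paths. -/
theorem sum_rooted_false [DecidableEq D] [Finite D] [Fintype ι] [DecidableEq ι]
    (τ : Cycle Bool → ℂ) (z : ℂ) (f : ι → ℕ → ℂ) (g v l : ℕ) :
    ∑ᶠ M ∈ (rooted D g v (List.replicate (l + 1) false) : Set (PMap Unit ι (Ext D))),
        M.wt τ z f =
      (∑ᶠ u : List Bool, τ ((false :: u : List Bool) : Cycle Bool) *
        labSum τ z f D g v (fun _ : Unit => u ++ List.replicate l false)) +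
      (∑ᶠ q : ι × ℕ × ℕ, f q.1 (q.2.1 + q.2.2 + 1) *
        labSum τ z (fun j : {j // j ≠ q.1} => f j) D g v
          (fun _ : Unit => List.replicate (q.2.1 + q.2.2 + l) false)) +
      ∑ n ∈ Finset.range l, labSum τ z f D g v
        (fun k : Bool => if k then List.replicate (l - 1 - n) false else List.replicate n false) := by
  have ht : ∀ n, true ∉ List.replicate n false := by simp [List.mem_replicate]
  rw [List.replicate_succ, sum_rooted]
  congr 1
  · congr 1
    · exact finsum_congr fun u => sum_isUnm τ z f g v false u _ (Or.inl ⟨rfl, ht l⟩)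
    · refine finsum_congr fun q => ?_
      rw [sum_isAux τ z f g v q.1 q.2.1 q.2.2 _ (ht l), ← List.replicate_add]
  · rw [finsum_eq_sum_of_support_subset (s := Finset.range l)]
    · refine Finset.sum_congr rfl fun n hn => ?_
      have hn := Finset.mem_range.1 hn
      have h1 : List.replicate l false =
          List.replicate n false ++ false :: List.replicate (l - 1 - n) false := by
        rw [← List.replicate_succ, ← List.replicate_add]
        congr 1; omega
      have := sum_isSplit (D := D) τ z f g v false (List.replicate n false)
        (List.replicate (l - 1 - n) false) (ht _) (ht _)
      rw [← h1, List.length_replicate] at this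
      simpa using this
    · intro n hn
      by_contra hn'
      apply hn
      have : {M : PMap Unit ι (Ext D) | M ∈ rooted D g v (false :: List.replicate l false) ∧
          M.IsSplit n} = ∅ := by
        rw [Set.eq_empty_iff_forall_notMem]
        rintro M ⟨hM, h⟩
        obtain ⟨w₁, w₂, h1, rfl⟩ := h.word hM
        have := congrArg List.length h1
        simp at this hn'
        omega
      simp only [this, finsum_mem_empty]

/-- Removal of the root edge, when it is crossed by a path. -/
theorem sum_rooted_true [DecidableEq D] [Finite D] [Fintype ι]
    (τ : Cycle Bool → ℂ) (z : ℂ) (f : ι → ℕ → ℂ) (g v i m : ℕ) :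
    ∑ᶠ M ∈ (rooted D g v (true :: (List.replicate i false ++ true :: List.replicate m false)) :
        Set (PMap Unit ι (Ext D))), M.wt τ z f =
      (∑ᶠ u : List Bool, τ ((true :: u : List Bool) : Cycle Bool) *
        labSum τ z f D g v
          (fun _ : Unit => u ++ (List.replicate i false ++ true :: List.replicate m false))) +
      z * labSum τ z f D g v
        (fun k : Bool => if k then List.replicate m false else List.replicate i false) := by
  have ht : ∀ n, true ∉ List.replicate n false := by simp [List.mem_replicate]
  rw [sum_rooted]
  congr 1
  · rw [add_eq_left.2]
    · exact finsum_congr fun u => sum_isUnm τ z f g v true u _ (Or.inr ⟨rfl, by simp⟩)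
    · rw [← finsum_zero (α := ι × ℕ × ℕ)]
      exact finsum_congr fun q => sum_isAux_true _ g v _ _ _ _
  · rw [finsum_eq_single _ i]
    · have := sum_isSplit (D := D) τ z f g v true (List.replicate i false)
        (List.replicate m false) (ht _) (ht _)
      rw [List.length_replicate] at this
      simpa using this
    · intro n hn
      have : {M : PMap Unit ι (Ext D) | M ∈ rooted D g v
          (true :: (List.replicate i false ++ true :: List.replicate m false)) ∧
          M.IsSplit n} = ∅ := by
        rw [Set.eq_empty_iff_forall_notMem]
        rintro M ⟨hM, h⟩
        obtain ⟨w₁, w₂, h1, rfl⟩ := h.word hM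
        apply hn
        rcases List.append_eq_append_iff.1 h1 with ⟨a, ha, hb⟩ | ⟨a, ha, hb⟩
        · cases a with
          | nil => simp [ha]
          | cons x a =>
            simp only [List.cons_append, List.cons.injEq] at hb
            exact absurd (show true ∈ List.replicate m false by rw [hb.2]; simp) (ht m)
        · cases a with
          | nil => simpa using (congrArg List.length ha).symm
          | cons x a =>
            simp only [List.cons_append, List.cons.injEq] at hb
            exact absurd (show true ∈ List.replicate i false by rw [ha, ← hb.1]; simp) (ht i)
      rw [this, finsum_mem_empty]

end PMap

end ONModel

/-! ### The genus of a connected map -/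

namespace ONModel

open Equiv

variable {D : Type}

/-- Two relations generating the same equivalence relation have the same number of classes. -/
theorem card_quot_congr {r s : D → D → Prop} (h : ∀ x y, r x y → Relation.EqvGen s x y)
    (h' : ∀ x y, s x y → Relation.EqvGen r x y) : Nat.card (Quot r) = Nat.card (Quot s) :=
  Nat.card_congr
    { toFun := Quot.lift (Quot.mk s) fun x y hxy => Quot.eqvGen_sound (h x y hxy)
      invFun := Quot.lift (Quot.mk r) fun x y hxy => Quot.eqvGen_sound (h' x y hxy)
      left_inv := by rintro ⟨x⟩; rfl
      right_inv := by rintro ⟨x⟩; rfl }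

theorem sameCycle_mul_swap [DecidableEq D] [Finite D] {σ : Perm D} {a b : D}
    (h : ¬ σ.SameCycle a b) : (σ * swap a b).SameCycle a b := by
  obtain ⟨U, hU⟩ := exists_isCyc σ b
  obtain ⟨W, hW⟩ := exists_isCyc σ a
  have hn : (a :: U ++ b :: W).Nodup := by
    have h1 := List.nodup_cons.1 hU.nodup
    have h2 := List.nodup_cons.1 hW.nodup
    have h3 : ∀ x ∈ b :: U, x ∉ a :: W := by
      intro x hx hx'
      exact h (((hW.sameCycle_iff (by simp)).2 hx').trans
        ((hU.sameCycle_iff (by simp)).2 hx).symm)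
    simp only [List.cons_append, List.nodup_cons, List.mem_append, List.mem_cons, not_or,
      List.nodup_append]
    have hab : a ≠ b := by rintro rfl; exact h3 a (by simp) (by simp)
    refine ⟨⟨fun hx => h3 a (by simp [hx]) (by simp), hab, h2.1⟩, h1.2,
      ⟨fun hx => h3 b (by simp) (by simp [hx]), h2.2⟩, ?_⟩
    rintro x hx y hy rfl
    rcases hy with rfl | hy
    · exact h1.1 hx
    · exact h3 x (by simp [hx]) (by simp [hy])
  have := isCyc_mul_swap.1 ⟨hU, hW, hn⟩
  rw [this.sameCycle_iff (by simp)]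
  simp

theorem not_sameCycle_mul_swap [DecidableEq D] [Finite D] {σ : Perm D} {a b : D} (hab : a ≠ b)
    (h : σ.SameCycle a b) : ¬ (σ * swap a b).SameCycle a b := by
  obtain ⟨L, hL⟩ := exists_isCyc σ a
  rw [hL.sameCycle_iff (by simp)] at h
  have h : b ∈ L := by simpa [hab.symm] using h
  obtain ⟨U, W, rfl⟩ := List.append_of_mem h
  have h1 : IsCyc (σ * swap a b * swap a b) (a :: U ++ b :: W) := by
    rwa [mul_assoc, swap_mul_self, mul_one]
  obtain ⟨h2, h3, h4⟩ := isCyc_mul_swap.2 h1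
  rw [h3.sameCycle_iff (by simp)]
  simp only [List.cons_append, List.nodup_cons, List.mem_append, List.mem_cons, not_or,
      List.nodup_append] at h4
  simp only [List.mem_cons, not_or]
  exact ⟨hab.symm, h4.2.2.1.1⟩

theorem cycNum_mul_swap_of_not [DecidableEq D] [Finite D] {σ : Perm D} {a b : D}
    (h : ¬ σ.SameCycle a b) : cycNum (σ * swap a b) + 1 = cycNum σ := by
  rw [← eqvGen_iff_sameCycle] at h
  rw [cycNum, cycNum, ← (card_quot_insert (fun x y => σ x = y) a b).2 h]
  congr 1
  have hs := sameCycle_mul_swap (fun h' => h (eqvGen_iff_sameCycle.2 h'))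
  refine card_quot_congr ?_ ?_
  · rintro x _ rfl
    have key : ∀ x y, (σ x = y ∨ x = a ∧ y = b) →
        Relation.EqvGen (fun x y => σ x = y ∨ x = a ∧ y = b) x y := fun x y h => .rel _ _ h
    have hab := key a b (Or.inr ⟨rfl, rfl⟩)
    rw [Perm.mul_apply]
    by_cases hxa : x = a
    · rw [hxa, swap_apply_left]
      exact hab.trans _ _ _ (key b _ (Or.inl rfl))
    by_cases hxb : x = b
    · rw [hxb, swap_apply_right]
      exact (hab.symm _ _).trans _ _ _ (key a _ (Or.inl rfl))
    rw [swap_apply_of_ne_of_ne hxa hxb]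
    exact key x _ (Or.inl rfl)
  · have hab := eqvGen_iff_sameCycle.2 hs
    have key : ∀ x, Relation.EqvGen (fun x y => (σ * swap a b) x = y) x ((σ * swap a b) x) :=
      fun x => .rel _ _ rfl
    rintro x y (rfl | ⟨rfl, rfl⟩)
    · by_cases hxa : x = a
      · have := key b
        rw [Perm.mul_apply, swap_apply_right] at this
        rw [hxa]
        exact hab.trans _ _ _ this
      by_cases hxb : x = b
      · have := key a
        rw [Perm.mul_apply, swap_apply_left] at this
        rw [hxb]
        exact (hab.symm _ _).trans _ _ _ this
      have := key x
      rwa [Perm.mul_apply, swap_apply_of_ne_of_ne hxa hxb] at this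
    · exact hab

theorem cycNum_mul_swap_of_sameCycle [DecidableEq D] [Finite D] {σ : Perm D} {a b : D}
    (hab : a ≠ b) (h : σ.SameCycle a b) : cycNum (σ * swap a b) = cycNum σ + 1 := by
  have := cycNum_mul_swap_of_not (not_sameCycle_mul_swap hab h)
  rwa [mul_assoc, swap_mul_self, mul_one, eq_comm] at this

/-- The genus of a pair of permutations, the second of which is an involution, is a natural number:
adding the edges one at a time, each new edge joins two components, cuts a face in two, or joins two
faces of the same component, and only in the last case does the genus change, by `1`. -/
theorem exists_genus [DecidableEq D] [Fintype D] (σ α : Perm D) (hα : ∀ a, α (α a) = a) :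
    ∃ h, 2 * cycNum σ + 2 * cycNum (σ * α) + 4 * h =
      4 * Nat.card (Quot fun x y => σ x = y ∨ α x = y) + α.support.card := by
  induction hn : α.support.card using Nat.strong_induction_on generalizing α with
  | _ n ih =>
  -- Without edges, every component is a single cycle of `σ`.
  by_cases h1 : α = 1
  · subst h1
    refine ⟨0, ?_⟩
    have : Nat.card (Quot fun x y => σ x = y ∨ (1 : Perm D) x = y) = cycNum σ := by
      refine card_quot_congr ?_ fun x y h => .rel _ _ (Or.inl h)
      rintro x y (h | h)
      · exact .rel _ _ h
      · rw [Perm.one_apply] at h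
        rw [h]; exact .refl _
    rw [this, ← hn]
    simp
    omega
  -- Otherwise the edge `{a, b}` is removed from `α`, which gives the involution `β`.
  obtain ⟨a, ha⟩ : ∃ a, α a ≠ a := by
    by_contra h
    push Not at h
    exact h1 (Equiv.ext h)
  obtain ⟨b, hb⟩ : ∃ b, α a = b := ⟨_, rfl⟩
  have hb' : α b = a := by rw [← hb, hα]
  have hab : a ≠ b := fun h => ha (hb.trans h.symm)
  obtain ⟨β, hβ⟩ : ∃ β, β = α * swap a b := ⟨_, rfl⟩
  have hαβ : α = β * swap a b := by rw [hβ, mul_assoc, swap_mul_self, mul_one]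
  have b1 : β a = a := by rw [hβ, Perm.mul_apply, swap_apply_left, hb']
  have b2 : β b = b := by rw [hβ, Perm.mul_apply, swap_apply_right, hb]
  have b3 : ∀ x, x ≠ a → x ≠ b → β x = α x := fun x hxa hxb => by
    rw [hβ, Perm.mul_apply, swap_apply_of_ne_of_ne hxa hxb]
  have hββ : ∀ x, β (β x) = x := by
    intro x
    by_cases hxa : x = a
    · rw [hxa, b1, b1]
    by_cases hxb : x = b
    · rw [hxb, b2, b2]
    rw [b3 x hxa hxb, b3 _ (fun h => hxb (by rw [← hα x, h, hb]))
      (fun h => hxa (by rw [← hα x, h, hb'])), hα]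
  have hsupp : α.support = insert a (insert b β.support) := by
    ext x
    simp only [Perm.mem_support, Finset.mem_insert]
    by_cases hxa : x = a
    · simp [hxa, ha]
    by_cases hxb : x = b
    · simp [hxb, hb', hab]
    simp [hxa, hxb, b3 x hxa hxb]
  have hcard : α.support.card = β.support.card + 2 := by
    rw [hsupp, Finset.card_insert_of_notMem, Finset.card_insert_of_notMem]
    · simp [b2]
    · simp [b1, hab]
  obtain ⟨h, hh⟩ := ih β.support.card (by omega) β hββ rfl
  have hins := card_quot_insert (fun x y => σ x = y ∨ β x = y) a b
  have hq : Nat.card (Quot fun x y => (σ x = y ∨ β x = y) ∨ (x = a ∧ y = b)) =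
      Nat.card (Quot fun x y => σ x = y ∨ α x = y) := by
    refine card_quot_congr ?_ ?_
    · rintro x y ((h | h) | ⟨rfl, rfl⟩)
      · exact .rel _ _ (Or.inl h)
      · by_cases hxa : x = a
        · rw [hxa, b1] at h; rw [hxa, h]; exact .refl _
        by_cases hxb : x = b
        · rw [hxb, b2] at h; rw [hxb, h]; exact .refl _
        rw [b3 x hxa hxb] at h
        exact .rel _ _ (Or.inr h)
      · exact .rel _ _ (Or.inr hb)
    · rintro x y (h | h)
      · exact .rel _ _ (Or.inl (Or.inl h))
      · by_cases hxa : x = a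
        · rw [hxa, hb] at h; rw [hxa, ← h]; exact .rel _ _ (Or.inr ⟨rfl, rfl⟩)
        by_cases hxb : x = b
        · rw [hxb, hb'] at h; rw [hxb, ← h]; exact .symm _ _ (.rel _ _ (Or.inr ⟨rfl, rfl⟩))
        rw [← b3 x hxa hxb] at h
        exact .rel _ _ (Or.inl (Or.inr h))
  rw [hq] at hins
  have hσ : σ * α = σ * β * swap a b := by rw [hαβ, mul_assoc]
  -- Adding the edge back: `a` and `b` are on the same cycle of `σ * β`, or on two cycles of the same
  -- component, or in two components.
  by_cases hs : (σ * β).SameCycle a b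
  · have hc := cycNum_mul_swap_of_sameCycle hab hs
    rw [← hσ] at hc
    have he : Relation.EqvGen (fun x y => σ x = y ∨ β x = y) a b := by
      refine Quot.eqvGen_exact ?_
      have key : ∀ x, Quot.mk (fun x y => σ x = y ∨ β x = y) ((σ * β) x) = Quot.mk _ x := by
        intro x
        have h1 : Quot.mk (fun x y => σ x = y ∨ β x = y) (β x) = Quot.mk _ ((σ * β) x) :=
          Quot.sound (Or.inl rfl)
        have h2 : Quot.mk (fun x y => σ x = y ∨ β x = y) x = Quot.mk _ (β x) :=
          Quot.sound (Or.inr rfl)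
        rw [← h1, ← h2]
      obtain ⟨n, hn⟩ := hs.exists_nat_pow_eq
      rw [← hn]
      clear hn
      induction n with
      | zero => rfl
      | succ n ih => rw [pow_succ', Perm.mul_apply, key]; exact ih
    have := hins.1 he
    exact ⟨h, by omega⟩
  · have hc := cycNum_mul_swap_of_not hs
    rw [← hσ] at hc
    by_cases he : Relation.EqvGen (fun x y => σ x = y ∨ β x = y) a b
    · have := hins.1 he
      exact ⟨h + 1, by omega⟩
    · have := hins.2 he
      exact ⟨h, by omega⟩

/-- All the cycles of a permutation. -/
def cycles (σ : Perm D) : Set (Cycle D) := {s | ∃ l : List D, l ≠ [] ∧ (l : Cycle D) = s ∧ IsCyc σ l}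

theorem ncard_cycles [Finite D] (σ : Perm D) : (cycles σ).ncard = cycNum σ := by
  choose c hc using exists_isCyc σ
  have hq : ∀ a b, (∃ l, IsCyc σ l ∧ a ∈ l ∧ b ∈ l) →
      ((a :: c a : List D) : Cycle D) = ((b :: c b : List D) : Cycle D) := by
    rintro a b ⟨l, hl, ha, hb⟩
    exact Cycle.coe_eq_coe.2 (((hc a).isRotated hl (by simp) ha).trans
      ((hc b).isRotated hl (by simp) hb).symm)
  rw [cycNum, ← Nat.card_coe_set_eq]
  symm
  refine Nat.card_eq_of_bijective (f := Quot.lift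
    (fun a => (⟨_, a :: c a, by simp, rfl, hc a⟩ : cycles σ)) ?_) ⟨?_, ?_⟩
  · rintro a _ rfl
    refine Subtype.ext (hq a (σ a) ⟨_, hc a, by simp, (hc a).apply_mem_iff.2 (by simp)⟩)
  · rintro ⟨a⟩ ⟨b⟩ h
    have h : (a :: c a) ~r (b :: c b) := Cycle.coe_eq_coe.1 (Subtype.ext_iff.1 h)
    refine Quot.eqvGen_sound (eqvGen_iff_sameCycle.2 ?_)
    rw [(hc a).sameCycle_iff (by simp), h.mem_iff]
    simp
  · rintro ⟨_, l, hne, rfl, hl⟩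
    obtain ⟨a, ha⟩ := List.exists_mem_of_ne_nil l hne
    exact ⟨Quot.mk _ a, Subtype.ext (Cycle.coe_eq_coe.2 ((hc a).isRotated hl (by simp) ha))⟩

namespace PMap

variable {κ ι : Type}

/-- The cycles of the face permutation are the nonempty main faces, the auxiliary faces and the
unmarked faces. -/
theorem Ok.cycNum_face [Finite D] [Finite κ] [Finite ι] {M : PMap κ ι D} (H : M.Ok) :
    cycNum M.face = Nat.card {k // M.main k ≠ []} + Nat.card ι + M.faces.ncard := by
  have hX : cycles M.face = (Set.range (fun k : {k // M.main k ≠ []} => (M.main k : Cycle D)) ∪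
      Set.range (fun i => (M.aux i : Cycle D))) ∪ M.faces := by
    ext s
    constructor
    · rintro ⟨l, hne, rfl, hl⟩
      obtain ⟨a, ha⟩ := List.exists_mem_of_ne_nil l hne
      by_cases hu : M.Unm a
      · exact Or.inr ⟨l, hne, rfl, hl, Cut.unm_of_sameCycle H hl ha hu⟩
      · left
        by_cases hk : ∃ k, a ∈ M.main k
        · obtain ⟨k, hk⟩ := hk
          exact Or.inl ⟨⟨k, List.ne_nil_of_mem hk⟩,
            Cycle.coe_eq_coe.2 ((H.main_cyc k).isRotated hl hk ha)⟩
        · push Not at hk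
          have : ∃ i, a ∈ M.aux i := by
            by_contra h'; push Not at h'; exact hu ⟨hk, h'⟩
          obtain ⟨i, hi⟩ := this
          exact Or.inr ⟨i, Cycle.coe_eq_coe.2 ((H.aux_cyc i).isRotated hl hi ha)⟩
    · rintro ((⟨⟨k, hk⟩, rfl⟩ | ⟨i, rfl⟩) | ⟨l, hne, rfl, hl, -⟩)
      · exact ⟨_, hk, rfl, H.main_cyc k⟩
      · exact ⟨_, H.aux_ne i, rfl, H.aux_cyc i⟩
      · exact ⟨l, hne, rfl, hl⟩
  rw [← ncard_cycles, hX, Set.ncard_union_eq ?_ (Set.toFinite _) M.faces_finite,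
    Set.ncard_union_eq ?_ (Set.toFinite _) (Set.toFinite _), ← Nat.card_coe_set_eq,
    ← Nat.card_coe_set_eq, Nat.card_range_of_injective, Nat.card_range_of_injective]
  · intro i j h
    obtain ⟨a, ha⟩ := List.exists_mem_of_ne_nil _ (H.aux_ne i)
    exact H.aux_aux i j a ha ((Cycle.coe_eq_coe.1 h).mem_iff.1 ha)
  · rintro ⟨k, hk⟩ ⟨k', hk'⟩ h
    obtain ⟨a, ha⟩ := List.exists_mem_of_ne_nil _ hk
    exact Subtype.ext (H.main_main k k' a ha ((Cycle.coe_eq_coe.1 h).mem_iff.1 ha))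
  · rw [Set.disjoint_left]
    rintro _ ⟨⟨k, hk⟩, rfl⟩ ⟨i, h⟩
    obtain ⟨a, ha⟩ := List.exists_mem_of_ne_nil _ hk
    exact H.main_aux k i a ha ((Cycle.coe_eq_coe.1 h).mem_iff.2 ha)
  · rw [Set.disjoint_left]
    rintro _ (⟨⟨k, hk⟩, rfl⟩ | ⟨i, rfl⟩) ⟨l, hne, h, -, hu⟩
    · obtain ⟨a, ha⟩ := List.exists_mem_of_ne_nil _ hk
      exact (hu a ((Cycle.coe_eq_coe.1 h).mem_iff.2 ha)).1 k ha
    · obtain ⟨a, ha⟩ := List.exists_mem_of_ne_nil _ (H.aux_ne i)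
      exact (hu a ((Cycle.coe_eq_coe.1 h).mem_iff.2 ha)).2 i ha

/-- A map with one main face is connected, hence has a genus. -/
theorem Ok.exists_genus [Finite D] [Finite ι] {M : PMap Unit ι D} (H : M.Ok) : ∃ g, M.Genus g := by
  classical
  have := Fintype.ofFinite D
  obtain ⟨h, hh⟩ := ONModel.exists_genus M.face M.glue H.glue_glue
  have hs : M.glue.support = Finset.univ := by
    ext a; simp [H.glue_ne a]
  rw [hs, Finset.card_univ, ← Nat.card_eq_fintype_card, H.cycNum_face, card_unit] at hh
  refine ⟨h, ?_⟩
  unfold Genus nv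
  rw [card_unit, Nat.card_unique]
  -- The map reduced to a vertex has no half-edges and no component in the sense of `exists_genus`.
  cases hm : M.main () with
  | nil =>
    have hD : IsEmpty D := ⟨fun a => H.conn ∅ (by simp) (by simp)
      (by rintro ⟨⟩ a ha; simp [hm] at ha) a⟩
    have hq : IsEmpty (Quot fun x y => M.face x = y ∨ M.glue x = y) :=
      ⟨by rintro ⟨a⟩; exact hD.elim a⟩
    simp only [Nat.card_of_isEmpty, hm] at hh ⊢
    simp at hh ⊢
    omega
  | cons a T =>
    have ho : Nat.card (Quot fun x y => M.face x = y ∨ M.glue x = y) = 1 := by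
      rw [Nat.card_eq_one_iff_unique]
      refine ⟨⟨?_⟩, ⟨Quot.mk _ a⟩⟩
      have key : ∀ x, Quot.mk (fun x y => M.face x = y ∨ M.glue x = y) x = Quot.mk _ a := by
        have h1 : ∀ x, Quot.mk (fun x y => M.face x = y ∨ M.glue x = y) (M.face x) = Quot.mk _ x :=
          fun x => (Quot.sound (r := fun x y => M.face x = y ∨ M.glue x = y) (Or.inl rfl)).symm
        have h2 : ∀ x, Quot.mk (fun x y => M.face x = y ∨ M.glue x = y) (M.glue x) = Quot.mk _ x :=
          fun x => (Quot.sound (r := fun x y => M.face x = y ∨ M.glue x = y) (Or.inr rfl)).symm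
        refine H.conn {x | Quot.mk _ x = Quot.mk _ a} (fun x hx => (h1 x).trans hx)
          (fun x hx => (h2 x).trans hx) ?_
        rintro ⟨⟩ x hx
        have hc := H.main_cyc ()
        rw [hm] at hc hx
        exact mem_of_isCyc hc (T := {x | Quot.mk _ x = Quot.mk _ a})
          (fun x hx => (h1 x).trans hx) rfl x hx
      rintro ⟨x⟩ ⟨y⟩
      exact (key x).trans (key y).symm
    rw [ho] at hh
    simp only [hm] at hh ⊢
    simp at hh ⊢
    omega

end PMap

end ONModel

/-! ### Maps with two main faces -/

namespace ONModel

open Equiv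

namespace PMap

variable {κ ι D κ₁ ι₁ D₁ κ₂ ι₂ D₂ : Type}

theorem Emb.unique {M₁ M₁' : PMap κ₁ ι₁ D₁} {M : PMap κ ι D} {gκ : κ₁ → κ} {gι : ι₁ → ι}
    {e : D₁ → D} (h : Emb M₁ M gκ gι e) (h' : Emb M₁' M gκ gι e) : M₁ = M₁' := by
  obtain ⟨f, g, c, m, x⟩ := M₁
  obtain ⟨f', g', c', m', x'⟩ := M₁'
  simp only [PMap.mk.injEq]
  refine ⟨?_, ?_, ?_, ?_, ?_⟩
  · ext a; exact h.inj ((h.face a).symm.trans (h'.face a))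
  · ext a; exact h.inj ((h.glue a).symm.trans (h'.glue a))
  · funext a; exact (h.col a).symm.trans (h'.col a)
  · funext k; exact h.inj.list_map ((h.main k).symm.trans (h'.main k))
  · funext k; exact h.inj.list_map ((h.aux k).symm.trans (h'.aux k))

theorem IsSum.unique {M₁ : PMap κ₁ ι₁ D₁} {M₂ : PMap κ₂ ι₂ D₂} {M M' : PMap κ ι D}
    {eκ : κ₁ ⊕ κ₂ ≃ κ} {eι : ι₁ ⊕ ι₂ ≃ ι} {e : D₁ ⊕ D₂ ≃ D} (h : IsSum M₁ M₂ M eκ eι e)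
    (h' : IsSum M₁ M₂ M' eκ eι e) : M = M' := by
  obtain ⟨f, g, c, m, x⟩ := M
  obtain ⟨f', g', c', m', x'⟩ := M'
  simp only [PMap.mk.injEq]
  refine ⟨?_, ?_, ?_, ?_, ?_⟩
  · refine Equiv.ext (e.forall_congr_right.1 ?_)
    rintro (a | a)
    · exact (h.left.face a).trans (h'.left.face a).symm
    · exact (h.right.face a).trans (h'.right.face a).symm
  · refine Equiv.ext (e.forall_congr_right.1 ?_)
    rintro (a | a)
    · exact (h.left.glue a).trans (h'.left.glue a).symm
    · exact (h.right.glue a).trans (h'.right.glue a).symm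
  · refine funext (e.forall_congr_right.1 ?_)
    rintro (a | a)
    · exact (h.left.col a).trans (h'.left.col a).symm
    · exact (h.right.col a).trans (h'.right.col a).symm
  · refine funext (eκ.forall_congr_right.1 ?_)
    rintro (a | a)
    · exact (h.left.main a).trans (h'.left.main a).symm
    · exact (h.right.main a).trans (h'.right.main a).symm
  · refine funext (eι.forall_congr_right.1 ?_)
    rintro (a | a)
    · exact (h.left.aux a).trans (h'.left.aux a).symm
    · exact (h.right.aux a).trans (h'.right.aux a).symm

/-- The disjoint union of two maps. -/
theorem exists_isSum (M₁ : PMap κ₁ ι₁ D₁) (M₂ : PMap κ₂ ι₂ D₂) (eκ : κ₁ ⊕ κ₂ ≃ κ)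
    (eι : ι₁ ⊕ ι₂ ≃ ι) (e : D₁ ⊕ D₂ ≃ D) : ∃ M : PMap κ ι D, IsSum M₁ M₂ M eκ eι e := by
  refine ⟨⟨e.permCongr (Perm.sumCongr M₁.face M₂.face), e.permCongr (Perm.sumCongr M₁.glue M₂.glue),
    fun a => Sum.elim M₁.col M₂.col (e.symm a),
    fun k => Sum.elim (fun k => (M₁.main k).map fun a => e (.inl a))
      (fun k => (M₂.main k).map fun a => e (.inr a)) (eκ.symm k),
    fun k => Sum.elim (fun k => (M₁.aux k).map fun a => e (.inl a))
      (fun k => (M₂.aux k).map fun a => e (.inr a)) (eι.symm k)⟩, ?_, ?_⟩ <;> constructor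
  case refine_1.inj => intro a b h; simpa using h
  case refine_2.inj => intro a b h; simpa using h
  all_goals intro a; simp

theorem exists_map_val {p : D → Prop} {l : List D} (h : ∀ a ∈ l, p a) :
    ∃ m : List {a // p a}, l = m.map Subtype.val :=
  ⟨l.attachWith p h, by simp⟩

/-- The restriction of a map to a union of components. -/
theorem exists_restrict (M : PMap κ ι D) (p : D → Prop) (hf : ∀ a, p (M.face a) ↔ p a)
    (hg : ∀ a, p (M.glue a) ↔ p a) (gκ : κ₁ → κ) (gι : ι₁ → ι)
    (hm : ∀ k, ∀ a ∈ M.main (gκ k), p a) (hx : ∀ k, ∀ a ∈ M.aux (gι k), p a) :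
    ∃ M₁ : PMap κ₁ ι₁ {a // p a}, Emb M₁ M gκ gι Subtype.val := by
  choose m hm using fun k => exists_map_val (hm k)
  choose x hx using fun k => exists_map_val (hx k)
  exact ⟨⟨M.face.subtypePerm hf, M.glue.subtypePerm hg, fun a => M.col a, m, x⟩,
    Subtype.val_injective, fun a => rfl, fun a => rfl, fun a => rfl, hm, hx⟩

/-- The component of the first main face. -/
def comp (M : PMap Bool ι D) : Set D :=
  {a | ∀ T : Set D, (∀ a ∈ T, M.face a ∈ T) → (∀ a ∈ T, M.glue a ∈ T) →
    (∀ a ∈ M.main false, a ∈ T) → a ∈ T}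

/-- Both main faces belong to the same component, and the second one is not reduced to a vertex. -/
def Linked (M : PMap Bool ι D) : Prop := M.main true ≠ [] ∧ M.comp = Set.univ

theorem comp_face (M : PMap Bool ι D) : ∀ a ∈ M.comp, M.face a ∈ M.comp :=
  fun a ha T t1 t2 t3 => t1 a (ha T t1 t2 t3)

theorem comp_glue (M : PMap Bool ι D) : ∀ a ∈ M.comp, M.glue a ∈ M.comp :=
  fun a ha T t1 t2 t3 => t2 a (ha T t1 t2 t3)

theorem comp_main (M : PMap Bool ι D) : ∀ a ∈ M.main false, a ∈ M.comp :=
  fun a ha _ _ _ t3 => t3 a ha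

theorem perm_mem_iff [Finite D] (σ : Perm D) {S : Set D} (h : ∀ a ∈ S, σ a ∈ S) (a : D) :
    σ a ∈ S ↔ a ∈ S := by
  refine ⟨fun ha => ?_, h a⟩
  obtain ⟨l, hl⟩ := exists_isCyc σ (σ a)
  refine mem_of_isCyc hl h ha a ?_
  rw [← hl.apply_mem_iff]
  simp

theorem mem_of_mem_isCyc [Finite D] {σ : Perm D} {S : Set D} (h : ∀ a ∈ S, σ a ∈ S) {l : List D}
    (hl : IsCyc σ l) {a : D} (ha : a ∈ l) (haS : a ∈ S) : ∀ x ∈ l, x ∈ S := by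
  obtain ⟨m, hm, hlm⟩ := hl.exists_cons ha
  exact fun x hx => mem_of_isCyc hm h haS x (hlm.mem_iff.1 hx)

theorem comp_eq_of_isSum [Finite D] {ι₁ ι₂ : Type} {S : Finset D} [DecidablePred (· ∈ S)]
    {M₁ : PMap Unit ι₁ {a // a ∈ S}} {M₂ : PMap Unit ι₂ {a // a ∉ S}} {M : PMap Bool ι D}
    {eι : ι₁ ⊕ ι₂ ≃ ι} (H : M₁.Ok)
    (h : IsSum M₁ M₂ M boolEquivPUnitSumPUnit.symm eι (sumCompl fun a => a ∈ S)) :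
    M.comp = (S : Set D) := by
  apply Set.Subset.antisymm
  · intro a ha
    refine ha (S : Set D) ?_ ?_ ?_
    · intro a ha
      have := h.left.face ⟨a, ha⟩
      simp only [sumCompl_apply_inl] at this
      rw [this]
      exact (M₁.face ⟨a, ha⟩).2
    · intro a ha
      have := h.left.glue ⟨a, ha⟩
      simp only [sumCompl_apply_inl] at this
      rw [this]
      exact (M₁.glue ⟨a, ha⟩).2
    · intro a ha
      have h1 := h.left.main ()
      simp only [sumCompl_apply_inl] at h1
      change M.main false = _ at h1
      rw [h1] at ha
      obtain ⟨b, -, rfl⟩ := List.mem_map.1 ha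
      exact b.2
  · intro a ha T t1 t2 t3
    refine H.conn {b | (b : D) ∈ T} ?_ ?_ ?_ ⟨a, ha⟩
    · intro b hb
      have := h.left.face b
      simp only [sumCompl_apply_inl] at this
      change ((M₁.face b : _) : D) ∈ T
      rw [← this]
      exact t1 _ hb
    · intro b hb
      have := h.left.glue b
      simp only [sumCompl_apply_inl] at this
      change ((M₁.glue b : _) : D) ∈ T
      rw [← this]
      exact t2 _ hb
    · rintro ⟨⟩ b hb
      refine t3 _ ?_
      have h1 := h.left.main ()
      simp only [sumCompl_apply_inl] at h1
      change M.main false = _ at h1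
      rw [h1]
      exact List.mem_map_of_mem hb

theorem genus_of_isSum [Finite D₁] [Finite D₂] [Finite ι₁] [Finite ι₂]
    {M₁ : PMap Unit ι₁ D₁} {M₂ : PMap Unit ι₂ D₂} {M : PMap Bool ι D} {eκ : Unit ⊕ Unit ≃ Bool}
    {eι : ι₁ ⊕ ι₂ ≃ ι} {e : D₁ ⊕ D₂ ≃ D} (h : IsSum M₁ M₂ M eκ eι e) {g₁ g₂ : ℕ}
    (h₁ : M₁.Genus g₁) (h₂ : M₂.Genus g₂) (g : ℕ) : M.Genus g ↔ g₁ + g₂ = g := by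
  unfold Genus at *
  rw [h.nv_eq, h.ncard_faces, ← Nat.card_congr eι, ← Nat.card_congr e, Nat.card_sum, Nat.card_sum]
  simp only [Nat.card_unique, Nat.card_eq_fintype_card (α := Bool), Fintype.card_bool] at *
  omega

theorem Genus.unique {M : PMap κ ι D} {g g' : ℕ} (h : M.Genus g) (h' : M.Genus g') : g = g' := by
  unfold Genus at *
  omega

/-- `M` is the disjoint union of two maps with one main face: the first has the auxiliary faces `J`,
the half-edges `S`, genus `a.1` and `b.1` vertices, the second the complementary faces and
half-edges, genus `a.2` and `b.2` vertices. -/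
def IsUnion [DecidableEq ι] [DecidableEq D] (J : Finset ι) (S : Finset D) (a b : ℕ × ℕ)
    (w : Bool → List Bool) (M : PMap Bool ι D) : Prop :=
  ∃ M₁ ∈ (maps {a // a ∈ S} a.1 b.1 (fun _ => w false) : Set (PMap Unit {i // i ∈ J} _)),
  ∃ M₂ ∈ (maps {a // a ∉ S} a.2 b.2 (fun _ => w true) : Set (PMap Unit {i // i ∉ J} _)),
    IsSum M₁ M₂ M boolEquivPUnitSumPUnit.symm (sumCompl fun i => i ∈ J) (sumCompl fun a => a ∈ S)

section

variable [DecidableEq ι] [DecidableEq D]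

theorem IsUnion.mem [Finite D] [Finite ι] {J : Finset ι} {S : Finset D} {a b : ℕ × ℕ}
    {w : Bool → List Bool} {M : PMap Bool ι D} (h : M.IsUnion J S a b w) :
    M ∈ (maps D (a.1 + a.2) (b.1 + b.2) w : Set (PMap Bool ι D)) ∧ ¬ M.Linked := by
  obtain ⟨M₁, ⟨H₁, G₁, v₁, w₁⟩, M₂, ⟨H₂, G₂, v₂, w₂⟩, h⟩ := h
  have hm₁ : M.main false = (M₁.main ()).map Subtype.val := h.left.main ()
  have hm₂ : M.main true = (M₂.main ()).map Subtype.val := h.right.main ()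
  refine ⟨⟨h.ok_iff.2 ⟨H₁, H₂⟩, (genus_of_isSum h G₁ G₂ _).2 rfl, ?_, ?_⟩, ?_⟩
  · rw [h.nv_eq, v₁, v₂]
  · rintro (_ | _)
    · rw [hm₁, List.map_map]
      refine Eq.trans ?_ (w₁ ())
      exact List.map_congr_left fun a _ => h.left.col a
    · rw [hm₂, List.map_map]
      refine Eq.trans ?_ (w₂ ())
      exact List.map_congr_left fun a _ => h.right.col a
  -- The component of the first main face is `S`, which misses the second main face.
  · rintro ⟨hne, hc⟩
    obtain ⟨x, hx⟩ := List.exists_mem_of_ne_nil _ hne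
    rw [comp_eq_of_isSum H₁ h] at hc
    have h1 : x ∈ S := by
      have : x ∈ (S : Set D) := hc ▸ Set.mem_univ x
      exact this
    rw [hm₂] at hx
    obtain ⟨y, -, rfl⟩ := List.mem_map.1 hx
    exact y.2 h1

/-- A map with two main faces that are not linked is the disjoint union of the component of the
first main face and of the rest, which is the component of the second. Both have a genus since they
are connected. -/
theorem exists_isUnion [Finite D] [Fintype ι] {g v : ℕ} {w : Bool → List Bool} {M : PMap Bool ι D}
    (hM : M ∈ (maps D g v w : Set (PMap Bool ι D))) (hl : ¬ M.Linked) :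
    ∃ J S, ∃ a ∈ Finset.HasAntidiagonal.antidiagonal g,
      ∃ b ∈ Finset.HasAntidiagonal.antidiagonal v, M.IsUnion J S a b w := by
  classical
  have := Fintype.ofFinite D
  obtain ⟨H, hG, hv, hw⟩ := hM
  let S : Finset D := Finset.univ.filter (· ∈ M.comp)
  have hS : ∀ a, a ∈ S ↔ a ∈ M.comp := by simp [S]
  let J : Finset ι := Finset.univ.filter fun i => ∀ a ∈ M.aux i, a ∈ M.comp
  have hJ : ∀ i, i ∈ J ↔ ∀ a ∈ M.aux i, a ∈ M.comp := by simp [J]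
  have hf : ∀ a, M.face a ∈ S ↔ a ∈ S := by
    intro a
    rw [hS, hS]
    exact perm_mem_iff M.face M.comp_face a
  have hg : ∀ a, M.glue a ∈ S ↔ a ∈ S := by
    intro a
    rw [hS, hS]
    exact perm_mem_iff M.glue M.comp_glue a
  obtain ⟨M₁, E₁⟩ := M.exists_restrict (κ₁ := Unit) (· ∈ S) hf hg (fun _ => false)
    (fun i : {i // i ∈ J} => (i : ι))
    (fun _ a ha => (hS a).2 (M.comp_main a ha)) (fun i a ha => (hS a).2 ((hJ i).1 i.2 a ha))
  obtain ⟨M₂, E₂⟩ := M.exists_restrict (κ₁ := Unit) (· ∉ S) (fun a => not_congr (hf a))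
    (fun a => not_congr (hg a)) (fun _ => true) (fun i : {i // i ∉ J} => (i : ι))
    (by
      intro _ a ha haS
      rw [hS] at haS
      refine hl ⟨List.ne_nil_of_mem ha, Set.eq_univ_iff_forall.2 ?_⟩
      refine H.conn _ M.comp_face M.comp_glue ?_
      rintro (_ | _)
      · exact M.comp_main
      · exact mem_of_mem_isCyc M.comp_face (H.main_cyc true) ha haS)
    (by
      intro i a ha haS
      rw [hS] at haS
      exact i.2 ((hJ i).2 (mem_of_mem_isCyc M.comp_face (H.aux_cyc i) ha haS)))
  have h : IsSum M₁ M₂ M boolEquivPUnitSumPUnit.symm (sumCompl fun i => i ∈ J)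
      (sumCompl fun a => a ∈ S) := ⟨E₁, E₂⟩
  obtain ⟨H₁, H₂⟩ := h.ok_iff.1 H
  obtain ⟨g₁, G₁⟩ := H₁.exists_genus
  obtain ⟨g₂, G₂⟩ := H₂.exists_genus
  refine ⟨J, S, (g₁, g₂), ?_, (M₁.nv, M₂.nv), ?_, M₁, ⟨H₁, G₁, rfl, ?_⟩, M₂, ⟨H₂, G₂, rfl, ?_⟩, h⟩
  · rw [Finset.HasAntidiagonal.mem_antidiagonal]
    exact (genus_of_isSum h G₁ G₂ g).1 hG
  · rw [Finset.HasAntidiagonal.mem_antidiagonal, ← hv, h.nv_eq]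
  · intro k
    rw [← hw false, E₁.main k, List.map_map]
    exact List.map_congr_left fun a _ => (E₁.col a).symm
  · intro k
    rw [← hw true, E₂.main k, List.map_map]
    exact List.map_congr_left fun a _ => (E₂.col a).symm

theorem IsUnion.unique [Finite D] {J J' : Finset ι} {S S' : Finset D} {a b a' b' : ℕ × ℕ}
    {w : Bool → List Bool} {M : PMap Bool ι D} (h : M.IsUnion J S a b w)
    (h' : M.IsUnion J' S' a' b' w) : (J, S, a, b) = (J', S', a', b') := by
  obtain ⟨M₁, ⟨H₁, G₁, v₁, w₁⟩, M₂, ⟨H₂, G₂, v₂, w₂⟩, h⟩ := h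
  obtain ⟨M₁', ⟨H₁', G₁', v₁', w₁'⟩, M₂', ⟨H₂', G₂', v₂', w₂'⟩, h'⟩ := h'
  obtain rfl : S = S' := Finset.coe_injective
    ((comp_eq_of_isSum H₁ h).symm.trans (comp_eq_of_isSum H₁' h'))
  have key : ∀ {J : Finset ι} {M₁ : PMap Unit {i // i ∈ J} {a // a ∈ S}}
      {M₂ : PMap Unit {i // i ∉ J} {a // a ∉ S}} (_ : M₁.Ok) (_ : M₂.Ok)
      (_ : IsSum M₁ M₂ M boolEquivPUnitSumPUnit.symm (sumCompl fun i => i ∈ J)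
        (sumCompl fun a => a ∈ S)), ∀ i, i ∈ J ↔ ∀ a ∈ M.aux i, a ∈ S := by
    intro J M₁ M₂ H₁ H₂ h i
    constructor
    · intro hi a ha
      have := h.left.aux ⟨i, hi⟩
      change M.aux i = (M₁.aux ⟨i, hi⟩).map Subtype.val at this
      rw [this] at ha
      obtain ⟨b, -, rfl⟩ := List.mem_map.1 ha
      exact b.2
    · intro ha
      by_contra hi
      have := h.right.aux ⟨i, hi⟩
      change M.aux i = (M₂.aux ⟨i, hi⟩).map Subtype.val at this
      obtain ⟨b, hb⟩ := List.exists_mem_of_ne_nil _ (H₂.aux_ne ⟨i, hi⟩)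
      exact b.2 (ha b (by rw [this]; exact List.mem_map_of_mem hb))
  obtain rfl : J = J' := by
    ext i
    rw [key H₁ H₂ h, key H₁' H₂' h']
  obtain rfl := h.left.unique h'.left
  obtain rfl := h.right.unique h'.right
  have e1 : a = a' := Prod.ext (G₁.unique G₁') (G₂.unique G₂')
  have e2 : b = b' := Prod.ext (v₁.symm.trans v₁') (v₂.symm.trans v₂')
  rw [e1, e2]

theorem finsum_mem_prod_mul {α β : Type} {A : Set α} {B : Set β} (hA : A.Finite) (hB : B.Finite)
    (F : α → ℂ) (G : β → ℂ) :
    ∑ᶠ q ∈ A ×ˢ B, F q.1 * G q.2 = (∑ᶠ a ∈ A, F a) * ∑ᶠ b ∈ B, G b := by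
  classical
  rw [finsum_mem_eq_finite_toFinset_sum _ hA, finsum_mem_eq_finite_toFinset_sum _ hB,
    finsum_mem_eq_finite_toFinset_sum _ (hA.prod hB), Finset.sum_mul_sum, ← Finset.sum_product',
    Set.Finite.toFinset_prod]

/-- Weights are multiplicative for disjoint unions. -/
theorem sum_isUnion [Finite D] [Fintype ι] (τ : Cycle Bool → ℂ) (z : ℂ) (f : ι → ℕ → ℂ)
    (J : Finset ι) (S : Finset D) (a b : ℕ × ℕ) (w : Bool → List Bool) :
    ∑ᶠ M ∈ {M : PMap Bool ι D | M.IsUnion J S a b w}, M.wt τ z f =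
      labSum τ z (fun i : {i // i ∈ J} => f i) {a // a ∈ S} a.1 b.1 (fun _ : Unit => w false) *
      labSum τ z (fun i : {i // i ∉ J} => f i) {a // a ∉ S} a.2 b.2 (fun _ : Unit => w true) := by
  rw [labSum, labSum, ← finsum_mem_prod_mul (finite_maps _ _ _) (finite_maps _ _ _)]
  refine finsum_mem_eq_of_rel (fun M q => IsSum q.1 q.2 M boolEquivPUnitSumPUnit.symm
    (sumCompl fun i => i ∈ J) (sumCompl fun a => a ∈ S)) ?_ ?_ ?_ ?_ ?_
  · rintro M ⟨M₁, h₁, M₂, h₂, h⟩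
    exact ⟨(M₁, M₂), ⟨h₁, h₂⟩, h⟩
  · rintro ⟨M₁, M₂⟩ ⟨h₁, h₂⟩
    obtain ⟨M, h⟩ := exists_isSum M₁ M₂ boolEquivPUnitSumPUnit.symm
      (sumCompl fun i => i ∈ J) (sumCompl fun a => a ∈ S)
    exact ⟨M, ⟨M₁, h₁, M₂, h₂, h⟩, h⟩
  · rintro M - M' - q - h h'
    exact h.unique h'
  · rintro M - q - q' - h h'
    exact Prod.ext (h.left.unique h'.left) (h.right.unique h'.right)
  · rintro M - q - h
    rw [h.wt_eq]
    rfl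

end

/-- The sum over maps with two main faces that are not linked, according to the auxiliary faces, the
half-edges, the genus and the vertices of the component of the first one. -/
theorem sum_not_linked [DecidableEq ι] [Fintype D] [DecidableEq D] [Fintype ι] (τ : Cycle Bool → ℂ)
    (z : ℂ) (f : ι → ℕ → ℂ) (g v : ℕ) (w : Bool → List Bool) :
    ∑ᶠ M ∈ {M : PMap Bool ι D | M ∈ maps D g v w ∧ ¬ M.Linked}, M.wt τ z f =
      ∑ J : Finset ι, ∑ S : Finset D,
      ∑ a ∈ Finset.HasAntidiagonal.antidiagonal g, ∑ b ∈ Finset.HasAntidiagonal.antidiagonal v,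
      labSum τ z (fun i : {i // i ∈ J} => f i) {a // a ∈ S} a.1 b.1 (fun _ : Unit => w false) *
      labSum τ z (fun i : {i // i ∉ J} => f i) {a // a ∉ S} a.2 b.2 (fun _ : Unit => w true) := by
  have hfin : {M : PMap Bool ι D | M ∈ maps D g v w ∧ ¬ M.Linked}.Finite :=
    (finite_maps (D := D) g v w).subset fun _ h => h.1
  rw [finsum_mem_fiberwise hfin
    (fun k : Finset ι × Finset D × (ℕ × ℕ) × (ℕ × ℕ) => {M : PMap Bool ι D |
      (k.2.2.1 ∈ Finset.HasAntidiagonal.antidiagonal g ∧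
        k.2.2.2 ∈ Finset.HasAntidiagonal.antidiagonal v) ∧
      M.IsUnion k.1 k.2.1 k.2.2.1 k.2.2.2 w})]
  · rw [finsum_eq_sum_of_support_subset (s := Finset.univ ×ˢ Finset.univ ×ˢ
      Finset.HasAntidiagonal.antidiagonal g ×ˢ Finset.HasAntidiagonal.antidiagonal v)]
    · simp only [Finset.sum_product]
      refine Finset.sum_congr rfl fun J _ => Finset.sum_congr rfl fun S _ =>
        Finset.sum_congr rfl fun a ha => Finset.sum_congr rfl fun b hb => ?_
      simp only [ha, hb, true_and, and_self]
      exact sum_isUnion τ z f J S a b w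
    · intro k hk
      by_contra hk'
      apply hk
      have : ¬ (k.2.2.1 ∈ Finset.HasAntidiagonal.antidiagonal g ∧
        k.2.2.2 ∈ Finset.HasAntidiagonal.antidiagonal v) := by
        intro h
        exact hk' (by simpa using h)
      simp only [this, false_and, Set.ofPred_false, finsum_mem_empty]
  · rintro ⟨J, S, a, b⟩ M ⟨⟨ha, hb⟩, h⟩
    simp only [Finset.HasAntidiagonal.mem_antidiagonal] at ha hb h
    rw [← ha, ← hb]
    exact h.mem
  · rintro M ⟨hM, hl⟩
    obtain ⟨J, S, a, ha, b, hb, h⟩ := exists_isUnion hM hl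
    exact ⟨(J, S, a, b), ⟨ha, hb⟩, h⟩
  · rintro ⟨J, S, a, b⟩ ⟨J', S', a', b'⟩ M ⟨-, h⟩ ⟨-, h'⟩
    exact h.unique h'

/-- The second main face becomes an auxiliary one. -/
def toAux (M : PMap Bool ι D) : PMap Unit (Option ι) D where
  face := M.face
  glue := M.glue
  col := M.col
  main _ := M.main false
  aux o := o.elim (M.main true) M.aux

theorem toAux_injective : Function.Injective (toAux : PMap Bool ι D → _) := by
  rintro ⟨f, g, c, m, x⟩ ⟨f', g', c', m', x'⟩ h
  simp only [toAux, PMap.mk.injEq] at h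
  obtain ⟨rfl, rfl, rfl, h1, h2⟩ := h
  have h3 : m false = m' false := congrFun h1 ()
  have h4 : m true = m' true := congrFun h2 none
  have h5 : x = x' := funext fun i => congrFun h2 (some i)
  have h6 : m = m' := funext fun k => by cases k <;> assumption
  rw [h5, h6]

theorem toAux_surjective (M : PMap Unit (Option ι) D) : ∃ M' : PMap Bool ι D, M'.toAux = M :=
  ⟨⟨M.face, M.glue, M.col, fun k => if k then M.aux none else M.main (), fun i => M.aux (some i)⟩,
    by
      obtain ⟨f, g, c, m, x⟩ := M
      simp only [toAux, PMap.mk.injEq, true_and]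
      exact ⟨rfl, funext fun o => by cases o <;> rfl⟩⟩

/-- Both descriptions of a map with two marked faces agree on linked maps only, since `PMap.Ok` asks
each component to contain a main face and auxiliary faces to be nonempty. -/
theorem toAux_ok {M : PMap Bool ι D} (hc : ∀ a ∈ M.main true, M.col a = false) :
    M.toAux.Ok ↔ M.Ok ∧ M.Linked := by
  constructor
  · intro H
    have hl : M.Linked := by
      refine ⟨H.aux_ne none, Set.eq_univ_iff_forall.2 fun a T t1 t2 t3 => ?_⟩
      exact H.conn T t1 t2 (fun _ => t3) a
    refine ⟨⟨H.glue_glue, H.glue_ne, H.col_glue, ?_, fun i => H.aux_cyc (some i),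
      fun i => H.aux_ne (some i), fun i => H.aux_col (some i), ?_, ?_, ?_, ?_⟩, hl⟩
    · rintro (_ | _)
      · exact H.main_cyc ()
      · exact H.aux_cyc none
    · rintro (_ | _) (_ | _) a ha ha'
      · rfl
      · exact (H.main_aux () none a ha ha').elim
      · exact (H.main_aux () none a ha' ha).elim
      · rfl
    · intro i j a ha ha'
      exact Option.some_injective _ (H.aux_aux (some i) (some j) a ha ha')
    · rintro (_ | _) i a ha ha'
      · exact H.main_aux () (some i) a ha ha'
      · exact Option.some_ne_none i (H.aux_aux (some i) none a ha' ha)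
    · exact fun T t1 t2 t3 a => H.conn T t1 t2 (fun _ => t3 false) a
  · rintro ⟨H, hne, hl⟩
    refine ⟨H.glue_glue, H.glue_ne, H.col_glue, fun _ => H.main_cyc false, ?_, ?_, ?_, ?_, ?_, ?_, ?_⟩
    · rintro (_ | i)
      · exact H.main_cyc true
      · exact H.aux_cyc i
    · rintro (_ | i)
      · exact hne
      · exact H.aux_ne i
    · rintro (_ | i)
      · exact hc
      · exact H.aux_col i
    · exact fun _ _ _ _ _ => rfl
    · rintro (_ | i) (_ | j) a ha ha'
      · rfl
      · exact (H.main_aux true j a ha ha').elim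
      · exact (H.main_aux true i a ha' ha).elim
      · exact congrArg some (H.aux_aux i j a ha ha')
    · rintro ⟨⟩ (_ | i) a ha ha'
      · exact Bool.false_ne_true (H.main_main false true a ha ha')
      · exact H.main_aux false i a ha ha'
    · exact fun T t1 t2 t3 a => (Set.eq_univ_iff_forall.1 hl a) T t1 t2 (t3 ())

theorem toAux_unm {M : PMap Bool ι D} (a : D) : M.toAux.Unm a ↔ M.Unm a := by
  simp only [Unm, toAux, Option.forall, Bool.forall_bool, Option.elim]
  constructor
  · rintro ⟨h1, h2, h3⟩; exact ⟨⟨h1 (), h2⟩, h3⟩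
  · rintro ⟨⟨h1, h2⟩, h3⟩; exact ⟨fun _ => h1, h2, h3⟩

theorem toAux_faces (M : PMap Bool ι D) : M.toAux.faces = M.faces := by
  ext s
  constructor
  · rintro ⟨l, h1, h2, h3, h4⟩
    exact ⟨l, h1, h2, h3, fun a ha => (toAux_unm a).1 (h4 a ha)⟩
  · rintro ⟨l, h1, h2, h3, h4⟩
    exact ⟨l, h1, h2, h3, fun a ha => (toAux_unm a).2 (h4 a ha)⟩

theorem toAux_nv {M : PMap Bool ι D} (h : M.main true ≠ []) : M.toAux.nv = M.nv := by
  classical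
  unfold nv
  rw [card_unit, card_bool]
  simp only [toAux, h, if_false, add_zero]
  congr!

theorem toAux_wt [Fintype ι] (τ : Cycle Bool → ℂ) (z : ℂ) (f : Option ι → ℕ → ℂ)
    (M : PMap Bool ι D) :
    M.toAux.wt τ z f = f none (M.main true).length * M.wt τ z fun i => f (some i) := by
  unfold wt
  rw [toAux_faces, Fintype.prod_option]
  have : M.toAux.loops = M.loops := rfl
  rw [this]
  simp only [toAux, Option.elim]
  ring

theorem toAux_genus [Finite ι] {M : PMap Bool ι D} (h : M.main true ≠ []) (g : ℕ) :
    M.toAux.Genus g ↔ M.Genus (g + 1) := by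
  unfold Genus
  rw [toAux_nv h, toAux_faces, Finite.card_option]
  simp only [Nat.card_unique, Nat.card_eq_fintype_card (α := Bool), Fintype.card_bool]
  omega

/-- The weighted number of maps of genus `g - 1` with an additional auxiliary face of degree `l₂`. -/
noncomputable def linkedSum [Fintype ι] (τ : Cycle Bool → ℂ) (z : ℂ) (f : ι → ℕ → ℂ) (D : Type) :
    ℕ → ℕ → ℕ → ℕ → ℂ
  | 0, _, _, _ => 0
  | g + 1, v, l₁, l₂ => labSum τ z (fun o : Option ι => o.elim (fun l => if l = l₂ then 1 else 0) f)
      D g v (fun _ : Unit => List.replicate l₁ false)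

/-- Linked maps with two main faces are maps with one main face and one more auxiliary face, of
genus lower by one. There are none for `g = 0`, because a connected map has a genus. -/
theorem sum_linked [Finite D] [Fintype ι] (τ : Cycle Bool → ℂ)
    (z : ℂ) (f : ι → ℕ → ℂ) (g v l₁ l₂ : ℕ) :
    ∑ᶠ M ∈ {M : PMap Bool ι D | M ∈ maps D g v
      (fun k => if k then List.replicate l₂ false else List.replicate l₁ false) ∧ M.Linked},
        M.wt τ z f = linkedSum τ z f D g v l₁ l₂ := by
  have hcol : ∀ M : PMap Bool ι D, (M.main true).map M.col = List.replicate l₂ false →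
      ∀ a ∈ M.main true, M.col a = false := by
    intro M h a ha
    have : M.col a ∈ List.replicate l₂ false := h ▸ List.mem_map_of_mem ha
    exact List.eq_of_mem_replicate this
  cases g with
  | zero =>
    rw [linkedSum]
    convert finsum_mem_empty
    rw [Set.eq_empty_iff_forall_notMem]
    rintro M ⟨⟨H, hG, -, hw⟩, hl⟩
    obtain ⟨g, hg⟩ := ((toAux_ok (hcol M (by simpa using hw true))).2 ⟨H, hl⟩).exists_genus
    have := ((toAux_genus hl.1 g).1 hg).unique hG
    omega
  | succ g =>
    rw [linkedSum, labSum]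
    have hset : ∑ᶠ M ∈ (maps D g v (fun _ => List.replicate l₁ false) :
          Set (PMap Unit (Option ι) D)),
        M.wt τ z (fun o => o.elim (fun l => if l = l₂ then 1 else 0) f) =
        ∑ᶠ M ∈ {M : PMap Unit (Option ι) D | M ∈ maps D g v (fun _ => List.replicate l₁ false) ∧
          (M.aux none).length = l₂},
        M.wt τ z (fun o => o.elim (fun l => if l = l₂ then 1 else 0) f) := by
      refine finsum_mem_inter_support_eq _ _ _ ?_
      ext M
      simp only [Set.mem_inter_iff, Set.mem_ofPred_eq, Function.mem_support]
      constructor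
      · rintro ⟨h, h'⟩
        refine ⟨⟨h, ?_⟩, h'⟩
        by_contra hne
        apply h'
        unfold wt
        rw [Fintype.prod_option]
        simp [hne]
      · rintro ⟨⟨h, -⟩, h'⟩
        exact ⟨h, h'⟩
    rw [hset]
    have key : ∀ M : PMap Bool ι D, (M ∈ maps D (g + 1) v
        (fun k => if k then List.replicate l₂ false else List.replicate l₁ false) ∧ M.Linked) ↔
        (M.toAux ∈ maps D g v (fun _ => List.replicate l₁ false) ∧
          (M.toAux.aux none).length = l₂) := by
      intro M
      constructor
      · rintro ⟨⟨H, hG, hv, hw⟩, hl⟩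
        have h2 : (M.main true).map M.col = List.replicate l₂ false := by simpa using hw true
        refine ⟨⟨(toAux_ok (hcol M h2)).2 ⟨H, hl⟩, (toAux_genus hl.1 g).2 hG,
          (toAux_nv hl.1).trans hv, fun _ => ?_⟩, ?_⟩
        · have := hw false
          simpa [toAux] using this
        · simpa [toAux] using congrArg List.length h2
      · rintro ⟨⟨H, hG, hv, hw⟩, hlen⟩
        have hc : ∀ a ∈ M.main true, M.col a = false := H.aux_col none
        obtain ⟨H', hl⟩ := (toAux_ok hc).1 H
        refine ⟨⟨H', (toAux_genus hl.1 g).1 hG, (toAux_nv hl.1).symm.trans hv, ?_⟩, hl⟩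
        rintro (_ | _)
        · have := hw ()
          simpa [toAux] using this
        · simp only [if_true]
          rw [List.eq_replicate_iff]
          refine ⟨by simpa [toAux] using hlen, ?_⟩
          intro c hc'
          obtain ⟨a, ha, rfl⟩ := List.mem_map.1 hc'
          exact hc a ha
    refine finsum_mem_eq_of_bijOn toAux ⟨?_, ?_, ?_⟩ ?_
    · exact fun M hM => (key M).1 hM
    · exact toAux_injective.injOn
    · intro M hM
      obtain ⟨M', rfl⟩ := toAux_surjective M
      exact ⟨M', (key M').2 hM, rfl⟩
    · rintro M hM
      have h := ((key M).1 hM).2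
      change (M.main true).length = l₂ at h
      rw [toAux_wt, h]
      simp

/-- Maps with two main faces: both faces are in the same component, or each in its own. -/
theorem labSum_bool [DecidableEq ι] [Fintype D] [DecidableEq D] [Fintype ι] (τ : Cycle Bool → ℂ)
    (z : ℂ) (f : ι → ℕ → ℂ) (g v l₁ l₂ : ℕ) :
    labSum τ z f D g v
      (fun k : Bool => if k then List.replicate l₂ false else List.replicate l₁ false) =
    linkedSum τ z f D g v l₁ l₂ +
      ∑ J : Finset ι, ∑ S : Finset D,
      ∑ a ∈ Finset.HasAntidiagonal.antidiagonal g, ∑ b ∈ Finset.HasAntidiagonal.antidiagonal v,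
      labSum τ z (fun i : {i // i ∈ J} => f i) {a // a ∈ S} a.1 b.1
        (fun _ : Unit => List.replicate l₁ false) *
      labSum τ z (fun i : {i // i ∉ J} => f i) {a // a ∉ S} a.2 b.2
        (fun _ : Unit => List.replicate l₂ false) := by
  have h := sum_not_linked (D := D) τ z f g v
    (fun k : Bool => if k then List.replicate l₂ false else List.replicate l₁ false)
  simp only [if_true, Bool.false_eq_true, if_false] at h
  rw [← sum_linked, ← h, ← finsum_mem_union]
  · rw [labSum]
    congr! 4
    ext M
    simp only [Set.mem_union, Set.mem_ofPred_eq, ← and_or_left]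
    simp [em]
  · rw [Set.disjoint_left]
    rintro M ⟨-, h⟩ ⟨-, h'⟩
    exact h' h
  · exact (finite_maps (D := D) g v _).subset fun _ h => h.1
  · exact (finite_maps (D := D) g v _).subset fun _ h => h.1

end PMap

end ONModel

/-! ### Rerooting and choice of the root edge -/

namespace ONModel

open Equiv

namespace PMap

variable {κ ι D : Type}

theorem Ok.length_le [Finite D] {M : PMap κ ι D} (H : M.Ok) (k : κ) :
    (M.main k).length ≤ Nat.card D := by
  classical
  have := Fintype.ofFinite D
  rw [← List.toFinset_card_of_nodup (H.main_cyc k).nodup, Nat.card_eq_fintype_card]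
  exact Finset.card_le_univ _

/-- If all the unmarked faces have degree at least `m`, there are at most `|D| / m` of them. -/
theorem mul_ncard_faces_le [Finite D] {M : PMap κ ι D} (m : ℕ)
    (h : ∀ s ∈ M.faces, m ≤ s.length) : m * M.faces.ncard ≤ Nat.card D := by
  classical
  have := Fintype.ofFinite D
  rw [Set.ncard_eq_toFinset_card _ M.faces_finite, Nat.card_eq_fintype_card, mul_comm,
    ← smul_eq_mul]
  have hdis : (M.faces_finite.toFinset : Set (Cycle D)).PairwiseDisjoint
      fun s => s.toFinset := by
    rintro s hs t ht hst
    rw [Finset.mem_coe, Set.Finite.mem_toFinset] at hs ht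
    obtain ⟨l, -, rfl, hl, -⟩ := hs
    obtain ⟨l', -, rfl, hl', -⟩ := ht
    rw [Function.onFun, Finset.disjoint_left]
    intro a ha ha'
    exact hst (Cycle.coe_eq_coe.2 (hl.isRotated hl' (by simpa using ha) (by simpa using ha')))
  refine (Finset.card_nsmul_le_sum _ (fun s => s.toFinset.card) m ?_).trans ?_
  · intro s hs
    rw [Set.Finite.mem_toFinset] at hs
    have hs' := h s hs
    obtain ⟨l, -, rfl, hl, -⟩ := hs
    rwa [Cycle.coe_toFinset, List.toFinset_card_of_nodup hl.nodup]
  · rw [← Finset.card_biUnion hdis]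
    exact Finset.card_le_univ _

/-- Change of the marked edge of the main face. -/
def rot (n : ℕ) (M : PMap Unit ι D) : PMap Unit ι D :=
  { M with main := fun k => (M.main k).rotate n }

theorem rot_unm (n : ℕ) (M : PMap Unit ι D) (a : D) : (M.rot n).Unm a ↔ M.Unm a := by
  simp [Unm, rot]

theorem rot_faces (n : ℕ) (M : PMap Unit ι D) : (M.rot n).faces = M.faces := by
  ext s
  constructor
  · rintro ⟨l, h1, h2, h3, h4⟩
    exact ⟨l, h1, h2, h3, fun a ha => (rot_unm n M a).1 (h4 a ha)⟩
  · rintro ⟨l, h1, h2, h3, h4⟩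
    exact ⟨l, h1, h2, h3, fun a ha => (rot_unm n M a).2 (h4 a ha)⟩

theorem rot_ok {n : ℕ} {M : PMap Unit ι D} (H : M.Ok) : (M.rot n).Ok where
  glue_glue := H.glue_glue
  glue_ne := H.glue_ne
  col_glue := H.col_glue
  main_cyc k := (H.main_cyc k).rotate n
  aux_cyc := H.aux_cyc
  aux_ne := H.aux_ne
  aux_col := H.aux_col
  main_main _ _ _ _ _ := rfl
  aux_aux := H.aux_aux
  main_aux k i a ha := H.main_aux k i a (List.mem_rotate.1 ha)
  conn S s1 s2 s3 := H.conn S s1 s2 fun k a ha => s3 k a (List.mem_rotate.2 ha)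

theorem rot_mem_maps {A B : List Bool} {M : PMap Unit ι D} {g v : ℕ}
    (h : M ∈ (maps D g v (fun _ => A ++ B) : Set (PMap Unit ι D))) :
    M.rot A.length ∈ (maps D g v (fun _ => B ++ A) : Set (PMap Unit ι D)) := by
  obtain ⟨H, hG, hv, hw⟩ := h
  have hnv : (M.rot A.length).nv = M.nv := by
    unfold nv
    simp [rot]
  refine ⟨rot_ok H, ?_, hnv.trans hv, fun k => ?_⟩
  · unfold Genus at hG ⊢
    rwa [rot_faces, hnv]
  · have : ((M.rot A.length).main k).map (M.rot A.length).col =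
        ((M.main k).map M.col).rotate A.length := by
      simp [rot, List.map_rotate]
    rw [this, hw k, List.rotate_append_length_eq]

theorem rot_rot {A B : List Bool} {M : PMap Unit ι D} {g v : ℕ}
    (h : M ∈ (maps D g v (fun _ => A ++ B) : Set (PMap Unit ι D))) :
    (M.rot A.length).rot B.length = M := by
  have hl : ∀ k, (M.main k).length = A.length + B.length := fun k => by
    have := congrArg List.length (h.2.2.2 k)
    simpa using this
  obtain ⟨f, c, e, m, x⟩ := M
  simp only [rot, PMap.mk.injEq, true_and, and_true]
  funext k
  rw [List.rotate_rotate, ← hl k, List.rotate_length]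

theorem rot_wt [Fintype ι] (τ : Cycle Bool → ℂ) (z : ℂ) (f : ι → ℕ → ℂ) (n : ℕ)
    (M : PMap Unit ι D) : (M.rot n).wt τ z f = M.wt τ z f := by
  unfold wt
  rw [rot_faces]
  rfl

/-- The marked edge of the main face can be moved, which rotates its word of colours. -/
theorem labSum_append_comm [Fintype ι] (τ : Cycle Bool → ℂ) (z : ℂ) (f : ι → ℕ → ℂ) (g v : ℕ)
    (A B : List Bool) :
    labSum τ z f D g v (fun _ : Unit => A ++ B) = labSum τ z f D g v (fun _ : Unit => B ++ A) := by
  refine finsum_mem_eq_of_bijOn (rot A.length) ⟨fun M h => rot_mem_maps h, ?_, ?_⟩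
    fun M _ => (rot_wt τ z f _ M).symm
  · intro M h M' h' heq
    rw [← rot_rot h, heq, rot_rot h']
  · intro M h
    exact ⟨M.rot B.length, rot_mem_maps h, rot_rot h⟩

theorem exists_ext_equiv {n : ℕ} (a b : Fin (n + 2)) (hab : a ≠ b) :
    ∃ e : Ext (Fin n) ≃ Fin (n + 2), e none = a ∧ e (some none) = b := by
  let e₀ : Ext (Fin n) ≃ Fin (n + 2) := Fintype.equivFinOfCardEq (by simp)
  let e₁ := e₀.trans (swap (e₀ none) a)
  have h1 : e₁ none = a := by simp [e₁]
  have h2 : e₁ (some none) ≠ a := by rw [← h1]; simp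
  refine ⟨e₁.trans (swap (e₁ (some none)) b), ?_, ?_⟩
  · rw [trans_apply, h1, swap_apply_of_ne_of_ne h2.symm hab]
  · rw [trans_apply, swap_apply_left]

/-- Symmetry breaking: the two half-edges of the root edge may be chosen arbitrarily. -/
theorem labSum_cons [Fintype ι] (τ : Cycle Bool → ℂ) (z : ℂ) (f : ι → ℕ → ℂ) (g v n : ℕ)
    (p : Bool) (w : List Bool) :
    labSum τ z f (Fin (n + 2)) g v (fun _ : Unit => p :: w) =
      (n + 2) * (n + 1) *
        ∑ᶠ M ∈ (rooted (Fin n) g v (p :: w) : Set (PMap Unit ι (Ext (Fin n)))), M.wt τ z f := by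
  classical
  have hfin := finite_maps (D := Fin (n + 2)) (ι := ι) g v (fun _ : Unit => p :: w)
  rw [labSum, finsum_mem_fiberwise hfin
    (fun q : {q : Fin (n + 2) × Fin (n + 2) // q ∈ (Finset.univ : Finset (Fin (n + 2))).offDiag} =>
      {M : PMap Unit ι (Fin (n + 2)) | M ∈ maps (Fin (n + 2)) g v (fun _ : Unit => p :: w) ∧
        M.glue q.1.1 = q.1.2 ∧ ∃ T, M.main () = q.1.1 :: T})]
  · have key : ∀ q : {q : Fin (n + 2) × Fin (n + 2) //
        q ∈ (Finset.univ : Finset (Fin (n + 2))).offDiag},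
        ∑ᶠ M ∈ {M : PMap Unit ι (Fin (n + 2)) |
          M ∈ maps (Fin (n + 2)) g v (fun _ : Unit => p :: w) ∧
          M.glue q.1.1 = q.1.2 ∧ ∃ T, M.main () = q.1.1 :: T}, M.wt τ z f =
        ∑ᶠ M ∈ (rooted (Fin n) g v (p :: w) : Set (PMap Unit ι (Ext (Fin n)))), M.wt τ z f := by
      rintro ⟨⟨a, b⟩, hq⟩
      obtain ⟨e, he1, he2⟩ := exists_ext_equiv a b (by simpa using hq)
      have hk : ∀ M : PMap Unit ι (Ext (Fin n)), (M ∈ rooted (Fin n) g v (p :: w)) ↔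
          ((M.relabel (Equiv.refl _) (Equiv.refl _) e) ∈
            (maps (Fin (n + 2)) g v (fun _ : Unit => p :: w) : Set (PMap Unit ι _)) ∧
          (M.relabel (Equiv.refl _) (Equiv.refl _) e).glue a = b ∧
          ∃ T, (M.relabel (Equiv.refl _) (Equiv.refl _) e).main () = a :: T) := by
        intro M
        rw [relabel_mem_maps]
        have h1 : (M.relabel (Equiv.refl _) (Equiv.refl _) e).glue a = e (M.glue none) := by
          simp [relabel, ← he1]
        have h2 : (M.relabel (Equiv.refl _) (Equiv.refl _) e).main () = (M.main ()).map e := by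
          simp [relabel]
        rw [h1, h2, ← he1, ← he2, e.apply_eq_iff_eq]
        refine and_congr Iff.rfl (and_congr Iff.rfl ?_)
        constructor
        · rintro ⟨T, hT⟩
          exact ⟨T.map e, by rw [hT]; rfl⟩
        · rintro ⟨T, hT⟩
          cases hm : M.main () with
          | nil => simp [hm] at hT
          | cons x T' =>
            rw [hm, List.map_cons, List.cons.injEq, e.apply_eq_iff_eq] at hT
            exact ⟨T', by rw [hT.1]⟩
      symm
      refine finsum_mem_eq_of_bijOn (relabel (Equiv.refl _) (Equiv.refl _) e) ⟨?_, ?_, ?_⟩ ?_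
      · exact fun M hM => (hk M).1 hM
      · exact (relabel_injective _ _ _).injOn
      · intro M hM
        have hs := relabel_symm (Equiv.refl _) (Equiv.refl _) e M
        exact ⟨_, (hk _).2 (by rw [hs]; exact hM), hs⟩
      · exact fun M _ => (relabel_wt τ z f (Equiv.refl _) (Equiv.refl _) e M).symm
    simp only [key]
    rw [finsum_eq_sum_of_fintype, Finset.sum_const, Finset.card_univ, Fintype.card_coe,
      Finset.offDiag_card, Finset.card_univ, Fintype.card_fin, nsmul_eq_mul]
    congr 1
    have : (n + 2) * (n + 2) - (n + 2) = (n + 2) * (n + 1) := by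
      rw [Nat.sub_eq_iff_eq_add (by nlinarith)]; ring
    rw [this]
    push_cast
    ring
  · exact fun q M h => h.1
  · intro M hM
    cases hm : M.main () with
    | nil =>
      have := hM.2.2.2 ()
      simp [hm] at this
    | cons a T =>
      exact ⟨⟨(a, M.glue a), by simpa using (hM.1.glue_ne a).symm⟩, hM, rfl, T, hm⟩
  · rintro ⟨⟨a, b⟩, h⟩ ⟨⟨a', b'⟩, h'⟩ M ⟨-, h1, T, hT⟩ ⟨-, h1', T', hT'⟩
    have := (List.cons.inj (hT.symm.trans hT')).1
    simp only at this h1 h1'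
    subst this
    simp [← h1, ← h1']

/-- A map with an edge has at least two half-edges. -/
theorem labSum_cons_of_le_one [Fintype ι] (τ : Cycle Bool → ℂ) (z : ℂ) (f : ι → ℕ → ℂ) {n : ℕ}
    (hn : n ≤ 1) (g v : ℕ) (p : Bool) (w : List Bool) :
    labSum τ z f (Fin n) g v (fun _ : Unit => p :: w) = 0 := by
  rw [labSum]
  convert finsum_mem_empty
  rw [Set.eq_empty_iff_forall_notMem]
  rintro M ⟨H, -, -, hw⟩
  cases hm : M.main () with
  | nil => have := hw (); simp [hm] at this
  | cons a T =>
    have : Subsingleton (Fin n) := by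
      rw [Fin.subsingleton_iff_le_one]; exact hn
    exact H.glue_ne a (Subsingleton.elim _ _)

theorem labSum_eq_zero_of_length [Finite D] [Fintype ι] (τ : Cycle Bool → ℂ) (z : ℂ)
    (f : ι → ℕ → ℂ) (g v : ℕ) (w : κ → List Bool) (k : κ) (h : Nat.card D < (w k).length) :
    labSum τ z f D g v w = 0 := by
  rw [labSum]
  convert finsum_mem_empty
  rw [Set.eq_empty_iff_forall_notMem]
  rintro M ⟨H, -, -, hw⟩
  have := congrArg List.length (hw k)
  rw [List.length_map] at this
  have := H.length_le k
  omega

end PMap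

namespace Params

/-- The weight of an unmarked face, in terms of the cyclic word of its colours: empty polygons have
no coloured side, and triangles carrying a piece of path have two of them. -/
noncomputable def faceWt (p : Params) (s : Cycle Bool) : ℂ :=
  if s.toMultiset.count true = 0 ∧ 3 ≤ s.toMultiset.count false ∧
      s.toMultiset.count false ≤ p.d then
    p.tHat (s.toMultiset.count false)
  else if s.toMultiset.count true = 2 ∧ s.toMultiset.count false = 1 then -1 / p.c else 0

theorem faceWt_coe (p : Params) (l : List Bool) : p.faceWt (l : Cycle Bool) =
    if l.count true = 0 ∧ 3 ≤ l.count false ∧ l.count false ≤ p.d then p.tHat (l.count false)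
    else if l.count true = 2 ∧ l.count false = 1 then -1 / p.c else 0 := by
  simp [faceWt]

theorem faceWt_eq_zero (p : Params) {l : List Bool} (h : l.length < 3) :
    p.faceWt (l : Cycle Bool) = 0 := by
  have := List.count_true_add_count_false l
  rw [faceWt_coe, if_neg, if_neg] <;> omega

/-- The unmarked faces that can be adjacent to an uncrossed edge: the empty polygons, and the
triangles with a path through their two other sides. -/
theorem finsum_faceWt_false (p : Params) (G : List Bool → ℂ) :
    ∑ᶠ u : List Bool, p.faceWt ((false :: u : List Bool) : Cycle Bool) * G u =
      ∑ j ∈ Finset.Icc 3 p.d, p.tHat j * G (List.replicate (j - 1) false) +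
        -1 / p.c * G [true, true] := by
  classical
  have hinj : Set.InjOn (fun j => List.replicate (j - 1) false) (Finset.Icc 3 p.d : Set ℕ) := by
    intro i hi j hj h
    have := congrArg List.length h
    simp at this hi hj
    omega
  rw [finsum_eq_sum_of_support_subset
    (s := insert [true, true] ((Finset.Icc 3 p.d).image fun j => List.replicate (j - 1) false)),
    Finset.sum_insert, Finset.sum_image hinj, add_comm]
  · congr 1
    · refine Finset.sum_congr rfl fun j hj => ?_
      rw [Finset.mem_Icc] at hj
      rw [← List.replicate_succ, faceWt_coe, if_pos]
      · simp [show j - 1 + 1 = j by omega]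
      · simp [List.count_replicate]
        omega
  · simp only [Finset.mem_image, not_exists, not_and]
    intro j hj h
    have : true ∈ List.replicate (j - 1) false := by rw [h]; simp
    simp [List.mem_replicate] at this
  · intro u hu
    have h0 : p.faceWt ((false :: u : List Bool) : Cycle Bool) ≠ 0 := left_ne_zero_of_mul hu
    rw [faceWt_coe] at h0
    have hlen := List.count_true_add_count_false u
    simp only [List.count_cons_self, List.count_cons_of_ne (show false ≠ true by simp)] at h0
    simp only [Finset.coe_insert, Finset.coe_image, Set.mem_insert_iff, Set.mem_image]
    split_ifs at h0 with h1 h2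
    · right
      refine ⟨u.count false + 1, by simpa using h1.2, ?_⟩
      rw [eq_comm, List.eq_replicate_iff]
      refine ⟨by omega, fun b hb => ?_⟩
      have := List.count_eq_zero.1 h1.1
      cases b
      · rfl
      · exact absurd hb this
    · left
      have h3 : u.count false = 0 := by omega
      have := List.count_eq_zero.1 h3
      have h4 : u = List.replicate 2 true := by
        rw [List.eq_replicate_iff]
        refine ⟨by omega, fun b hb => ?_⟩
        cases b
        · exact absurd hb this
        · rfl
      rw [h4]; rfl
    · exact absurd rfl h0

/-- The unmarked faces that can be adjacent to a crossed edge are triangles, whose path goes out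
through one of the two other sides. -/
theorem finsum_faceWt_true (p : Params) (G : List Bool → ℂ) :
    ∑ᶠ u : List Bool, p.faceWt ((true :: u : List Bool) : Cycle Bool) * G u =
      -1 / p.c * (G [true, false] + G [false, true]) := by
  classical
  rw [finsum_eq_sum_of_support_subset (s := {[true, false], [false, true]}),
    Finset.sum_pair (by simp), mul_add]
  · congr 1
  · intro u hu
    have h0 : p.faceWt ((true :: u : List Bool) : Cycle Bool) ≠ 0 := left_ne_zero_of_mul hu
    rw [faceWt_coe] at h0
    have hlen := List.count_true_add_count_false u
    simp only [List.count_cons_self, List.count_cons_of_ne (show true ≠ false by simp)] at h0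
    rw [if_neg (by omega)] at h0
    split_ifs at h0 with h2
    · have h3 : u.length = 2 := by omega
      obtain ⟨x, y, rfl⟩ := List.length_eq_two.1 h3
      cases x <;> cases y <;> simp at h2 ⊢
    · exact absurd rfl h0

end Params

/-- For given genus and number of vertices there are finitely many maps: unmarked faces have degree
at least `3`, and Euler's relation bounds the number of half-edges. -/
theorem labSum_eq_zero {κ ι D : Type} [Finite D] [Fintype ι] (p : Params) (z : ℂ) (f : ι → ℕ → ℂ)
    (g v : ℕ) (w : κ → List Bool) (h : 6 * (v + Fintype.card ι + 2 * g) < Nat.card D) :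
    labSum p.faceWt z f D g v w = 0 := by
  rw [labSum]
  refine finsum_mem_eq_zero_of_forall_eq_zero fun M hM => ?_
  by_cases hs : ∀ s ∈ M.faces, 3 ≤ s.length
  · have h1 := PMap.mul_ncard_faces_le 3 hs
    -- Euler's relation, with `3 F ≤ 2 E`, contradicts `h`.
    obtain ⟨H, hG, hv, -⟩ := hM
    unfold PMap.Genus at hG
    rw [← Nat.card_eq_fintype_card] at h
    omega
  · push Not at hs
    obtain ⟨s, hs, hlt⟩ := hs
    have : ∏ᶠ s ∈ M.faces, p.faceWt (s.map M.col) = 0 := by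
      rw [finprod_mem_eq_finite_toFinset_prod _ M.faces_finite]
      refine Finset.prod_eq_zero ((Set.Finite.mem_toFinset _).2 hs) ?_
      obtain ⟨l, -, rfl, -, -⟩ := hs
      exact p.faceWt_eq_zero (by simpa using hlt)
    rw [PMap.wt, this]
    simp

end ONModel

/-! ### Recursions for the weighted numbers of maps -/

namespace ONModel

open Equiv

variable {κ ι : Type}

/-- The sum over unlabelled maps, `n!` being the number of labellings of `n` half-edges. -/
noncomputable def total [Fintype ι] (p : Params) (f : ι → ℕ → ℂ) (g v : ℕ) (w : κ → List Bool) : ℂ :=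
  ∑ᶠ n : ℕ, labSum p.faceWt p.𝔫 f (Fin n) g v w / n.factorial

/-- A bound on the number of half-edges of the maps that contribute to `total`. -/
def bound (ι : Type) [Fintype ι] (g v : ℕ) : ℕ := 6 * (v + Fintype.card ι + 2 * g) + 1

theorem labSum_eq_zero_of_bound [Fintype ι] (p : Params) (f : ι → ℕ → ℂ) {g v n : ℕ}
    (w : κ → List Bool) (h : bound ι g v ≤ n) : labSum p.faceWt p.𝔫 f (Fin n) g v w = 0 := by
  refine labSum_eq_zero p _ f g v w ?_
  rw [Nat.card_eq_fintype_card, Fintype.card_fin]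
  unfold bound at h
  omega

theorem total_eq_sum [Fintype ι] (p : Params) (f : ι → ℕ → ℂ) {g v N : ℕ} (w : κ → List Bool)
    (h : bound ι g v ≤ N) :
    total p f g v w =
      ∑ n ∈ Finset.range N, labSum p.faceWt p.𝔫 f (Fin n) g v w / n.factorial := by
  rw [total, finsum_eq_sum_of_support_subset]
  intro n hn
  by_contra hn'
  apply hn
  simp only [Finset.coe_range, Set.mem_Iio, not_lt] at hn'
  simp only
  rw [labSum_eq_zero_of_bound p f w (h.trans hn'), zero_div]

theorem total_eq_zero [Fintype ι] (p : Params) (f : ι → ℕ → ℂ) {g v : ℕ} (w : κ → List Bool) (k : κ)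
    (h : bound ι g v ≤ (w k).length) : total p f g v w = 0 := by
  rw [total_eq_sum p f w le_rfl]
  refine Finset.sum_eq_zero fun n hn => ?_
  rw [PMap.labSum_eq_zero_of_length _ _ _ _ _ _ k, zero_div]
  rw [Nat.card_eq_fintype_card, Fintype.card_fin]
  exact (Finset.mem_range.1 hn).trans_le h

theorem total_append_comm [Fintype ι] (p : Params) (f : ι → ℕ → ℂ) (g v : ℕ) (A B : List Bool) :
    total p f g v (fun _ : Unit => A ++ B) = total p f g v (fun _ : Unit => B ++ A) := by
  unfold total
  simp only [PMap.labSum_append_comm _ _ _ _ _ A B]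

theorem total_relabel {κ' ι' : Type} [Fintype ι] [Fintype ι'] [Finite κ] (p : Params)
    (f : ι' → ℕ → ℂ) (eκ : κ ≃ κ') (eι : ι ≃ ι') (g v : ℕ) (w : κ' → List Bool) :
    total p (fun i => f (eι i)) g v (fun k => w (eκ k)) = total p f g v w := by
  unfold total
  exact finsum_congr fun n => by rw [labSum_relabel _ _ f eκ eι (Equiv.refl _)]

/-- The factor `(n + 2) (n + 1)` for the choice of the root edge turns `(n + 2)!` into `n!`. -/
theorem total_cons [Fintype ι] (p : Params) (f : ι → ℕ → ℂ) {g v N : ℕ} (b : Bool) (w : List Bool)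
    (h : bound ι g v ≤ N) :
    total p f g v (fun _ : Unit => b :: w) = ∑ n ∈ Finset.range N,
      (∑ᶠ M ∈ (PMap.rooted (Fin n) g v (b :: w) : Set (PMap Unit ι (Ext (Fin n)))),
        M.wt p.faceWt p.𝔫 f) / n.factorial := by
  rw [total_eq_sum p f (N := N + 2) _ (by omega), Finset.sum_range_succ', Finset.sum_range_succ',
    PMap.labSum_cons_of_le_one _ _ _ le_rfl, PMap.labSum_cons_of_le_one _ _ _ zero_le_one,
    zero_div, zero_div, add_zero, add_zero]
  refine Finset.sum_congr rfl fun n _ => ?_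
  rw [PMap.labSum_cons, Nat.factorial_succ, Nat.factorial_succ]
  have h1 : ((n : ℂ) + 2) ≠ 0 := by exact_mod_cast (by omega : n + 2 ≠ 0)
  have h2 : ((n : ℂ) + 1) ≠ 0 := by exact_mod_cast (by omega : n + 1 ≠ 0)
  have h3 : (n.factorial : ℂ) ≠ 0 := by exact_mod_cast n.factorial_ne_zero
  push_cast
  have h4 : ((n : ℂ) + 1 + 1) ≠ 0 := by rwa [add_assoc, one_add_one_eq_two]
  field_simp
  ring

/-- Maps whose root face has degree `l` and no coloured side. -/
noncomputable def tot [Fintype ι] (p : Params) (f : ι → ℕ → ℂ) (g v l : ℕ) : ℂ :=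
  total p f g v (fun _ : Unit => List.replicate l false)

/-- Maps with two root faces without coloured sides. -/
noncomputable def tot₂ [Fintype ι] (p : Params) (f : ι → ℕ → ℂ) (g v l₁ l₂ : ℕ) : ℂ :=
  total p f g v (fun k : Bool => if k then List.replicate l₂ false else List.replicate l₁ false)

/-- Maps whose root face has two coloured sides, separated by `i` and by `m` uncoloured ones. -/
noncomputable def totH [Fintype ι] (p : Params) (f : ι → ℕ → ℂ) (g v i m : ℕ) : ℂ :=
  total p f g v (fun _ : Unit => true :: (List.replicate i false ++ true :: List.replicate m false))

theorem totH_comm [Fintype ι] (p : Params) (f : ι → ℕ → ℂ) (g v i m : ℕ) :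
    totH p f g v i m = totH p f g v m i := by
  unfold totH
  exact total_append_comm p f g v (true :: List.replicate i false) (true :: List.replicate m false)

theorem totH_eq_zero [Fintype ι] (p : Params) (f : ι → ℕ → ℂ) {g v i m : ℕ}
    (h : bound ι g v ≤ i + m) : totH p f g v i m = 0 :=
  total_eq_zero p f _ () (by simp; omega)

theorem tot_eq_zero [Fintype ι] (p : Params) (f : ι → ℕ → ℂ) {g v l : ℕ}
    (h : bound ι g v ≤ l) : tot p f g v l = 0 :=
  total_eq_zero p f _ () (by simpa using h)

/-- Recursion for maps whose root edge is crossed by a path. On the other side there is a triangle,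
where the path goes on to one of the two other sides, or the root face itself, and then the path is
a loop that crosses this edge only, of weight `𝔫`. -/
theorem totH_rec [Fintype ι] (p : Params) (f : ι → ℕ → ℂ) (g v i m : ℕ) :
    totH p f g v i m = -1 / p.c * (totH p f g v (i + 1) m + totH p f g v i (m + 1)) +
      p.𝔫 * tot₂ p f g v i m := by
  classical
  have h1 : totH p f g v (i + 1) m = total p f g v (fun _ : Unit =>
      [true, false] ++ (List.replicate i false ++ true :: List.replicate m false)) := by
    unfold totH; rw [List.replicate_succ]; rfl
  have h2 : totH p f g v i (m + 1) = total p f g v (fun _ : Unit =>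
      [false, true] ++ (List.replicate i false ++ true :: List.replicate m false)) := by
    have := total_append_comm p f g v [false]
      (true :: (List.replicate i false ++ true :: List.replicate m false))
    simp only [List.cons_append, List.nil_append, List.append_assoc] at this ⊢
    rw [this]
    unfold totH
    rw [List.replicate_succ']
  have hN : bound ι g v ≤ bound ι g v := le_rfl
  rw [h1, h2, tot₂, totH, total_cons p f _ _ hN, total_eq_sum p f _ hN, total_eq_sum p f _ hN,
    total_eq_sum p f _ hN, ← Finset.sum_add_distrib, Finset.mul_sum, Finset.mul_sum,
    ← Finset.sum_add_distrib]
  refine Finset.sum_congr rfl fun n _ => ?_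
  rw [PMap.sum_rooted_true, p.finsum_faceWt_true]
  ring

/-- There are `L + 1` pairs `(s, t)` with `s + t = L`: a marked face of degree `L + 1` can be
adjacent to the root edge along any of its edges. -/
theorem finsum_antidiagonal [Fintype ι] (G : ι → ℕ → ℂ) (N : ℕ) (hG : ∀ i L, N ≤ L → G i L = 0) :
    ∑ᶠ q : ι × ℕ × ℕ, G q.1 (q.2.1 + q.2.2) = ∑ i, ∑ L ∈ Finset.range N, (L + 1) * G i L := by
  classical
  rw [finsum_eq_sum_of_support_subset (s := Finset.univ ×ˢ
    ((Finset.range N ×ˢ Finset.range N).filter fun q => q.1 + q.2 < N)), Finset.sum_product]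
  · refine Finset.sum_congr rfl fun i _ => ?_
    rw [← Finset.sum_fiberwise_of_maps_to (g := fun q : ℕ × ℕ => q.1 + q.2)
      (t := Finset.range N) (by simp)]
    refine Finset.sum_congr rfl fun L hL => ?_
    rw [Finset.mem_range] at hL
    have : (((Finset.range N ×ˢ Finset.range N).filter fun q => q.1 + q.2 < N).filter
        fun q => q.1 + q.2 = L) = Finset.HasAntidiagonal.antidiagonal L := by
      ext q
      simp only [Finset.mem_filter, Finset.mem_product, Finset.mem_range,
        Finset.HasAntidiagonal.mem_antidiagonal]
      omega
    rw [this, Finset.sum_congr rfl (g := fun _ => G i L)]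
    · rw [Finset.sum_const, Finset.Nat.card_antidiagonal, nsmul_eq_mul]
      push_cast; rfl
    · intro q hq
      rw [Finset.HasAntidiagonal.mem_antidiagonal.1 hq]
  · intro q hq
    by_contra hq'
    apply hq
    refine hG _ _ ?_
    by_contra h
    apply hq'
    simp
    omega

/-- Recursion for maps whose root edge is not crossed by a path. On the other side there is an empty
polygon, a triangle with a piece of path, an auxiliary face, or the root face itself. -/
theorem tot_succ [Fintype ι] [DecidableEq ι] (p : Params) (f : ι → ℕ → ℂ) {g v N : ℕ} (l : ℕ)
    (hN : bound ι g v ≤ N) :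
    tot p f g v (l + 1) = ∑ j ∈ Finset.Icc 3 p.d, p.tHat j * tot p f g v (j - 1 + l) +
      -1 / p.c * totH p f g v 0 l +
      ∑ i, ∑ L ∈ Finset.range N, (L + 1) * (f i (L + 1) *
        tot p (fun j : {j // j ≠ i} => f j) g v (L + l)) +
      ∑ n ∈ Finset.range l, tot₂ p f g v n (l - 1 - n) := by
  have hN' : ∀ i : ι, bound {j // j ≠ i} g v ≤ N := fun i => by
    have := Fintype.card_subtype_le fun j => j ≠ i
    unfold bound at hN ⊢
    omega
  have hlen : ∀ (i : ι) (L n : ℕ), n < N → N ≤ L →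
      labSum p.faceWt p.𝔫 (fun j : {j // j ≠ i} => f j) (Fin n) g v
        (fun _ : Unit => List.replicate (L + l) false) = 0 := by
    intro i L n hn hL
    refine PMap.labSum_eq_zero_of_length _ _ _ _ _ _ () ?_
    rw [Nat.card_eq_fintype_card, Fintype.card_fin, List.length_replicate]
    omega
  have e1 : tot p f g v (l + 1) = ∑ n ∈ Finset.range N,
      (((∑ j ∈ Finset.Icc 3 p.d, p.tHat j * labSum p.faceWt p.𝔫 f (Fin n) g v
          (fun _ : Unit => List.replicate (j - 1 + l) false)) +
        -1 / p.c * labSum p.faceWt p.𝔫 f (Fin n) g v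
          (fun _ : Unit => true :: ([] ++ true :: List.replicate l false))) +
        (∑ i, ∑ L ∈ Finset.range N, (L + 1) * (f i (L + 1) *
          labSum p.faceWt p.𝔫 (fun j : {j // j ≠ i} => f j) (Fin n) g v
            (fun _ : Unit => List.replicate (L + l) false))) +
        ∑ k ∈ Finset.range l, labSum p.faceWt p.𝔫 f (Fin n) g v
          (fun b : Bool => if b then List.replicate (l - 1 - k) false
            else List.replicate k false)) / n.factorial := by
    rw [tot, List.replicate_succ, total_cons p f _ _ hN]
    refine Finset.sum_congr rfl fun n hn => ?_
    rw [← List.replicate_succ, PMap.sum_rooted_false, p.finsum_faceWt_false,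
      ← finsum_antidiagonal]
    · simp only [← List.replicate_add]
      rfl
    · intro i L hL
      rw [hlen i L n (Finset.mem_range.1 hn) hL, mul_zero]
  rw [e1]
  have e2 : ∀ l, tot p f g v l = _ := fun l => total_eq_sum p f _ hN
  have e3 : totH p f g v 0 l = _ := total_eq_sum p f _ hN
  have e4 : ∀ k m, tot₂ p f g v k m = _ := fun l m => total_eq_sum p f _ hN
  have e5 : ∀ i l, tot p (fun j : {j // j ≠ i} => f j) g v l = _ :=
    fun i l => total_eq_sum p _ _ (hN' i)
  simp only [e2, e3, e4, e5, add_div, Finset.sum_add_distrib, Finset.sum_div, Finset.mul_sum]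
  congr 1
  · congr 1
    · congr 1
      · rw [Finset.sum_comm]
        exact Finset.sum_congr rfl fun _ _ => Finset.sum_congr rfl fun _ _ => by ring
      · exact Finset.sum_congr rfl fun _ _ => by
          rw [List.replicate_zero]; ring
    · rw [Finset.sum_comm]
      refine Finset.sum_congr rfl fun i _ => ?_
      rw [Finset.sum_comm]
      exact Finset.sum_congr rfl fun _ _ => Finset.sum_congr rfl fun _ _ => by ring
  · rw [Finset.sum_comm]

theorem sum_antidiagonal_mul (a b : ℕ → ℂ) (N : ℕ) (ha : ∀ n, N ≤ n → a n = 0)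
    (hb : ∀ n, N ≤ n → b n = 0) :
    ∑ n ∈ Finset.range (2 * N), ∑ q ∈ Finset.HasAntidiagonal.antidiagonal n, a q.1 * b q.2 =
      (∑ n ∈ Finset.range N, a n) * ∑ n ∈ Finset.range N, b n := by
  rw [Finset.sum_mul_sum, ← Finset.sum_product', ← Finset.sum_fiberwise_of_maps_to
    (g := fun q : ℕ × ℕ => q.1 + q.2) (t := Finset.range (2 * N))]
  · refine Finset.sum_congr rfl fun n hn => ?_
    symm
    refine Finset.sum_subset_zero_on_sdiff ?_ ?_ fun _ _ => rfl
    · intro q hq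
      simp only [Finset.mem_filter] at hq
      exact Finset.HasAntidiagonal.mem_antidiagonal.2 hq.2
    · intro q hq
      simp only [Finset.mem_sdiff, Finset.HasAntidiagonal.mem_antidiagonal, Finset.mem_filter,
        Finset.mem_product, Finset.mem_range, not_and] at hq
      by_cases h1 : N ≤ q.1
      · rw [ha _ h1, zero_mul]
      · by_cases h2 : N ≤ q.2
        · rw [hb _ h2, mul_zero]
        · exact absurd hq.1 (hq.2 ⟨by omega, by omega⟩)
  · intro q hq
    simp at hq ⊢
    omega

/-- Distributing `n` labels on two maps: the binomial coefficient is absorbed by the factorials, as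
in a product of exponential generating functions. -/
theorem sum_finset_labSum {ι₁ ι₂ : Type} [Fintype ι₁] [Fintype ι₂] (p : Params) (f₁ : ι₁ → ℕ → ℂ)
    (f₂ : ι₂ → ℕ → ℂ) (g₁ g₂ v₁ v₂ : ℕ) (w₁ w₂ : Unit → List Bool) (n : ℕ) :
    (∑ S : Finset (Fin n), labSum p.faceWt p.𝔫 f₁ {a // a ∈ S} g₁ v₁ w₁ *
      labSum p.faceWt p.𝔫 f₂ {a // a ∉ S} g₂ v₂ w₂) / n.factorial =
    ∑ q ∈ Finset.HasAntidiagonal.antidiagonal n,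
      labSum p.faceWt p.𝔫 f₁ (Fin q.1) g₁ v₁ w₁ / q.1.factorial *
      (labSum p.faceWt p.𝔫 f₂ (Fin q.2) g₂ v₂ w₂ / q.2.factorial) := by
  have h1 : ∀ S : Finset (Fin n), labSum p.faceWt p.𝔫 f₁ {a // a ∈ S} g₁ v₁ w₁ *
      labSum p.faceWt p.𝔫 f₂ {a // a ∉ S} g₂ v₂ w₂ =
      labSum p.faceWt p.𝔫 f₁ (Fin S.card) g₁ v₁ w₁ *
      labSum p.faceWt p.𝔫 f₂ (Fin (n - S.card)) g₂ v₂ w₂ := by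
    intro S
    let e₁ : {a // a ∈ S} ≃ Fin S.card := Fintype.equivFinOfCardEq (by simp)
    let e₂ : {a // a ∉ S} ≃ Fin (n - S.card) := Fintype.equivFinOfCardEq (by
      rw [Fintype.card_subtype_compl, Fintype.card_fin, Fintype.card_coe])
    congr 1
    · exact labSum_relabel _ _ f₁ (Equiv.refl _) (Equiv.refl _) e₁ g₁ v₁ w₁
    · exact labSum_relabel _ _ f₂ (Equiv.refl _) (Equiv.refl _) e₂ g₂ v₂ w₂
  simp only [h1]
  have h2 := Finset.sum_powerset_apply_card (x := (Finset.univ : Finset (Fin n)))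
    (fun k => labSum p.faceWt p.𝔫 f₁ (Fin k) g₁ v₁ w₁ *
      labSum p.faceWt p.𝔫 f₂ (Fin (n - k)) g₂ v₂ w₂)
  rw [Finset.powerset_univ, Finset.card_univ, Fintype.card_fin] at h2
  rw [h2, Finset.sum_div, Finset.Nat.sum_antidiagonal_eq_sum_range_succ_mk]
  refine Finset.sum_congr rfl fun k hk => ?_
  rw [Finset.mem_range, Nat.lt_succ_iff] at hk
  have hn : (n.factorial : ℂ) = n.choose k * k.factorial * (n - k).factorial := by
    exact_mod_cast (Nat.choose_mul_factorial_mul_factorial hk).symm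
  have c1 : (n.choose k : ℂ) ≠ 0 := by exact_mod_cast (Nat.choose_pos hk).ne'
  have c2 : (k.factorial : ℂ) ≠ 0 := by exact_mod_cast k.factorial_ne_zero
  have c3 : ((n - k).factorial : ℂ) ≠ 0 := by exact_mod_cast (n - k).factorial_ne_zero
  rw [nsmul_eq_mul, hn]
  field_simp

/-- The maps with two root faces in the same component. -/
noncomputable def totLinked [Fintype ι] (p : Params) (f : ι → ℕ → ℂ) : ℕ → ℕ → ℕ → ℕ → ℂ
  | 0, _, _, _ => 0
  | g + 1, v, l₁, l₂ =>
    tot p (fun o : Option ι => o.elim (fun l => if l = l₂ then 1 else 0) f) g v l₁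

/-- Maps with two root faces are connected, of genus lower by one, or have two components. -/
theorem tot₂_eq [Fintype ι] [DecidableEq ι] (p : Params) (f : ι → ℕ → ℂ) (g v l₁ l₂ : ℕ) :
    tot₂ p f g v l₁ l₂ = totLinked p f g v l₁ l₂ +
      ∑ J : Finset ι, ∑ a ∈ Finset.HasAntidiagonal.antidiagonal g,
        ∑ b ∈ Finset.HasAntidiagonal.antidiagonal v,
        tot p (fun i : {i // i ∈ J} => f i) a.1 b.1 l₁ *
        tot p (fun i : {i // i ∉ J} => f i) a.2 b.2 l₂ := by
  have hN : bound ι g v ≤ 2 * bound ι g v := by omega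
  have hL : totLinked p f g v l₁ l₂ = ∑ n ∈ Finset.range (2 * bound ι g v),
      PMap.linkedSum p.faceWt p.𝔫 f (Fin n) g v l₁ l₂ / n.factorial := by
    cases g with
    | zero => simp [totLinked, PMap.linkedSum]
    | succ g =>
      have : bound (Option ι) g v ≤ 2 * bound ι (g + 1) v := by
        unfold bound
        rw [Fintype.card_option]
        omega
      exact total_eq_sum p _ _ this
  rw [tot₂, total_eq_sum p f _ hN, hL]
  simp only [PMap.labSum_bool, add_div, Finset.sum_add_distrib]
  congr 1
  have hb₁ : ∀ (J : Finset ι), ∀ a ∈ Finset.HasAntidiagonal.antidiagonal g,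
      ∀ b ∈ Finset.HasAntidiagonal.antidiagonal v,
      bound {i // i ∈ J} a.1 b.1 ≤ bound ι g v := by
    intro J a ha b hb
    rw [Finset.HasAntidiagonal.mem_antidiagonal] at ha hb
    have := Fintype.card_subtype_le fun i => i ∈ J
    unfold bound
    omega
  have hb₂ : ∀ (J : Finset ι), ∀ a ∈ Finset.HasAntidiagonal.antidiagonal g,
      ∀ b ∈ Finset.HasAntidiagonal.antidiagonal v,
      bound {i // i ∉ J} a.2 b.2 ≤ bound ι g v := by
    intro J a ha b hb
    rw [Finset.HasAntidiagonal.mem_antidiagonal] at ha hb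
    have := Fintype.card_subtype_le fun i => i ∉ J
    unfold bound
    omega
  -- After distributing the labels, only Cauchy products over `n` remain.
  have key : ∀ n, (∑ J : Finset ι, ∑ S : Finset (Fin n),
      ∑ a ∈ Finset.HasAntidiagonal.antidiagonal g, ∑ b ∈ Finset.HasAntidiagonal.antidiagonal v,
      labSum p.faceWt p.𝔫 (fun i : {i // i ∈ J} => f i) {a // a ∈ S} a.1 b.1
        (fun _ : Unit => List.replicate l₁ false) *
      labSum p.faceWt p.𝔫 (fun i : {i // i ∉ J} => f i) {a // a ∉ S} a.2 b.2
        (fun _ : Unit => List.replicate l₂ false)) / (n.factorial : ℂ) =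
      ∑ J : Finset ι, ∑ a ∈ Finset.HasAntidiagonal.antidiagonal g,
        ∑ b ∈ Finset.HasAntidiagonal.antidiagonal v, ∑ q ∈ Finset.HasAntidiagonal.antidiagonal n,
        labSum p.faceWt p.𝔫 (fun i : {i // i ∈ J} => f i) (Fin q.1) a.1 b.1
          (fun _ : Unit => List.replicate l₁ false) / q.1.factorial *
        (labSum p.faceWt p.𝔫 (fun i : {i // i ∉ J} => f i) (Fin q.2) a.2 b.2
          (fun _ : Unit => List.replicate l₂ false) / q.2.factorial) := by
    intro n
    simp only [← sum_finset_labSum, ← Finset.sum_div]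
    congr 1
    refine Finset.sum_congr rfl fun J _ => ?_
    rw [Finset.sum_comm]
    refine Finset.sum_congr rfl fun a _ => ?_
    rw [Finset.sum_comm]
  simp only [key]
  rw [Finset.sum_comm]
  refine Finset.sum_congr rfl fun J _ => ?_
  rw [Finset.sum_comm]
  refine Finset.sum_congr rfl fun a ha => ?_
  rw [Finset.sum_comm]
  refine Finset.sum_congr rfl fun b hb => ?_
  rw [sum_antidiagonal_mul
    (fun k => labSum p.faceWt p.𝔫 (fun i : {i // i ∈ J} => f i) (Fin k) a.1 b.1
          (fun _ : Unit => List.replicate l₁ false) / k.factorial)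
    (fun k => labSum p.faceWt p.𝔫 (fun i : {i // i ∉ J} => f i) (Fin k) a.2 b.2
          (fun _ : Unit => List.replicate l₂ false) / k.factorial)]
  · rw [tot, tot, total_eq_sum p _ _ (hb₁ J a ha b hb), total_eq_sum p _ _ (hb₂ J a ha b hb)]
  · intro n hn
    rw [labSum_eq_zero_of_bound p _ _ ((hb₁ J a ha b hb).trans hn), zero_div]
  · intro n hn
    rw [labSum_eq_zero_of_bound p _ _ ((hb₂ J a ha b hb).trans hn), zero_div]

end ONModel

/-! ### From loop maps to labelled maps -/

namespace ONModel

open Equiv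

section Cyc

variable {D : Type} [Finite D]

/-- The cycle through `a`, listed from `a`. -/
noncomputable def cyc (σ : Perm D) (a : D) : List D := a :: (exists_isCyc σ a).choose

theorem isCyc_cyc (σ : Perm D) (a : D) : IsCyc σ (cyc σ a) := (exists_isCyc σ a).choose_spec

/-- A cycle is determined by its first element. -/
theorem IsCyc.eq_cyc {σ : Perm D} {a : D} {l : List D} (h : IsCyc σ (a :: l)) :
    a :: l = cyc σ a := congrArg (List.cons a) (h.unique (isCyc_cyc σ a))

theorem mem_cyc {σ : Perm D} {a b : D} : b ∈ cyc σ a ↔ σ.SameCycle a b :=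
  ((isCyc_cyc σ a).sameCycle_iff (by simp [cyc])).symm

theorem self_mem_cyc (σ : Perm D) (a : D) : a ∈ cyc σ a := by simp [cyc]

theorem length_cyc (σ : Perm D) (a : D) : (cyc σ a).length = Function.minimalPeriod σ a :=
  ((isCyc_cyc σ a).minimalPeriod_eq (self_mem_cyc σ a)).symm

end Cyc

/-- The colour words of the unmarked faces: empty polygons, and triangles with a piece of path. -/
def ValidWord (d : ℕ) (w : List Bool) : Prop :=
  (w.count true = 0 ∧ 3 ≤ w.count false ∧ w.count false ≤ d) ∨
    (w.count true = 2 ∧ w.count false = 1)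

namespace PMap

/-- The unmarked faces are of the two allowed types. -/
def Good {κ ι D : Type} (d : ℕ) (M : PMap κ ι D) : Prop :=
  ∀ l, l ≠ [] → IsCyc M.face l → (∀ a ∈ l, M.Unm a) → ValidWord d (l.map M.col)

end PMap

namespace LoopMap

variable {d : ℕ} {ι ι' D D' : Type} [Finite D] [Finite D']

open Classical in
/-- The presentation of a map by lists of half-edges; `e` chooses the root face among the marked
faces. -/
noncomputable def toPMap (e : Option ι ≃ ι') (M : LoopMap d ι' D) : PMap Unit ι D where
  face := M.face
  glue := M.glue
  col a := decide (a ∈ M.path)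
  main _ := cyc M.face (M.root (e none))
  aux i := cyc M.face (M.root (e (some i)))

variable {e : Option ι ≃ ι'}

theorem col_toPMap {M : LoopMap d ι' D} {a : D} : (M.toPMap e).col a = true ↔ a ∈ M.path := by
  simp [toPMap]

theorem col_toPMap_false {M : LoopMap d ι' D} {a : D} :
    (M.toPMap e).col a = false ↔ a ∉ M.path := by
  simp [toPMap]

theorem toPMap_unm {M : LoopMap d ι' D} {a : D} :
    (M.toPMap e).Unm a ↔ ∀ i, ¬ M.face.SameCycle (M.root i) a := by
  simp only [PMap.Unm, toPMap, mem_cyc]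
  rw [← e.forall_congr_right, Option.forall]
  simp

theorem toPMap_ok (M : LoopMap d ι' D) : (M.toPMap e).Ok where
  glue_glue := M.glue_glue
  glue_ne := M.glue_ne
  col_glue a := by
    rw [Bool.eq_iff_iff, col_toPMap, col_toPMap]
    exact ⟨fun h => M.glue_glue a ▸ M.path_glue _ h, M.path_glue a⟩
  main_cyc _ := isCyc_cyc _ _
  aux_cyc _ := isCyc_cyc _ _
  aux_ne _ := List.cons_ne_nil _ _
  aux_col i a ha := col_toPMap_false.2 fun h => M.path_unmarked a h _ (mem_cyc.1 ha)
  main_main _ _ _ _ _ := rfl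
  aux_aux i j a ha ha' := by
    have := M.root_face _ _ ((mem_cyc.1 ha).trans (mem_cyc.1 ha').symm)
    simpa using this
  main_aux _ i a ha ha' := by
    have := M.root_face _ _ ((mem_cyc.1 ha).trans (mem_cyc.1 ha').symm)
    simp at this
  conn S s1 s2 s3 a := by
    obtain ⟨s, hs, rfl⟩ := M.connected (M.root (e none)) a
    have key : ∀ s ∈ Subgroup.closure {M.face, M.glue}, ∀ x, s x ∈ S ↔ x ∈ S := by
      intro s hs
      induction hs using Subgroup.closure_induction with
      | mem s hs =>
        rcases hs with rfl | rfl
        · exact PMap.perm_mem_iff M.face s1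
        · exact PMap.perm_mem_iff M.glue s2
      | one => simp
      | mul s t _ _ ihs iht => intro x; rw [Perm.mul_apply, ihs, iht]
      | inv s _ ih => intro x; rw [← ih]; simp
    exact (key s hs _).2 (s3 () _ (self_mem_cyc _ _))

theorem toPMap_good (M : LoopMap d ι' D) : (M.toPMap e).Good d := by
  intro l hne hl hu
  have hl' : IsCyc M.face l := hl
  by_cases h : ∃ a ∈ l, a ∈ M.path
  · obtain ⟨a, ha, hp⟩ := h
    obtain ⟨m, hm, hr⟩ := hl'.exists_cons ha
    obtain ⟨h3, hx⟩ := M.path_triangle a hp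
    rw [hm.minimalPeriod_eq (by simp), List.length_cons, Nat.add_left_inj, List.length_eq_two] at h3
    obtain ⟨b, c, rfl⟩ := h3
    have h4 := (isCyc_cons.1 hm).2
    simp only [List.map_cons, List.map_nil, List.cons_append, List.nil_append,
      List.cons.injEq, and_true] at h4
    rw [h4.1, h4.2.1] at hx
    have hperm := (hr.perm.map (M.toPMap e).col)
    right
    rw [hperm.count_eq, hperm.count_eq]
    have ca := (col_toPMap (e := e)).2 hp
    by_cases hb : b ∈ M.path
    · have hc : c ∉ M.path := fun hc => hx ⟨fun _ => hc, fun _ => hb⟩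
      simp [ca, (col_toPMap (e := e)).2 hb, (col_toPMap_false (e := e)).2 hc]
    · have hc : c ∈ M.path := by
        by_contra hc
        exact hx ⟨fun h => absurd h hb, fun h => absurd h hc⟩
      simp [ca, (col_toPMap (e := e)).2 hc, (col_toPMap_false (e := e)).2 hb]
  · push Not at h
    left
    obtain ⟨a, ha⟩ := List.exists_mem_of_ne_nil l hne
    have h0 : (l.map (M.toPMap e).col).count true = 0 := by
      rw [List.count_eq_zero, List.mem_map]
      rintro ⟨b, hb, hc⟩
      exact h b hb (col_toPMap.1 hc)
    have h1 := List.count_true_add_count_false (l.map (M.toPMap e).col)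
    have h2 := M.degree_mem a (toPMap_unm.1 (hu a ha)) fun b hb hba =>
      h b ((hl'.sameCycle_iff ha).1 hba.symm) hb
    rw [hl'.minimalPeriod_eq ha] at h2
    rw [List.length_map] at h1
    exact ⟨h0, by omega, by omega⟩

theorem toPMap_injective : Function.Injective (toPMap e : LoopMap d ι' D → PMap Unit ι D) := by
  intro M M' h
  have h1 : M.face = M'.face := congrArg PMap.face h
  have h2 : M.glue = M'.glue := congrArg PMap.glue h
  have h3 : M.path = M'.path := by
    ext a
    rw [← col_toPMap (e := e), h, col_toPMap]
  have h4 : M.root = M'.root := by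
    funext i
    obtain ⟨o, rfl⟩ := e.surjective i
    cases o with
    | none => exact (List.cons.inj (congrFun (congrArg PMap.main h) ())).1
    | some i => exact (List.cons.inj (congrFun (congrArg PMap.aux h) i)).1
  cases M; cases M'
  simp only at h1 h2 h3 h4
  subst h1 h2 h3 h4
  rfl

/-- The labelled maps that present a loop map are those whose unmarked faces are empty polygons and
triangles with a piece of path, and whose main face is not crossed by a path. The map reduced to a
vertex, which has no half-edges, is not of this form. -/
theorem exists_toPMap [Nonempty D] {M' : PMap Unit ι D} (H : M'.Ok) (hG : M'.Good d)
    (hc : ∀ a ∈ M'.main (), M'.col a = false) : ∃ M : LoopMap d ι' D, M.toPMap e = M' := by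
  have hne : M'.main () ≠ [] := by
    intro h
    obtain ⟨a⟩ := ‹Nonempty D›
    exact H.conn ∅ (by simp) (by simp) (by rintro ⟨⟩ a ha; simp [h] at ha) a
  let L : Option ι → List D := fun o => o.elim (M'.main ()) M'.aux
  have hL : ∀ o, L o ≠ [] := by
    rintro (_ | i)
    · exact hne
    · exact H.aux_ne i
  have hLc : ∀ o, IsCyc M'.face (L o) := by
    rintro (_ | i)
    · exact H.main_cyc ()
    · exact H.aux_cyc i
  have hLcol : ∀ o, ∀ a ∈ L o, M'.col a = false := by
    rintro (_ | i)
    · exact hc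
    · exact H.aux_col i
  have hLdis : ∀ o o' a, a ∈ L o → a ∈ L o' → o = o' := by
    rintro (_ | i) (_ | j) a ha ha'
    · rfl
    · exact (H.main_aux () j a ha ha').elim
    · exact (H.main_aux () i a ha' ha).elim
    · exact congrArg some (H.aux_aux i j a ha ha')
  choose R T hRT using fun o => List.exists_cons_of_ne_nil (hL o)
  have hR : ∀ o, R o ∈ L o := fun o => by rw [hRT]; simp
  have hsame : ∀ o x, M'.face.SameCycle (R o) x ↔ x ∈ L o := fun o x =>
    (hLc o).sameCycle_iff (hR o)
  have hunm : ∀ a, M'.Unm a ↔ ∀ o, a ∉ L o := by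
    intro a
    rw [Option.forall]
    exact ⟨fun h => ⟨h.1 (), h.2⟩, fun h => ⟨fun _ => h.1, h.2⟩⟩
  have hcycle : ∀ a, M'.Unm a → ValidWord d ((cyc M'.face a).map M'.col) := fun a ha =>
    hG _ (List.cons_ne_nil _ _) (isCyc_cyc _ _)
      (PMap.Cut.unm_of_sameCycle H (isCyc_cyc _ _) (self_mem_cyc _ _) ha)
  let M : LoopMap d ι' D :=
    { face := M'.face
      glue := M'.glue
      path := {a | M'.col a = true}
      root := fun i => R (e.symm i)
      glue_glue := H.glue_glue
      glue_ne := H.glue_ne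
      nonempty := inferInstance
      connected := by
        have key : ∀ x, ∃ s ∈ Subgroup.closure {M'.face, M'.glue}, s (R none) = x := by
          refine H.conn {x | ∃ s ∈ Subgroup.closure {M'.face, M'.glue}, s (R none) = x} ?_ ?_ ?_
          · rintro _ ⟨s, hs, rfl⟩
            exact ⟨M'.face * s, mul_mem (Subgroup.subset_closure (by simp)) hs, rfl⟩
          · rintro _ ⟨s, hs, rfl⟩
            exact ⟨M'.glue * s, mul_mem (Subgroup.subset_closure (by simp)) hs, rfl⟩
          · rintro ⟨⟩ x hx
            obtain ⟨j, hj⟩ := (hsame none x).2 hx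
            exact ⟨M'.face ^ j, zpow_mem (Subgroup.subset_closure (by simp)) j, hj⟩
        intro a b
        obtain ⟨s, hs, rfl⟩ := key a
        obtain ⟨t, ht, rfl⟩ := key b
        exact ⟨t * s⁻¹, mul_mem ht (inv_mem hs), by simp⟩
      root_face := by
        intro i j h
        rw [hsame] at h
        exact e.symm.injective (hLdis _ _ _ h (hR _))
      path_glue := fun a ha => (H.col_glue a).trans ha
      path_unmarked := by
        intro a ha i h
        rw [hsame] at h
        have h1 := hLcol _ a h
        rw [Set.mem_ofPred_eq, h1] at ha
        exact Bool.false_ne_true ha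
      path_triangle := by
        intro a ha
        rw [Set.mem_ofPred_eq] at ha
        have hu : M'.Unm a := (hunm a).2 fun o h => by
          rw [hLcol o a h] at ha; exact Bool.false_ne_true ha
        have hv := hcycle a hu
        have hm := isCyc_cyc M'.face a
        obtain ⟨m, hm'⟩ : ∃ m, cyc M'.face a = a :: m := ⟨_, rfl⟩
        rw [hm'] at hv hm
        have h1 := List.count_true_add_count_false ((a :: m).map M'.col)
        rcases hv with ⟨h0, -⟩ | ⟨h2, h3⟩
        · simp [ha] at h0
        · rw [h2, h3, List.length_map, List.length_cons] at h1
          have h4 : m.length = 2 := by omega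
          obtain ⟨b, c, rfl⟩ := List.length_eq_two.1 h4
          have h5 := (isCyc_cons.1 hm).2
          simp only [List.map_cons, List.map_nil, List.cons_append, List.nil_append,
            List.cons.injEq, and_true] at h5
          refine ⟨by rw [hm.minimalPeriod_eq (by simp)]; rfl, ?_⟩
          rw [h5.1, h5.2.1, Set.mem_ofPred_eq, Set.mem_ofPred_eq]
          simp only [List.map_cons, List.map_nil, ha] at h2
          cases hb : M'.col b <;> cases hc : M'.col c <;> simp [hb, hc] at h2 ⊢
      degree_mem := by
        intro a ha hp
        have hu : M'.Unm a := (hunm a).2 fun o h => ha (e o) (by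
          rw [e.symm_apply_apply, hsame]; exact h)
        have hv := hcycle a hu
        have h0 : ((cyc M'.face a).map M'.col).count true = 0 := by
          rw [List.count_eq_zero, List.mem_map]
          rintro ⟨b, hb, hc⟩
          exact hp b hc (mem_cyc.1 hb).symm
        have h1 := List.count_true_add_count_false ((cyc M'.face a).map M'.col)
        rw [List.length_map, length_cyc] at h1
        rcases hv with ⟨-, h2, h3⟩ | ⟨h2, -⟩
        · omega
        · omega }
  refine ⟨M, ?_⟩
  have hcyc : ∀ o, cyc M'.face (R o) = L o := by
    intro o
    have := hLc o
    rw [hRT] at this ⊢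
    exact this.eq_cyc.symm
  have hcol : ∀ a, (M.toPMap e).col a = M'.col a := by
    intro a
    rw [Bool.eq_iff_iff, col_toPMap]
    exact Iff.rfl
  have hmain : (M.toPMap e).main () = M'.main () := by
    change cyc M'.face (R (e.symm (e none))) = _
    rw [e.symm_apply_apply, hcyc]
    rfl
  have haux : ∀ i, (M.toPMap e).aux i = M'.aux i := by
    intro i
    change cyc M'.face (R (e.symm (e (some i)))) = _
    rw [e.symm_apply_apply, hcyc]
    rfl
  obtain ⟨f, g, c, m, x⟩ := M'
  have e1 : (M.toPMap e).face = f := rfl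
  have e2 : (M.toPMap e).glue = g := rfl
  have e3 : (M.toPMap e).col = c := funext hcol
  have e4 : (M.toPMap e).main = m := funext fun _ => hmain
  have e5 : (M.toPMap e).aux = x := funext haux
  rw [← e1, ← e2, ← e3, ← e4, ← e5]

/-- Isomorphisms of loop maps are relabellings of the half-edges of their presentations. -/
theorem isIso_iff {M : LoopMap d ι' D} {M' : LoopMap d ι' D'} {σ : D ≃ D'} :
    IsIso M M' σ ↔
      (M.toPMap e).relabel (Equiv.refl _) (Equiv.refl _) σ = M'.toPMap e := by
  constructor
  · rintro ⟨h1, h2, h3, h4⟩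
    have hcyc : ∀ a, (cyc M.face a).map σ = cyc M'.face (σ a) := fun a =>
      ((isCyc_cyc M.face a).map σ.injective fun a _ => (h1 a).symm).eq_cyc
    simp only [PMap.relabel, toPMap, PMap.mk.injEq, Equiv.refl_symm, Equiv.refl_apply, hcyc, h4]
    refine ⟨?_, ?_, ?_, trivial, trivial⟩
    · ext a; simp [h1]
    · ext a; simp [h2]
    · funext a; rw [decide_eq_decide, h3, σ.apply_symm_apply]
  · intro h
    have h1 := congrArg PMap.face h
    have h2 := congrArg PMap.glue h
    have h3 := congrArg PMap.col h
    have h4 := congrFun (congrArg PMap.main h) ()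
    have h5 := fun i => congrFun (congrArg PMap.aux h) i
    refine ⟨fun a => ?_, fun a => ?_, fun a => ?_, fun i => ?_⟩
    · have := Equiv.congr_fun h1 (σ a)
      simpa [PMap.relabel, toPMap] using this
    · have := Equiv.congr_fun h2 (σ a)
      simpa [PMap.relabel, toPMap] using this
    · have := congrFun h3 (σ a)
      simpa [PMap.relabel, toPMap] using this
    · obtain ⟨o, rfl⟩ := e.surjective i
      cases o with
      | none => exact (List.cons.inj h4).1
      | some i => exact (List.cons.inj (h5 i)).1

theorem numVertices_eq (M : LoopMap d ι' D) : M.numVertices = (M.toPMap e).nv := by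
  rw [numVertices, PMap.nv]
  have : IsEmpty {k // (M.toPMap e).main k = []} := ⟨fun ⟨k, hk⟩ => List.cons_ne_nil _ _ hk⟩
  rw [Nat.card_of_isEmpty (α := {k // (M.toPMap e).main k = []}), add_zero]
  exact card_quotient_sameCycle _

omit [Finite D] in
theorem two_mul_card_edge (M : LoopMap d ι' D) : 2 * Nat.card M.Edge = Nat.card D := by
  have h := Nat.card_eq_of_bijective
    (fun z : M.Edge × Bool => if z.2 then Quotient.out z.1 else M.glue (Quotient.out z.1)) ?_
  · rw [← h, Nat.card_prod, Nat.card_eq_fintype_card (α := Bool), Fintype.card_bool, mul_comm]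
  -- Each edge consists of a chosen half-edge and of its image under the gluing.
  have hpow : ∀ a b, M.glue.SameCycle a b → b = a ∨ b = M.glue a := by
    rintro a _ ⟨j, rfl⟩
    have h2 : M.glue ^ (2 : ℤ) = 1 := by
      ext b
      rw [zpow_two, Perm.mul_apply, M.glue_glue]; rfl
    rcases Int.even_or_odd' j with ⟨i, rfl | rfl⟩
    · left; rw [zpow_mul, h2, one_zpow]; rfl
    · right; rw [zpow_add, zpow_mul, h2, one_zpow, one_mul, zpow_one]
  have hout : ∀ q : M.Edge, Quotient.mk (Perm.SameCycle.setoid M.glue) (Quotient.out q) = q :=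
    fun q => Quotient.out_eq q
  have hglue : ∀ a, Quotient.mk (Perm.SameCycle.setoid M.glue) (M.glue a) =
      Quotient.mk (Perm.SameCycle.setoid M.glue) a := fun a =>
    Quotient.sound (Perm.sameCycle_apply_left.2 (Perm.SameCycle.refl _ _))
  constructor
  · rintro ⟨q, b⟩ ⟨q', b'⟩ h
    have hq : q = q' := by
      have := congrArg (Quotient.mk (Perm.SameCycle.setoid M.glue)) h
      cases b <;> cases b' <;> simp [hglue, hout] at this <;> exact this
    subst hq
    cases b <;> cases b' <;> simp at h ⊢
    · exact M.glue_ne _ h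
    · exact M.glue_ne _ h.symm
  · intro a
    let q : M.Edge := Quotient.mk _ a
    rcases hpow (Quotient.out q) a (Quotient.exact (Quotient.out_eq q)) with h | h
    · exact ⟨(q, true), by simp [← h]⟩
    · exact ⟨(q, false), by simp [← h]⟩

theorem hasGenus_iff [Finite ι] (M : LoopMap d ι' D) (g : ℕ) :
    M.HasGenus g ↔ (M.toPMap e).Genus g := by
  have hF : Nat.card M.Face = _ :=
    (card_quotient_sameCycle M.face).trans (M.toPMap_ok (e := e)).cycNum_face
  have hV : Nat.card M.Vertex = _ := M.numVertices_eq (e := e)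
  have hE := M.two_mul_card_edge
  have hm : Nat.card {k // (M.toPMap e).main k ≠ []} = 1 := by
    classical
    rw [PMap.card_unit, if_pos (show (M.toPMap e).main () ≠ [] from List.cons_ne_nil _ _)]
  unfold HasGenus PMap.Genus
  rw [hF, hV, hm, Nat.card_unique (α := Unit)]
  omega

theorem numLoops_eq (M : LoopMap d ι' D) : M.numLoops = (M.toPMap e).loops := by
  unfold numLoops PMap.loops
  refine Nat.card_congr (Quot.congr (Equiv.subtypeEquivRight fun a => col_toPMap.symm) ?_)
  intro a b
  exact Iff.rfl

/-- The face, as a cyclic list of half-edges. -/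
noncomputable def faceCycle (M : LoopMap d ι' D) : M.Face → Cycle D :=
  Quotient.lift (fun a => (cyc M.face a : Cycle D)) fun a b (h : M.face.SameCycle a b) =>
    Cycle.coe_eq_coe.2 ((isCyc_cyc M.face a).isRotated (isCyc_cyc M.face b) (mem_cyc.2 h)
      (self_mem_cyc _ _))

theorem faceCycle_injective (M : LoopMap d ι' D) : Function.Injective M.faceCycle := by
  rintro ⟨a⟩ ⟨b⟩ h
  refine Quotient.sound (?_ : M.face.SameCycle a b)
  rw [← mem_cyc, (Cycle.coe_eq_coe.1 h).mem_iff]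
  exact self_mem_cyc _ _

theorem faceCycle_mem_faces (M : LoopMap d ι' D) (a : D) :
    M.faceCycle (Quotient.mk _ a) ∈ (M.toPMap e).faces ↔ ∀ i, ¬ M.face.SameCycle (M.root i) a := by
  rw [← toPMap_unm (e := e)]
  constructor
  · rintro ⟨l, hne, hl, hc, hu⟩
    refine hu a ((Cycle.coe_eq_coe.1 hl).mem_iff.2 (self_mem_cyc _ _))
  · intro h
    exact ⟨_, List.cons_ne_nil _ _, rfl, isCyc_cyc M.face a,
      PMap.Cut.unm_of_sameCycle (M.toPMap_ok) (isCyc_cyc M.face a) (self_mem_cyc _ _) h⟩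

theorem exists_faceCycle {M : LoopMap d ι' D} {s : Cycle D} (h : s ∈ (M.toPMap e).faces) :
    ∃ a : D, M.faceCycle (Quotient.mk _ a) = s := by
  obtain ⟨l, hne, rfl, hc, hu⟩ := h
  obtain ⟨a, ha⟩ := List.exists_mem_of_ne_nil l hne
  exact ⟨a, Cycle.coe_eq_coe.2 ((isCyc_cyc M.face a).isRotated hc (self_mem_cyc _ _) ha)⟩

/-- The weights of the unmarked faces. -/
theorem prod_faces (p : Params) (M : LoopMap p.d ι' D) :
    ∏ᶠ s ∈ (M.toPMap e).faces, p.faceWt (s.map (M.toPMap e).col) =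
      (-1 / p.c) ^ M.numPathTriangles * ∏ j ∈ Finset.Icc 3 p.d, p.tHat j ^ M.numEmpty j := by
  classical
  set F := (M.toPMap e).faces_finite.toFinset with hF
  have hFm : ∀ s, s ∈ F ↔ s ∈ (M.toPMap e).faces := fun s => Set.Finite.mem_toFinset _
  rw [finprod_mem_eq_finite_toFinset_prod _ (M.toPMap e).faces_finite, ← hF]
  let P : Cycle D → Prop := fun s => ∃ a ∈ M.path, a ∈ s
  have hmem : ∀ a b, b ∈ M.faceCycle (Quotient.mk _ a) ↔ M.face.SameCycle a b := fun a b => by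
    rw [← mem_cyc]; exact Iff.rfl
  have hword : ∀ a, (∀ i, ¬ M.face.SameCycle (M.root i) a) →
      ValidWord p.d ((cyc M.face a).map (M.toPMap e).col) := fun a ha =>
    M.toPMap_good (e := e) _ (List.cons_ne_nil _ _) (isCyc_cyc M.face a)
      (PMap.Cut.unm_of_sameCycle (M.toPMap_ok) (isCyc_cyc M.face a) (self_mem_cyc _ _)
        (toPMap_unm.2 ha))
  have hP : ∀ a, P (M.faceCycle (Quotient.mk _ a)) ↔
      ((cyc M.face a).map (M.toPMap e).col).count true ≠ 0 := by
    intro a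
    rw [Ne, List.count_eq_zero, not_not, List.mem_map]
    simp only [P, hmem, mem_cyc, col_toPMap]
    exact ⟨fun ⟨b, h1, h2⟩ => ⟨b, h2, h1⟩, fun ⟨b, h1, h2⟩ => ⟨b, h2, h1⟩⟩
  -- `P` tells the triangles with a piece of path from the empty polygons.
  rw [← Finset.prod_filter_mul_prod_filter_not F P]
  congr 1
  · rw [Finset.prod_congr rfl (g := fun _ => -1 / p.c), Finset.prod_const]
    · congr 1
      rw [numPathTriangles, ← Set.ncard_coe_finset]
      have : ((F.filter P : Finset (Cycle D)) : Set (Cycle D)) =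
          M.faceCycle '' {q | ∃ a ∈ M.path, Quotient.mk _ a = q} := by
        ext s
        simp only [Finset.coe_filter, Set.mem_ofPred_eq, Set.mem_image, hFm]
        constructor
        · rintro ⟨hs, b, hb, hbs⟩
          obtain ⟨a, rfl⟩ := exists_faceCycle hs
          exact ⟨_, ⟨b, hb, Quotient.sound ((hmem a b).1 hbs).symm⟩, rfl⟩
        · rintro ⟨_, ⟨b, hb, rfl⟩, rfl⟩
          exact ⟨(M.faceCycle_mem_faces b).2 (M.path_unmarked b hb), b, hb,
            (hmem b b).2 (Perm.SameCycle.refl _ _)⟩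
      rw [this, Set.ncard_image_of_injective _ M.faceCycle_injective, ← Nat.card_coe_set_eq]
      rfl
    · intro s hs
      rw [Finset.mem_filter, hFm] at hs
      obtain ⟨a, rfl⟩ := exists_faceCycle hs.1
      have h1 := (hP a).1 hs.2
      have h2 := hword a ((M.faceCycle_mem_faces a).1 hs.1)
      change p.faceWt (((cyc M.face a).map (M.toPMap e).col : List Bool) : Cycle Bool) = _
      rcases h2 with h2 | h2
      · exact absurd h2.1 h1
      · rw [Params.faceWt_coe, if_neg (fun h => h1 h.1), if_pos h2]
  · have hval : ∀ s ∈ F.filter (fun s => ¬ P s), p.faceWt (s.map (M.toPMap e).col) =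
        p.tHat s.length ∧ s.length ∈ Finset.Icc 3 p.d := by
      intro s hs
      rw [Finset.mem_filter, hFm] at hs
      obtain ⟨a, rfl⟩ := exists_faceCycle hs.1
      have h1 := hs.2
      rw [hP, not_not] at h1
      have h2 := hword a ((M.faceCycle_mem_faces a).1 hs.1)
      have h3 := List.count_true_add_count_false ((cyc M.face a).map (M.toPMap e).col)
      rw [h1, zero_add, List.length_map] at h3
      have hlen : (M.faceCycle (Quotient.mk _ a)).length = (cyc M.face a).length := rfl
      rcases h2 with h2 | h2
      · rw [hlen, ← h3]
        refine ⟨?_, Finset.mem_Icc.2 h2.2⟩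
        change p.faceWt (((cyc M.face a).map (M.toPMap e).col : List Bool) : Cycle Bool) = _
        rw [Params.faceWt_coe, if_pos h2]
      · omega
    rw [Finset.prod_congr rfl fun s hs => (hval s hs).1,
      ← Finset.prod_fiberwise_of_maps_to fun s hs => (hval s hs).2]
    refine Finset.prod_congr rfl fun j hj => ?_
    rw [Finset.prod_congr rfl (g := fun _ => p.tHat j)
      (fun s hs => by rw [(Finset.mem_filter.1 hs).2]), Finset.prod_const]
    congr 1
    rw [numEmpty, ← Set.ncard_coe_finset]
    have : (((F.filter fun s => ¬ P s).filter fun s => s.length = j : Finset (Cycle D)) :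
        Set (Cycle D)) = M.faceCycle '' {q | ∃ a : D, Quotient.mk _ a = q ∧
        (∀ i, ¬ M.face.SameCycle (M.root i) a) ∧ (∀ b ∈ M.path, ¬ M.face.SameCycle b a) ∧
        Function.minimalPeriod M.face a = j} := by
      ext s
      simp only [Finset.coe_filter, Set.mem_ofPred_eq, Set.mem_image, hFm, Finset.mem_filter]
      constructor
      · rintro ⟨⟨hs, hnp⟩, hl⟩
        obtain ⟨a, rfl⟩ := exists_faceCycle hs
        refine ⟨_, ⟨a, rfl, (M.faceCycle_mem_faces a).1 hs, ?_, ?_⟩, rfl⟩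
        · exact fun b hb hba => hnp ⟨b, hb, (hmem a b).2 hba.symm⟩
        · rw [← length_cyc]; exact hl
      · rintro ⟨_, ⟨a, rfl, h1, h2, h3⟩, rfl⟩
        refine ⟨⟨(M.faceCycle_mem_faces a).2 h1, ?_⟩, ?_⟩
        · rintro ⟨b, hb, hba⟩
          exact h2 b hb ((hmem a b).1 hba).symm
        · rw [← h3, ← length_cyc]; rfl
    rw [this, Set.ncard_image_of_injective _ M.faceCycle_injective, ← Nat.card_coe_set_eq]
    rfl

end LoopMap

end ONModel

/-! ### Isomorphism classes and labellings -/

namespace ONModel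

open Equiv

namespace PMap

variable {ι D : Type}

/-- Orbit counting: the number of labelled maps isomorphic to `M`, times the number of automorphisms
of `M`, is the number of relabellings. -/
theorem ncard_orbit [Finite D] (M : PMap Unit ι D) :
    {M' | ∃ σ : Perm D, M.relabel (Equiv.refl _) (Equiv.refl _) σ = M'}.ncard *
      Nat.card {σ : Perm D // M.relabel (Equiv.refl _) (Equiv.refl _) σ = M} =
      (Nat.card D).factorial := by
  let _ : MulAction (Perm D) (PMap Unit ι D) :=
    { smul := fun σ M => M.relabel (Equiv.refl _) (Equiv.refl _) σ
      one_smul := by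
        rintro ⟨f, g, c, m, x⟩
        change PMap.relabel _ _ _ _ = _
        simp only [relabel, PMap.mk.injEq]
        refine ⟨?_, ?_, ?_, ?_, ?_⟩
        · ext a; simp
        · ext a; simp
        · rfl
        · ext1 k; simp
        · ext1 k; simp
      mul_smul := by
        rintro σ τ ⟨f, g, c, m, x⟩
        change PMap.relabel _ _ _ _ = PMap.relabel _ _ _ (PMap.relabel _ _ _ _)
        simp only [relabel, PMap.mk.injEq]
        refine ⟨?_, ?_, ?_, ?_, ?_⟩
        · ext a; simp [Perm.mul_def]
        · ext a; simp [Perm.mul_def]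
        · rfl
        · ext1 k; simp
        · ext1 k; simp }
  have h := (MulAction.stabilizer (Perm D) M).card_mul_index
  rw [MulAction.index_stabilizer, mul_comm, Nat.card_perm] at h
  exact h

/-- Maps whose unmarked faces are not all of the allowed types have weight zero. -/
theorem wt_eq_zero_of_not_good [Finite D] [Fintype ι] (p : Params) (f : ι → ℕ → ℂ)
    {M : PMap Unit ι D} (h : ¬ M.Good p.d) : M.wt p.faceWt p.𝔫 f = 0 := by
  classical
  unfold Good at h
  push Not at h
  obtain ⟨l, hne, hl, hu, hw⟩ := h
  have h0 : ∏ᶠ s ∈ M.faces, p.faceWt (s.map M.col) = 0 := by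
    rw [finprod_mem_eq_finite_toFinset_prod _ M.faces_finite]
    refine Finset.prod_eq_zero (i := (l : Cycle D)) ?_ ?_
    · rw [Set.Finite.mem_toFinset]
      exact ⟨l, hne, rfl, hl, hu⟩
    · change p.faceWt ((l.map M.col : List Bool) : Cycle Bool) = 0
      rw [Params.faceWt_coe, if_neg fun h => hw (Or.inl h), if_neg fun h => hw (Or.inr h)]
  rw [wt, h0, zero_mul, zero_mul]

theorem Good.relabel {D' : Type} {d : ℕ} {M : PMap Unit ι D} (h : M.Good d) (σ : D ≃ D') :
    (M.relabel (Equiv.refl _) (Equiv.refl _) σ).Good d := by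
  intro l hne hl hu
  have h1 := h (l.map σ.symm) (by simpa using hne) (hl.map σ.symm.injective fun a _ => by
    simp [PMap.relabel]) (by
      intro a ha
      obtain ⟨b, hb, rfl⟩ := List.mem_map.1 ha
      refine ⟨fun k hk => (hu b hb).1 k ?_, fun i hi => (hu b hb).2 i ?_⟩
      · exact List.mem_map.2 ⟨_, hk, σ.apply_symm_apply b⟩
      · exact List.mem_map.2 ⟨_, hi, σ.apply_symm_apply b⟩)
  rw [List.map_map] at h1
  exact h1

/-- The only map without half-edges is the map reduced to a vertex. -/
theorem labSum_fin_zero [Fintype ι] (p : Params) (f : ι → ℕ → ℂ) (g v : ℕ) :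
    labSum p.faceWt p.𝔫 f (Fin 0) g v (fun _ : Unit => []) =
      if Fintype.card ι = 0 ∧ g = 0 ∧ v = 1 then 1 else 0 := by
  classical
  have hcyc : ∀ s : Perm (Fin 0), cycNum s = 0 := fun s => by
    unfold cycNum
    rw [Nat.card_eq_zero]
    exact Or.inl ⟨fun q => Quot.inductionOn q fun a => a.elim0⟩
  have hfaces : ∀ M : PMap Unit ι (Fin 0), M.faces = ∅ := fun M => by
    rw [Set.eq_empty_iff_forall_notMem]
    rintro s ⟨l, hne, -⟩
    obtain ⟨a, -⟩ := List.exists_mem_of_ne_nil l hne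
    exact a.elim0
  have hnil : ∀ l : List (Fin 0), l = [] := fun l => by
    cases l with
    | nil => rfl
    | cons a _ => exact a.elim0
  have hnv : ∀ M : PMap Unit ι (Fin 0), M.nv = 1 := fun M => by
    rw [nv, hcyc, zero_add, Nat.card_congr (Equiv.subtypeUnivEquiv fun k => hnil _),
      Nat.card_unique]
  have hι : ∀ M : PMap Unit ι (Fin 0), M.Ok → Fintype.card ι = 0 := fun M H =>
    Fintype.card_eq_zero_iff.2 ⟨fun i => H.aux_ne i (hnil _)⟩
  have hgen : ∀ M : PMap Unit ι (Fin 0), Fintype.card ι = 0 → (M.Genus g ↔ g = 0) := fun M h => by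
    unfold Genus
    rw [hnv, hfaces, Nat.card_eq_fintype_card (α := ι), h, Nat.card_unique (α := Unit),
      Set.ncard_empty, Nat.card_eq_fintype_card (α := Fin 0), Fintype.card_fin]
    omega
  split_ifs with h
  · obtain ⟨h1, rfl, rfl⟩ := h
    have hem : IsEmpty ι := Fintype.card_eq_zero_iff.1 h1
    let M₀ : PMap Unit ι (Fin 0) := ⟨1, 1, fun _ => false, fun _ => [], fun _ => []⟩
    have hset : (PMap.maps (Fin 0) 0 1 (fun _ : Unit => []) : Set (PMap Unit ι (Fin 0))) = {M₀} := by
      ext M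
      simp only [Set.mem_singleton_iff]
      constructor
      · intro _
        obtain ⟨f, g, c, m, x⟩ := M
        simp only [M₀, PMap.mk.injEq]
        exact ⟨Subsingleton.elim _ _, Subsingleton.elim _ _, Subsingleton.elim _ _,
          funext fun k => hnil _, Subsingleton.elim _ _⟩
      · rintro rfl
        refine ⟨?_, (hgen _ h1).2 rfl, hnv _, fun k => rfl⟩
        exact ⟨fun a => a.elim0, fun a => a.elim0, fun a => a.elim0,
          fun _ => ⟨List.nodup_nil, rfl⟩, fun i => isEmptyElim i, fun i => isEmptyElim i,
          fun i => isEmptyElim i, fun _ _ a => a.elim0, fun i => isEmptyElim i,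
          fun _ i => isEmptyElim i, fun _ _ _ _ a => a.elim0⟩
    rw [labSum, hset, finsum_mem_singleton, wt, hfaces, finprod_mem_empty, Finset.univ_eq_empty,
      Finset.prod_empty, one_mul, mul_one]
    have : M₀.loops = 0 := by
      unfold loops
      rw [Nat.card_eq_zero]
      exact Or.inl ⟨fun q => Quot.inductionOn q fun a => a.1.elim0⟩
    rw [this, pow_zero]
  · rw [labSum]
    convert finsum_mem_empty
    rw [Set.eq_empty_iff_forall_notMem]
    rintro M ⟨H, hG, hv, -⟩
    exact h ⟨hι M H, (hgen M (hι M H)).1 hG, by rw [← hv, hnv]⟩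

end PMap

namespace LoopMap

variable {d : ℕ} {ι ι' D : Type} [Finite D]

theorem finite_loopMap [Finite ι'] : Finite (LoopMap d ι' D) :=
  Finite.of_injective (β := Perm D × Perm D × Set D × (ι' → D))
    (fun M => (M.face, M.glue, M.path, M.root)) (by
      rintro ⟨⟩ ⟨⟩ h
      simp only [Prod.mk.injEq] at h
      obtain ⟨rfl, rfl, rfl, rfl⟩ := h
      rfl)

theorem main_col (e : Option ι ≃ ι') (M : LoopMap d ι' D) (a : D) (ha : a ∈ (M.toPMap e).main ()) :
    (M.toPMap e).col a = false :=
  col_toPMap_false.2 fun h => M.path_unmarked a h _ (mem_cyc.1 ha)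

/-- Orbit counting for loop maps. -/
theorem ncard_isIso (e : Option ι ≃ ι') (M : LoopMap d ι' D) :
    {M' : LoopMap d ι' D | ∃ σ, IsIso M M' σ}.ncard * M.numAut = (Nat.card D).factorial := by
  have hne := M.nonempty
  have h : toPMap e '' {M' : LoopMap d ι' D | ∃ σ, IsIso M M' σ} =
      {M' | ∃ σ : Perm D, (M.toPMap e).relabel (Equiv.refl _) (Equiv.refl _) σ = M'} := by
    ext N
    constructor
    · rintro ⟨M', ⟨σ, hσ⟩, rfl⟩
      exact ⟨σ, isIso_iff.1 hσ⟩
    · rintro ⟨σ, rfl⟩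
      obtain ⟨M', hM'⟩ := exists_toPMap (e := e)
        ((PMap.relabel_ok (Equiv.refl _) (Equiv.refl _) σ _).2 M.toPMap_ok)
        (M.toPMap_good.relabel σ) (by
          intro a ha
          obtain ⟨b, hb, rfl⟩ := List.mem_map.1 ha
          simpa [PMap.relabel] using M.main_col e b hb)
      exact ⟨M', ⟨σ, isIso_iff.2 hM'.symm⟩, hM'⟩
  rw [← Set.ncard_image_of_injective _ (toPMap_injective (e := e)), h,
    ← PMap.ncard_orbit (M.toPMap e),
    numAut, Nat.card_congr (Equiv.subtypeEquivRight fun σ => isIso_iff (e := e))]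

theorem numAut_ne_zero (e : Option ι ≃ ι') (M : LoopMap d ι' D) : M.numAut ≠ 0 := by
  intro h
  have := M.ncard_isIso e
  rw [h, mul_zero] at this
  exact Nat.factorial_ne_zero _ this.symm

/-- Maps with labelled half-edges, of given genus and number of vertices. -/
def labelled (d : ℕ) (ι' D : Type) (g v : ℕ) : Set (LoopMap d ι' D) :=
  {M | M.HasGenus g ∧ M.numVertices = v}

theorem IsIso.mem_labelled [Finite ι'] (e : Option ι ≃ ι') {M M' : LoopMap d ι' D} {σ : D ≃ D}
    (h : IsIso M M' σ) {g v : ℕ} : M' ∈ labelled d ι' D g v ↔ M ∈ labelled d ι' D g v := by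
  have : Finite ι := Finite.of_injective (fun i => e (some i)) fun i j h => by simpa using h
  simp only [labelled, Set.mem_ofPred_eq, hasGenus_iff (e := e), numVertices_eq (e := e)]
  rw [← isIso_iff.1 h, PMap.relabel_genus, PMap.relabel_nv]

/-- A sum over isomorphism classes, each weighted by the inverse of its number of automorphisms, is
a sum over maps with labelled half-edges, divided by the number of labellings. -/
theorem finsum_maps [Fintype ι'] (e : Option ι ≃ ι') (Φ : ∀ n, LoopMap d ι' (Fin n) → ℂ)
    (hΦ : ∀ n (M M' : LoopMap d ι' (Fin n)) σ, IsIso M M' σ → Φ n M' = Φ n M) {g v N : ℕ}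
    (hN : 6 * (2 * g + Fintype.card ι' + v) < N) :
    ∑ᶠ q ∈ maps d ι' g v, Φ _ q.rep / q.rep.numAut =
      ∑ n ∈ Finset.range N, (∑ᶠ M ∈ labelled d ι' (Fin n) g v, Φ n M) / n.factorial := by
  classical
  have hlab : ∀ q : MapClass d ι', q ∈ maps d ι' g v ↔ q.rep ∈ labelled d ι' _ g v := by
    intro q
    constructor
    · rintro ⟨⟨n, M⟩, rfl, hM⟩
      obtain ⟨σ, hσ⟩ := Quotient.mk_out (s := isoSetoid d ι') ⟨n, M⟩
      have hn := Fin.equiv_iff_eq.1 ⟨σ⟩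
      unfold MapClass.rep
      generalize (Quotient.out (Quotient.mk (isoSetoid d ι') ⟨n, M⟩)) = r at σ hσ hn ⊢
      obtain ⟨n', M'⟩ := r
      simp only at hn
      subst hn
      exact (hσ.mem_labelled e).1 hM
    · intro h
      exact ⟨Quotient.out q, Quotient.out_eq q, h⟩
  have hfin := maps_finite d ι' g v
  -- The class of `M` contributes `n! / numAut M` equal terms to the sum over labelled maps.
  have hinner : ∀ n, ∑ᶠ M ∈ labelled d ι' (Fin n) g v, Φ n M =
      ∑ q ∈ hfin.toFinset, if (Quotient.out q).1 = n then
        (n.factorial : ℂ) * (Φ _ q.rep / q.rep.numAut) else 0 := by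
    intro n
    have hf : Finite (LoopMap d ι' (Fin n)) := finite_loopMap
    rw [finsum_mem_fiberwise (X := labelled d ι' (Fin n) g v) (Set.toFinite _)
      (fun q : MapClass d ι' => {M | M ∈ labelled d ι' (Fin n) g v ∧
        (Quotient.mk (isoSetoid d ι') ⟨n, M⟩) = q})
      (fun k M hM => hM.1) (fun M hM => ⟨_, hM, rfl⟩) (fun k k' M h h' => h.2.symm.trans h'.2),
      finsum_eq_sum_of_support_subset (s := hfin.toFinset)]
    · refine Finset.sum_congr rfl fun q hq => ?_
      rw [Set.Finite.mem_toFinset] at hq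
      split_ifs with h
      · rw [hlab] at hq
        have hq' := Quotient.out_eq q
        unfold MapClass.rep at *
        generalize Quotient.out q = r at *
        obtain ⟨n', M₀⟩ := r
        simp only at h hq ⊢
        subst h
        have hset : {M | M ∈ labelled d ι' (Fin n') g v ∧
            (Quotient.mk (isoSetoid d ι') ⟨n', M⟩) = q} = {M | ∃ σ, IsIso M₀ M σ} := by
          ext M
          rw [← hq']
          constructor
          · rintro ⟨h1, h2⟩
            exact Quotient.exact h2.symm
          · rintro ⟨σ, hσ⟩
            exact ⟨(hσ.mem_labelled e).2 hq, Quotient.sound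
              (Setoid.symm' (isoSetoid d ι') ⟨σ, hσ⟩)⟩
        rw [hset, finsum_mem_congr rfl (g := fun _ => Φ n' M₀) (fun M hM => by
            obtain ⟨σ, hσ⟩ := hM
            exact hΦ _ _ _ σ hσ),
          finsum_mem_eq_finite_toFinset_sum _ (Set.toFinite _), Finset.sum_const,
          ← Set.ncard_eq_toFinset_card, nsmul_eq_mul]
        have h1 := M₀.ncard_isIso e
        rw [Nat.card_eq_fintype_card, Fintype.card_fin] at h1
        have h2 : (M₀.numAut : ℂ) ≠ 0 := Nat.cast_ne_zero.2 (M₀.numAut_ne_zero e)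
        rw [← h1]
        push_cast
        field_simp
      · convert finsum_mem_empty
        rw [Set.eq_empty_iff_forall_notMem]
        rintro M ⟨-, rfl⟩
        obtain ⟨σ, -⟩ := Quotient.mk_out (s := isoSetoid d ι') ⟨n, M⟩
        exact h (Fin.equiv_iff_eq.1 ⟨σ⟩)
    · intro q hq
      obtain ⟨M, hM, -⟩ := exists_ne_zero_of_finsum_mem_ne_zero hq
      rw [Set.Finite.coe_toFinset]
      exact ⟨⟨n, M⟩, hM.2, hM.1⟩
  simp only [hinner, Finset.sum_div]
  rw [finsum_mem_eq_finite_toFinset_sum _ hfin, Finset.sum_comm]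
  refine Finset.sum_congr rfl fun q hq => ?_
  rw [Set.Finite.mem_toFinset, hlab] at hq
  have hlt : (Quotient.out q).1 < N := (card_le q.rep hq.1 hq.2).trans_lt hN
  rw [Finset.sum_eq_single (Quotient.out q).1]
  · rw [if_pos rfl, mul_div_cancel_left₀]
    exact_mod_cast Nat.factorial_ne_zero _
  · intro n _ hn
    rw [if_neg hn.symm, zero_div]
  · intro h
    exact absurd (Finset.mem_range.2 hlt) h

end LoopMap

end ONModel

/-! ### Expansion of the generating functions -/

namespace ONModel

open Equiv

namespace LoopMap

variable {ι ι' : Type}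

/-- Loop maps with `n` labelled half-edges, according to the degree of the root face. -/
theorem finsum_labelled [Fintype ι] [Finite ι'] (p : Params) (e : Option ι ≃ ι') (f : ι → ℕ → ℂ)
    (u : ℂ) {g v n N : ℕ} (hn : n ≠ 0) (hN : n < N) :
    ∑ᶠ M ∈ labelled p.d ι' (Fin n) g v, (M.toPMap e).wt p.faceWt p.𝔫 f *
        (1 / u ^ (((M.toPMap e).main ()).length + 1)) =
      ∑ l ∈ Finset.range N, 1 / u ^ (l + 1) *
        labSum p.faceWt p.𝔫 f (Fin n) g v (fun _ : Unit => List.replicate l false) := by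
  classical
  have : NeZero n := ⟨hn⟩
  -- The presentations of loop maps, apart from the condition on unmarked faces, which is enforced by
  -- the weights.
  set Z : Set (PMap Unit ι (Fin n)) :=
    {M | M.Ok ∧ M.Genus g ∧ M.nv = v ∧ ∀ a ∈ M.main (), M.col a = false} with hZ
  set G : PMap Unit ι (Fin n) → ℂ := fun M =>
    M.wt p.faceWt p.𝔫 f * (1 / u ^ ((M.main ()).length + 1)) with hG
  have himg : toPMap e '' labelled p.d ι' (Fin n) g v = {M | M ∈ Z ∧ M.Good p.d} := by
    ext M'
    constructor
    · rintro ⟨M, ⟨h1, h2⟩, rfl⟩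
      exact ⟨⟨M.toPMap_ok, (M.hasGenus_iff g).1 h1, (M.numVertices_eq).symm.trans h2,
        M.main_col e⟩, M.toPMap_good⟩
    · rintro ⟨⟨h1, h2, h3, h4⟩, h5⟩
      obtain ⟨M, rfl⟩ := exists_toPMap (e := e) h1 h5 h4
      exact ⟨M, ⟨(M.hasGenus_iff g).2 h2, M.numVertices_eq.trans h3⟩, rfl⟩
  have h1 : ∑ᶠ M ∈ labelled p.d ι' (Fin n) g v, G (M.toPMap e) = ∑ᶠ M ∈ Z, G M := by
    rw [← finsum_mem_image toPMap_injective.injOn, himg]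
    refine finsum_mem_inter_support_eq _ _ _ ?_
    ext M
    simp only [Set.mem_inter_iff, Set.mem_ofPred_eq, Function.mem_support, and_congr_left_iff,
      and_iff_left_iff_imp]
    intro h _
    by_contra hgood
    exact h (by rw [hG]; simp only; rw [PMap.wt_eq_zero_of_not_good p f hgood, zero_mul])
  have hlen : ∀ M ∈ Z, (M.main ()).length < N := fun M hM => by
    have := hM.1.length_le ()
    rw [Nat.card_eq_fintype_card, Fintype.card_fin] at this
    omega
  have hword : ∀ M : PMap Unit ι (Fin n), ∀ l, M ∈ (PMap.maps (Fin n) g v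
      (fun _ : Unit => List.replicate l false) : Set (PMap Unit ι (Fin n))) ↔
      M ∈ Z ∧ (M.main ()).length = l := by
    intro M l
    simp only [PMap.maps, hZ, Set.mem_ofPred_eq, and_assoc, List.eq_replicate_iff, List.length_map,
      List.mem_map]
    constructor
    · rintro ⟨h1, h2, h3, h4⟩
      exact ⟨h1, h2, h3, fun a ha => (h4 ()).2 _ ⟨a, ha, rfl⟩, (h4 ()).1⟩
    · rintro ⟨h1, h2, h3, h4, h5⟩
      exact ⟨h1, h2, h3, fun _ => ⟨h5, by rintro _ ⟨a, ha, rfl⟩; exact h4 a ha⟩⟩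
  refine h1.trans ?_
  rw [finsum_mem_fiberwise (X := Z) (PMap.finite_ok.subset fun M hM => hM.1)
    (fun l : ℕ => PMap.maps (Fin n) g v (fun _ : Unit => List.replicate l false))
    (fun l M hM => ((hword M l).1 hM).1) (fun M hM => ⟨_, (hword M _).2 ⟨hM, rfl⟩⟩)
    (fun k k' M h h' => ((hword M k).1 h).2.symm.trans ((hword M k').1 h').2),
    finsum_eq_sum_of_support_subset (s := Finset.range N)]
  · refine Finset.sum_congr rfl fun l _ => ?_
    rw [labSum, mul_comm, finsum_mem_mul]
    refine finsum_mem_congr rfl fun M hM => ?_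
    rw [hG]
    simp only
    rw [((hword M l).1 hM).2]
  · intro l hl
    obtain ⟨M, hM, -⟩ := exists_ne_zero_of_finsum_mem_ne_zero hl
    have h2 := (hword M l).1 hM
    rw [Finset.coe_range, Set.mem_Iio, ← h2.2]
    exact hlen M h2.1

end LoopMap

variable {ι ι' : Type} [Fintype ι] [Fintype ι']

/-- The weight of a map, with the factor of the root face written separately. -/
theorem weight_eq (p : Params) (e : Option ι ≃ ι') (x : ι' → ℂ) (q : MapClass p.d ι') :
    weight p q * ∏ i, 1 / (x i - p.c / 2) ^ (q.rep.length i + 1) =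
      ((q.rep.toPMap e).wt p.faceWt p.𝔫 (fun i L => 1 / (x (e (some i)) - p.c / 2) ^ (L + 1)) *
        (1 / (x (e none) - p.c / 2) ^ (((q.rep.toPMap e).main ()).length + 1))) /
        q.rep.numAut := by
  have h1 : ∀ i, ((q.rep.toPMap e).aux i).length = q.rep.length (e (some i)) := fun i =>
    length_cyc _ _
  have h2 : ((q.rep.toPMap e).main ()).length = q.rep.length (e none) := length_cyc _ _
  rw [weight, PMap.wt, LoopMap.prod_faces, ← LoopMap.numLoops_eq, ← e.prod_comp, Fintype.prod_option,
    h2]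
  simp only [h1]
  ring

/-- The expansion of the generating functions in terms of the weighted numbers of maps. -/
theorem coeff_W (p : Params) (e : Option ι ≃ ι') (x : ι' → ℂ) {g v N : ℕ}
    (hN : bound ι g v ≤ N) :
    PowerSeries.coeff v (W p g x) = ∑ l ∈ Finset.range N, 1 / (x (e none) - p.c / 2) ^ (l + 1) *
      tot p (fun i L => 1 / (x (e (some i)) - p.c / 2) ^ (L + 1)) g v l := by
  classical
  set u := x (e none) - p.c / 2
  set f : ι → ℕ → ℂ := fun i L => 1 / (x (e (some i)) - p.c / 2) ^ (L + 1) with hf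
  have hcard : Fintype.card ι' = Fintype.card ι + 1 := by
    rw [← Fintype.card_congr e, Fintype.card_option]
  -- The bound of `LoopMap.finsum_maps` on the number of half-edges is larger than `bound ι g v`.
  have hsub : ∑ l ∈ Finset.range N, 1 / u ^ (l + 1) * tot p f g v l =
      ∑ l ∈ Finset.range (N + 6), 1 / u ^ (l + 1) * tot p f g v l := by
    refine Finset.sum_subset (Finset.range_mono (by omega)) fun l _ hl => ?_
    rw [tot_eq_zero p f (hN.trans (not_lt.1 (Finset.mem_range.not.1 hl))), mul_zero]
  have hbound : bound ι g v ≤ N + 6 := by omega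
  rw [hsub, W, PowerSeries.coeff_mk, finsum_mem_congr rfl fun q _ => weight_eq p e x q,
    LoopMap.finsum_maps e (N := N + 6) (fun n M => (M.toPMap e).wt p.faceWt p.𝔫 f *
        (1 / u ^ (((M.toPMap e).main ()).length + 1)))]
  · simp only [tot, total_eq_sum p f _ hbound, Finset.mul_sum]
    rw [Finset.sum_comm, Finset.sum_range_succ', Finset.sum_range_succ' _ (N + 5),
      add_comm, add_assoc]
    congr 1
    · refine Finset.sum_congr rfl fun n hn => ?_
      rw [LoopMap.finsum_labelled p e f u (N := N + 6) (by omega)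
        (by have := Finset.mem_range.1 hn; omega), Finset.sum_div]
      exact Finset.sum_congr rfl fun l _ => mul_div_assoc _ _ _
    -- There is no loop map without half-edges; the map reduced to a vertex is the additional term of
    -- `W`.
    · have hempty : LoopMap.labelled p.d ι' (Fin 0) g v = ∅ := by
        rw [Set.eq_empty_iff_forall_notMem]
        intro M _
        obtain ⟨a⟩ := M.nonempty
        exact a.elim0
      rw [hempty, finsum_mem_empty, zero_div, zero_add, Finset.sum_range_succ',
        Finset.sum_eq_zero, zero_add]
      · rw [List.replicate_zero, PMap.labSum_fin_zero]
        by_cases h : Fintype.card ι = 0 ∧ g = 0 ∧ v = 1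
        · have : IsEmpty ι := Fintype.card_eq_zero_iff.1 h.1
          rw [if_pos h, if_pos ⟨by omega, h.2⟩, ← e.prod_comp, Fintype.prod_option]
          simp [u]
        · rw [if_neg h, if_neg (fun h' => h ⟨by omega, h'.2⟩)]
          simp
      · intro l _
        rw [PMap.labSum_eq_zero_of_length _ _ _ _ _ _ () (by simp), zero_div, mul_zero]
  · intro n M M' σ h
    rw [← LoopMap.isIso_iff.1 h, PMap.relabel_wt]
    simp [PMap.relabel]
  · unfold bound at hN
    omega

end ONModel

/-! ### Loop equations for generating functions -/

namespace ONModel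

open Equiv

/-- The generating function, in powers of `1 / u`, of a finite sequence. -/
noncomputable def gen (N : ℕ) (F : ℕ → ℂ) (u : ℂ) : ℂ := ∑ l ∈ Finset.range N, 1 / u ^ (l + 1) * F l

/-- The generating function, in powers of `1 / u` and `1 / y`, of a finite double sequence. -/
noncomputable def gen₂ (N : ℕ) (K : ℕ → ℕ → ℂ) (u y : ℂ) : ℂ :=
  ∑ a ∈ Finset.range N, ∑ b ∈ Finset.range N, 1 / u ^ (a + 1) * (1 / y ^ (b + 1) * K a b)

theorem sum_sum_antidiagonal (N : ℕ) (K : ℕ → ℕ → ℂ) (hK : ∀ a b, N ≤ a + b → K a b = 0) :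
    ∑ m ∈ Finset.range N, ∑ q ∈ Finset.HasAntidiagonal.antidiagonal m, K q.1 q.2 =
      ∑ a ∈ Finset.range N, ∑ b ∈ Finset.range N, K a b := by
  rw [← Finset.sum_product' (f := K), ← Finset.sum_filter_of_ne (p := fun q : ℕ × ℕ => q.1 + q.2 < N),
    ← Finset.sum_fiberwise_of_maps_to (g := fun q : ℕ × ℕ => q.1 + q.2) (t := Finset.range N)
      (fun q hq => Finset.mem_range.2 (Finset.mem_filter.1 hq).2)]
  · refine Finset.sum_congr rfl fun m hm => Finset.sum_congr ?_ fun _ _ => rfl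
    rw [Finset.mem_range] at hm
    ext q
    simp only [Finset.mem_filter, Finset.mem_product, Finset.mem_range,
      Finset.HasAntidiagonal.mem_antidiagonal]
    omega
  · intro q _ hq
    by_contra h
    exact hq (hK _ _ (not_lt.1 h))

/-- Multiplication by `u ^ k` shifts the sequence, apart from a polynomial. -/
theorem pow_mul_gen {N : ℕ} {F : ℕ → ℂ} (hF : ∀ l, N ≤ l → F l = 0) {u : ℂ} (hu : u ≠ 0) (k : ℕ) :
    u ^ k * gen N F u =
      ∑ l ∈ Finset.range k, F l * u ^ (k - 1 - l) + gen N (fun l => F (k + l)) u := by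
  have h : gen N F u = ∑ l ∈ Finset.range (k + N), 1 / u ^ (l + 1) * F l := by
    refine Finset.sum_subset (Finset.range_mono (by omega)) fun l _ hl => ?_
    rw [hF l (not_lt.1 (Finset.mem_range.not.1 hl)), mul_zero]
  rw [h, Finset.sum_range_add, mul_add, Finset.mul_sum, Finset.mul_sum, gen]
  congr 1
  · refine Finset.sum_congr rfl fun l hl => ?_
    rw [Finset.mem_range] at hl
    have : u ^ k = u ^ (k - 1 - l) * u ^ (l + 1) := by rw [← pow_add]; congr 1; omega
    rw [this]
    field_simp
  · refine Finset.sum_congr rfl fun l _ => ?_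
    rw [add_assoc, pow_add]
    field_simp

/-- A series in `1 / u` vanishes at infinity. -/
theorem tendsto_gen (N : ℕ) (F : ℕ → ℂ) (a : ℂ) :
    Tendsto (fun y => gen N F (y - a)) (Bornology.cobounded ℂ) (𝓝 0) := by
  unfold gen
  rw [← Finset.sum_const_zero (s := Finset.range N)]
  refine tendsto_finsetSum _ fun l _ => ?_
  have h1 : Tendsto (fun y : ℂ => (y - a)⁻¹) (Bornology.cobounded ℂ) (𝓝 0) :=
    tendsto_inv₀_cobounded.comp (by
      simp [sub_eq_add_neg])
  have h2 := (h1.pow (l + 1)).mul_const (F l)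
  simpa using h2

theorem eval_derivative_V (p : Params) (x : ℂ) : (Polynomial.derivative (V p)).eval x =
    (x - p.c / 2) - ∑ j ∈ Finset.Icc 3 p.d, p.tHat j * (x - p.c / 2) ^ (j - 1) := by
  rw [V, Polynomial.derivative_comp]
  simp only [Polynomial.derivative_sub, Polynomial.derivative_X, Polynomial.derivative_C, sub_zero,
    one_mul, Polynomial.eval_comp, Polynomial.eval_sub, Polynomial.eval_X, Polynomial.eval_C,
    Polynomial.derivative_sum, Polynomial.derivative_C_mul_X_pow, Polynomial.eval_finsetSum,
    Polynomial.eval_mul, Polynomial.eval_pow]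
  congr 1
  · norm_num
  · refine Finset.sum_congr rfl fun j hj => ?_
    have : (j : ℂ) ≠ 0 := by
      have := Finset.mem_Icc.1 hj
      exact_mod_cast (by omega : j ≠ 0)
    rw [div_mul_cancel₀ _ this]

/-- The expansion of `V' W`, with its polynomial part. -/
theorem V'_mul_gen (p : Params) {N : ℕ} {F : ℕ → ℂ} (hF : ∀ l, N ≤ l → F l = 0) {u : ℂ}
    (hu : u ≠ 0) :
    (u - ∑ j ∈ Finset.Icc 3 p.d, p.tHat j * u ^ (j - 1)) * gen N F u =
      (F 0 - ∑ j ∈ Finset.Icc 3 p.d, p.tHat j *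
        ∑ l ∈ Finset.range (j - 1), F l * u ^ (j - 1 - 1 - l)) +
      (gen N (fun l => F (l + 1)) u -
        ∑ j ∈ Finset.Icc 3 p.d, p.tHat j * gen N (fun l => F (j - 1 + l)) u) := by
  have h1 := pow_mul_gen hF hu 1
  simp only [pow_one, Finset.sum_range_one, Nat.sub_self, pow_zero, mul_one] at h1
  rw [sub_mul, h1, Finset.sum_mul]
  simp only [mul_assoc, pow_mul_gen hF hu, mul_add, Finset.sum_add_distrib, add_comm 1]
  ring

theorem gen_sub_sum (p : Params) (N : ℕ) (F : ℕ → ℂ) (u : ℂ) : gen N (fun l => F (l + 1)) u -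
      ∑ j ∈ Finset.Icc 3 p.d, p.tHat j * gen N (fun l => F (j - 1 + l)) u =
    gen N (fun l => F (l + 1) - ∑ j ∈ Finset.Icc 3 p.d, p.tHat j * F (j - 1 + l)) u := by
  simp only [gen, mul_sub, Finset.sum_sub_distrib, Finset.mul_sum]
  rw [Finset.sum_comm]
  congr 1
  exact Finset.sum_congr rfl fun l _ => Finset.sum_congr rfl fun j _ => by ring

variable {ι : Type} [Fintype ι]

/-- The weights of the marked faces. -/
noncomputable def markedWt (p : Params) (I : ι → ℂ) (i : ι) (L : ℕ) : ℂ :=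
  1 / (I i - p.c / 2) ^ (L + 1)

theorem coeff_W_adjoin (p : Params) (x : ℂ) (I : ι → ℂ) {g v N : ℕ} (hN : bound ι g v ≤ N) :
    PowerSeries.coeff v (W p g (adjoin x I)) =
      gen N (tot p (markedWt p I) g v) (x - p.c / 2) :=
  coeff_W p (Equiv.refl _) (adjoin x I) hN

/-- The polynomial part of `V' W`: the remainder in `V'_mul_gen` vanishes at infinity. -/
theorem coeff_P (p : Params) (x : ℂ) (I : ι → ℂ) (g v : ℕ) :
    PowerSeries.coeff v (P p g x I) = tot p (markedWt p I) g v 0 -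
      ∑ j ∈ Finset.Icc 3 p.d, p.tHat j * ∑ l ∈ Finset.range (j - 1),
        tot p (markedWt p I) g v l * (x - p.c / 2) ^ (j - 1 - 1 - l) := by
  set F := tot p (markedWt p I) g v
  rw [P, PowerSeries.coeff_mk, polyPart_eq (q := Polynomial.C (F 0) -
      ∑ j ∈ Finset.Icc 3 p.d, Polynomial.C (p.tHat j) * ∑ l ∈ Finset.range (j - 1),
        Polynomial.C (F l) * (Polynomial.X - Polynomial.C (p.c / 2)) ^ (j - 1 - 1 - l))]
  · simp [Polynomial.eval_finsetSum]
  · refine (tendsto_gen (bound ι g v) (fun l => F (l + 1) -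
      ∑ j ∈ Finset.Icc 3 p.d, p.tHat j * F (j - 1 + l)) (p.c / 2)).congr' ?_
    filter_upwards [Bornology.eventually_ne_cobounded (p.c / 2)] with y hy
    rw [V', PowerSeries.coeff_C_mul, eval_derivative_V, coeff_W_adjoin p y I le_rfl,
      V'_mul_gen p (fun l => tot_eq_zero p _) (sub_ne_zero.2 hy), gen_sub_sum]
    simp [Polynomial.eval_finsetSum, F]

/-- The part of `V' W` that vanishes at infinity. -/
theorem coeff_V'_mul_W_sub_P (p : Params) {x : ℂ} (hx : x ≠ p.c / 2) (I : ι → ℂ) {g v N : ℕ}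
    (hN : bound ι g v ≤ N) :
    PowerSeries.coeff v (V' p x * W p g (adjoin x I) - P p g x I) =
      gen N (fun l => tot p (markedWt p I) g v (l + 1)) (x - p.c / 2) -
        ∑ j ∈ Finset.Icc 3 p.d, p.tHat j *
          gen N (fun l => tot p (markedWt p I) g v (j - 1 + l)) (x - p.c / 2) := by
  rw [map_sub, V', PowerSeries.coeff_C_mul, eval_derivative_V, coeff_W_adjoin p x I hN,
    V'_mul_gen p (fun l hl => tot_eq_zero p _ (hN.trans hl)) (sub_ne_zero.2 hx), coeff_P,
    add_sub_cancel_left]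

theorem tot₂_eq_zero (p : Params) (f : ι → ℕ → ℂ) {g v a b : ℕ} (h : 2 * bound ι g v ≤ a + b) :
    tot₂ p f g v a b = 0 := by
  rcases le_total (bound ι g v) a with ha | ha
  · exact total_eq_zero p f _ false (by simpa using ha)
  · exact total_eq_zero p f _ true (by simp; omega)

/-- The loop equation of the maps whose root edge is not crossed by a path. -/
theorem gen_tot_succ [DecidableEq ι] (p : Params) (f : ι → ℕ → ℂ) {g v N : ℕ}
    (hN : 2 * bound ι g v ≤ N) (u : ℂ) :
    gen (N + 1) (fun l => tot p f g v (l + 1)) u =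
      ∑ j ∈ Finset.Icc 3 p.d, p.tHat j * gen (N + 1) (fun l => tot p f g v (j - 1 + l)) u +
      -1 / p.c * gen (N + 1) (totH p f g v 0) u +
      ∑ i, ∑ L ∈ Finset.range (N + 1), (L + 1) * (f i (L + 1) *
        gen (N + 1) (fun l => tot p (fun j : {j // j ≠ i} => f j) g v (L + l)) u) +
      gen₂ (N + 1) (tot₂ p f g v) u u := by
  -- The two parts of the root face share its degree, minus the two sides of the root edge; the range
  -- `N + 1` is one more than the bound on the total degree because of the shift by one.
  have h₂ : gen₂ (N + 1) (tot₂ p f g v) u u = ∑ l ∈ Finset.range (N + 1), 1 / u ^ (l + 1) *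
      ∑ n ∈ Finset.range l, tot₂ p f g v n (l - 1 - n) := by
    rw [Finset.sum_range_succ', Finset.sum_range_zero, mul_zero, add_zero, gen₂,
      Finset.sum_range_succ, Finset.sum_eq_zero (s := Finset.range (N + 1)) (f := fun b =>
        1 / u ^ (N + 1) * (1 / u ^ (b + 1) * tot₂ p f g v N b)), add_zero]
    · have : ∀ a, ∑ b ∈ Finset.range (N + 1), 1 / u ^ (a + 1) * (1 / u ^ (b + 1) * tot₂ p f g v a b)
          = ∑ b ∈ Finset.range N, 1 / u ^ (a + 1) * (1 / u ^ (b + 1) * tot₂ p f g v a b) := by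
        intro a
        rw [Finset.sum_range_succ, tot₂_eq_zero p f (a := a) (b := N) (by omega), mul_zero, mul_zero,
          add_zero]
      simp only [this]
      rw [← sum_sum_antidiagonal N fun a b =>
        1 / u ^ (a + 1) * (1 / u ^ (b + 1) * tot₂ p f g v a b)]
      · refine Finset.sum_congr rfl fun m _ => ?_
        rw [Finset.Nat.sum_antidiagonal_eq_sum_range_succ
          (fun a b => 1 / u ^ (a + 1) * (1 / u ^ (b + 1) * tot₂ p f g v a b)), Finset.mul_sum]
        refine Finset.sum_congr rfl fun n hn => ?_
        have hn := Finset.mem_range.1 hn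
        rw [← mul_assoc, one_div_mul_one_div, ← pow_add, Nat.add_sub_cancel,
          show n + 1 + (m - n + 1) = m + 1 + 1 by omega]
      · intro a b hab
        rw [tot₂_eq_zero p f (hN.trans hab), mul_zero, mul_zero]
    · intro b _
      rw [tot₂_eq_zero p f (by omega), mul_zero, mul_zero]
  rw [h₂]
  unfold gen
  have hN' : bound ι g v ≤ N + 1 := by omega
  simp only [tot_succ p f _ hN', mul_add, Finset.sum_add_distrib, Finset.mul_sum]
  congr 1
  congr 1
  · congr 1
    · rw [Finset.sum_comm]
      exact Finset.sum_congr rfl fun l _ => Finset.sum_congr rfl fun j _ => by ring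
    · exact Finset.sum_congr rfl fun l _ => by ring
  · rw [Finset.sum_comm]
    refine Finset.sum_congr rfl fun i _ => ?_
    rw [Finset.sum_comm]
    exact Finset.sum_congr rfl fun l _ => Finset.sum_congr rfl fun j _ => by ring

/-- The contribution of the triangles, for two opposite values of `x`, that is for `u + u' = - c`. -/
theorem gen_totH (p : Params) (hc : p.c ≠ 0) (f : ι → ℕ → ℂ) {g v N : ℕ}
    (hN : bound ι g v ≤ N) {u u' : ℂ} (hu : u ≠ 0) (hu' : u' ≠ 0) (h : u + u' = -p.c) :
    -1 / p.c * gen N (totH p f g v 0) u + -1 / p.c * gen N (totH p f g v 0) u' =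
      p.𝔫 * gen₂ N (tot₂ p f g v) u u' := by
  set H := totH p f g v with hH
  -- Shifting an index of `H` amounts to multiplying by `u` or `u'`, up to the boundary terms.
  have e1 : gen₂ N (fun a b => H (a + 1) b) u u' = u * gen₂ N H u u' - gen N (H 0) u' := by
    have hz : ∀ b l, N ≤ l → H l b = 0 := fun b l hl => totH_eq_zero p f (by omega)
    have h1 : ∀ K : ℕ → ℕ → ℂ, gen₂ N K u u' =
        ∑ b ∈ Finset.range N, 1 / u' ^ (b + 1) * gen N (fun a => K a b) u := by
      intro K
      unfold gen₂ gen
      rw [Finset.sum_comm]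
      simp only [Finset.mul_sum]
      exact Finset.sum_congr rfl fun l _ => Finset.sum_congr rfl fun j _ => by ring
    rw [h1, h1, Finset.mul_sum, gen, ← Finset.sum_sub_distrib]
    refine Finset.sum_congr rfl fun b _ => ?_
    have h2 := pow_mul_gen (hz b) hu 1
    simp only [pow_one, Finset.sum_range_one, Nat.sub_self, pow_zero, mul_one, add_comm 1] at h2
    rw [mul_left_comm, h2]
    ring
  have e2 : gen₂ N (fun a b => H a (b + 1)) u u' = u' * gen₂ N H u u' - gen N (H 0) u := by
    have hz : ∀ a l, N ≤ l → H a l = 0 := fun b l hl => totH_eq_zero p f (by omega)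
    have h1 : ∀ K : ℕ → ℕ → ℂ, gen₂ N K u u' =
        ∑ a ∈ Finset.range N, 1 / u ^ (a + 1) * gen N (K a) u' := by
      intro K
      unfold gen₂ gen
      simp only [Finset.mul_sum]
    rw [h1, h1, Finset.mul_sum, gen, ← Finset.sum_sub_distrib]
    refine Finset.sum_congr rfl fun b _ => ?_
    have h2 := pow_mul_gen (hz b) hu' 1
    simp only [pow_one, Finset.sum_range_one, Nat.sub_self, pow_zero, mul_one, add_comm 1] at h2
    rw [mul_left_comm, h2, hH, totH_comm p f g v 0 b]
    ring
  -- In `totH_rec` the coefficient of `gen₂ N H u u'` is `1 + (u + u') / c`, which vanishes.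
  have e3 : gen₂ N H u u' = -1 / p.c * (gen₂ N (fun a b => H (a + 1) b) u u' +
      gen₂ N (fun a b => H a (b + 1)) u u') + p.𝔫 * gen₂ N (tot₂ p f g v) u u' := by
    have h3 : H = fun a b => -1 / p.c * (H (a + 1) b + H a (b + 1)) + p.𝔫 * tot₂ p f g v a b := by
      funext a b
      exact totH_rec p f g v a b
    conv_lhs => rw [h3]
    unfold gen₂
    simp only [mul_add, Finset.sum_add_distrib, Finset.mul_sum]
    refine congrArg₂ _ (congrArg₂ _ ?_ ?_) ?_ <;>
    exact Finset.sum_congr rfl fun l _ => Finset.sum_congr rfl fun j _ => by ring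
  rw [e1, e2] at e3
  have hp : p.c = -(u + u') := by rw [h, neg_neg]
  have e4 : p.𝔫 * gen₂ N (tot₂ p f g v) u u' = gen₂ N H u u' + 1 / p.c * (
      u * gen₂ N H u u' - gen N (H 0) u' +
      (u' * gen₂ N H u u' - gen N (H 0) u)) := by linear_combination -e3
  rw [e4]
  field_simp
  linear_combination -(gen₂ N H u u') * h

end ONModel

/-! ### Divided differences and maps with two root faces -/

namespace ONModel

open Equiv

variable {ι : Type} [Fintype ι]

/-- Linearity in the weight of an auxiliary face: the faces of each degree can be counted
separately. -/
theorem tot_option (p : Params) (f : ι → ℕ → ℂ) (h : ℕ → ℂ) {g v N : ℕ}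
    (hN : bound (Option ι) g v ≤ N) (l : ℕ) :
    tot p (fun o : Option ι => o.elim h f) g v l = ∑ b ∈ Finset.range N, h b *
      tot p (fun o : Option ι => o.elim (fun L => if L = b then 1 else 0) f) g v l := by
  simp only [tot, total_eq_sum p _ _ hN, Finset.mul_sum]
  rw [Finset.sum_comm]
  refine Finset.sum_congr rfl fun n hn => ?_
  rw [Finset.sum_congr rfl fun b _ => (mul_div_assoc _ _ _).symm, ← Finset.sum_div]
  congr 1
  simp only [labSum]
  have hfin := PMap.finite_maps (κ := Unit) (ι := Option ι) (D := Fin n) g v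
    (fun _ : Unit => List.replicate l false)
  simp only [finsum_mem_eq_finite_toFinset_sum _ hfin, Finset.mul_sum]
  rw [Finset.sum_comm]
  refine Finset.sum_congr rfl fun M hM => ?_
  rw [Set.Finite.mem_toFinset] at hM
  simp only [PMap.wt, Fintype.prod_option, Option.elim_none, Option.elim_some]
  have hlt : (M.aux none).length ∈ Finset.range N := by
    have := (hM.1.aux_cyc none).1.length_le_card
    rw [Fintype.card_fin] at this
    have := Finset.mem_range.1 hn
    rw [Finset.mem_range]
    omega
  rw [Finset.sum_eq_single_of_mem _ hlt]
  · rw [if_pos rfl]; ring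
  · intro b _ hb
    rw [if_neg hb.symm]; ring

/-- Connected maps with two root faces are counted by `W_{k+1}` in genus `g - 1`. -/
theorem gen₂_totLinked (p : Params) (x y : ℂ) (I : ι → ℂ) {g v N : ℕ} (hN : bound ι g v ≤ N) :
    gen₂ N (totLinked p (markedWt p I) g v) (x - p.c / 2) (y - p.c / 2) =
      PowerSeries.coeff v (WPred p g (adjoin x (adjoin y I))) := by
  cases g with
  | zero => simp [gen₂, totLinked, WPred]
  | succ g =>
    have hb : bound (Option ι) g v ≤ N := by
      unfold bound at hN ⊢
      rw [Fintype.card_option]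
      omega
    rw [WPred, coeff_W_adjoin p x _ hb, gen₂, gen]
    refine Finset.sum_congr rfl fun a _ => ?_
    rw [← Finset.mul_sum]
    congr 1
    have : markedWt p (adjoin y I) = fun o : Option ι =>
        o.elim (fun L => 1 / (y - p.c / 2) ^ (L + 1)) (markedWt p I) := by
      funext o L
      cases o <;> rfl
    rw [this, tot_option p _ _ hb]
    rfl

/-- The maps with two root faces: either connected, of smaller genus, or with two components. -/
theorem gen₂_tot₂ [DecidableEq ι] (p : Params) (x y : ℂ) (I : ι → ℂ) {g v N : ℕ}
    (hN : bound ι g v ≤ N) :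
    gen₂ N (tot₂ p (markedWt p I) g v) (x - p.c / 2) (y - p.c / 2) =
      PowerSeries.coeff v (WPred p g (adjoin x (adjoin y I)) +
        ∑ J : Finset ι, ∑ h ∈ Finset.range (g + 1),
          W p h (adjoin x fun j : {j // j ∈ J} => I j) *
            W p (g - h) (adjoin y fun j : {j // j ∉ J} => I j)) := by
  have hcard₁ : ∀ J : Finset ι, ∀ a b, a ≤ g → b ≤ v → bound {j // j ∈ J} a b ≤ N := by
    intro J a b ha hb
    have := Fintype.card_subtype_le fun j => j ∈ J
    unfold bound at hN ⊢
    omega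
  have hcard₂ : ∀ J : Finset ι, ∀ a b, a ≤ g → b ≤ v → bound {j // j ∉ J} a b ≤ N := by
    intro J a b ha hb
    have := Fintype.card_subtype_le fun j => j ∉ J
    unfold bound at hN ⊢
    omega
  rw [map_add, ← gen₂_totLinked p x y I hN, map_sum]
  have h1 : ∀ J : Finset ι, PowerSeries.coeff v (∑ h ∈ Finset.range (g + 1),
      W p h (adjoin x fun j : {j // j ∈ J} => I j) *
        W p (g - h) (adjoin y fun j : {j // j ∉ J} => I j)) =
      ∑ a ∈ Finset.HasAntidiagonal.antidiagonal g, ∑ b ∈ Finset.HasAntidiagonal.antidiagonal v,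
        gen N (tot p (markedWt p fun j : {j // j ∈ J} => I j) a.1 b.1) (x - p.c / 2) *
        gen N (tot p (markedWt p fun j : {j // j ∉ J} => I j) a.2 b.2) (y - p.c / 2) := by
    intro J
    rw [map_sum, ← Finset.Nat.sum_antidiagonal_eq_sum_range_succ (fun h h' =>
      PowerSeries.coeff v (W p h (adjoin x fun j : {j // j ∈ J} => I j) *
        W p h' (adjoin y fun j : {j // j ∉ J} => I j)))]
    refine Finset.sum_congr rfl fun a ha => ?_
    rw [Finset.HasAntidiagonal.mem_antidiagonal] at ha
    rw [PowerSeries.coeff_mul]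
    refine Finset.sum_congr rfl fun b hb => ?_
    rw [Finset.HasAntidiagonal.mem_antidiagonal] at hb
    rw [coeff_W_adjoin p x _ (hcard₁ J a.1 b.1 (by omega) (by omega)),
      coeff_W_adjoin p y _ (hcard₂ J a.2 b.2 (by omega) (by omega))]
  simp only [h1]
  have h2 : ∀ a b, tot₂ p (markedWt p I) g v a b = _ := fun a b => tot₂_eq p (markedWt p I) g v a b
  unfold gen₂ gen
  simp only [h2, mul_add, Finset.sum_add_distrib, Finset.mul_sum, Finset.sum_mul]
  congr 1
  rw [Finset.sum_congr rfl fun a _ => Finset.sum_comm, Finset.sum_comm]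
  refine Finset.sum_congr rfl fun J _ => ?_
  rw [Finset.sum_congr rfl fun a _ => Finset.sum_comm, Finset.sum_comm]
  refine Finset.sum_congr rfl fun q _ => ?_
  rw [Finset.sum_congr rfl fun a _ => Finset.sum_comm, Finset.sum_comm]
  refine Finset.sum_congr rfl fun r _ => ?_
  rw [Finset.sum_comm]
  refine Finset.sum_congr rfl fun a _ => Finset.sum_congr rfl fun b _ => ?_
  change _ * (_ * (tot p (markedWt p fun j : {j // j ∈ J} => I j) q.1 r.1 _ *
    tot p (markedWt p fun j : {j // j ∉ J} => I j) q.2 r.2 _)) = _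
  ring

/-- The divided difference of `1 / u ^ (m + 1)`. -/
theorem divided_difference {u y : ℂ} (hu : u ≠ 0) (hy : y ≠ 0) (h : u ≠ y) (m : ℕ) :
    1 / (u - y) * (1 / u ^ (m + 1) - 1 / y ^ (m + 1)) =
      -∑ q ∈ Finset.HasAntidiagonal.antidiagonal m, 1 / u ^ (q.1 + 1) * (1 / y ^ (q.2 + 1)) := by
  have h0 : u - y ≠ 0 := sub_ne_zero.2 h
  rw [one_div, inv_mul_eq_iff_eq_mul₀ h0]
  induction m with
  | zero => simp; field_simp; ring
  | succ m ih =>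
    rw [Finset.Nat.sum_antidiagonal_succ']
    have h1 : ∑ q ∈ Finset.HasAntidiagonal.antidiagonal m,
        1 / u ^ (q.1 + 1) * (1 / y ^ (q.2 + 1 + 1)) =
        1 / y * ∑ q ∈ Finset.HasAntidiagonal.antidiagonal m,
          1 / u ^ (q.1 + 1) * (1 / y ^ (q.2 + 1)) := by
      rw [Finset.mul_sum]
      refine Finset.sum_congr rfl fun q _ => ?_
      rw [pow_succ y (q.2 + 1)]
      field_simp
    rw [h1]
    have h2 : (u - y) * -(1 / u ^ (m + 1 + 1) * (1 / y ^ (0 + 1)) + 1 / y *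
      ∑ q ∈ Finset.HasAntidiagonal.antidiagonal m, 1 / u ^ (q.1 + 1) * (1 / y ^ (q.2 + 1))) =
      -((u - y) * (1 / u ^ (m + 1 + 1) * (1 / y ^ (0 + 1)))) + 1 / y * ((u - y) *
      -∑ q ∈ Finset.HasAntidiagonal.antidiagonal m, 1 / u ^ (q.1 + 1) * (1 / y ^ (q.2 + 1))) := by ring
    rw [h2, ← ih]
    field_simp
    ring

/-- The divided difference of a generating function is minus the generating function of the two
parts of a degree. -/
theorem gen_divided_difference {N : ℕ} {F : ℕ → ℂ} (hF : ∀ l, N ≤ l → F l = 0) {u y : ℂ}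
    (hu : u ≠ 0) (hy : y ≠ 0) (h : u ≠ y) :
    1 / (u - y) * (gen N F u - gen N F y) = -∑ L ∈ Finset.range N,
      1 / y ^ (L + 1) * gen N (fun l => F (L + l)) u := by
  have h1 : 1 / (u - y) * (gen N F u - gen N F y) = -∑ m ∈ Finset.range N,
      ∑ q ∈ Finset.HasAntidiagonal.antidiagonal m,
        1 / u ^ (q.1 + 1) * (1 / y ^ (q.2 + 1)) * F (q.1 + q.2) := by
    unfold gen
    rw [← Finset.sum_sub_distrib, Finset.mul_sum, ← Finset.sum_neg_distrib]
    refine Finset.sum_congr rfl fun m _ => ?_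
    rw [← sub_mul, ← mul_assoc, divided_difference hu hy h, neg_mul, Finset.sum_mul]
    congr 1
    refine Finset.sum_congr rfl fun q hq => ?_
    rw [Finset.HasAntidiagonal.mem_antidiagonal.1 hq]
  rw [h1, sum_sum_antidiagonal N fun a b => 1 / u ^ (a + 1) * (1 / y ^ (b + 1)) * F (a + b)]
  · unfold gen
    rw [Finset.sum_comm]
    simp only [Finset.mul_sum]
    congr 1
    refine Finset.sum_congr rfl fun a _ => Finset.sum_congr rfl fun b _ => ?_
    rw [add_comm a b]
    ring
  · intro a b hab
    rw [hF _ hab, mul_zero]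

/-- In the derivative of the divided difference, a marked face of degree `L + 1`, whose weight is
`1 / (y - a) ^ (L + 2)`, has the multiplicity `L + 1` of the choice of its edge adjacent to the root
edge. -/
theorem hasDerivAt_divided_difference {N : ℕ} {F : ℕ → ℂ} (hF : ∀ l, N ≤ l → F l = 0) {u a y : ℂ}
    (hu : u ≠ 0) (hy : y - a ≠ 0) (h : u ≠ y - a) :
    HasDerivAt (fun z => 1 / (u - (z - a)) * (gen N F u - gen N F (z - a)))
      (∑ L ∈ Finset.range N, (L + 1) * (1 / (y - a) ^ (L + 2) * gen N (fun l => F (L + l)) u)) y := by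
  have hev : (fun z => 1 / (u - (z - a)) * (gen N F u - gen N F (z - a))) =ᶠ[𝓝 y] fun z =>
      -∑ L ∈ Finset.range N, 1 / (z - a) ^ (L + 1) * gen N (fun l => F (L + l)) u := by
    have hc : ContinuousAt (fun z => z - a) y := by fun_prop
    -- The divided difference has a pole at `z - a = 0` and is a junk value at `z - a = u`: both are
    -- excluded near `y`.
    filter_upwards [hc.eventually_ne hy, hc.eventually_ne h.symm] with z h1 h2
    exact gen_divided_difference hF hu h1 h2.symm
  refine HasDerivAt.congr_of_eventuallyEq ?_ hev
  rw [← neg_neg (∑ L ∈ Finset.range N, _), ← Finset.sum_neg_distrib]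
  refine HasDerivAt.neg (HasDerivAt.fun_sum fun L _ => ?_)
  have h1 : HasDerivAt (fun z => (z - a) ^ (L + 1)) ((L + 1 : ℕ) * (y - a) ^ L * 1) y := by
    simpa using ((hasDerivAt_id y).sub_const a).fun_pow (L + 1)
  have h2 := (h1.fun_inv (pow_ne_zero _ hy)).mul_const (gen N (fun l => F (L + l)) u)
  simp only [one_div]
  refine h2.congr_deriv ?_
  push_cast
  field_simp
  ring

end ONModel

/-! ### The coefficients of the loop equation -/

namespace ONModel

open Equiv

/-- When the `i`-th variable is replaced by `y`, it can be taken as the variable of the root face. -/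
theorem coeff_W_update (p : Params) {m : ℕ} (I : Fin m → ℂ) (i : Fin m) (y : ℂ) {g v N : ℕ}
    (hN : bound (Fin m) g v ≤ N) :
    PowerSeries.coeff v (W p g (Function.update I i y)) =
      gen N (tot p (markedWt p fun j : {j // j ≠ i} => I j) g v) (y - p.c / 2) := by
  have hN' : bound {j // j ≠ i} g v ≤ N := by
    have := Fintype.card_subtype_le fun j => j ≠ i
    unfold bound at hN ⊢
    omega
  rw [coeff_W p (Equiv.optionSubtypeNe i) _ hN', gen]
  have h1 : (fun (j : {j // j ≠ i}) (L : ℕ) => 1 / (Function.update I i y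
      (Equiv.optionSubtypeNe i (some j)) - p.c / 2) ^ (L + 1)) =
      markedWt p fun j : {j // j ≠ i} => I j := by
    funext j L
    simp [markedWt, Function.update_of_ne j.2]
  rw [h1]
  simp

/-- The derivative term of the loop equation. -/
theorem coeff_ddx (p : Params) {m : ℕ} (x : ℂ) (I : Fin m → ℂ) (i : Fin m) {g v N : ℕ}
    (hN : bound (Fin m) g v ≤ N) (hx : x ≠ p.c / 2) (hx' : x ≠ -(p.c / 2)) (hI : I i ≠ p.c / 2)
    (h : I i ≠ x) (h' : I i ≠ -x) :
    PowerSeries.coeff v (ddx (fun y =>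
        (1 / (x - y)) • (W p g (adjoin x fun j : {j // j ≠ i} => I j) -
          W p g (Function.update I i y)) -
        (1 / (x + y)) • (W p g (adjoin (-x) fun j : {j // j ≠ i} => I j) -
          W p g (Function.update I i y))) (I i)) =
      ∑ L ∈ Finset.range N, (L + 1) * (markedWt p I i (L + 1) *
        gen N (fun l => tot p (markedWt p fun j : {j // j ≠ i} => I j) g v (L + l)) (x - p.c / 2)) +
      ∑ L ∈ Finset.range N, (L + 1) * (markedWt p I i (L + 1) *
        gen N (fun l => tot p (markedWt p fun j : {j // j ≠ i} => I j) g v (L + l))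
          (-x - p.c / 2)) := by
  have hN' : bound {j // j ≠ i} g v ≤ N := by
    have := Fintype.card_subtype_le fun j => j ≠ i
    unfold bound at hN ⊢
    omega
  set F := tot p (markedWt p fun j : {j // j ≠ i} => I j) g v with hF
  have hF0 : ∀ l, N ≤ l → F l = 0 := fun l hl => tot_eq_zero p _ (hN'.trans hl)
  have hu : x - p.c / 2 ≠ 0 := sub_ne_zero.2 hx
  have hu' : -x - p.c / 2 ≠ 0 := fun h0 => hx' (by linear_combination -h0)
  have hy : I i - p.c / 2 ≠ 0 := sub_ne_zero.2 hI
  have d1 := hasDerivAt_divided_difference hF0 hu hy fun h0 => h (by linear_combination -h0)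
  have d2 := hasDerivAt_divided_difference hF0 hu' hy fun h0 => h' (by linear_combination -h0)
  rw [ddx, PowerSeries.coeff_mk]
  refine ((d1.add d2).congr_of_eventuallyEq (Eventually.of_forall fun z => ?_)).deriv
  simp only [Pi.add_apply, map_sub, map_smul, smul_eq_mul, coeff_W_adjoin p _ _ hN',
    coeff_W_update p I i z hN]
  rw [show x - p.c / 2 - (z - p.c / 2) = x - z by ring,
    show -x - p.c / 2 - (z - p.c / 2) = -(x + z) by ring, one_div_neg_eq_neg_one_div]
  ring

/-- The loop equation, in terms of the generating functions of maps with two root faces. The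
contributions of the triangles for `x` and `-x` combine into the term with the factor `𝔫`. -/
theorem coeff_loop_equation (p : Params) (hc : p.c ≠ 0) {m : ℕ} (x : ℂ) (I : Fin m → ℂ)
    {g v N : ℕ} (hN : 2 * bound (Fin m) g v ≤ N) (hx : x ≠ p.c / 2) (hx' : x ≠ -(p.c / 2)) :
    PowerSeries.coeff v (V' p x * W p g (adjoin x I) - P p g x I) +
      PowerSeries.coeff v (V' p (-x) * W p g (adjoin (-x) I) - P p g (-x) I) =
    gen₂ (N + 1) (tot₂ p (markedWt p I) g v) (x - p.c / 2) (x - p.c / 2) +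
    gen₂ (N + 1) (tot₂ p (markedWt p I) g v) (-x - p.c / 2) (-x - p.c / 2) +
    p.𝔫 * gen₂ (N + 1) (tot₂ p (markedWt p I) g v) (x - p.c / 2) (-x - p.c / 2) +
    ∑ i, (∑ L ∈ Finset.range (N + 1), (L + 1) * (markedWt p I i (L + 1) *
        gen (N + 1) (fun l => tot p (markedWt p fun j : {j // j ≠ i} => I j) g v (L + l))
          (x - p.c / 2)) +
      ∑ L ∈ Finset.range (N + 1), (L + 1) * (markedWt p I i (L + 1) *
        gen (N + 1) (fun l => tot p (markedWt p fun j : {j // j ≠ i} => I j) g v (L + l))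
          (-x - p.c / 2))) := by
  have hu : x - p.c / 2 ≠ 0 := sub_ne_zero.2 hx
  have hu' : -x - p.c / 2 ≠ 0 := fun h0 => hx' (by linear_combination -h0)
  have hb : bound (Fin m) g v ≤ N + 1 := by omega
  have h1 := gen_tot_succ p (markedWt p I) hN (x - p.c / 2)
  have h2 := gen_tot_succ p (markedWt p I) hN (-x - p.c / 2)
  have h3 := gen_totH p hc (markedWt p I) hb hu hu' (by ring)
  rw [coeff_V'_mul_W_sub_P p hx I hb, coeff_V'_mul_W_sub_P p (sub_ne_zero.1 hu') I hb, h1, h2,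
    ← h3, Finset.sum_add_distrib]
  change _ = _ + _ + _ + (∑ i, ∑ L ∈ Finset.range (N + 1), (L + 1) * (markedWt p I i (L + 1) *
    gen (N + 1) (fun l => tot p (fun j : {j // j ≠ i} => markedWt p I j) g v (L + l))
      (x - p.c / 2)) + ∑ i, ∑ L ∈ Finset.range (N + 1), (L + 1) * (markedWt p I i (L + 1) *
    gen (N + 1) (fun l => tot p (fun j : {j // j ≠ i} => markedWt p I j) g v (L + l))
      (-x - p.c / 2)))
  ring

/-- Without other marked faces, `W` depends on `x` only. -/
theorem W_adjoin_of_isEmpty (p : Params) {ι₁ ι₂ : Type} [Fintype ι₁] [Fintype ι₂] [IsEmpty ι₁]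
    [IsEmpty ι₂] (g : ℕ) (x : ℂ) (I₁ : ι₁ → ℂ) (I₂ : ι₂ → ℂ) :
    W p g (adjoin x I₁) = W p g (adjoin x I₂) := by
  ext v
  have hb : bound ι₁ g v = bound ι₂ g v := by simp [bound]
  rw [coeff_W_adjoin p x I₁ hb.le, coeff_W_adjoin p x I₂ le_rfl]
  congr 1
  funext l
  rw [tot, tot, ← total_relabel p (markedWt p I₂) (Equiv.refl Unit) (Equiv.equivOfIsEmpty ι₁ ι₂)]
  congr 1
  exact Subsingleton.elim _ _

end ONModel

theorem mainTheorem2 (p : ONModel.Params) (hc : p.c ≠ 0) :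
    (∀ (m g : ℕ) (x : ℂ) (I : Fin m → ℂ), x ≠ p.c / 2 → x ≠ -(p.c / 2) →
      (∀ i, I i ≠ p.c / 2) → (∀ i, I i ≠ x ∧ I i ≠ -x) →
      ONModel.WPred p g (ONModel.adjoin x (ONModel.adjoin x I))
        + ONModel.WPred p g (ONModel.adjoin (-x) (ONModel.adjoin (-x) I))
        + p.𝔫 • ONModel.WPred p g (ONModel.adjoin x (ONModel.adjoin (-x) I))
        + ∑ J : Finset (Fin m), ∑ h ∈ Finset.range (g + 1),
            (ONModel.W p h (ONModel.adjoin x fun j : {j // j ∈ J} => I j)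
                * ONModel.W p (g - h) (ONModel.adjoin x fun j : {j // j ∉ J} => I j)
              + ONModel.W p h (ONModel.adjoin (-x) fun j : {j // j ∈ J} => I j)
                * ONModel.W p (g - h) (ONModel.adjoin (-x) fun j : {j // j ∉ J} => I j)
              + p.𝔫 • (ONModel.W p h (ONModel.adjoin x fun j : {j // j ∈ J} => I j)
                * ONModel.W p (g - h) (ONModel.adjoin (-x) fun j : {j // j ∉ J} => I j)))
        + ∑ i : Fin m, ONModel.ddx (fun y =>
            (1 / (x - y)) • (ONModel.W p g (ONModel.adjoin x fun j : {j // j ≠ i} => I j)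
              - ONModel.W p g (Function.update I i y))
            - (1 / (x + y)) • (ONModel.W p g (ONModel.adjoin (-x) fun j : {j // j ≠ i} => I j)
              - ONModel.W p g (Function.update I i y))) (I i)
      = ONModel.V' p x * ONModel.W p g (ONModel.adjoin x I)
        + ONModel.V' p (-x) * ONModel.W p g (ONModel.adjoin (-x) I)
        - ONModel.P p g x I - ONModel.P p g (-x) I) ∧
    (∀ (x : ℂ) (I : Fin 0 → ℂ), x ≠ p.c / 2 → x ≠ -(p.c / 2) →
      ONModel.W p 0 (ONModel.adjoin x I) ^ 2
        + p.𝔫 • (ONModel.W p 0 (ONModel.adjoin x I) * ONModel.W p 0 (ONModel.adjoin (-x) I))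
        + ONModel.W p 0 (ONModel.adjoin (-x) I) ^ 2
      = ONModel.V' p x * ONModel.W p 0 (ONModel.adjoin x I)
        + ONModel.V' p (-x) * ONModel.W p 0 (ONModel.adjoin (-x) I)
        - ONModel.P p 0 x I - ONModel.P p 0 (-x) I) := by
  refine (and_iff_left_of_imp fun main x I hx hx' => ?_).2 fun m g x I hx hx' hI hIx => ?_
  -- Without other variables, only `J = ∅` and `h = 0` occur and there is no derivative term.
  · have h := main 0 0 x I hx hx' (fun i => i.elim0) (fun i => i.elim0)
    have h₁ : ∀ y, ONModel.W p 0 (ONModel.adjoin y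
        fun j : {j // j ∈ (∅ : Finset (Fin 0))} => I j) = ONModel.W p 0 (ONModel.adjoin y I) :=
      fun y => ONModel.W_adjoin_of_isEmpty p 0 y _ _
    have h₂ : ∀ y, ONModel.W p 0 (ONModel.adjoin y
        fun j : {j // j ∉ (∅ : Finset (Fin 0))} => I j) = ONModel.W p 0 (ONModel.adjoin y I) :=
      fun y => ONModel.W_adjoin_of_isEmpty p 0 y _ _
    rw [← h, Fintype.sum_unique, Finset.sum_range_one, Finset.univ_eq_empty (α := Fin 0),
      Finset.sum_empty]
    rw [show (default : Finset (Fin 0)) = ∅ from rfl, h₁, h₂, h₁, h₂]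
    simp only [ONModel.WPred, smul_zero]
    ring
  · ext v
    have hN : 2 * ONModel.bound (Fin m) g v ≤ 2 * ONModel.bound (Fin m) g v := le_rfl
    have hb : ONModel.bound (Fin m) g v ≤ 2 * ONModel.bound (Fin m) g v + 1 := by omega
    have h := ONModel.coeff_loop_equation p hc x I hN hx hx'
    rw [ONModel.gen₂_tot₂ p x x I hb, ONModel.gen₂_tot₂ p (-x) (-x) I hb,
      ONModel.gen₂_tot₂ p x (-x) I hb] at h
    have hd := fun i => ONModel.coeff_ddx p x I i hb hx hx' (hI i) (hIx i).1 (hIx i).2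
    simp only [Finset.sum_add_distrib, map_add, map_sum, map_sub, map_smul,
      smul_eq_mul, mul_add] at h hd ⊢
    simp only [hd]
    simp only [Finset.sum_add_distrib, Finset.mul_sum] at h ⊢
    linear_combination -h
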